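/- **Conventions.** Let $K$ be a field (for example $\mathbb C$ or $\mathbb C(q^{1/2})$). Let $g_n$ be of type $A_n,B_n,C_n$ ($n\ge1$) or $D_n$ ($n\ge3$), with Cartan matrix $(a_{ij})_{1\le i,j\le n}$. The nodes form the chain $1-2-\cdots-n$ for $A_n,B_n,C_n$; node $1$ is the short root for $B_n$ and the long root for $C_n$. For $D_n$ the nodes $1$ and $2$ are both joined to $3$, followed by the chain $3-4-\cdots-n$. Put $d_i=1$ for $i\ge2$ and $d_1=1,\tfrac12,2,1$ for $A_n,B_n,C_n,D_n$, so $d_ia_{ij}=d_ja_{ji}$. Let $q\in K^\times$ with $q^{2d_i}\neq1$ for all $i$; for $B_n$ a square root $q^{1/2}\in K$ is fixed. Write $\{a\}_p=(a-a^{-1})/(p-p^{-1})$ and $\{a\}=\{a\}_q$. $U_q(g_n)$ is the $K$-algebra generated by $e_i,f_i,t_i^{\pm1}$ ($1\le i\le n$) with the relations $$t_it_j=t_jt_i,\quad t_ie_jt_i^{-1}=q^{d_ia_{ij}}e_j,\quad t_if_jt_i^{-1}=q^{-d_ia_{ij}}f_j,\quad [e_i,f_j]=\delta_{ij}\{t_i\}_{q^{d_i}},$$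 $$\sum_{v=0}^{1-a_{ij}}(-1)^v\begin{bmatrix}1-a_{ij}\\v\end{bmatrix}_{q^{d_i}}e_i^{1-a_{ij}-v}e_je_i^v=0\quad(i\ne j),$$ and the same Serre relations for the $f_i$; the Gaussian binomials are Laurent polynomials evaluated at $q^{d_i}$. $\bar U_q(g_{n-1})$ is the algebra with generators $E_i,T_i^{\pm1}$ ($1\le i\le n$) and $F_i$ ($1\le i\le n-1$) and those of the above relations of $U_q(g_n)$ that involve only these. The Weyl algebra $W$ is generated by invertible $x,z$ with $xz=qzx$; $W_i$ (generators $x_i,z_i$) and $\tilde W_i$ (generators $\tilde x_i,\tilde z_i$) are copies of it. The index $i$ of $W_i$ runs over $1,\dots,n$; that of $\tilde W_i$ runs over no index for $A_n$, over $2,\dots,n$ for $B_n,C_n$, and over $3,\dots,n$ for $D_n$. Let $l$ be the total number of factors $W_i,\tilde W_i$. Put $F_0=0$, and $x_i^{-1}=\tilde x_i^{-1}=0$, $z_i=\tilde z_i=1$ for $i$ out of range. Let $\Delta^+(g)$ be the number of positive roots of $g$. For $B_n$, adjoin $z_1^{1/2}$ with $x_1z_1^{1/2}=q^{1/2}z_1^{1/2}x_1$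 to the algebra generated by $x_1,z_1$. In the formulas $z_1^{1/2}$ and $x_1$ occur only in combinations that lie in the subalgebra generated by $z_1$ and $y_1^{\pm1}$, where $y_1=z_1^{-1/2}x_1$. As $y_1z_1=qz_1y_1$, this subalgebra is again a Weyl algebra with parameter $q$, and for $B_n$ it is the one denoted $W_1$. **Theorem.** (1) There is an algebra homomorphism $\rho:U_q(g_n)\to(\bigotimes_iW_i\otimes\bigotimes_i\tilde W_i)\otimes\bar U_q(g_{n-1})$ given as follows. *Type $A_n$:* $$\rho(f_i)=\{z_{i-1}z_i^{-1}\}x_i+x_{i-1}^{-1}x_iF_{i-1},\quad\rho(e_i)=\{z_iz_{i+1}^{-1}T_i\}x_i^{-1}+E_i,\quad\rho(t_i)=z_{i-1}^{-1}z_i^2z_{i+1}^{-1}T_i.$$ *Types $B_n,C_n$ with $i>1$ and type $D_n$ with $i>2$:* $$\rho(f_i)=\{z_{i+1}z_i^{-1}\}x_i+\{\tilde z_i\tilde z_{i+1}^{-1}\}x_{i+1}^{-1}x_i\tilde x_{i+1}+x_{i+1}^{-1}x_i\tilde x_{i+1}\tilde x_i^{-1}F_i,$$ $$\rho(e_i)=\{z_i\,\kappa_i\,\tilde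 z_i^2\tilde z_{i+1}^{-1}T_i\}x_i^{-1}+\{\tilde z_i\tilde z_{i+1}^{-1}T_i\}\tilde x_i^{-1}+E_i,\qquad\rho(t_i)=z_{i+1}^{-1}z_i^2\,\kappa_i\,\tilde z_i^2\tilde z_{i+1}^{-1}T_i,$$ where $\kappa_i=z_{i-1}^{-1}\tilde z_{i-1}^{-1}$, except that $\kappa_2=z_1^{-2}$ for $C_n$ and $\kappa_3=z_1^{-1}z_2^{-1}$ for $D_n$. *Type $B_n$, $i=1$:* $$\rho(f_1)=\{z_2z_1^{-1/2}\}_{q^{1/2}}x_1+\{\tilde z_2^{-1}z_1^{1/2}\}_{q^{1/2}}x_2^{-1}x_1\tilde x_2+x_2^{-1}\tilde x_2F_1,$$ $$\rho(e_1)=\{z_1^{1/2}\tilde z_2^{-1}T_1\}_{q^{1/2}}x_1^{-1}+E_1,\qquad\rho(t_1)=z_2^{-1}z_1\tilde z_2^{-1}T_1.$$ *Type $C_n$, $i=1$:* $$\rho(f_1)=\{z_1^2\tilde z_2^{-2}\}_{q^2}x_2^{-2}x_1\tilde x_2^2+\{z_2\tilde z_2^{-1}\}x_2^{-1}x_1\tilde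 x_2+\{z_2^2z_1^{-2}\}_{q^2}x_1+x_2^{-2}\tilde x_2^2F_1,$$ $$\rho(e_1)=\{z_1^2\tilde z_2^{-2}T_1\}_{q^2}x_1^{-1}+E_1,\qquad\rho(t_1)=z_2^{-2}z_1^4\tilde z_2^{-2}T_1.$$ *Type $D_n$, $\{i,j\}=\{1,2\}$:* $$\rho(f_i)=\{z_3z_i^{-1}\}x_i+\{z_j\tilde z_3^{-1}\}\tilde x_3x_3^{-1}x_i+x_3^{-1}x_ix_j^{-1}\tilde x_3F_j,$$ $$\rho(e_i)=\{z_i\tilde z_3^{-1}T_i\}x_i^{-1}+E_i,\qquad\rho(t_i)=z_3^{-1}z_i^2\tilde z_3^{-1}T_i.$$ (2) The number of Weyl algebras is $l=\Delta^+(g_n)-\Delta^+(g_{n-1})$. (3) Let $q=\varepsilon$ be a primitive $N$-th root of unity ($N\ge1$), and let $g,h\in(K^\times)^l$. Let $\sigma_{gh}$ be the representation of $\bigotimes_iW_i\otimes\bigotimes_i\tilde W_i$ on $(K^N)^{\otimes l}$ whose $k$-th factor is $x\mapsto g_kP$, $z\mapsto h_k\,\mathrm{diag}(1,\varepsilon,\dots,\varepsilon^{N-1})$,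 where $P$ is the cyclic shift matrix with entries $1$ at the places $(1,2),\dots,(N-1,N),(N,1)$. For $W_1$ in type $B_n$ put $Z=h_1\,\mathrm{diag}(1,\varepsilon^{1/2},\dots,\varepsilon^{(N-1)/2})$ (the matrix that stands for $z_1^{1/2}$) and let $\sigma_{gh}(z_1)=Z^2$, $\sigma_{gh}(y_1)=Z^{-1}g_1P$. Then $\pi=(\sigma_{gh}\otimes\mathrm{id})\circ\rho$ is an algebra homomorphism. For every representation $\bar\rho'$ of $\bar U_\varepsilon(g_{n-1})$ on a vector space $V$ of any dimension, $\pi$ yields a representation $\pi'$ of $U_\varepsilon(g_n)$ on $(K^N)^{\otimes l}\otimes V$, of dimension $N^{\Delta^+(g_n)-\Delta^+(g_{n-1})}\dim V$. The representation $\pi'$ depends on the $2l=2(\Delta^+(g_n)-\Delta^+(g_{n-1}))$ free parameters $(g,h)\in(K^\times)^l\times(K^\times)^l$ in addition to those of $\bar\rho'$, and none of these is redundant: for $V\ne0$, the map $(g,h,\bar\rho')\mapsto\pi'$, from $(K^\times)^{2l}$ times the set of representations of $\bar U_\varepsilon(g_{n-1})$ on $V$ to the set of representations of $U_\varepsilon(g_n)$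 on $(K^N)^{\otimes l}\otimes V$, has finite fibres. -/

import Mathlib

open scoped TensorProduct

universe u w

noncomputable section

namespace QuantumSeries

/-! ### Cartan data -/

/-- The four classical series. -/
inductive Series : Type
  | A
  | B
  | C
  | D

/-- Entry `a_{ij}` of the Cartan matrix; the nodes carry the labels `1, …, n`.  The first root is
the short one for `B`, the long one for `C`, and the nodes `1`, `2` are both joined to `3` for
`D`. -/
def cartanEntry (X : Series) (i j : ℕ) : ℤ :=
  if i = j then 2 else
  match X with
  | .A => if i + 1 = j ∨ j + 1 = i then -1 else 0
  | .B => if i = 1 ∧ j = 2 then -2 else if i + 1 = j ∨ j + 1 = i then -1 else 0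
  | .C => if i = 2 ∧ j = 1 then -2 else if i + 1 = j ∨ j + 1 = i then -1 else 0
  | .D =>
    if (i = 1 ∧ j = 2) ∨ (i = 2 ∧ j = 1) then 0
    else if (i = 1 ∧ j = 3) ∨ (i = 3 ∧ j = 1) ∨ i + 1 = j ∨ j + 1 = i then -1 else 0

/-- The Cartan matrix of `X_n`; `i : Fin n` is the node with label `i + 1`. -/
def cartan (X : Series) (n : ℕ) : Matrix (Fin n) (Fin n) ℤ :=
  Matrix.of fun i j => cartanEntry X (i + 1) (j + 1)

/-- The smallest rank considered: `n ≥ 1` for `A`, `B`, `C` and `n ≥ 3` for `D`. -/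
def minRank : Series → ℕ
  | .A => 1
  | .B => 1
  | .C => 1
  | .D => 3

/-- The base parameter `v` satisfies `q = v ^ qExp X`.  Thus `v = q`, except for the series `B`,
where `v = q^{1/2}` (there `q^{d_1} = q^{1/2}` occurs). -/
def qExp : Series → ℕ
  | .B => 2
  | _ => 1

/-- The exponent with `q^{d_i} = v ^ dExp X i`.  So `d_i = 1` for `i ≥ 2`, and `d_1` is `1`, `1/2`,
`2`, `1` for `A`, `B`, `C`, `D`. -/
def dExp (X : Series) (i : ℕ) : ℕ :=
  match X with
  | .A => 1
  | .B => if i = 1 then 1 else 2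
  | .C => if i = 1 then 2 else 1
  | .D => 1

/-- The roots of a Cartan matrix, as coefficient vectors with respect to the simple roots: the orbit
of the simple roots under the simple reflections `β ↦ β - ⟨β, α_i^∨⟩ α_i`. -/
inductive IsRoot {n : ℕ} (a : Matrix (Fin n) (Fin n) ℤ) : (Fin n → ℤ) → Prop
  | simple (i : Fin n) : IsRoot a (Pi.single i 1)
  | reflect (i : Fin n) (β : Fin n → ℤ) (h : IsRoot a β) :
      IsRoot a (β - Pi.single i (∑ j, a i j * β j))

/-- `Δ⁺(X_n)`, the number of positive roots. -/
def numPosRoots (X : Series) (n : ℕ) : ℕ :=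
  Set.ncard {β : Fin n → ℤ | IsRoot (cartan X n) β ∧ ∀ i, 0 ≤ β i}

/-! ### Gaussian binomials -/

section Algebras

variable {K : Type u} [Field K]

/-- The (symmetric) Gaussian binomial, a Laurent polynomial evaluated at `q`, given by its Pascal
rule. -/
def qBinom (q : K) : ℕ → ℕ → K
  | _, 0 => 1
  | 0, _ + 1 => 0
  | m + 1, k + 1 => q ^ (k + 1) * qBinom q m (k + 1) + q⁻¹ ^ (m - k) * qBinom q m k

/-- `[m]_q! = ∏_{j=1}^m (q^j - q^{-j}) / (q - q^{-1})`. -/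
def qFact (q : K) (m : ℕ) : K :=
  ∏ j ∈ Finset.range m, (q ^ (j + 1) - q⁻¹ ^ (j + 1)) / (q - q⁻¹)

theorem qBinom_of_lt (q : K) : ∀ m k : ℕ, m < k → qBinom q m k = 0
  | 0, 0, h => absurd h (lt_irrefl 0)
  | m + 1, 0, h => absurd h (Nat.not_lt_zero _)
  | 0, k + 1, _ => by simp [qBinom]
  | m + 1, k + 1, h => by
      rw [qBinom, qBinom_of_lt q m (k + 1) (by omega), qBinom_of_lt q m k (by omega)]
      simp

/-- The Gaussian binomial is the quotient of factorials `[m]! / ([m-k]! [k]!)`. -/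
theorem qBinom_mul_qFact (q : K) (hq : q ≠ 0) :
    ∀ m k : ℕ, k ≤ m → qBinom q m k * (qFact q (m - k) * qFact q k) = qFact q m
  | m, 0, _ => by cases m <;> simp [qBinom, qFact]
  | 0, k + 1, h => absurd h (by omega)
  | m + 1, k + 1, h => by
      have ih2 := qBinom_mul_qFact q hq m k (by omega)
      have hm1 : qFact q (m + 1) = qFact q m * ((q ^ (m + 1) - q⁻¹ ^ (m + 1)) / (q - q⁻¹)) :=
        Finset.prod_range_succ _ _
      have hk1 : qFact q (k + 1) = qFact q k * ((q ^ (k + 1) - q⁻¹ ^ (k + 1)) / (q - q⁻¹)) :=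
        Finset.prod_range_succ _ _
      rw [qBinom, Nat.add_sub_add_right]
      rcases Nat.lt_or_ge k m with hkm | hkm
      · have ih1 := qBinom_mul_qFact q hq m (k + 1) hkm
        obtain ⟨r, rfl⟩ : ∃ r, m = k + 1 + r := ⟨m - (k + 1), by omega⟩
        have e1 : k + 1 + r - k = r + 1 := by omega
        have e2 : k + 1 + r - (k + 1) = r := by omega
        have hr1 : qFact q (r + 1) = qFact q r * ((q ^ (r + 1) - q⁻¹ ^ (r + 1)) / (q - q⁻¹)) :=
          Finset.prod_range_succ _ _
        rw [e1] at ih2 ⊢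
        rw [e2] at ih1
        have key : (q ^ (k + 1 + r + 1) - q⁻¹ ^ (k + 1 + r + 1)) / (q - q⁻¹)
            = q ^ (k + 1) * ((q ^ (r + 1) - q⁻¹ ^ (r + 1)) / (q - q⁻¹))
              + q⁻¹ ^ (r + 1) * ((q ^ (k + 1) - q⁻¹ ^ (k + 1)) / (q - q⁻¹)) := by
          rw [mul_div_assoc', mul_div_assoc', ← add_div]
          congr 1
          ring
        rw [hm1, key, mul_add, add_mul]
        congr 1
        · rw [hr1, ← ih1]; ring
        · rw [hk1, ← ih2]; ring
      · obtain rfl : k = m := by omega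
        have h0 : qFact q 0 = 1 := by simp [qFact]
        rw [Nat.sub_self, h0, one_mul] at ih2 ⊢
        rw [qBinom_of_lt q k (k + 1) (by omega), hk1]
        calc _ = (qBinom q k k * qFact q k) *
              ((q ^ (k + 1) - q⁻¹ ^ (k + 1)) / (q - q⁻¹)) := by simp; ring
          _ = _ := by rw [ih2]

/-! ### The quantized enveloping algebras -/

/-- Chevalley generators: all `e_i`, `t_i`, `t_i⁻¹`, and `f_i` for `i` in a set `S` of nodes. -/
inductive Gen {n : ℕ} (S : Set (Fin n)) : Type
  | e (i : Fin n)
  | f (i : S)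
  | t (i : Fin n)
  | tInv (i : Fin n)

/-- The defining relations among the generators; `d` is such that `q^{d_i} = v ^ d i`. -/
inductive Rel {n : ℕ} (a : Matrix (Fin n) (Fin n) ℤ) (d : Fin n → ℕ) (v : K) (S : Set (Fin n)) :
    FreeAlgebra K (Gen S) → FreeAlgebra K (Gen S) → Prop
  | t_comm (i j : Fin n) :
      Rel a d v S (.ι K (.t i) * .ι K (.t j)) (.ι K (.t j) * .ι K (.t i))
  | t_tInv (i : Fin n) : Rel a d v S (.ι K (.t i) * .ι K (.tInv i)) 1
  | tInv_t (i : Fin n) : Rel a d v S (.ι K (.tInv i) * .ι K (.t i)) 1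
  | t_e (i j : Fin n) :
      Rel a d v S (.ι K (.t i) * .ι K (.e j) * .ι K (.tInv i))
        (v ^ ((d i : ℤ) * a i j) • .ι K (.e j))
  | t_f (i : Fin n) (j : S) :
      Rel a d v S (.ι K (.t i) * .ι K (.f j) * .ι K (.tInv i))
        (v ^ (-((d i : ℤ) * a i j)) • .ι K (.f j))
  | e_f (i : S) :
      Rel a d v S (.ι K (.e i) * .ι K (.f i) - .ι K (.f i) * .ι K (.e i))
        ((v ^ d i - (v ^ d i)⁻¹)⁻¹ • (.ι K (.t i) - .ι K (.tInv i)))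
  | e_f_ne (i : Fin n) (j : S) (h : i ≠ j) :
      Rel a d v S (.ι K (.e i) * .ι K (.f j) - .ι K (.f j) * .ι K (.e i)) 0
  | serre_e (i j : Fin n) (h : i ≠ j) :
      Rel a d v S
        (∑ s ∈ Finset.range ((1 - a i j).toNat + 1),
          ((-1) ^ s * qBinom (v ^ d i) (1 - a i j).toNat s) •
            (.ι K (.e i) ^ ((1 - a i j).toNat - s) * .ι K (.e j) * .ι K (.e i) ^ s)) 0
  | serre_f (i j : S) (h : i ≠ j) :
      Rel a d v S
        (∑ s ∈ Finset.range ((1 - a i j).toNat + 1),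
          ((-1) ^ s * qBinom (v ^ d i) (1 - a i j).toNat s) •
            (.ι K (.f i) ^ ((1 - a i j).toNat - s) * .ι K (.f j) * .ι K (.f i) ^ s)) 0

/-- The algebra with the generators `Gen S` of type `X_n` and the defining relations among them. -/
def QAlg (X : Series) (n : ℕ) (v : K) (S : Set (Fin n)) : Type u :=
  RingQuot (Rel (cartan X n) (fun i => dExp X (i + 1)) v S)

instance (X : Series) (n : ℕ) (v : K) (S : Set (Fin n)) : Ring (QAlg X n v S) :=
  inferInstanceAs (Ring (RingQuot (Rel (cartan X n) (fun i => dExp X (i + 1)) v S)))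

instance (X : Series) (n : ℕ) (v : K) (S : Set (Fin n)) : Algebra K (QAlg X n v S) :=
  inferInstanceAs (Algebra K (RingQuot (Rel (cartan X n) (fun i => dExp X (i + 1)) v S)))

/-- `U_q(X_n)`, with `q = v ^ qExp X`. -/
abbrev U (X : Series) (n : ℕ) (v : K) : Type u := QAlg X n v Set.univ

/-- `Ū_q(X_{n-1})`: generators `E_i, T_i^{±1}` with `1 ≤ i ≤ n` and `F_i` with `1 ≤ i ≤ n - 1`, and
the defining relations of `U_q(X_n)` among these. -/
abbrev UBar (X : Series) (n : ℕ) (v : K) : Type u := QAlg X n v {i | (i : ℕ) + 1 < n}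

namespace QAlg

variable (X : Series) (n : ℕ) (v : K) (S : Set (Fin n))

/-- The quotient map from the free algebra on the generators. -/
def mk : FreeAlgebra K (Gen S) →ₐ[K] QAlg X n v S :=
  RingQuot.mkAlgHom K (Rel (cartan X n) (fun i => dExp X (i + 1)) v S)

theorem mk_rel {a b : FreeAlgebra K (Gen S)}
    (h : Rel (cartan X n) (fun i => dExp X (i + 1)) v S a b) : mk X n v S a = mk X n v S b :=
  RingQuot.mkAlgHom_rel K h

/-- A generator, as an element of the algebra. -/
def gen (y : Gen S) : QAlg X n v S := mk X n v S (FreeAlgebra.ι K y)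

/-- `t_i` as an invertible element. -/
def tUnit (i : Fin n) : (QAlg X n v S)ˣ where
  val := gen X n v S (.t i)
  inv := gen X n v S (.tInv i)
  val_inv := by
    simpa only [map_mul, map_one, gen] using mk_rel X n v S (Rel.t_tInv i)
  inv_val := by
    simpa only [map_mul, map_one, gen] using mk_rel X n v S (Rel.tInv_t i)

end QAlg

/-! ### Weyl algebras -/

/-- Generators of the Weyl algebra. -/
inductive WGen : Type
  | x
  | xInv
  | z
  | zInv

/-- Relations of the Weyl algebra: `x`, `z` are invertible and `x z = q z x`. -/
inductive WRel (q : K) : FreeAlgebra K WGen → FreeAlgebra K WGen → Prop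
  | x_xInv : WRel q (.ι K .x * .ι K .xInv) 1
  | xInv_x : WRel q (.ι K .xInv * .ι K .x) 1
  | z_zInv : WRel q (.ι K .z * .ι K .zInv) 1
  | zInv_z : WRel q (.ι K .zInv * .ι K .z) 1
  | x_z : WRel q (.ι K .x * .ι K .z) (q • (.ι K .z * .ι K .x))

/-- The Weyl algebra `W` with parameter `q`. -/
def Weyl (q : K) : Type u := RingQuot (WRel q)

instance (q : K) : Ring (Weyl q) := inferInstanceAs (Ring (RingQuot (WRel q)))

instance (q : K) : Algebra K (Weyl q) := inferInstanceAs (Algebra K (RingQuot (WRel q)))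

namespace Weyl

variable (q : K)

/-- The quotient map from the free algebra on the generators. -/
def mk : FreeAlgebra K WGen →ₐ[K] Weyl q := RingQuot.mkAlgHom K (WRel q)

theorem mk_rel {a b : FreeAlgebra K WGen} (h : WRel q a b) : mk q a = mk q b :=
  RingQuot.mkAlgHom_rel K h

/-- A generator, as an element of the algebra. -/
def gen (y : WGen) : Weyl q := mk q (FreeAlgebra.ι K y)

/-- The generator `x` as an invertible element. -/
def x : (Weyl q)ˣ where
  val := gen q .x
  inv := gen q .xInv
  val_inv := by simpa only [map_mul, map_one, gen] using mk_rel q WRel.x_xInv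
  inv_val := by simpa only [map_mul, map_one, gen] using mk_rel q WRel.xInv_x

/-- The generator `z` as an invertible element. -/
def z : (Weyl q)ˣ where
  val := gen q .z
  inv := gen q .zInv
  val_inv := by simpa only [map_mul, map_one, gen] using mk_rel q WRel.z_zInv
  inv_val := by simpa only [map_mul, map_one, gen] using mk_rel q WRel.zInv_z

theorem x_mul_z : (x q : Weyl q) * (z q : Weyl q) = q • ((z q : Weyl q) * (x q : Weyl q)) := by
  simpa only [map_mul, map_smul, x, z, gen] using mk_rel q WRel.x_z

/-- Invertible elements `a`, `b` with `a b = q b a` define a homomorphism from the Weyl algebra,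
`x ↦ a`, `z ↦ b`. -/
def lift {R : Type*} [Ring R] [Algebra K R] (a b : Rˣ)
    (h : (a : R) * (b : R) = q • ((b : R) * (a : R))) : Weyl q →ₐ[K] R :=
  RingQuot.liftAlgHom K (s := WRel q) ⟨FreeAlgebra.lift K fun y =>
    match y with
    | .x => (a : R)
    | .xInv => ((a⁻¹ : Rˣ) : R)
    | .z => (b : R)
    | .zInv => ((b⁻¹ : Rˣ) : R), by
      intro y y' hy
      cases hy <;> simp [h]⟩

theorem x_mul_z_pow (d : ℕ) :
    (x q : Weyl q) * (z q : Weyl q) ^ d = q ^ d • ((z q : Weyl q) ^ d * (x q : Weyl q)) := by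
  induction d with
  | zero => simp
  | succ d ih =>
    rw [pow_succ, ← mul_assoc, ih, smul_mul_assoc, mul_assoc, x_mul_z, mul_smul_comm, smul_smul,
      mul_assoc, pow_succ]

/-- Adjoining a root of `z`.  If `p ^ d = q`, the Weyl algebra with parameter `q` embeds into the one
with parameter `p`, the generator `z` of the latter being the `d`-th root `z^{1/d}` of the former.
The generator `x` of the former is `z^{1/d} ^ (1 - d) * x`; so for `d = 1` this is the identity, and
for `d = 2` it is `z ↦ (z^{1/2})^2`, `x ↦ z^{-1/2} x`. -/
def adjoinRoot (p q : K) (d : ℕ) (h : p ^ d = q) : Weyl q →ₐ[K] Weyl p :=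
  lift q (z p ^ (1 - d : ℤ) * x p) (z p ^ d) (by
    have hc : ((z p ^ (1 - d : ℤ) : (Weyl p)ˣ) : Weyl p) * (z p : Weyl p) ^ d
        = (z p : Weyl p) ^ d * ((z p ^ (1 - d : ℤ) : (Weyl p)ˣ) : Weyl p) := by
      rw [← Units.val_pow_eq_pow_val, ← Units.val_mul, ← Units.val_mul]
      congr 1
      exact ((Commute.refl (z p)).zpow_left _).pow_right d
    rw [Units.val_mul, Units.val_pow_eq_pow_val, mul_assoc, x_mul_z_pow, mul_smul_comm,
      ← mul_assoc, hc, mul_assoc, h])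

/-- The operator on `K^N` with matrix entries `c j` at the places `(j, j + 1)`, the indices taken
modulo `N`. -/
def shiftOp (N : ℕ) (c : Fin N → Kˣ) : (Module.End K (Fin N → K))ˣ where
  val :=
    { toFun := fun y j => (c j : K) * y (finRotate N j)
      map_add' := fun y y' => by funext j; simp [mul_add]
      map_smul' := fun r y => by funext j; simp [mul_left_comm] }
  inv :=
    { toFun := fun y j => ((c ((finRotate N).symm j))⁻¹ : Kˣ) * y ((finRotate N).symm j)
      map_add' := fun y y' => by funext j; simp [mul_add]
      map_smul' := fun r y => by funext j; simp [mul_left_comm] }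
  val_inv := LinearMap.ext fun y => funext fun j => by
    change (c j : K) * (((c ((finRotate N).symm (finRotate N j)))⁻¹ : Kˣ) *
      y ((finRotate N).symm (finRotate N j))) = y j
    rw [Equiv.symm_apply_apply, Units.mul_inv_cancel_left]
  inv_val := LinearMap.ext fun y => funext fun j => by
    change ((c ((finRotate N).symm j))⁻¹ : Kˣ) * ((c ((finRotate N).symm j) : K) *
      y (finRotate N ((finRotate N).symm j))) = y j
    rw [Equiv.apply_symm_apply, Units.inv_mul_cancel_left]

/-- The diagonal operator on `K^N` with entries `c 0, …, c (N - 1)`. -/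
def diagOp (N : ℕ) (c : Fin N → Kˣ) : (Module.End K (Fin N → K))ˣ where
  val :=
    { toFun := fun y j => (c j : K) * y j
      map_add' := fun y y' => by funext j; simp [mul_add]
      map_smul' := fun r y => by funext j; simp [mul_left_comm] }
  inv :=
    { toFun := fun y j => ((c j)⁻¹ : Kˣ) * y j
      map_add' := fun y y' => by funext j; simp [mul_add]
      map_smul' := fun r y => by funext j; simp [mul_left_comm] }
  val_inv := by ext; simp
  inv_val := by ext; simp

theorem finRotate_pow (q : Kˣ) (N : ℕ) (hN : q ^ N = 1) (j : Fin N) :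
    q ^ ((finRotate N j : Fin N) : ℕ) = q * q ^ (j : ℕ) := by
  cases N with
  | zero => exact j.elim0
  | succ m =>
    rw [finRotate_apply, Fin.val_add, Fin.val_one', Nat.add_mod_mod, ← pow_eq_pow_mod _ hN,
      pow_succ']

/-- The `N`-dimensional representation `σ_{gh}` of the Weyl algebra with parameter `q`, `q ^ N = 1`.
For `d = 1`, `p = q` it is `x ↦ g · (cyclic shift)`, `z ↦ h · diag(1, q, …, q^{N-1})`.
For general `d`, with `p ^ d = q`, put `Z = h · diag(1, p, …, p^{N-1})` (the matrix of `z^{1/d}`) and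
`S = g · (cyclic shift)`; then `z ↦ Z ^ d` and `x ↦ Z ^ (1 - d) * S`, in accordance with
`adjoinRoot`. -/
def sigma (p q : Kˣ) (d : ℕ) (hpq : p ^ d = q) (N : ℕ) (hN : q ^ N = 1) (g h : Kˣ) :
    Weyl (q : K) →ₐ[K] Module.End K (Fin N → K) :=
  lift (q : K)
    (shiftOp N fun j => (h * p ^ (j : ℕ)) ^ (1 - d : ℤ) * g)
    (diagOp N fun j => (h * p ^ (j : ℕ)) ^ d)
    (LinearMap.ext fun y => funext fun j => by
      have key : (h * p ^ ((finRotate N j : Fin N) : ℕ)) ^ d = q * (h * p ^ (j : ℕ)) ^ d := by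
        rw [mul_pow, mul_pow, ← pow_mul, ← pow_mul, mul_comm _ d, mul_comm _ d, pow_mul, pow_mul,
          hpq, finRotate_pow q N hN, mul_left_comm]
      change (((h * p ^ (j : ℕ)) ^ (1 - d : ℤ) * g : Kˣ) : K) *
          (((h * p ^ ((finRotate N j : Fin N) : ℕ)) ^ d : Kˣ) * y (finRotate N j))
        = (q : K) * (((h * p ^ (j : ℕ)) ^ d : Kˣ) *
          ((((h * p ^ (j : ℕ)) ^ (1 - d : ℤ) * g : Kˣ) : K) * y (finRotate N j)))
      rw [key, Units.val_mul q]
      ring)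

end Weyl

/-! ### The target algebra -/

/-- The number of Weyl algebras `W̃_i`. -/
def numTilde (X : Series) (n : ℕ) : ℕ :=
  match X with
  | .A => 0
  | .B => n - 1
  | .C => n - 1
  | .D => n - 2

/-- Index set of the Weyl algebras: `W_1, …, W_n` and `W̃_i` with `n - numTilde X n < i ≤ n`, that is,
`2 ≤ i ≤ n` for `B`, `C`, and `3 ≤ i ≤ n` for `D`. -/
abbrev WIdx (X : Series) (n : ℕ) : Type := Fin n ⊕ Fin (numTilde X n)

/-- Position of `W_i`, if `i` is in range. -/
def idx (X : Series) (n i : ℕ) : Option (WIdx X n) :=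
  if h : 1 ≤ i ∧ i ≤ n then some (.inl ⟨i - 1, by omega⟩) else none

/-- Position of `W̃_i`, if `i` is in range. -/
def idxTilde (X : Series) (n i : ℕ) : Option (WIdx X n) :=
  if h : n - numTilde X n < i ∧ i ≤ n then some (.inr ⟨i - (n - numTilde X n) - 1, by omega⟩)
  else none

/-- The root of `z` that the formulas use: `z_1^{1/2}` in `B_n`, and `z` itself otherwise. -/
def rootDeg (X : Series) (n : ℕ) : WIdx X n → ℕ
  | .inl k => match X with
    | .B => if (k : ℕ) = 0 then 2 else 1
    | _ => 1
  | .inr _ => 1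

/-- The parameter `q^{1 / rootDeg}`. -/
def rootParam (X : Series) (n : ℕ) (v : Kˣ) (k : WIdx X n) : Kˣ :=
  if rootDeg X n k = 2 then v else v ^ qExp X

theorem rootParam_pow (X : Series) (n : ℕ) (v : Kˣ) (k : WIdx X n) :
    rootParam X n v k ^ rootDeg X n k = v ^ qExp X := by
  rcases k with k | k
  · cases X
    case B => by_cases hk : (k : ℕ) = 0 <;> simp [rootParam, rootDeg, qExp, hk]
    all_goals simp [rootParam, rootDeg, qExp]
  · simp [rootParam, rootDeg]

/-- `⨂_i W_i`, all factors being the Weyl algebra with parameter `q = v ^ qExp X`. -/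
def WTensor (X : Series) (n : ℕ) (v : Kˣ) : Type u :=
  ⨂[K] _ : WIdx X n, Weyl ((v ^ qExp X : Kˣ) : K)

instance (X : Series) (n : ℕ) (v : Kˣ) : Ring (WTensor X n v) :=
  inferInstanceAs (Ring (⨂[K] _ : WIdx X n, Weyl ((v ^ qExp X : Kˣ) : K)))

instance (X : Series) (n : ℕ) (v : Kˣ) : Algebra K (WTensor X n v) :=
  inferInstanceAs (Algebra K (⨂[K] _ : WIdx X n, Weyl ((v ^ qExp X : Kˣ) : K)))

/-- `⨂_i W_i` with `z_1^{1/2}` adjoined to `W_1` in the case of `B_n`. -/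
def WTensorRoot (X : Series) (n : ℕ) (v : Kˣ) : Type u :=
  ⨂[K] k : WIdx X n, Weyl ((rootParam X n v k : Kˣ) : K)

instance (X : Series) (n : ℕ) (v : Kˣ) : Ring (WTensorRoot X n v) :=
  inferInstanceAs (Ring (⨂[K] k : WIdx X n, Weyl ((rootParam X n v k : Kˣ) : K)))

instance (X : Series) (n : ℕ) (v : Kˣ) : Algebra K (WTensorRoot X n v) :=
  inferInstanceAs (Algebra K (⨂[K] k : WIdx X n, Weyl ((rootParam X n v k : Kˣ) : K)))

/-- `(⨂_i W_i) ⊗ Ū_q(X_{n-1})`. -/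
abbrev Target (X : Series) (n : ℕ) (v : Kˣ) : Type u :=
  WTensor X n v ⊗[K] UBar X n (v : K)

/-- `(⨂_i W_i) ⊗ Ū_q(X_{n-1})` with `z_1^{1/2}` adjoined in the case of `B_n`. -/
abbrev TargetRoot (X : Series) (n : ℕ) (v : Kˣ) : Type u :=
  WTensorRoot X n v ⊗[K] UBar X n (v : K)

/-- The algebra homomorphism of tensor products given by homomorphisms of the factors. -/
def piTensorMap {ι : Type} {A B : ι → Type u} [∀ i, Ring (A i)] [∀ i, Algebra K (A i)]
    [∀ i, Ring (B i)] [∀ i, Algebra K (B i)] (φ : ∀ i, A i →ₐ[K] B i) :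
    (⨂[K] i, A i) →ₐ[K] ⨂[K] i, B i :=
  PiTensorProduct.liftAlgHom
    ((PiTensorProduct.tprod K).compLinearMap fun i => (φ i).toLinearMap)
    (by
      simp only [MultilinearMap.compLinearMap_apply, Pi.one_apply, AlgHom.toLinearMap_apply,
        map_one]
      rfl)
    (fun a b => by
      simp only [MultilinearMap.compLinearMap_apply, Pi.mul_apply, AlgHom.toLinearMap_apply,
        map_mul]
      exact (PiTensorProduct.tprod_mul_tprod _ _).symm)

/-- The tensor product of representations of the factors. -/
def piTensorRep {ι : Type} {A M : ι → Type u} [∀ i, Ring (A i)] [∀ i, Algebra K (A i)]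
    [∀ i, AddCommGroup (M i)] [∀ i, Module K (M i)] (φ : ∀ i, A i →ₐ[K] Module.End K (M i)) :
    (⨂[K] i, A i) →ₐ[K] Module.End K (⨂[K] i, M i) :=
  PiTensorProduct.liftAlgHom
    ((PiTensorProduct.mapMultilinear K M M).compLinearMap fun i => (φ i).toLinearMap)
    (by
      simp only [MultilinearMap.compLinearMap_apply, Pi.one_apply, AlgHom.toLinearMap_apply,
        map_one]
      exact PiTensorProduct.map_one)
    (fun a b => by
      simp only [MultilinearMap.compLinearMap_apply, Pi.mul_apply, AlgHom.toLinearMap_apply,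
        map_mul]
      exact PiTensorProduct.map_mul _ _)

/-- The embedding `⨂_i W_i → WTensorRoot`; it is the identity on all factors, apart from `W_1` in the
case of `B_n`, where the generators of `W_1` go to `z_1^{-1/2} x_1` and `z_1 = (z_1^{1/2})^2`. -/
def weylToRoot (X : Series) (n : ℕ) (v : Kˣ) : WTensor X n v →ₐ[K] WTensorRoot X n v :=
  piTensorMap fun k => Weyl.adjoinRoot ((rootParam X n v k : Kˣ) : K) ((v ^ qExp X : Kˣ) : K)
    (rootDeg X n k) (by rw [← rootParam_pow X n v k, Units.val_pow_eq_pow_val])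

/-- The embedding of `(⨂_i W_i) ⊗ Ū_q(X_{n-1})` given by `weylToRoot`. -/
def toRoot (X : Series) (n : ℕ) (v : Kˣ) : Target X n v →ₐ[K] TargetRoot X n v :=
  Algebra.TensorProduct.map (weylToRoot X n v) (AlgHom.id K _)

/-! ### The formulas -/

/-- The elements that occur in the formulas, indexed by their labels. -/
structure Symbols (R : Type u) [Ring R] where
  /-- `x_i` -/
  x : ℕ → R
  /-- `x_i⁻¹`, which is `0` if `i` is out of range -/
  xi : ℕ → R
  /-- `z_i`, which is `1` if `i` is out of range -/
  z : ℕ → Rˣ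
  /-- `x̃_i` -/
  xt : ℕ → R
  /-- `x̃_i⁻¹`, which is `0` if `i` is out of range -/
  xti : ℕ → R
  /-- `z̃_i`, which is `1` if `i` is out of range -/
  zt : ℕ → Rˣ
  /-- `z_1^{1/2}`, used for the series `B` only -/
  zh : Rˣ
  /-- `E_i` -/
  E : ℕ → R
  /-- `F_i`, where `F_0 = 0` -/
  F : ℕ → R
  /-- `T_i` -/
  T : ℕ → Rˣ

section Formulas

variable {R : Type u} [Ring R] [Algebra K R]

/-- `{a}_Q = (a - a⁻¹) / (Q - Q⁻¹)`. -/
def curly (Q : Kˣ) (a : Rˣ) : R :=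
  ((Q : K) - ((Q⁻¹ : Kˣ) : K))⁻¹ • ((a : R) - ((a⁻¹ : Rˣ) : R))

/-- The formula for `ρ(f_i)`; here `q = v ^ qExp X`, so `v = q^{1/2}` in the case `B`. -/
def fFormula (X : Series) (v : Kˣ) (s : Symbols R) (i : ℕ) : R :=
  let q := v ^ qExp X
  let general : R :=
    curly q (s.z (i + 1) * (s.z i)⁻¹) * s.x i
      + curly q (s.zt i * (s.zt (i + 1))⁻¹) * (s.xi (i + 1) * s.x i * s.xt (i + 1))
      + s.xi (i + 1) * s.x i * s.xt (i + 1) * s.xti i * s.F i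
  match X with
  | .A => curly q (s.z (i - 1) * (s.z i)⁻¹) * s.x i + s.xi (i - 1) * s.x i * s.F (i - 1)
  | .B =>
    if i = 1 then
      curly v (s.z 2 * s.zh⁻¹) * s.x 1
        + curly v ((s.zt 2)⁻¹ * s.zh) * (s.xi 2 * s.x 1 * s.xt 2)
        + s.xi 2 * s.xt 2 * s.F 1
    else general
  | .C =>
    if i = 1 then
      curly (q ^ 2) (s.z 1 ^ 2 * (s.zt 2)⁻¹ ^ 2) * (s.xi 2 ^ 2 * s.x 1 * s.xt 2 ^ 2)
        + curly q (s.z 2 * (s.zt 2)⁻¹) * (s.xi 2 * s.x 1 * s.xt 2)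
        + curly (q ^ 2) (s.z 2 ^ 2 * (s.z 1)⁻¹ ^ 2) * s.x 1
        + s.xi 2 ^ 2 * s.xt 2 ^ 2 * s.F 1
    else general
  | .D =>
    if i = 1 then
      curly q (s.z 3 * (s.z 1)⁻¹) * s.x 1
        + curly q (s.z 2 * (s.zt 3)⁻¹) * (s.xt 3 * s.xi 3 * s.x 1)
        + s.xi 3 * s.x 1 * s.xi 2 * s.xt 3 * s.F 2
    else if i = 2 then
      curly q (s.z 3 * (s.z 2)⁻¹) * s.x 2
        + curly q (s.z 1 * (s.zt 3)⁻¹) * (s.xt 3 * s.xi 3 * s.x 2)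
        + s.xi 3 * s.x 2 * s.xi 1 * s.xt 3 * s.F 1
    else general

/-- The product of the factors of `ρ(t_i)`, `i ≥ 2` (`i ≥ 3` for `D`), that stem from the neighbours
of the node `i` with smaller label: in general `z_{i-1}⁻¹ z̃_{i-1}⁻¹`, but `z_1⁻²` for the node `2`
of `C_n` and `z_1⁻¹ z_2⁻¹` for the node `3` of `D_n`. -/
def lower (X : Series) (s : Symbols R) (i : ℕ) : Rˣ :=
  match X with
  | .C => if i = 2 then (s.z 1)⁻¹ ^ 2 else (s.z (i - 1))⁻¹ * (s.zt (i - 1))⁻¹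
  | .D => if i = 3 then (s.z 1)⁻¹ * (s.z 2)⁻¹ else (s.z (i - 1))⁻¹ * (s.zt (i - 1))⁻¹
  | _ => (s.z (i - 1))⁻¹ * (s.zt (i - 1))⁻¹

/-- The formula for `ρ(e_i)`. -/
def eFormula (X : Series) (v : Kˣ) (s : Symbols R) (i : ℕ) : R :=
  let q := v ^ qExp X
  let general : R :=
    curly q (s.z i * lower X s i * s.zt i ^ 2 * (s.zt (i + 1))⁻¹ * s.T i) * s.xi i
      + curly q (s.zt i * (s.zt (i + 1))⁻¹ * s.T i) * s.xti i
      + s.E i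
  match X with
  | .A => curly q (s.z i * (s.z (i + 1))⁻¹ * s.T i) * s.xi i + s.E i
  | .B =>
    if i = 1 then curly v (s.zh * (s.zt 2)⁻¹ * s.T 1) * s.xi 1 + s.E 1
    else general
  | .C =>
    if i = 1 then curly (q ^ 2) (s.z 1 ^ 2 * (s.zt 2)⁻¹ ^ 2 * s.T 1) * s.xi 1 + s.E 1
    else general
  | .D =>
    if i = 1 ∨ i = 2 then curly q (s.z i * (s.zt 3)⁻¹ * s.T i) * s.xi i + s.E i
    else general

/-- The formula for `ρ(t_i)`. -/
def tFormula (X : Series) (s : Symbols R) (i : ℕ) : Rˣ :=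
  let general : Rˣ :=
    (s.z (i + 1))⁻¹ * s.z i ^ 2 * lower X s i * s.zt i ^ 2 * (s.zt (i + 1))⁻¹ * s.T i
  match X with
  | .A => (s.z (i - 1))⁻¹ * s.z i ^ 2 * (s.z (i + 1))⁻¹ * s.T i
  | .B => if i = 1 then (s.z 2)⁻¹ * s.z 1 * (s.zt 2)⁻¹ * s.T 1 else general
  | .C => if i = 1 then (s.z 2)⁻¹ ^ 2 * s.z 1 ^ 4 * (s.zt 2)⁻¹ ^ 2 * s.T 1 else general
  | .D =>
    if i = 1 ∨ i = 2 then (s.z 3)⁻¹ * s.z i ^ 2 * (s.zt 3)⁻¹ * s.T i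
    else general

end Formulas

section Instantiation

variable (X : Series) (n : ℕ) (v : Kˣ)

/-- The inclusion of the factor with index `k` in `WTensorRoot`. -/
def singleW (k : WIdx X n) : Weyl ((rootParam X n v k : Kˣ) : K) →ₐ[K] WTensorRoot X n v :=
  PiTensorProduct.singleAlgHom (R := K)
    (A := fun k : WIdx X n => Weyl ((rootParam X n v k : Kˣ) : K)) k

/-- The inclusion of the Weyl algebra with index `k` in `TargetRoot`. -/
def inclW (k : WIdx X n) : Weyl ((rootParam X n v k : Kˣ) : K) →ₐ[K] TargetRoot X n v :=
  Algebra.TensorProduct.includeLeft.comp (singleW X n v k)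

/-- The inclusion of `Ū_q(X_{n-1})` as a factor of `TargetRoot`. -/
def inclU : UBar X n (v : K) →ₐ[K] TargetRoot X n v :=
  Algebra.TensorProduct.includeRight

/-- The generator `x` of a factor of `TargetRoot`. -/
def xAt (k : WIdx X n) : (TargetRoot X n v)ˣ :=
  Units.map (inclW X n v k).toRingHom.toMonoidHom (Weyl.x _)

/-- The generator `z` of a factor of `TargetRoot`; it is `z_1^{1/2}` for the first factor in the case
of `B_n`. -/
def zAt (k : WIdx X n) : (TargetRoot X n v)ˣ :=
  Units.map (inclW X n v k).toRingHom.toMonoidHom (Weyl.z _)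

/-- The symbols of the formulas, as elements of `TargetRoot`. -/
def symbols : Symbols (TargetRoot X n v) where
  x i := (idx X n i).elim 0 fun k => (xAt X n v k : TargetRoot X n v)
  xi i := (idx X n i).elim 0 fun k => ((xAt X n v k)⁻¹ : (TargetRoot X n v)ˣ)
  z i := (idx X n i).elim 1 fun k => zAt X n v k ^ rootDeg X n k
  xt i := (idxTilde X n i).elim 0 fun k => (xAt X n v k : TargetRoot X n v)
  xti i := (idxTilde X n i).elim 0 fun k => ((xAt X n v k)⁻¹ : (TargetRoot X n v)ˣ)
  zt i := (idxTilde X n i).elim 1 fun k => zAt X n v k ^ rootDeg X n k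
  zh := (idx X n 1).elim 1 fun k => zAt X n v k
  E i := if h : 1 ≤ i ∧ i ≤ n then inclU X n v (QAlg.gen X n (v : K) _ (.e ⟨i - 1, by omega⟩)) else 0
  F i :=
    if h : 1 ≤ i ∧ i < n then
      inclU X n v (QAlg.gen X n (v : K) _ (.f ⟨⟨i - 1, by omega⟩, by change i - 1 + 1 < n; omega⟩))
    else 0
  T i :=
    if h : 1 ≤ i ∧ i ≤ n then
      Units.map (inclU X n v).toRingHom.toMonoidHom (QAlg.tUnit X n (v : K) _ ⟨i - 1, by omega⟩)
    else 1

end Instantiation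

/-! ### Roots of unity -/

section Roots

variable (X : Series) (n : ℕ) (v : Kˣ) (N : ℕ)

/-- The representation space `(K^N)^{⊗ l}` of `⨂_i W_i`. -/
abbrev WSpace (K : Type u) [Field K] (X : Series) (n N : ℕ) : Type u :=
  ⨂[K] _ : WIdx X n, (Fin N → K)

/-- The representation `σ_{gh}` of `⨂_i W_i`, with parameters `g_i`, `h_i` for every factor. -/
def sigma (hN : (v ^ qExp X) ^ N = 1) (g h : WIdx X n → Kˣ) :
    WTensor X n v →ₐ[K] Module.End K (WSpace K X n N) :=
  piTensorRep fun k =>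
    Weyl.sigma (rootParam X n v k) (v ^ qExp X) (rootDeg X n k) (rootParam_pow X n v k) N hN
      (g k) (h k)

/-- `π = (σ_{gh} ⊗ id) ∘ ρ`. -/
def piHom (ρ : U X n (v : K) →ₐ[K] Target X n v) (hN : (v ^ qExp X) ^ N = 1)
    (g h : WIdx X n → Kˣ) :
    U X n (v : K) →ₐ[K] Module.End K (WSpace K X n N) ⊗[K] UBar X n (v : K) :=
  (Algebra.TensorProduct.map (sigma X n v N hN g h) (AlgHom.id K _)).comp ρ

/-- The representation `π'` obtained from `π` by taking `Ū` in the representation `τ`. -/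
def piRep (ρ : U X n (v : K) →ₐ[K] Target X n v) (hN : (v ^ qExp X) ^ N = 1)
    (g h : WIdx X n → Kˣ) {V : Type w} [AddCommGroup V] [Module K V]
    (τ : UBar X n (v : K) →ₐ[K] Module.End K V) :
    U X n (v : K) →ₐ[K] Module.End K (WSpace K X n N ⊗[K] V) :=
  (Module.endTensorEndAlgHom (R := K) (S := K) (A := K)).comp
    ((Algebra.TensorProduct.map (AlgHom.id K _) τ).comp (piHom X n v N ρ hN g h))

end Roots

end Algebras

end QuantumSeries

end

/-! The images of the generators are sums of three kinds of terms: monomials c·z^a·x^ξ in the Weyl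
generators and the T_i, the elements E_i, and products x^ξ F_i. A monomial commutes with any term up
to a power of v, and the exponent is bilinear in the exponents of the terms. `QSystem` collects
these commutation rules, the relations of the E_i and F_i, and the boundary values. Relations in the
algebra thereby become integer arithmetic on exponents. The target algebra is such a system
(`targetSystem`), and so is its image under any homomorphism (`QSystem.map`); the same notion
therefore serves for ρ and for the representations.

Relations. The conjugations by t_i are read off from the exponents. For [e_i, f_j], the commutator
of two brackets {a}x^ξ is again a bracket or zero whenever the exponents match (`comm_curl_curl`),
and [E_i, x^ξ F_i] is a bracket as well. These cancel in pairs and leave {t_i} for i = j. At the end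
of the diagram the superfluous terms vanish since x_{n+1}⁻¹ = 0 and F_n = 0.

The Serre relations rest on the fact that Serre expressions are primitive for a braided coproduct
(`serre_add`): they are additive on (a, c) and (b, d) when the first pair commutes with the second
up to the right powers. The terms of two neighbouring generators are arranged in a list of blocks,
each standing in this position to all later ones, so that only single blocks remain
(`serrePair_sum`). A block with an empty side is trivial, and the block of the two E's or F's is a
Serre relation of Ū. The f's at the double bonds of B and C need two further kinds of blocks,
settled by `serre_three_enclosed` and `serre_two_square`. In type D, f_1 and f_2 commute only after
a cancellation between mixed terms.

Number of Weyl algebras. Roots have coordinates ε_k + ε_l with signed indices, where ε_{-k} = -ε_k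
and ε_0 = 0, and simple reflections permute the signed indices. Coefficients are essentially tail
sums of coordinates, so positivity of a root means positivity of its index of larger absolute value.
The positive roots fall into n layers according to that index, and the last layer has as many
elements as there are Weyl algebras.

Finite fibres. For two parameter tuples, the operators of the x's and z's agree up to scalars.
Suppose both tuples give the same π'. Commuting the equations for π'(f_i) with such operators
separates their summands (`evalSum_eq_of_separated`), by the argument for independence of
characters. Equality of both monomials of a bracket, scaled by cr and c⁻¹r, gives c² = r² = 1.
Following the diagram from an end where z is 1 shows that all ratios of parameters are roots of
unity of bounded order (`Scaled.isTorsion`). For fixed g, h the images of t_i, e_i, f_i recover T_i,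
E_i, F_i, since each of these occurs with an invertible coefficient (`rep_eq_of_evalSum_eq`). -/

noncomputable section

namespace QuantumSeries

/-! ### Commutation up to a scalar. -/

section QCommute

variable {K : Type*} [Field K] {R : Type*} [Ring R] [Algebra K R]

/-- `a` and `b` commute up to the scalar `c`. -/
def QCommute (c : K) (a b : R) : Prop := a * b = c • (b * a)

namespace QCommute

variable {c c' : K} {a a' b b' : R}

theorem zero_left (c : K) (b : R) : QCommute c 0 b := by simp [QCommute]

theorem zero_right (c : K) (a : R) : QCommute c a 0 := by simp [QCommute]

theorem add_left (h : QCommute c a b) (h' : QCommute c a' b) : QCommute c (a + a') b := by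
  simp only [QCommute] at *
  rw [add_mul, mul_add, h, h', smul_add]

theorem add_right (h : QCommute c a b) (h' : QCommute c a b') : QCommute c a (b + b') := by
  simp only [QCommute] at *
  rw [add_mul, mul_add, h, h', smul_add]

end QCommute

/-! ### Serre expressions -/

/-- The left hand side of the quantum Serre relation. -/
def serre (Q : K) (m : ℕ) (x y : R) : R :=
  ∑ s ∈ Finset.range (m + 1), ((-1) ^ s * qBinom Q m s) • (x ^ (m - s) * y * x ^ s)

theorem serre_one (Q : K) (x y : R) : serre Q 1 x y = x * y - y * x := by
  simp [serre, Finset.sum_range_succ, qBinom, sub_eq_add_neg]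

/-- With L and R the left and right multiplications by x and with Q ≠ 0, this is (L - QR)(L - Q⁻¹R)
applied to y. The cubic expression is likewise (L - Q²R)(L - R)(L - Q⁻²R) applied to y. -/
theorem serre_two (Q : K) (x y : R) :
    serre Q 2 x y = x * x * y - (Q + Q⁻¹) • (x * y * x) + y * x * x := by
  simp only [serre, Finset.sum_range_succ, Finset.range_zero, Finset.sum_empty, qBinom, pow_succ,
    pow_zero, one_mul, mul_assoc, mul_one, Nat.sub_zero, Nat.sub_self, mul_zero, zero_add, one_smul,
    Nat.add_one_sub_one, Nat.reduceAdd, Nat.reduceSub]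
  match_scalars <;> ring

theorem serre_three (Q : K) (hQ : Q ≠ 0) (x y : R) :
    serre Q 3 x y = x * x * x * y - (Q ^ 2 + 1 + Q⁻¹ ^ 2) • (x * x * y * x)
      + (Q ^ 2 + 1 + Q⁻¹ ^ 2) • (x * y * x * x) - y * x * x * x := by
  simp only [serre, Finset.sum_range_succ, Finset.range_zero, Finset.sum_empty, qBinom, pow_succ,
    pow_zero, one_mul, mul_assoc, mul_one, Nat.sub_zero, Nat.sub_self, mul_zero, zero_add, one_smul,
    Nat.add_one_sub_one, Nat.reduceAdd, Nat.reduceSub]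
  match_scalars <;> field_simp <;> ring

theorem serre_zero_left (Q : K) {m : ℕ} (hm : m = 1 ∨ m = 2 ∨ m = 3) (hQ : Q ≠ 0) (y : R) :
    serre Q m 0 y = 0 := by
  rcases hm with rfl | rfl | rfl <;> simp_all [serre_one, serre_two, serre_three]

theorem serre_zero_right (Q : K) (m : ℕ) (x : R) : serre Q m x 0 = 0 := by
  simp [serre]

theorem serre_add_right (Q : K) (m : ℕ) (x y y' : R) :
    serre Q m x (y + y') = serre Q m x y + serre Q m x y' := by
  simp only [serre, ← Finset.sum_add_distrib, mul_add, add_mul, smul_add]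

/-- The Serre expressions are primitive for the braided coproduct. -/
theorem serre_add (Q : K) (hQ : Q ≠ 0) {m : ℕ} (hm : m = 1 ∨ m = 2 ∨ m = 3) {a b c d : R}
    (hab : QCommute (Q ^ 2) a b) (had : QCommute (Q ^ (1 - m : ℤ)) a d)
    (hcb : QCommute (Q ^ (1 - m : ℤ)) c b) :
    serre Q m (a + b) (c + d) = serre Q m a c + serre Q m b d := by
  -- Normal form: b moves to the left of a and c, and d to the left of a. The mixed monomials then
  -- have coefficients that cancel by identities between Gaussian binomials.
  have hab' (t : R) : a * (b * t) = (Q ^ 2) • (b * (a * t)) := by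
    rw [← mul_assoc, hab, smul_mul_assoc, mul_assoc]
  have had' (t : R) : a * (d * t) = (Q ^ (1 - m : ℤ)) • (d * (a * t)) := by
    rw [← mul_assoc, had, smul_mul_assoc, mul_assoc]
  have hcb' (t : R) : c * (b * t) = (Q ^ (1 - m : ℤ)) • (b * (c * t)) := by
    rw [← mul_assoc, hcb, smul_mul_assoc, mul_assoc]
  have hab0 : a * b = (Q ^ 2) • (b * a) := hab
  have had0 : a * d = (Q ^ (1 - m : ℤ)) • (d * a) := had
  have hcb0 : c * b = (Q ^ (1 - m : ℤ)) • (b * c) := hcb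
  rcases hm with rfl | rfl | rfl
  · norm_num at had0 hcb0
    simp only [serre_one, add_mul, mul_add, had0, hcb0]
    abel
  · have e : Q ^ (1 - (2 : ℕ) : ℤ) = Q⁻¹ := by norm_num
    rw [e] at had0 hcb0 had' hcb'
    simp only [serre_two, add_mul, mul_add, had0, hcb0, hab0, mul_assoc, had', hcb', hab',
      smul_mul_assoc, mul_smul_comm, smul_add, smul_smul]
    match_scalars <;> field_simp <;> ring
  · have e : Q ^ (1 - (3 : ℕ) : ℤ) = Q⁻¹ ^ 2 := by
      rw [inv_pow]; norm_num
    rw [e] at had0 hcb0 had' hcb'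
    simp only [serre_three Q hQ, add_mul, mul_add, had0, hcb0, hab0, mul_assoc, had', hcb', hab',
      smul_mul_assoc, mul_smul_comm, smul_add, smul_smul]
    match_scalars <;> field_simp <;> ring

/-- Two elements that commute up to a scalar satisfy the Serre relation for a suitable scalar. -/
theorem serre_eq_zero_of_qCommute (Q : K) (hQ : Q ≠ 0) {m : ℕ} (hm : m = 1 ∨ m = 2 ∨ m = 3)
    {x y : R} {k : ℤ} (hk : k = 1 - m ∨ k = m - 1 ∨ (m = 3 ∧ k = 0)) (h : QCommute (Q ^ k) x y) :
    serre Q m x y = 0 := by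
  -- Since x^{m-s} y x^s = Q^{k(m-s)} y x^m, the expression is a scalar times y x^m. By the Gaussian
  -- binomial theorem the scalar vanishes for k = m - 1, m - 3, …, 1 - m.
  have h0 : x * y = Q ^ k • (y * x) := h
  have h' (t : R) : x * (y * t) = Q ^ k • (y * (x * t)) := by
    rw [← mul_assoc, h0, smul_mul_assoc, mul_assoc]
  have e2 : Q ^ (-2 : ℤ) = Q⁻¹ ^ 2 := by rw [inv_pow]; exact_mod_cast zpow_neg Q 2
  rcases hm with rfl | rfl | rfl
  · obtain rfl : k = 0 := by omega
    rw [serre_one, h0]; simp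
  · rw [serre_two]
    rcases hk with rfl | rfl | ⟨h, -⟩
    · norm_num at h0 h'
      simp only [mul_assoc, h0, h', smul_mul_assoc, mul_smul_comm, smul_smul]
      match_scalars; field_simp; ring
    · norm_num at h0 h'
      simp only [mul_assoc, h0, h', smul_mul_assoc, mul_smul_comm, smul_smul]
      match_scalars; field_simp; ring
    · omega
  · rw [serre_three Q hQ]
    rcases hk with rfl | rfl | ⟨-, rfl⟩
    · norm_num [e2] at h0 h'
      simp only [mul_assoc, h0, h', smul_mul_assoc, mul_smul_comm, smul_smul]
      match_scalars; field_simp; ring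
    · norm_num at h0 h'
      simp only [mul_assoc, h0, h', smul_mul_assoc, mul_smul_comm, smul_smul]
      match_scalars; field_simp; ring
    · norm_num at h0 h'
      simp only [mul_assoc, h0, h']
      match_scalars; ring

/-- Multiplication by commuting elements preserves the Serre relation. -/
theorem serre_mul_mul (Q : K) (m : ℕ) {p p' x y : R} (hpp : Commute p p') (hpx : Commute p x)
    (hpy : Commute p y) (hpx' : Commute p' x) :
    serre Q m (p * x) (p' * y) = p ^ m * p' * serre Q m x y := by
  simp only [serre, Finset.mul_sum]
  refine Finset.sum_congr rfl fun s hs => ?_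
  rw [mul_smul_comm]
  congr 1
  have hs' : m = (m - s) + s := by have := Finset.mem_range.1 hs; omega
  rw [hpx.mul_pow, hpx.mul_pow]
  conv_rhs => rw [hs', pow_add]
  have h1 : x ^ (m - s) * p' = p' * x ^ (m - s) := (hpx'.symm.pow_left _).eq
  have h2 : p ^ s * p' = p' * p ^ s := (hpp.pow_left _).eq
  have h3 : y * p ^ s = p ^ s * y := (hpy.symm.pow_right _).eq
  have h4 : x ^ (m - s) * p ^ s = p ^ s * x ^ (m - s) := ((hpx.pow_left s).pow_right _).symm.eq
  simp only [mul_assoc, ]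
  congr 1
  rw [← mul_assoc (x ^ (m - s)) p', h1, ← mul_assoc (p ^ s) p', h2, mul_assoc, mul_assoc]
  congr 1
  rw [← mul_assoc y, h3, mul_assoc, ← mul_assoc, h4, mul_assoc, Nat.sub_add_cancel
    (by have := Finset.mem_range.1 hs; omega)]

theorem QCommute.symm {c : K} (hc : c ≠ 0) {a b : R} (h : QCommute c a b) : QCommute c⁻¹ b a := by
  have h0 : a * b = c • (b * a) := h
  rw [QCommute, h0, inv_smul_smul₀ hc]

/-- Two elements with `a b = Q ^ 4 b a` that enclose `y` satisfy the Serre relations of type `B₂`. -/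
theorem serre_three_enclosed (Q : K) (hQ : Q ≠ 0) {a b y : R} (hab : QCommute (Q ^ 4) a b)
    (hay : QCommute (Q⁻¹ ^ 2) a y) (hyb : QCommute (Q⁻¹ ^ 2) y b) :
    serre Q 3 (a + b) y = 0 := by
  have hab0 : a * b = (Q ^ 4) • (b * a) := hab
  have hay0 : a * y = (Q⁻¹ ^ 2) • (y * a) := hay
  have hyb0 : y * b = (Q⁻¹ ^ 2) • (b * y) := hyb
  have hab' (t : R) : a * (b * t) = (Q ^ 4) • (b * (a * t)) := by
    rw [← mul_assoc, hab, smul_mul_assoc, mul_assoc]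
  have hay' (t : R) : a * (y * t) = (Q⁻¹ ^ 2) • (y * (a * t)) := by
    rw [← mul_assoc, hay, smul_mul_assoc, mul_assoc]
  have hyb' (t : R) : y * (b * t) = (Q⁻¹ ^ 2) • (b * (y * t)) := by
    rw [← mul_assoc, hyb, smul_mul_assoc, mul_assoc]
  -- Everything is brought into the order b, y, a. The reason for the vanishing is the factorization
  -- in terms of the multiplications L, R by a + b: the factor L - Q²R turns y into (1 - Q⁴) a y,
  -- then L - R gives (1 - Q⁴)(1 - Q²)(a + b) a y, and right multiplication of this by a + b equals
  -- Q² times left multiplication, so that L - Q⁻²R kills it.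
  simp only [serre_three Q hQ, add_mul, mul_add, hab0, hay0, hyb0, mul_assoc, hab', hay', hyb',
      smul_mul_assoc, mul_smul_comm, smul_add, smul_smul]
  match_scalars <;> field_simp <;> ring

/-- The sum of `u = p ^ 2`, `m = p r + r p` and `l = r ^ 2`, where `p r = Q ^ 2 r p` and `y` is
enclosed by `p` and `r`, satisfies a Serre relation with parameter `Q ^ 2`. -/
theorem serre_two_square (Q : K) (hQ : Q ≠ 0) {u m l y : R} (huy : QCommute (Q⁻¹ ^ 2) u y)
    (hmy : QCommute (1 : K) m y) (hyl : QCommute (Q⁻¹ ^ 2) y l) (hum : QCommute (Q ^ 4) u m)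
    (hml : QCommute (Q ^ 4) m l) (hul : QCommute (Q ^ 8) u l)
    (hmm : m * m = (Q⁻¹ ^ 4 * (Q + Q⁻¹) ^ 2) • (u * l)) :
    serre (Q ^ 2) 2 (u + m + l) y = 0 := by
  have huy0 : u * y = (Q⁻¹ ^ 2) • (y * u) := huy
  have hmy0 : m * y = (1 : K) • (y * m) := hmy
  have hyl0 : y * l = (Q⁻¹ ^ 2) • (l * y) := hyl
  have hum0 : u * m = (Q ^ 4) • (m * u) := hum
  have hml0 : m * l = (Q ^ 4) • (l * m) := hml
  have hul0 : u * l = (Q ^ 8) • (l * u) := hul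
  rw [hul0] at hmm
  have huy' (t : R) : u * (y * t) = (Q⁻¹ ^ 2) • (y * (u * t)) := by
    rw [← mul_assoc, huy, smul_mul_assoc, mul_assoc]
  have hmy' (t : R) : m * (y * t) = (1 : K) • (y * (m * t)) := by
    rw [← mul_assoc, hmy, smul_mul_assoc, mul_assoc]
  have hyl' (t : R) : y * (l * t) = (Q⁻¹ ^ 2) • (l * (y * t)) := by
    rw [← mul_assoc, hyl, smul_mul_assoc, mul_assoc]
  -- In the model u = p², m = pr + rp, l = r² the sum is (p + r)². The factor L - Q²R turns y into
  -- (1 - Q⁴)(p + r) p y. On this element R acts as Q²L, so the second factor L - Q⁻²R annihilates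
  -- it. The hypothesis on m·m is what remains of the model when only u, m, l are given.
  simp only [serre_two, add_mul, mul_add, huy0, hmy0, hyl0, hum0, hml0, hul0, hmm, mul_assoc, huy',
    hmy', hyl', smul_mul_assoc, mul_smul_comm, smul_add, smul_smul]
  match_scalars <;> field_simp <;> ring

/-- Both Serre relations for a pair of elements. -/
def SerrePair (Q Q' : K) (m m' : ℕ) (x y : R) : Prop :=
  serre Q m x y = 0 ∧ serre Q' m' y x = 0

/-- The commutation relations between two pairs of elements under which Serre expressions are
additive. -/
structure Precedes (Q Q' c : K) (s t : R × R) : Prop where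
  fst_fst : QCommute (Q ^ 2) s.1 t.1
  fst_snd : QCommute c s.1 t.2
  snd_fst : QCommute c s.2 t.1
  snd_snd : QCommute (Q' ^ 2) s.2 t.2

theorem Precedes.sum {Q Q' c : K} {s : R × R} :
    ∀ {l : List (R × R)}, (∀ t ∈ l, Precedes Q Q' c s t) →
      Precedes Q Q' c s ((l.map Prod.fst).sum, (l.map Prod.snd).sum)
  | [], _ => ⟨.zero_right _ _, .zero_right _ _, .zero_right _ _, .zero_right _ _⟩
  | t :: l, h => by
    have h1 := h t (by simp)
    have h2 := Precedes.sum (l := l) fun t' ht' => h t' (by simp [ht'])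
    simp only [List.map_cons, List.sum_cons]
    exact ⟨h1.1.add_right h2.1, h1.2.add_right h2.2, h1.3.add_right h2.3, h1.4.add_right h2.4⟩

/-- Serre relations for sums of elements. -/
theorem serrePair_sum {Q Q' : K} (hQ : Q ≠ 0) (hQ' : Q' ≠ 0) {m m' : ℕ}
    (hm : m = 1 ∨ m = 2 ∨ m = 3) (hm' : m' = 1 ∨ m' = 2 ∨ m' = 3) {c : K}
    (hc : Q ^ (1 - m : ℤ) = c) (hc' : Q' ^ (1 - m' : ℤ) = c) :
    ∀ {l : List (R × R)}, l.Pairwise (Precedes Q Q' c) →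
      (∀ s ∈ l, SerrePair Q Q' m m' s.1 s.2) →
      SerrePair Q Q' m m' (l.map Prod.fst).sum (l.map Prod.snd).sum
  | [], _, _ => ⟨serre_zero_right _ _ _, serre_zero_right _ _ _⟩
  | s :: l, hl, h => by
    have h1 := h s (by simp)
    rw [List.pairwise_cons] at hl
    have h2 := serrePair_sum hQ hQ' hm hm' hc hc' hl.2 fun t ht => h t (by simp [ht])
    have h3 := Precedes.sum hl.1
    simp only [List.map_cons, List.sum_cons]
    -- The two relations need the same mixed factor c. For Q = q^{d_i} and m = 1 - a_{ij} the
    -- equality of Q^{1-m} and Q'^{1-m'} is the symmetry d_i a_{ij} = d_j a_{ji}.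
    constructor
    · rw [serre_add Q hQ hm h3.1 (hc ▸ h3.2) (hc ▸ h3.3), h1.1, h2.1, add_zero]
    · rw [serre_add Q' hQ' hm' h3.4 (hc' ▸ h3.3) (hc' ▸ h3.2), h1.2, h2.2, add_zero]

theorem serrePair_zero_left {Q Q' : K} (hQ : Q ≠ 0) {m m' : ℕ} (hm : m = 1 ∨ m = 2 ∨ m = 3)
    (y : R) : SerrePair Q Q' m m' 0 y :=
  ⟨serre_zero_left Q hm hQ y, serre_zero_right _ _ _⟩

theorem serrePair_zero_right {Q Q' : K} (hQ' : Q' ≠ 0) {m m' : ℕ}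
    (hm' : m' = 1 ∨ m' = 2 ∨ m' = 3) (x : R) : SerrePair Q Q' m m' x 0 :=
  ⟨serre_zero_right _ _ _, serre_zero_left Q' hm' hQ' x⟩

end QCommute

end QuantumSeries

namespace QuantumSeries

/-! ### Monomials -/

/-- Labels of the commuting units `z_i`, `z̃_i`, `T_i`. -/
inductive ZLabel : Type
  | z (i : ℕ)
  | zt (i : ℕ)
  | t (i : ℕ)

/-- Labels of the commuting elements `x_i`, `x_i⁻¹`, `x̃_i`, `x̃_i⁻¹`. -/
inductive XLabel : Type
  | x (i : ℕ)
  | xi (i : ℕ)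
  | xt (i : ℕ)
  | xti (i : ℕ)

/-- Exponents of monomials in `z_i`, `z̃_i`, `T_i`. -/
abbrev ZExp : Type := ZLabel →₀ ℤ

/-- Exponents of monomials in `x_i`, `x_i⁻¹`, `x̃_i`, `x̃_i⁻¹`. -/
abbrev XExp : Type := XLabel →₀ ℕ

namespace ZExp

def z (i : ℕ) : ZExp := Finsupp.single (.z i) 1
def zt (i : ℕ) : ZExp := Finsupp.single (.zt i) 1
def t (i : ℕ) : ZExp := Finsupp.single (.t i) 1

end ZExp

namespace XExp

def x (i : ℕ) : XExp := Finsupp.single (.x i) 1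
def xi (i : ℕ) : XExp := Finsupp.single (.xi i) 1
def xt (i : ℕ) : XExp := Finsupp.single (.xt i) 1
def xti (i : ℕ) : XExp := Finsupp.single (.xti i) 1

end XExp

open ZExp XExp

/-- The exponent `k` in `a b = q ^ k b a` for the generators. -/
def weylForm : XLabel → ZLabel → ℤ
  | .x i, .z j => if i = j then 1 else 0
  | .xi i, .z j => if i = j then -1 else 0
  | .xt i, .zt j => if i = j then 1 else 0
  | .xti i, .zt j => if i = j then -1 else 0
  | _, _ => 0

/-- The bilinear extension of `weylForm`, multiplied by `d`. -/
def pairingHom (d : ℕ) : XExp →+ ZExp →+ ℤ :=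
  Finsupp.liftAddHom fun l => multiplesHom (ZExp →+ ℤ)
    (Finsupp.liftAddHom fun a => zmultiplesHom ℤ (d * weylForm l a))

/-- The exponent `k` in `a b = v ^ k b a` for monomials `a` and `b`, where `q = v ^ d`. -/
def pairing (d : ℕ) (ξ : XExp) (a : ZExp) : ℤ := pairingHom d ξ a

/-- The additive form of `weight`. -/
def weightHom (X : Series) (n : ℕ) (j : ℕ) : ZExp →+ ℤ :=
  Finsupp.liftAddHom fun a => zmultiplesHom ℤ
    (match a with
    | .t i => if 1 ≤ i ∧ i ≤ n then dExp X i * cartanEntry X i j else 0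
    | _ => 0)

/-- The exponent `k` in `a E_j = v ^ k E_j a` for monomials `a`. -/
def weight (X : Series) (n : ℕ) (j : ℕ) (a : ZExp) : ℤ := weightHom X n j a

section pairing

variable (d i j : ℕ)

theorem pairing_single (l : XLabel) (a : ZLabel) :
    pairing d (Finsupp.single l 1) (Finsupp.single a 1) = d * weylForm l a := by
  simp [pairing, pairingHom]

@[simp] theorem pairing_add_left (ξ η : XExp) (a : ZExp) :
    pairing d (ξ + η) a = pairing d ξ a + pairing d η a := by
  simp [pairing]

@[simp] theorem pairing_nsmul_left (k : ℕ) (ξ : XExp) (a : ZExp) :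
    pairing d (k • ξ) a = k * pairing d ξ a := by
  simp [pairing]

@[simp] theorem pairing_zero_left (a : ZExp) : pairing d 0 a = 0 := by simp [pairing]

@[simp] theorem pairing_add (ξ : XExp) (a b : ZExp) :
    pairing d ξ (a + b) = pairing d ξ a + pairing d ξ b := by
  simp [pairing]

@[simp] theorem pairing_sub (ξ : XExp) (a b : ZExp) :
    pairing d ξ (a - b) = pairing d ξ a - pairing d ξ b := by
  simp [pairing]

@[simp] theorem pairing_neg (ξ : XExp) (a : ZExp) : pairing d ξ (-a) = -pairing d ξ a := by
  simp [pairing]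

@[simp] theorem pairing_zero (ξ : XExp) : pairing d ξ 0 = 0 := by simp [pairing]

@[simp] theorem pairing_nsmul (k : ℕ) (ξ : XExp) (a : ZExp) :
    pairing d ξ (k • a) = k * pairing d ξ a := by
  simp [pairing]

@[simp] theorem pairing_x_z : pairing d (x i) (z j) = if i = j then (d : ℤ) else 0 := by
  rw [x, z, pairing_single]; simp [weylForm]
@[simp] theorem pairing_xi_z : pairing d (xi i) (z j) = if i = j then -(d : ℤ) else 0 := by
  rw [xi, z, pairing_single]; simp [weylForm]
@[simp] theorem pairing_xt_z : pairing d (xt i) (z j) = 0 := by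
  rw [xt, z, pairing_single]; simp [weylForm]
@[simp] theorem pairing_xti_z : pairing d (xti i) (z j) = 0 := by
  rw [xti, z, pairing_single]; simp [weylForm]
@[simp] theorem pairing_x_zt : pairing d (x i) (zt j) = 0 := by
  rw [x, zt, pairing_single]; simp [weylForm]
@[simp] theorem pairing_xi_zt : pairing d (xi i) (zt j) = 0 := by
  rw [xi, zt, pairing_single]; simp [weylForm]
@[simp] theorem pairing_xt_zt : pairing d (xt i) (zt j) = if i = j then (d : ℤ) else 0 := by
  rw [xt, zt, pairing_single]; simp [weylForm]
@[simp] theorem pairing_xti_zt : pairing d (xti i) (zt j) = if i = j then -(d : ℤ) else 0 := by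
  rw [xti, zt, pairing_single]; simp [weylForm]

@[simp] theorem pairing_t (ξ : XExp) : pairing d ξ (t j) = 0 := by
  induction ξ using Finsupp.induction_linear with
  | zero => simp
  | add f g hf hg => rw [pairing_add_left, hf, hg, add_zero]
  | single l k =>
    rw [← mul_one k, ← smul_eq_mul, ← Finsupp.smul_single, pairing_nsmul_left, t, pairing_single]
    cases l <;> simp [weylForm]

variable (X : Series) (n : ℕ)

@[simp] theorem weight_z : weight X n j (z i) = 0 := by simp [weight, weightHom, z]
@[simp] theorem weight_zt : weight X n j (zt i) = 0 := by simp [weight, weightHom, zt]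
@[simp] theorem weight_t :
    weight X n j (t i) = if 1 ≤ i ∧ i ≤ n then (dExp X i * cartanEntry X i j : ℤ) else 0 := by
  simp [weight, weightHom, t]

@[simp] theorem weight_add (a b : ZExp) : weight X n j (a + b) = weight X n j a + weight X n j b := by
  simp [weight]

@[simp] theorem weight_sub (a b : ZExp) : weight X n j (a - b) = weight X n j a - weight X n j b := by
  simp [weight]

@[simp] theorem weight_neg (a : ZExp) : weight X n j (-a) = -weight X n j a := by simp [weight]

@[simp] theorem weight_zero : weight X n j 0 = 0 := by simp [weight]

@[simp] theorem weight_nsmul (k : ℕ) (a : ZExp) : weight X n j (k • a) = k * weight X n j a := by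
  simp [weight]

end pairing

/-! ### Elements with the commutation relations of the target algebra -/

/-- Elements of an algebra with the commutation relations of `(⨂_i W_i) ⊗ Ū_q(X_{n-1})`. -/
structure QSystem {K : Type*} [Field K] (X : Series) (n : ℕ) (v : Kˣ) (R : Type*) [Ring R]
    [Algebra K R] where
  H : Multiplicative ZExp →* Rˣ
  -- Only a homomorphism of monoids: x_i⁻¹ is a letter of its own, as it is 0 for indices out of
  -- range. That it is inverse to x_i is a separate axiom for the indices in range.
  P : Multiplicative XExp →* R
  E : ℕ → R
  F : ℕ → R
  P_H (ξ : XExp) (a : ZExp) :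
    QCommute ((v : K) ^ pairing (qExp X) ξ a) (P (.ofAdd ξ)) (H (.ofAdd a) : R)
  E_H (j : ℕ) (a : ZExp) : QCommute ((v : K) ^ (-weight X n j a)) (E j) (H (.ofAdd a) : R)
  F_H (j : ℕ) (a : ZExp) : QCommute ((v : K) ^ weight X n j a) (F j) (H (.ofAdd a) : R)
  P_E (ξ : XExp) (j : ℕ) : Commute (P (.ofAdd ξ)) (E j)
  P_F (ξ : XExp) (j : ℕ) : Commute (P (.ofAdd ξ)) (F j)
  E_F_of_ne (i j : ℕ) (h : i ≠ j) : Commute (E i) (F j)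
  E_F (i : ℕ) (h : 1 ≤ i) (h' : i < n) : E i * F i - F i * E i =
    ((v : K) ^ dExp X i - ((v : K) ^ dExp X i)⁻¹)⁻¹ • ((H (.ofAdd (t i)) : R) - H (.ofAdd (-t i)))
  F_eq_zero (i : ℕ) (h : n ≤ i) : F i = 0
  serre_E (i j : ℕ) (h : i ≠ j) :
    serre ((v : K) ^ dExp X i) (1 - cartanEntry X i j).toNat (E i) (E j) = 0
  serre_F (i j : ℕ) (h : i ≠ j) :
    serre ((v : K) ^ dExp X i) (1 - cartanEntry X i j).toNat (F i) (F j) = 0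
  P_xi_eq_zero (i : ℕ) (h : n < i) : P (.ofAdd (xi i)) = 0
  x_xi (i : ℕ) (h : 1 ≤ i) (h' : i ≤ n) : P (.ofAdd (x i + xi i)) = 1
  xt_xti (i : ℕ) (h : n - numTilde X n < i) (h' : i ≤ n) : P (.ofAdd (xt i + xti i)) = 1

namespace QSystem

variable {K : Type*} [Field K] {X : Series} {n : ℕ} {v : Kˣ} {R : Type*} [Ring R] [Algebra K R]
  (s : QSystem X n v R)

/-- A monomial. -/
def mon (c : K) (a : ZExp) (ξ : XExp) : R := c • ((s.H (.ofAdd a) : R) * s.P (.ofAdd ξ))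

theorem H_add (a b : ZExp) :
    (s.H (.ofAdd (a + b)) : R) = s.H (.ofAdd a) * (s.H (.ofAdd b) : R) := by
  rw [ofAdd_add, map_mul, Units.val_mul]

theorem P_add (a b : XExp) : s.P (.ofAdd (a + b)) = s.P (.ofAdd a) * s.P (.ofAdd b) := by
  rw [ofAdd_add, map_mul]

/-- Only x^ξ and z^b have to be exchanged, because the z's commute among themselves and so do the
x's. -/
theorem mon_mul_mon (c c' : K) (a b : ZExp) (ξ η : XExp) :
    s.mon c a ξ * s.mon c' b η
      = s.mon (c * c' * (v : K) ^ pairing (qExp X) ξ b) (a + b) (ξ + η) := by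
  have h := s.P_H ξ b
  rw [QCommute] at h
  simp only [mon, H_add, P_add, smul_mul_assoc, mul_smul_comm, smul_smul]
  rw [show ∀ p q r t : R, p * q * (r * t) = p * (q * r) * t from fun p q r t => by
    simp only [mul_assoc], h]
  simp only [smul_mul_assoc, mul_smul_comm, smul_smul, mul_assoc, mul_left_comm c' c]

theorem zpow_add' (k l : ℤ) : (v : K) ^ (k + l) = (v : K) ^ k * (v : K) ^ l :=
  zpow_add₀ v.ne_zero k l

theorem qCommute_mon_mon {c c' : K} {a b : ZExp} {ξ η : XExp} {k : ℤ}
    (h : pairing (qExp X) ξ b - pairing (qExp X) η a = k) :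
    QCommute ((v : K) ^ k) (s.mon c a ξ) (s.mon c' b η) := by
  rw [QCommute, mon_mul_mon, mon_mul_mon, add_comm b, add_comm η]
  simp only [mon, smul_smul]
  congr 1
  rw [show pairing (qExp X) ξ b = k + pairing (qExp X) η a by omega, zpow_add']
  ring

theorem E_mul_mon (i : ℕ) (c : K) (a : ZExp) (ξ : XExp) :
    s.E i * s.mon c a ξ = (v : K) ^ (-weight X n i a) • (s.mon c a ξ * s.E i) := by
  have h := s.E_H i a
  rw [QCommute] at h
  simp only [mon, mul_smul_comm, smul_mul_assoc]
  rw [← mul_assoc, h, smul_mul_assoc, mul_assoc, ← (s.P_E ξ i).eq, mul_assoc, smul_comm]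

theorem F_mul_mon (i : ℕ) (c : K) (a : ZExp) (ξ : XExp) :
    s.F i * s.mon c a ξ = (v : K) ^ (weight X n i a) • (s.mon c a ξ * s.F i) := by
  have h := s.F_H i a
  rw [QCommute] at h
  simp only [mon, mul_smul_comm, smul_mul_assoc]
  rw [← mul_assoc, h, smul_mul_assoc, mul_assoc, ← (s.P_F ξ i).eq, mul_assoc, smul_comm]

theorem qCommute_E_mon {i : ℕ} {c : K} {a : ZExp} {ξ : XExp} {k : ℤ}
    (h : -weight X n i a = k) : QCommute ((v : K) ^ k) (s.E i) (s.mon c a ξ) := by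
  rw [QCommute, E_mul_mon, h]

theorem qCommute_mon_E {i : ℕ} {c : K} {a : ZExp} {ξ : XExp} {k : ℤ}
    (h : weight X n i a = k) : QCommute ((v : K) ^ k) (s.mon c a ξ) (s.E i) := by
  rw [QCommute, E_mul_mon, smul_smul, ← zpow_add', ← h, add_neg_cancel, zpow_zero, one_smul]

/-- The product of a monomial in the `x_i` and `F_i`. -/
def monF (ξ : XExp) (i : ℕ) : R := s.P (.ofAdd ξ) * s.F i

theorem P_mul_mon (ξ : XExp) (c : K) (a : ZExp) (η : XExp) :
    s.P (.ofAdd ξ) * s.mon c a η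
      = (v : K) ^ pairing (qExp X) ξ a • (s.mon c a η * s.P (.ofAdd ξ)) := by
  have h := s.P_H ξ a
  rw [QCommute] at h
  have h' : s.P (.ofAdd ξ) * s.P (.ofAdd η) = s.P (.ofAdd η) * s.P (.ofAdd ξ) := by
    rw [← P_add, add_comm, P_add]
  simp only [mon, mul_smul_comm, smul_mul_assoc]
  rw [← mul_assoc, h, smul_mul_assoc, mul_assoc, h', mul_assoc, smul_comm]

theorem monF_mul_mon (η : XExp) (i : ℕ) (c : K) (a : ZExp) (ξ : XExp) :
    s.monF η i * s.mon c a ξ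
      = (v : K) ^ (pairing (qExp X) η a + weight X n i a) • (s.mon c a ξ * s.monF η i) := by
  rw [monF, mul_assoc, F_mul_mon, mul_smul_comm, ← mul_assoc, P_mul_mon, smul_mul_assoc, smul_smul,
    ← zpow_add', mul_assoc, add_comm]

theorem qCommute_monF_mon {η ξ : XExp} {i : ℕ} {c : K} {a : ZExp} {k : ℤ}
    (h : pairing (qExp X) η a + weight X n i a = k) :
    QCommute ((v : K) ^ k) (s.monF η i) (s.mon c a ξ) := by
  rw [QCommute, monF_mul_mon, h]

theorem qCommute_mon_monF {η ξ : XExp} {i : ℕ} {c : K} {a : ZExp} {k : ℤ}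
    (h : -(pairing (qExp X) η a + weight X n i a) = k) :
    QCommute ((v : K) ^ k) (s.mon c a ξ) (s.monF η i) := by
  rw [QCommute, monF_mul_mon, smul_smul, ← zpow_add', ← h, neg_add_cancel, zpow_zero, one_smul]

/-- The Serre relations for elements that differ from `F_i`, `F_j` by monomials in the `x_i`. -/
theorem serre_monF (Q : K) (m : ℕ) (ξ η : XExp) (i j : ℕ) (h : serre Q m (s.F i) (s.F j) = 0) :
    serre Q m (s.monF ξ i) (s.monF η j) = 0 := by
  rw [monF, monF, serre_mul_mul _ _ (by rw [Commute, SemiconjBy, ← P_add, add_comm, P_add])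
    (s.P_F _ _) (s.P_F _ _) (s.P_F _ _), h, mul_zero]

theorem mon_congr {c c' : K} {a a' : ZExp} {ξ ξ' : XExp} (hc : c = c') (ha : a = a')
    (hξ : ξ = ξ') : s.mon c a ξ = s.mon c' a' ξ' := by rw [hc, ha, hξ]

/-- The elements `c (a - b) ξ`, for example `{a} ξ`. -/
def curl (c : K) (a b : ZExp) (ξ : XExp) : R := s.mon c a ξ + s.mon (-c) b ξ

/-- The summands of the images of the generators. -/
inductive Term (K : Type*) : Type _
  | mon (c : K) (a : ZExp) (ξ : XExp)
  | E (i : ℕ)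
  | F (ξ : XExp) (i : ℕ)

/-- The element given by a term. -/
def eval : Term K → R
  | .mon c a ξ => s.mon c a ξ
  | .E i => s.E i
  | .F ξ i => s.monF ξ i

/-- The condition on two terms that ensures `a b = v ^ k b a`. -/
def Term.QComm (X : Series) (n : ℕ) (k : ℤ) : Term K → Term K → Prop
  | .mon _ a ξ, .mon _ b η => pairing (qExp X) ξ b - pairing (qExp X) η a = k
  | .E i, .mon _ a _ => -weight X n i a = k
  | .mon _ a _, .E i => weight X n i a = k
  | .F η i, .mon _ a _ => pairing (qExp X) η a + weight X n i a = k
  | .mon _ a _, .F η i => -(pairing (qExp X) η a + weight X n i a) = k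
  | _, _ => False

/-- Pairs without a monomial are excluded by `Term.QComm`; their relations are not determined by
exponents and come from Ū. -/
theorem Term.QComm.qCommute {k : ℤ} :
    ∀ {a b : Term K}, Term.QComm X n k a b → QCommute ((v : K) ^ k) (s.eval a) (s.eval b)
  | .mon _ _ _, .mon _ _ _, h => s.qCommute_mon_mon h
  | .E _, .mon _ _ _, h => s.qCommute_E_mon h
  | .mon _ _ _, .E _, h => s.qCommute_mon_E h
  | .F _ _, .mon _ _ _, h => s.qCommute_monF_mon h
  | .mon _ _ _, .F _ _, h => s.qCommute_mon_monF h

/-- The sum of a list of terms. -/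
def evalSum (l : List (Term K)) : R := (l.map s.eval).sum

theorem evalSum_nil : s.evalSum [] = 0 := rfl

theorem evalSum_cons (t : Term K) (l : List (Term K)) :
    s.evalSum (t :: l) = s.eval t + s.evalSum l := by
  simp [evalSum]

theorem qCommute_evalSum {k : ℤ} {l l' : List (Term K)}
    (h : ∀ a ∈ l, ∀ b ∈ l', Term.QComm X n k a b) :
    QCommute ((v : K) ^ k) (s.evalSum l) (s.evalSum l') := by
  induction l with
  | nil => exact .zero_left _ _
  | cons a l ih =>
    rw [evalSum_cons]
    refine .add_left ?_ (ih fun a ha => h a (by simp [ha]))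
    clear ih
    induction l' with
    | nil => exact .zero_right _ _
    | cons b l' ih =>
      rw [evalSum_cons]
      exact .add_right ((h a (by simp) b (by simp)).qCommute s)
        (ih fun a ha b hb => h a ha b (by simp [hb]))

/-- The condition on pairs of sums under which Serre expressions with the parameters `v ^ d` and
`v ^ d'` are additive. -/
def Term.Precedes (X : Series) (n : ℕ) (d d' k : ℤ) (p p' : List (Term K) × List (Term K)) : Prop :=
  (∀ a ∈ p.1, (∀ b ∈ p'.1, Term.QComm X n (2 * d) a b) ∧ ∀ b ∈ p'.2, Term.QComm X n k a b) ∧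
  ∀ a ∈ p.2, (∀ b ∈ p'.1, Term.QComm X n k a b) ∧ ∀ b ∈ p'.2, Term.QComm X n (2 * d') a b

theorem Term.Precedes.precedes {d d' k : ℤ} {p p' : List (Term K) × List (Term K)}
    (h : Term.Precedes X n d d' k p p') :
    QuantumSeries.Precedes ((v : K) ^ d) ((v : K) ^ d') ((v : K) ^ k)
      (s.evalSum p.1, s.evalSum p.2) (s.evalSum p'.1, s.evalSum p'.2) := by
  have e (e : ℤ) : ((v : K) ^ e) ^ 2 = (v : K) ^ (2 * e) := by
    rw [mul_comm, zpow_mul, zpow_ofNat]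
  refine ⟨?_, ?_, ?_, ?_⟩
  · rw [e]; exact s.qCommute_evalSum fun a ha => (h.1 a ha).1
  · exact s.qCommute_evalSum fun a ha => (h.1 a ha).2
  · exact s.qCommute_evalSum fun a ha => (h.2 a ha).1
  · rw [e]; exact s.qCommute_evalSum fun a ha => (h.2 a ha).2

/-- Serre relations for sums of terms. -/
theorem serrePair_evalSum {d d' k : ℤ} {m m' : ℕ} (hm : m = 1 ∨ m = 2 ∨ m = 3)
    (hm' : m' = 1 ∨ m' = 2 ∨ m' = 3) (hk : d * (1 - m : ℤ) = k) (hk' : d' * (1 - m' : ℤ) = k)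
    {l : List (List (Term K) × List (Term K))} (hl : l.Pairwise (Term.Precedes X n d d' k))
    (h : ∀ p ∈ l, SerrePair ((v : K) ^ d) ((v : K) ^ d') m m' (s.evalSum p.1) (s.evalSum p.2))
    {a b : R} (ha : (l.map fun p => s.evalSum p.1).sum = a)
    (hb : (l.map fun p => s.evalSum p.2).sum = b) :
    SerrePair ((v : K) ^ d) ((v : K) ^ d') m m' a b := by
  have := serrePair_sum (l := l.map fun p => (s.evalSum p.1, s.evalSum p.2))
    (zpow_ne_zero d v.ne_zero) (zpow_ne_zero d' v.ne_zero) hm hm'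
    (c := (v : K) ^ k) (by rw [← zpow_mul, hk]) (by rw [← zpow_mul, hk'])
    (List.pairwise_map.2 (hl.imp fun h => h.precedes s)) (by rwa [List.forall_mem_map])
  simpa [Function.comp_def, ha, hb] using this

/-- A block with an empty side carries no condition of its own. This is what permits interleaving
the monomials of two generators one by one. -/
theorem serrePair_evalSum_nil_left (d d' : ℤ) {m m' : ℕ} (hm : m = 1 ∨ m = 2 ∨ m = 3)
    (l : List (Term K)) :
    SerrePair ((v : K) ^ d) ((v : K) ^ d') m m' (s.evalSum []) (s.evalSum l) :=
  serrePair_zero_left (zpow_ne_zero _ v.ne_zero) hm _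

theorem serrePair_evalSum_nil_right (d d' : ℤ) {m m' : ℕ} (hm' : m' = 1 ∨ m' = 2 ∨ m' = 3)
    (l : List (Term K)) :
    SerrePair ((v : K) ^ d) ((v : K) ^ d') m m' (s.evalSum l) (s.evalSum []) :=
  serrePair_zero_right (zpow_ne_zero _ v.ne_zero) hm' _

/-- The x-monomials in front of the F's commute with each other and with all F's, so they factor out
of the Serre expression. -/
theorem serrePair_F {i j : ℕ} (hij : i ≠ j) (ξ η : XExp) :
    SerrePair ((v : K) ^ (dExp X i : ℤ)) ((v : K) ^ (dExp X j : ℤ)) (1 - cartanEntry X i j).toNat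
      (1 - cartanEntry X j i).toNat (s.evalSum [.F ξ i]) (s.evalSum [.F η j]) := by
  simp only [evalSum_cons, evalSum_nil, add_zero, zpow_natCast, eval]
  exact ⟨s.serre_monF _ _ _ _ _ _ (s.serre_F i j hij),
    s.serre_monF _ _ _ _ _ _ (s.serre_F j i hij.symm)⟩

theorem serrePair_E {i j : ℕ} (hij : i ≠ j) :
    SerrePair ((v : K) ^ (dExp X i : ℤ)) ((v : K) ^ (dExp X j : ℤ)) (1 - cartanEntry X i j).toNat
      (1 - cartanEntry X j i).toNat (s.evalSum [.E i]) (s.evalSum [.E j]) := by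
  simp only [evalSum_cons, evalSum_nil, add_zero, zpow_natCast, eval]
  exact ⟨s.serre_E i j hij, s.serre_E j i hij.symm⟩

theorem serrePair_one_iff {Q Q' : K} {x y : R} : SerrePair Q Q' 1 1 x y ↔ Commute x y := by
  rw [SerrePair, serre_one, serre_one, sub_eq_zero, sub_eq_zero]
  exact ⟨fun h => h.1, fun h => ⟨h, h.symm⟩⟩

theorem commute_of_qCommute_zero {x y : R} (h : QCommute ((v : K) ^ (0 : ℤ)) x y) :
    Commute x y := by
  rwa [QCommute, zpow_zero, one_smul] at h

/-- Sums of terms commute if all terms do. -/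
theorem commute_evalSum {l l' : List (Term K)} {p p' : Term K}
    (h : Commute (s.eval p) (s.eval p')) (h1 : ∀ a ∈ l, ∀ b ∈ p' :: l', Term.QComm X n 0 a b)
    (h2 : ∀ b ∈ l', Term.QComm X n 0 p b) :
    Commute (s.evalSum (p :: l)) (s.evalSum (p' :: l')) := by
  rw [evalSum_cons]
  refine .add_left ?_ (commute_of_qCommute_zero (s.qCommute_evalSum h1))
  rw [evalSum_cons]
  refine h.add_right (commute_of_qCommute_zero (v := v) ?_)
  have := s.qCommute_evalSum (l := [p]) (l' := l') (k := 0) (by simpa using h2)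
  simpa [evalSum_cons, evalSum_nil] using this

theorem commute_E {i j : ℕ} (hij : i ≠ j) (h : cartanEntry X i j = 0) :
    Commute (s.eval (.E i)) (s.eval (.E j)) := by
  have := s.serre_E i j hij
  rw [h] at this
  exact sub_eq_zero.1 ((serre_one _ _ _).symm.trans this)

theorem commute_F {i j : ℕ} (hij : i ≠ j) (h : cartanEntry X i j = 0) (ξ η : XExp) :
    Commute (s.eval (.F ξ i)) (s.eval (.F η j)) := by
  have := s.serre_monF _ _ ξ η _ _ (s.serre_F i j hij)
  rw [h] at this
  exact sub_eq_zero.1 ((serre_one _ _ _).symm.trans this)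

/-! ### Commutators -/

/-- The commutator. -/
def comm (a b : R) : R := a * b - b * a

theorem comm_add (a b c : R) : comm a (b + c) = comm a b + comm a c := by
  simp only [comm, mul_add, add_mul]; abel

theorem add_comm_left (a b c : R) : comm (a + b) c = comm a c + comm b c := by
  simp only [comm, mul_add, add_mul]; abel

/-- The hypotheses make the products of first monomials, and those of second monomials, independent
of the order of the factors. Only the two crossed products remain, and they form a bracket. If the
two powers of v coincide, nothing is left. -/
theorem comm_curl_curl {c c' : K} {a b a' b' : ZExp} {ξ η : XExp}
    (h : pairing (qExp X) ξ a' = pairing (qExp X) η a)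
    (h' : pairing (qExp X) ξ b' = pairing (qExp X) η b) :
    comm (s.curl c a b ξ) (s.curl c' a' b' η) =
      s.curl (c * c' * ((v : K) ^ pairing (qExp X) η a - (v : K) ^ pairing (qExp X) η b))
        (a + b') (b + a') (ξ + η) := by
  simp only [comm, curl, add_mul, mul_add, mon_mul_mon, h, h', add_comm a', add_comm b',
    add_comm η]
  simp only [mon]
  module

theorem comm_curl_curl_eq_zero {c c' : K} {a b a' b' : ZExp} {ξ η : XExp}
    (h : pairing (qExp X) ξ a' = pairing (qExp X) η a)
    (h' : pairing (qExp X) ξ b' = pairing (qExp X) η b)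
    (h'' : pairing (qExp X) η a = pairing (qExp X) η b) :
    comm (s.curl c a b ξ) (s.curl c' a' b' η) = 0 := by
  rw [comm_curl_curl s h h', h'', sub_self, mul_zero]
  simp [curl, mon]

theorem comm_curl_monF {c : K} {a b : ZExp} {ξ η : XExp} {i : ℕ}
    (h : pairing (qExp X) η a + weight X n i a = 0)
    (h' : pairing (qExp X) η b + weight X n i b = 0) :
    comm (s.curl c a b ξ) (s.monF η i) = 0 := by
  rw [comm, curl, add_mul, mul_add, monF_mul_mon, monF_mul_mon, h, h', zpow_zero, one_smul,
    one_smul, sub_self]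

theorem comm_E_curl {c : K} {a b : ZExp} {ξ : XExp} {i : ℕ}
    (h : weight X n i a = 0) (h' : weight X n i b = 0) :
    comm (s.E i) (s.curl c a b ξ) = 0 := by
  rw [comm, curl, add_mul, mul_add, E_mul_mon, E_mul_mon, h, h', neg_zero, zpow_zero,
    one_smul, one_smul, sub_self]

theorem comm_E_monF_of_ne {i j : ℕ} (h : i ≠ j) (ξ : XExp) : comm (s.E i) (s.monF ξ j) = 0 := by
  rw [comm, monF, sub_eq_zero]
  exact ((s.P_E ξ i).symm.mul_right (s.E_F_of_ne i j h)).eq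

theorem curl_eq_zero {c : K} {a b : ZExp} {ξ : XExp} (h : s.P (.ofAdd ξ) = 0) :
    s.curl c a b ξ = 0 := by
  simp [curl, mon, h]

/-- For i = n the element F_n is zero although the bracket of T_n need not be. The condition on ξ
makes both sides vanish there. -/
theorem comm_E_monF {i : ℕ} (hi : 1 ≤ i) (ξ : XExp) (hξ : n ≤ i → s.P (.ofAdd ξ) = 0) :
    comm (s.E i) (s.monF ξ i) =
      s.curl (((v : K) ^ dExp X i - ((v : K) ^ dExp X i)⁻¹)⁻¹) (t i) (-t i) ξ := by
  rcases lt_or_ge i n with h | h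
  · rw [comm, monF, ← mul_assoc, ← (s.P_E ξ i).eq, mul_assoc, mul_assoc, ← mul_sub,
      s.E_F i hi h, curl, mon, mon, mul_smul_comm, mul_sub]
    have h1 := s.P_H ξ (t i)
    have h2 := s.P_H ξ (-t i)
    have h3 : pairing (qExp X) ξ (t i) = 0 := pairing_t _ _ _
    rw [QCommute] at h1 h2
    rw [pairing_neg, h3, neg_zero, zpow_zero, one_smul] at h2
    rw [h3, zpow_zero, one_smul] at h1
    rw [h1, h2, smul_sub, neg_smul, sub_eq_add_neg]
  · rw [s.curl_eq_zero (hξ h), monF, hξ h, zero_mul, comm, mul_zero, zero_mul,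
      sub_zero]

theorem curl_congr {c c' : K} {a a' b b' : ZExp} {ξ ξ' : XExp} (hc : c = c') (ha : a = a')
    (hb : b = b') (hξ : s.P (.ofAdd ξ) = s.P (.ofAdd ξ')) :
    s.curl c a b ξ = s.curl c' a' b' ξ' := by
  simp only [curl, mon, hc, ha, hb, hξ]

theorem curl_add_curl_eq_zero {c c' : K} {a a' b b' : ZExp} {ξ ξ' : XExp} (hc : c + c' = 0)
    (ha : a = a') (hb : b = b') (hξ : s.P (.ofAdd ξ) = s.P (.ofAdd ξ')) :
    s.curl c a b ξ + s.curl c' a' b' ξ' = 0 := by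
  obtain rfl := eq_neg_of_add_eq_zero_left hc
  simp only [curl, mon, ha, hb, hξ]
  module

/-- `(Q - Q⁻¹)⁻¹`. -/
def curlyCoeff (Q : Kˣ) : K := ((Q : K) - ((Q⁻¹ : Kˣ) : K))⁻¹

theorem curlyCoeff_mul {Q : Kˣ} (h : (Q : K) ^ 2 ≠ 1) : curlyCoeff Q * ((Q : K) - (Q : K)⁻¹) = 1 := by
  rw [curlyCoeff, Units.val_inv_eq_inv_val]
  refine inv_mul_cancel₀ fun h' => h ?_
  rw [sub_eq_zero] at h'
  rw [pow_two]
  nth_rewrite 2 [h']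
  exact mul_inv_cancel₀ Q.ne_zero

/-- The two terms of `curl c a b ξ`. -/
def curlTerms (c : K) (a b : ZExp) (ξ : XExp) : List (Term K) := [.mon c a ξ, .mon (-c) b ξ]

theorem H_mul_H_neg (a : ZExp) : (s.H (.ofAdd a) : R) * s.H (.ofAdd (-a)) = 1 := by
  rw [← H_add, add_neg_cancel, ofAdd_zero, map_one, Units.val_one]

theorem P_zero : s.P (.ofAdd 0) = 1 := by rw [ofAdd_zero, map_one]

theorem H_conj_evalSum {a : ZExp} {k : ℤ} {l : List (Term K)}
    (h : ∀ t ∈ l, Term.QComm X n k (.mon 1 a 0) t) :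
    (s.H (.ofAdd a) : R) * s.evalSum l * s.H (.ofAdd (-a)) = (v : K) ^ k • s.evalSum l := by
  have := s.qCommute_evalSum (l := [.mon 1 a 0]) (l' := l) (k := k) (by simpa using h)
  rw [QCommute] at this
  simp only [evalSum_cons, evalSum_nil, add_zero, eval, mon, P_zero, mul_one, one_smul] at this
  rw [this, smul_mul_assoc, mul_assoc, H_mul_H_neg, mul_one]

end QSystem

end QuantumSeries

namespace QuantumSeries
open ZExp XExp
namespace QSystem

variable {K : Type*} [Field K] {n : ℕ} {v : Kˣ} {R : Type*} [Ring R] [Algebra K R]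

section A

set_option linter.unusedSimpArgs false
set_option linter.flexible false

/-! ### Type `A` -/

variable (s : QSystem .A n v R)

/-- The terms of `ρ(f_i)` in type `A`. -/
def fTermsA (v : Kˣ) (i : ℕ) : List (Term K) :=
  .F (xi (i - 1) + x i) (i - 1) :: curlTerms (curlyCoeff v) (z (i - 1) - z i) (z i - z (i - 1)) (x i)

/-- The terms of `ρ(e_i)` in type `A`. -/
def eTermsA (v : Kˣ) (i : ℕ) : List (Term K) :=
  .E i :: curlTerms (curlyCoeff v) (z i - z (i + 1) + t i) (z (i + 1) - z i - t i) (xi i)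

/-- The exponent of `ρ(t_i)` in type `A`. -/
def tExpA (i : ℕ) : ZExp := 2 • z i - z (i - 1) - z (i + 1) + t i

theorem evalSum_fTermsA (i : ℕ) : s.evalSum (fTermsA v i) =
    s.monF (xi (i - 1) + x i) (i - 1) +
      s.curl (curlyCoeff v) (z (i - 1) - z i) (z i - z (i - 1)) (x i) := by
  simp [fTermsA, evalSum, curlTerms, curl, eval]

theorem evalSum_eTermsA (i : ℕ) : s.evalSum (eTermsA v i) =
    s.E i + s.curl (curlyCoeff v) (z i - z (i + 1) + t i) (z (i + 1) - z i - t i) (xi i) := by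
  simp [eTermsA, evalSum, curlTerms, curl, eval]

/-- The content is the order of the blocks: the monomials with coefficient of one sign, then the
block of the two F's, then the monomials of the other sign in mirrored order. Only the middle block
has two nonempty sides. All later Serre relations follow this pattern. -/
theorem serrePair_fTermsA_succ (k : ℕ) :
    SerrePair ((v : K) ^ (1 : ℤ)) ((v : K) ^ (1 : ℤ)) 2 2
      (s.evalSum (fTermsA v (k + 1))) (s.evalSum (fTermsA v (k + 2))) := by
  refine s.serrePair_evalSum (k := -1) (by simp) (by simp) (by simp) (by simp)
    (l := [([], [.mon (curlyCoeff v) (z (k + 1) - z (k + 2)) (x (k + 2))]),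
     ([.mon (curlyCoeff v) (z k - z (k + 1)) (x (k + 1))], []),
     ([.F (xi k + x (k + 1)) k], [.F (xi (k + 1) + x (k + 2)) (k + 1)]),
     ([.mon (-curlyCoeff v) (z (k + 1) - z k) (x (k + 1))], []),
     ([], [.mon (-curlyCoeff v) (z (k + 2) - z (k + 1)) (x (k + 2))])]) ?_ ?_ ?_ ?_
  · simp only [Term.Precedes, Term.QComm, qExp, List.pairwise_cons, List.forall_mem_cons,
      List.not_mem_nil, false_implies, implies_true, and_true, true_and, List.Pairwise.nil]
    simp
  · simp only [List.forall_mem_cons, List.not_mem_nil, false_implies, implies_true, and_true]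
    -- The value k = 0 is included: a system satisfies the Serre relations for all labels, elements
    -- with labels out of range being zero in the target.
    have := s.serrePair_F (i := k) (j := k + 1) (by simp) (xi k + x (k + 1))
      (xi (k + 1) + x (k + 2))
    rw [show cartanEntry .A k (k + 1) = -1 by simp [cartanEntry],
      show cartanEntry .A (k + 1) k = -1 by simp [cartanEntry]] at this
    exact ⟨s.serrePair_evalSum_nil_left 1 1 (by simp) _,
      s.serrePair_evalSum_nil_right 1 1 (by simp) _, this,
      s.serrePair_evalSum_nil_right 1 1 (by simp) _,
      s.serrePair_evalSum_nil_left 1 1 (by simp) _⟩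
  · simp [fTermsA, curlTerms, evalSum, eval]; abel
  · simp [fTermsA, curlTerms, evalSum, eval]; abel

theorem serrePair_eTermsA_succ (k : ℕ) (hk : k + 2 ≤ n) :
    SerrePair ((v : K) ^ (1 : ℤ)) ((v : K) ^ (1 : ℤ)) 2 2
      (s.evalSum (eTermsA v (k + 1))) (s.evalSum (eTermsA v (k + 2))) := by
  refine s.serrePair_evalSum (k := -1) (by simp) (by simp) (by simp) (by simp)
    (l := [([.mon (curlyCoeff v) (z (k + 1) - z (k + 2) + t (k + 1)) (xi (k + 1))], []),
     ([], [.mon (curlyCoeff v) (z (k + 2) - z (k + 3) + t (k + 2)) (xi (k + 2))]),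
     ([.E (k + 1)], [.E (k + 2)]),
     ([], [.mon (-curlyCoeff v) (z (k + 3) - z (k + 2) - t (k + 2)) (xi (k + 2))]),
     ([.mon (-curlyCoeff v) (z (k + 2) - z (k + 1) - t (k + 1)) (xi (k + 1))], [])]) ?_ ?_ ?_ ?_
  · simp only [Term.Precedes, Term.QComm, qExp, List.pairwise_cons, List.forall_mem_cons,
      List.not_mem_nil, false_implies, implies_true, and_true, true_and, List.Pairwise.nil]
    simp [hk, show k + 1 ≤ n by omega, cartanEntry, dExp]
  · simp only [List.forall_mem_cons, List.not_mem_nil, false_implies, implies_true, and_true]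
    have := s.serrePair_E (i := k + 1) (j := k + 2) (by simp)
    rw [show cartanEntry .A (k + 1) (k + 2) = -1 by simp [cartanEntry],
      show cartanEntry .A (k + 2) (k + 1) = -1 by simp [cartanEntry]] at this
    exact ⟨s.serrePair_evalSum_nil_right 1 1 (by simp) _,
      s.serrePair_evalSum_nil_left 1 1 (by simp) _, this,
      s.serrePair_evalSum_nil_left 1 1 (by simp) _,
      s.serrePair_evalSum_nil_right 1 1 (by simp) _⟩
  · simp [eTermsA, curlTerms, evalSum, eval]; abel
  · simp [eTermsA, curlTerms, evalSum, eval]; abel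

theorem commute_fTermsA {i j : ℕ} (hi : 1 ≤ i) (hij : i + 2 ≤ j) :
    Commute (s.evalSum (fTermsA v i)) (s.evalSum (fTermsA v j)) := by
  obtain ⟨k, rfl⟩ := Nat.exists_eq_add_of_le' hi
  obtain ⟨l, rfl⟩ := Nat.exists_eq_add_of_le hij
  refine s.commute_evalSum (s.commute_F (by omega) (by simp [cartanEntry]; omega) _ _) ?_ ?_
  all_goals
    simp only [Term.QComm, qExp, List.forall_mem_cons, curlTerms, List.not_mem_nil, false_implies,
      implies_true, and_true, true_and]
    simp +arith

theorem commute_eTermsA {i j : ℕ} (hi : 1 ≤ i) (hij : i + 2 ≤ j) (hj : j ≤ n) :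
    Commute (s.evalSum (eTermsA v i)) (s.evalSum (eTermsA v j)) := by
  obtain ⟨k, rfl⟩ := Nat.exists_eq_add_of_le' hi
  obtain ⟨l, rfl⟩ := Nat.exists_eq_add_of_le hij
  refine s.commute_evalSum (s.commute_E (by omega) (by simp [cartanEntry]; omega)) ?_ ?_
  all_goals
    simp only [Term.QComm, qExp, List.forall_mem_cons, curlTerms, List.not_mem_nil, false_implies,
      implies_true, and_true, true_and]
    simp +arith [cartanEntry]

/-- There are two sources of nonzero commutators. The bracket of e_i meets the bracket of f_i, which
gives {t_i}. In f_{i+1} the element E_i meets F_i, and this is cancelled by the commutator of the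
brackets of e_i and f_{i+1}. -/
theorem comm_eTermsA_fTermsA (i j : ℕ) (hi : 1 ≤ i) (hj : 1 ≤ j) (hin : i ≤ n) (hjn : j ≤ n)
    (hv : (v : K) ^ 2 ≠ 1) : comm (s.evalSum (eTermsA v i)) (s.evalSum (fTermsA v j)) =
      if i = j then s.curl (curlyCoeff v) (tExpA i) (-tExpA i) 0 else 0 := by
  have hc := curlyCoeff_mul hv
  obtain ⟨i, rfl⟩ := Nat.exists_eq_add_of_le' hi
  obtain ⟨j, rfl⟩ := Nat.exists_eq_add_of_le' hj
  rw [evalSum_fTermsA, evalSum_eTermsA, comm_add, add_comm_left, add_comm_left,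
    s.comm_E_curl (by simp) (by simp), zero_add,
    s.comm_curl_monF
      (by simp [hin, cartanEntry, dExp, qExp]; split_ifs <;> omega)
      (by simp [hin, cartanEntry, dExp, qExp]; split_ifs <;> omega), add_zero]
  rcases eq_or_ne j (i + 1) with rfl | h
  -- After the shift of labels this is the case of e_{i+1} and f_{i+2}, the latter containing
  -- F_{i+1}.
  · rw [if_neg (by omega), Nat.add_sub_cancel, s.comm_E_monF hi _ (fun h => by omega),
      s.comm_curl_curl (by simp [qExp]) (by simp [qExp])]
    refine s.curl_add_curl_eq_zero ?_ ?_ ?_ rfl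
    · simp [qExp, dExp]
      rw [show ((v : K) - (v : K)⁻¹)⁻¹ = curlyCoeff v by simp [curlyCoeff]]
      linear_combination (-curlyCoeff v) * hc
    · abel
    · abel
  · rw [Nat.add_sub_cancel, s.comm_E_monF_of_ne (Ne.symm h), zero_add]
    rcases eq_or_ne i j with rfl | h'
    · rw [if_pos rfl, s.comm_curl_curl (by simp [qExp]) (by simp [qExp])]
      refine s.curl_congr ?_ ?_ ?_ ?_
      · simp [qExp]
        linear_combination (curlyCoeff v) * hc
      · simp [tExpA]; abel
      · simp [tExpA]; abel
      · rw [add_comm, s.x_xi _ hi hin, P_zero]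
    · rw [if_neg (by omega), s.comm_curl_curl_eq_zero]
      all_goals
        simp [qExp]
        split_ifs <;> omega

theorem H_conj_eTermsA (i j : ℕ) (hi : 1 ≤ i) (hj : 1 ≤ j) (hin : i ≤ n) (hjn : j ≤ n) :
    (s.H (.ofAdd (tExpA i)) : R) * s.evalSum (eTermsA v j) * s.H (.ofAdd (-tExpA i)) =
      (v : K) ^ (dExp .A i * cartanEntry .A i j) • s.evalSum (eTermsA v j) := by
  refine s.H_conj_evalSum ?_
  obtain ⟨i, rfl⟩ := Nat.exists_eq_add_of_le' hi
  obtain ⟨j, rfl⟩ := Nat.exists_eq_add_of_le' hj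
  simp only [Term.QComm, qExp, List.forall_mem_cons, curlTerms, List.not_mem_nil, false_implies,
      implies_true, and_true, true_and, eTermsA, tExpA]
  simp [hin, cartanEntry, dExp]
  split_ifs <;> omega

theorem H_conj_fTermsA (i j : ℕ) (hi : 1 ≤ i) (hj : 1 ≤ j) (hin : i ≤ n) (hjn : j ≤ n) :
    (s.H (.ofAdd (tExpA i)) : R) * s.evalSum (fTermsA v j) * s.H (.ofAdd (-tExpA i)) =
      (v : K) ^ (-(dExp .A i * cartanEntry .A i j)) • s.evalSum (fTermsA v j) := by
  refine s.H_conj_evalSum ?_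
  obtain ⟨i, rfl⟩ := Nat.exists_eq_add_of_le' hi
  obtain ⟨j, rfl⟩ := Nat.exists_eq_add_of_le' hj
  simp only [Term.QComm, qExp, List.forall_mem_cons, curlTerms, List.not_mem_nil, false_implies,
      implies_true, and_true, true_and, fTermsA, tExpA]
  simp [hin, cartanEntry, dExp]
  split_ifs <;> omega

end A

end QSystem
end QuantumSeries

namespace QuantumSeries
open ZExp XExp
namespace QSystem

/-! ### The nodes of `B`, `C`, `D` with uniform formulas -/

/-- The nodes for which the general formulas hold. -/
def IsGeneral (X : Series) (i : ℕ) : Prop :=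
  match X with
  | .A => False
  | .B => 2 ≤ i
  | .C => 2 ≤ i
  | .D => 3 ≤ i

/-- The exponent of `lower`. -/
def lowerExp (X : Series) (i : ℕ) : ZExp :=
  match X with
  -- The label of z̃_1 is out of range and is omitted, since a system does not require its image to
  -- be 1. In the target it is 1, so this agrees with `lower`.
  | .B => if i = 2 then -z 1 else -z (i - 1) - zt (i - 1)
  | .C => if i = 2 then -(2 • z 1) else -z (i - 1) - zt (i - 1)
  | .D => if i = 3 then -z 1 - z 2 else -z (i - 1) - zt (i - 1)
  | _ => -z (i - 1) - zt (i - 1)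

namespace IsGeneral

variable {X : Series} {i j : ℕ}

theorem two_le (h : IsGeneral X i) : 2 ≤ i := by
  cases X <;> simp only [IsGeneral] at h <;> omega

theorem mono (h : IsGeneral X i) (hij : i ≤ j) : IsGeneral X j := by
  cases X <;> simp only [IsGeneral] at h ⊢ <;> omega

theorem dExp_eq (h : IsGeneral X i) : dExp X i = qExp X := by
  cases X <;> simp only [IsGeneral] at h <;> simp [dExp, qExp] <;> omega

theorem cartanEntry_succ (h : IsGeneral X i) : cartanEntry X i (i + 1) = -1 := by
  cases X <;> simp only [IsGeneral] at h <;> simp [cartanEntry] <;> omega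

theorem cartanEntry_succ' (h : IsGeneral X i) : cartanEntry X (i + 1) i = -1 := by
  cases X <;> simp only [IsGeneral] at h <;> simp [cartanEntry] <;> omega

theorem cartanEntry_far (h : IsGeneral X i) (hij : i + 2 ≤ j) : cartanEntry X i j = 0 := by
  cases X <;> simp only [IsGeneral] at h <;> simp [cartanEntry] <;> omega

theorem cartanEntry_far' (h : IsGeneral X i) (hij : i + 2 ≤ j) : cartanEntry X j i = 0 := by
  cases X <;> simp only [IsGeneral] at h <;> simp [cartanEntry] <;> omega

theorem lowerExp_succ (h : IsGeneral X i) : lowerExp X (i + 1) = -z i - zt i := by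
  cases X <;> simp only [IsGeneral] at h <;> simp [lowerExp] <;> omega

variable (d : ℕ)

/-- All indices in `lowerExp X i` are smaller than i. The same reason applies to the next three
lemmas. -/
theorem pairing_x_lowerExp (h : IsGeneral X i) (hij : i ≤ j) :
    pairing d (x j) (lowerExp X i) = 0 := by
  cases X <;> simp only [IsGeneral] at h <;> simp only [lowerExp] <;> (try split_ifs) <;>
    simp <;> omega

theorem pairing_xi_lowerExp (h : IsGeneral X i) (hij : i ≤ j) :
    pairing d (xi j) (lowerExp X i) = 0 := by
  cases X <;> simp only [IsGeneral] at h <;> simp only [lowerExp] <;> (try split_ifs) <;>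
    simp <;> omega

theorem pairing_xt_lowerExp (h : IsGeneral X i) (hij : i ≤ j) :
    pairing d (xt j) (lowerExp X i) = 0 := by
  cases X <;> simp only [IsGeneral] at h <;> simp only [lowerExp] <;> (try split_ifs) <;>
    simp <;> omega

theorem pairing_xti_lowerExp (h : IsGeneral X i) (hij : i ≤ j) :
    pairing d (xti j) (lowerExp X i) = 0 := by
  cases X <;> simp only [IsGeneral] at h <;> simp only [lowerExp] <;> (try split_ifs) <;>
    simp <;> omega

end IsGeneral

@[simp] theorem weight_lowerExp (X Y : Series) (n i j : ℕ) : weight Y n j (lowerExp X i) = 0 := by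
  cases X <;> simp only [lowerExp] <;> (try split_ifs) <;> simp

theorem cartanEntry_self (X : Series) (i : ℕ) : cartanEntry X i i = 2 := by simp [cartanEntry]

variable {K : Type*} [Field K] {X : Series} {n : ℕ} {v : Kˣ} {R : Type*} [Ring R] [Algebra K R]
  (s : QSystem X n v R)

/-- The terms of `ρ(f_i)` for general nodes. -/
def fTermsGen (X : Series) (v : Kˣ) (i : ℕ) : List (Term K) :=
  .F (xi (i + 1) + x i + xt (i + 1) + xti i) i ::
    (curlTerms (curlyCoeff (v ^ qExp X)) (z (i + 1) - z i) (z i - z (i + 1)) (x i) ++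
    curlTerms (curlyCoeff (v ^ qExp X)) (zt i - zt (i + 1)) (zt (i + 1) - zt i)
      (xi (i + 1) + x i + xt (i + 1)))

/-- The exponent `a` in the first summand `{a} x_i⁻¹` of `ρ(e_i)`. -/
def eExp (X : Series) (i : ℕ) : ZExp := z i + lowerExp X i + 2 • zt i - zt (i + 1) + t i

/-- The terms of `ρ(e_i)` for general nodes. -/
def eTermsGen (X : Series) (v : Kˣ) (i : ℕ) : List (Term K) :=
  .E i :: (curlTerms (curlyCoeff (v ^ qExp X)) (eExp X i) (-eExp X i) (xi i) ++
    curlTerms (curlyCoeff (v ^ qExp X)) (zt i - zt (i + 1) + t i) (zt (i + 1) - zt i - t i) (xti i))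

/-- The exponent of `ρ(t_i)` for general nodes. -/
def tExpGen (X : Series) (i : ℕ) : ZExp := eExp X i + z i - z (i + 1)

theorem evalSum_fTermsGen (i : ℕ) : s.evalSum (fTermsGen X v i) =
    s.monF (xi (i + 1) + x i + xt (i + 1) + xti i) i +
      (s.curl (curlyCoeff (v ^ qExp X)) (z (i + 1) - z i) (z i - z (i + 1)) (x i) +
      s.curl (curlyCoeff (v ^ qExp X)) (zt i - zt (i + 1)) (zt (i + 1) - zt i)
        (xi (i + 1) + x i + xt (i + 1))) := by
  simp only [fTermsGen, evalSum, curlTerms, curl, eval, List.map_cons, List.map_append,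
    List.map_nil, List.sum_cons, List.sum_append, List.sum_nil, add_zero]

theorem evalSum_eTermsGen (i : ℕ) : s.evalSum (eTermsGen X v i) =
    s.E i + (s.curl (curlyCoeff (v ^ qExp X)) (eExp X i) (-eExp X i) (xi i) +
      s.curl (curlyCoeff (v ^ qExp X)) (zt i - zt (i + 1) + t i) (zt (i + 1) - zt i - t i)
        (xti i)) := by
  simp only [eTermsGen, evalSum, curlTerms, curl, eval, List.map_cons, List.map_append,
    List.map_nil, List.sum_cons, List.sum_append, List.sum_nil, add_zero]

set_option linter.unusedSimpArgs false
set_option linter.flexible false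

/-- The list of blocks is a palindrome around the block of the F's, the mirrored entries having
opposite sign. -/
theorem serrePair_fTermsGen_succ {i : ℕ} (hi : IsGeneral X i) :
    SerrePair ((v : K) ^ (qExp X : ℤ)) ((v : K) ^ (qExp X : ℤ)) 2 2
      (s.evalSum (fTermsGen X v i)) (s.evalSum (fTermsGen X v (i + 1))) := by
  set c := curlyCoeff (v ^ qExp X) with hc
  refine s.serrePair_evalSum (k := -(qExp X)) (by simp) (by simp) (by simp) (by simp)
    (l := [([.mon c (z (i + 1) - z i) (x i)], []),
     ([], [.mon c (z (i + 2) - z (i + 1)) (x (i + 1))]),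
     ([], [.mon c (zt (i + 1) - zt (i + 2)) (xi (i + 2) + x (i + 1) + xt (i + 2))]),
     ([.mon c (zt i - zt (i + 1)) (xi (i + 1) + x i + xt (i + 1))], []),
     ([.F (xi (i + 1) + x i + xt (i + 1) + xti i) i],
      [.F (xi (i + 2) + x (i + 1) + xt (i + 2) + xti (i + 1)) (i + 1)]),
     ([.mon (-c) (zt (i + 1) - zt i) (xi (i + 1) + x i + xt (i + 1))], []),
     ([], [.mon (-c) (zt (i + 2) - zt (i + 1)) (xi (i + 2) + x (i + 1) + xt (i + 2))]),
     ([], [.mon (-c) (z (i + 1) - z (i + 2)) (x (i + 1))]),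
     ([.mon (-c) (z i - z (i + 1)) (x i)], [])]) ?_ ?_ ?_ ?_
  · simp only [Term.Precedes, Term.QComm, List.pairwise_cons, List.forall_mem_cons,
      List.not_mem_nil, false_implies, implies_true, and_true, true_and, List.Pairwise.nil]
    simp
    omega
  · simp only [List.forall_mem_cons, List.not_mem_nil, false_implies, implies_true, and_true]
    have := s.serrePair_F (i := i) (j := i + 1) (by simp) (xi (i + 1) + x i + xt (i + 1) + xti i)
      (xi (i + 2) + x (i + 1) + xt (i + 2) + xti (i + 1))
    rw [hi.cartanEntry_succ, hi.cartanEntry_succ', hi.dExp_eq, (hi.mono (Nat.le_succ _)).dExp_eq]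
      at this
    exact ⟨s.serrePair_evalSum_nil_right _ _ (by simp) _,
      s.serrePair_evalSum_nil_left _ _ (by simp) _,
      s.serrePair_evalSum_nil_left _ _ (by simp) _,
      s.serrePair_evalSum_nil_right _ _ (by simp) _, this,
      s.serrePair_evalSum_nil_right _ _ (by simp) _,
      s.serrePair_evalSum_nil_left _ _ (by simp) _,
      s.serrePair_evalSum_nil_left _ _ (by simp) _,
      s.serrePair_evalSum_nil_right _ _ (by simp) _⟩
  · simp [fTermsGen, curlTerms, evalSum, eval, ← hc]; abel
  · simp [fTermsGen, curlTerms, evalSum, eval, ← hc]; abel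

theorem serrePair_eTermsGen_succ {i : ℕ} (hi : IsGeneral X i) (hin : i + 1 ≤ n) :
    SerrePair ((v : K) ^ (qExp X : ℤ)) ((v : K) ^ (qExp X : ℤ)) 2 2
      (s.evalSum (eTermsGen X v i)) (s.evalSum (eTermsGen X v (i + 1))) := by
  set c := curlyCoeff (v ^ qExp X) with hc
  refine s.serrePair_evalSum (k := -(qExp X)) (by simp) (by simp) (by simp) (by simp)
    (l := [([], [.mon c (eExp X (i + 1)) (xi (i + 1))]),
     ([.mon c (eExp X i) (xi i)], []),
     ([.mon c (zt i - zt (i + 1) + t i) (xti i)], []),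
     ([], [.mon c (zt (i + 1) - zt (i + 2) + t (i + 1)) (xti (i + 1))]),
     ([.E i], [.E (i + 1)]),
     ([], [.mon (-c) (zt (i + 2) - zt (i + 1) - t (i + 1)) (xti (i + 1))]),
     ([.mon (-c) (zt (i + 1) - zt i - t i) (xti i)], []),
     ([.mon (-c) (-eExp X i) (xi i)], []),
     ([], [.mon (-c) (-eExp X (i + 1)) (xi (i + 1))])]) ?_ ?_ ?_ ?_
  · simp only [Term.Precedes, Term.QComm, List.pairwise_cons, List.forall_mem_cons,
      List.not_mem_nil, false_implies, implies_true, and_true, true_and, List.Pairwise.nil, eExp]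
    simp [hi.lowerExp_succ, hi.pairing_xi_lowerExp, hi.pairing_xti_lowerExp, hin,
      show i ≤ n by omega, show 1 ≤ i by have := hi.two_le; omega, cartanEntry_self,
      hi.cartanEntry_succ, hi.cartanEntry_succ', hi.dExp_eq, (hi.mono (Nat.le_succ _)).dExp_eq]
    omega
  · simp only [List.forall_mem_cons, List.not_mem_nil, false_implies, implies_true, and_true]
    have := s.serrePair_E (i := i) (j := i + 1) (by simp)
    rw [hi.cartanEntry_succ, hi.cartanEntry_succ', hi.dExp_eq, (hi.mono (Nat.le_succ _)).dExp_eq]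
      at this
    exact ⟨s.serrePair_evalSum_nil_left _ _ (by simp) _,
      s.serrePair_evalSum_nil_right _ _ (by simp) _,
      s.serrePair_evalSum_nil_right _ _ (by simp) _,
      s.serrePair_evalSum_nil_left _ _ (by simp) _, this,
      s.serrePair_evalSum_nil_left _ _ (by simp) _,
      s.serrePair_evalSum_nil_right _ _ (by simp) _,
      s.serrePair_evalSum_nil_right _ _ (by simp) _,
      s.serrePair_evalSum_nil_left _ _ (by simp) _⟩
  · simp [eTermsGen, curlTerms, evalSum, eval, ← hc]; abel
  · simp [eTermsGen, curlTerms, evalSum, eval, ← hc]; abel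

theorem commute_fTermsGen {i j : ℕ} (hi : IsGeneral X i) (hij : i + 2 ≤ j) :
    Commute (s.evalSum (fTermsGen X v i)) (s.evalSum (fTermsGen X v j)) := by
  have hc := hi.cartanEntry_far hij
  obtain ⟨l, rfl⟩ := Nat.exists_eq_add_of_le hij
  refine s.commute_evalSum (s.commute_F (by omega) hc _ _) ?_ ?_
  all_goals
    simp only [Term.QComm, List.forall_mem_cons, curlTerms, List.not_mem_nil, false_implies,
      implies_true, and_true, true_and, List.cons_append, List.nil_append]
    simp +arith

theorem commute_eTermsGen {i j : ℕ} (hi : IsGeneral X i) (hij : i + 2 ≤ j) (hj : j ≤ n) :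
    Commute (s.evalSum (eTermsGen X v i)) (s.evalSum (eTermsGen X v j)) := by
  have hc := hi.cartanEntry_far hij
  obtain ⟨l, rfl⟩ := Nat.exists_eq_add_of_le hij
  have hc1 := hi.cartanEntry_far (j := i + l + 2) (by omega)
  have hc2 := hi.cartanEntry_far' (j := i + l + 2) (by omega)
  have hl : lowerExp X (i + 2 + l) = -z (i + 1 + l) - zt (i + 1 + l) := by
    have := (hi.mono (j := i + 1 + l) (by omega)).lowerExp_succ
    rwa [show i + 1 + l + 1 = i + 2 + l by omega] at this
  refine s.commute_evalSum (s.commute_E (by omega) hc) ?_ ?_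
  all_goals
    simp only [Term.QComm, List.forall_mem_cons, curlTerms, List.not_mem_nil, false_implies,
      implies_true, and_true, true_and, List.cons_append, List.nil_append, eExp, hl]
    simp +arith [hc1, hc2, hi.pairing_xi_lowerExp, hi.pairing_xti_lowerExp]

/-- For i = j the brackets at x_i⁻¹ and x_i give {t_i}, while the bracket at x̃_i⁻¹ against the
second bracket of f_i cancels [E_i, x^ξ F_i]. For i = j + 1 the commutator of the two first brackets
cancels that of the two second ones. The monomials agree only after x̃_i x̃_i⁻¹ = 1, hence the
condition that W̃_i is in range. In all remaining cases every pair of terms commutes. -/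
theorem comm_eTermsGen_fTermsGen {i j : ℕ} (hi : IsGeneral X i) (hj : IsGeneral X j)
    (hin : i ≤ n) (hXi : n - numTilde X n < i) (hv : ((v ^ qExp X : Kˣ) : K) ^ 2 ≠ 1) :
    comm (s.evalSum (eTermsGen X v i)) (s.evalSum (fTermsGen X v j)) =
      if i = j then s.curl (curlyCoeff (v ^ qExp X)) (tExpGen X i) (-tExpGen X i) 0 else 0 := by
  have hc := curlyCoeff_mul hv
  have h1 : 1 ≤ i := by have := hi.two_le; omega
  have hd := hi.dExp_eq
  have hcs := cartanEntry_self X i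
  rw [Units.val_pow_eq_pow_val] at hc
  rw [evalSum_fTermsGen, evalSum_eTermsGen]
  simp only [comm_add, add_comm_left]
  rw [s.comm_E_curl (by simp) (by simp), s.comm_E_curl (by simp) (by simp)]
  simp only [zero_add]
  rcases eq_or_ne i j with rfl | hij
  -- For i = n the monomial contains x_{n+1}⁻¹ = 0.
  · rw [s.comm_E_monF h1 _ (fun h => by
        simp only [P_add, s.P_xi_eq_zero (i + 1) (by omega), zero_mul]),
      s.comm_curl_monF
        (by simp [eExp, hi.pairing_x_lowerExp, hi.pairing_xi_lowerExp, hi.pairing_xt_lowerExp,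
          hi.pairing_xti_lowerExp, h1, hin, hd, hcs]; omega)
        (by simp [eExp, hi.pairing_x_lowerExp, hi.pairing_xi_lowerExp, hi.pairing_xt_lowerExp,
          hi.pairing_xti_lowerExp, h1, hin, hd, hcs]; omega),
      s.comm_curl_monF (by simp [h1, hin, hd, hcs]; omega) (by simp [h1, hin, hd, hcs]; omega),
      s.comm_curl_curl_eq_zero (ξ := xti i) (η := x i) (by simp) (by simp) (by simp),
      s.comm_curl_curl_eq_zero (ξ := xi i) (η := xi (i + 1) + x i + xt (i + 1)) (by
        simp [eExp, hi.pairing_x_lowerExp, hi.pairing_xi_lowerExp, hi.pairing_xt_lowerExp])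
        (by simp [eExp, hi.pairing_x_lowerExp, hi.pairing_xi_lowerExp, hi.pairing_xt_lowerExp])
        (by simp [eExp, hi.pairing_x_lowerExp, hi.pairing_xi_lowerExp, hi.pairing_xt_lowerExp]),
      s.comm_curl_curl (by simp [eExp, hi.pairing_x_lowerExp])
        (by simp [eExp, hi.pairing_x_lowerExp]),
      s.comm_curl_curl (by simp) (by simp), if_pos rfl, zero_add, add_zero, zero_add, add_zero,
      add_left_comm, s.curl_add_curl_eq_zero, add_zero]
    · refine s.curl_congr ?_ ?_ ?_ ?_
      · simp [eExp, hi.pairing_x_lowerExp]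
        linear_combination (curlyCoeff (v ^ qExp X)) * hc
      · simp [tExpGen, add_sub_assoc]
      · simp [tExpGen]; abel
      · rw [add_comm, s.x_xi _ h1 hin, P_zero]
    · simp [hd]
      rw [show ((v : K) ^ qExp X - ((v : K) ^ qExp X)⁻¹)⁻¹ = curlyCoeff (v ^ qExp X) by
        simp [curlyCoeff]]
      linear_combination (-curlyCoeff (v ^ qExp X)) * hc
    · abel
    · abel
    · rw [add_comm (xti i)]
  · rw [s.comm_E_monF_of_ne hij, if_neg hij]
    rcases lt_trichotomy i j with h | h | h
    · obtain ⟨l, rfl⟩ : ∃ l, j = i + (l + 1) := ⟨j - i - 1, by omega⟩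
      have hx := hi.pairing_x_lowerExp (qExp X) (j := i + (l + 1)) (by omega)
      have hxi := hi.pairing_xi_lowerExp (qExp X) (j := i + (l + 2)) (by omega)
      have hxt := hi.pairing_xt_lowerExp (qExp X) (j := i + (l + 2)) (by omega)
      have hxti := hi.pairing_xti_lowerExp (qExp X) (j := i + (l + 1)) (by omega)
      have ha : cartanEntry X i (i + (l + 1)) = if l = 0 then -1 else 0 := by
        split_ifs with hl
        · subst hl; exact hi.cartanEntry_succ
        · exact hi.cartanEntry_far (by omega)
      rw [s.comm_curl_monF, s.comm_curl_monF, s.comm_curl_curl_eq_zero, s.comm_curl_curl_eq_zero,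
        s.comm_curl_curl_eq_zero, s.comm_curl_curl_eq_zero]
      · simp
      all_goals
        simp [eExp, hx, hxi, hxt, hxti, ha, h1, hin, hd, add_assoc]
    · exact absurd h hij
    · obtain ⟨l, rfl⟩ : ∃ l, i = j + (l + 1) := ⟨i - j - 1, by omega⟩
      rcases Nat.eq_zero_or_pos l with rfl | hl
      · simp only [zero_add] at *
        have hl := hj.lowerExp_succ
        have ha := hj.cartanEntry_succ'
        rw [s.comm_curl_monF, s.comm_curl_monF, s.comm_curl_curl (ξ := xi (j + 1)) (η := x j),
          s.comm_curl_curl_eq_zero (ξ := xti (j + 1)) (η := x j),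
          s.comm_curl_curl_eq_zero (ξ := xi (j + 1)), s.comm_curl_curl (ξ := xti (j + 1))]
        simp only [zero_add, add_zero]
        rw [s.curl_add_curl_eq_zero]
        · simp [eExp, hl]; ring
        · simp [eExp, hl]; abel
        · simp [eExp, hl]; abel
        · have := s.xt_xti (j + 1) hXi hin
          rw [show xti (j + 1) + (xi (j + 1) + x j + xt (j + 1)) =
            (xi (j + 1) + x j) + (xt (j + 1) + xti (j + 1)) by abel, s.P_add _ (xt (j + 1) + _),
            this, mul_one]
        all_goals
          simp [eExp, hl, ha, hin, hd]
          try omega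
      · have hlo : lowerExp X (j + (l + 1)) = -z (j + l) - zt (j + l) :=
          (hj.mono (j := j + l) (by omega)).lowerExp_succ
        have ha : cartanEntry X (j + (l + 1)) j = 0 := hj.cartanEntry_far' (by omega)
        have hl' : l ≠ 0 := by omega
        rw [s.comm_curl_monF, s.comm_curl_monF, s.comm_curl_curl_eq_zero, s.comm_curl_curl_eq_zero,
          s.comm_curl_curl_eq_zero, s.comm_curl_curl_eq_zero]
        · simp
        all_goals
          simp [eExp, hlo, ha, hin, hd, add_assoc, hl']
          try split_ifs <;> omega

/-- These are the exponents by which t_i conjugates the terms of e_j and f_j. The fourth entry says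
that the monomial of the second bracket of f_j has the same degree as x_j. The fifth says that the
monomial in front of F_j has degree 0, so that this term has the degree of F_j itself. -/
theorem IsGeneral.pairing_tExpGen {i j : ℕ} (hi : IsGeneral X i) (hj : IsGeneral X j)
    (hin : i ≤ n) :
    pairing (qExp X) (x j) (tExpGen X i) = dExp X i * cartanEntry X i j ∧
    pairing (qExp X) (xi j) (tExpGen X i) = -(dExp X i * cartanEntry X i j) ∧
    pairing (qExp X) (xti j) (tExpGen X i) = -(dExp X i * cartanEntry X i j) ∧
    pairing (qExp X) (xi (j + 1) + xt (j + 1)) (tExpGen X i) = 0 ∧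
    pairing (qExp X) (xi (j + 1) + x j + xt (j + 1) + xti j) (tExpGen X i) = 0 ∧
    weight X n j (tExpGen X i) = dExp X i * cartanEntry X i j := by
  have hd := hi.dExp_eq
  have h1 : 1 ≤ i := by have := hi.two_le; omega
  rcases lt_trichotomy i j with h | rfl | h
  · obtain ⟨l, rfl⟩ : ∃ l, j = i + (l + 1) := ⟨j - i - 1, by omega⟩
    have hx := hi.pairing_x_lowerExp (qExp X) (j := i + (l + 1)) (by omega)
    have hxi := hi.pairing_xi_lowerExp (qExp X) (j := i + (l + 2)) (by omega)
    have hxi' := hi.pairing_xi_lowerExp (qExp X) (j := i + (l + 1)) (by omega)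
    have hxt := hi.pairing_xt_lowerExp (qExp X) (j := i + (l + 2)) (by omega)
    have hxti := hi.pairing_xti_lowerExp (qExp X) (j := i + (l + 1)) (by omega)
    have ha : cartanEntry X i (i + (l + 1)) = if l = 0 then -1 else 0 := by
      split_ifs with hl
      · subst hl; exact hi.cartanEntry_succ
      · exact hi.cartanEntry_far (by omega)
    simp [tExpGen, eExp, hx, hxi, hxi', hxt, hxti, ha, h1, hin, hd, add_assoc]
    split_ifs <;> omega
  · have hx := hi.pairing_x_lowerExp (qExp X) (j := i) (by omega)
    have hxi := hi.pairing_xi_lowerExp (qExp X) (j := i + 1) (by omega)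
    have hxi' := hi.pairing_xi_lowerExp (qExp X) (j := i) (by omega)
    have hxt := hi.pairing_xt_lowerExp (qExp X) (j := i + 1) (by omega)
    have hxti := hi.pairing_xti_lowerExp (qExp X) (j := i) (by omega)
    simp [tExpGen, eExp, hx, hxi, hxi', hxt, hxti, cartanEntry_self, h1, hin, hd]
    omega
  · obtain ⟨l, rfl⟩ : ∃ l, i = j + (l + 1) := ⟨i - j - 1, by omega⟩
    have hlo : lowerExp X (j + (l + 1)) = -z (j + l) - zt (j + l) :=
      (hj.mono (j := j + l) (by omega)).lowerExp_succ
    have ha : cartanEntry X (j + (l + 1)) j = if l = 0 then -1 else 0 := by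
      split_ifs with hl
      · subst hl; exact hj.cartanEntry_succ'
      · exact hj.cartanEntry_far' (by omega)
    simp [tExpGen, eExp, hlo, ha, hin, hd, add_assoc]
    split_ifs <;> omega

theorem H_conj_eTermsGen {i j : ℕ} (hi : IsGeneral X i) (hj : IsGeneral X j) (hin : i ≤ n) :
    (s.H (.ofAdd (tExpGen X i)) : R) * s.evalSum (eTermsGen X v j) * s.H (.ofAdd (-tExpGen X i)) =
      (v : K) ^ (dExp X i * cartanEntry X i j) • s.evalSum (eTermsGen X v j) := by
  obtain ⟨h1, h2, h3, h4, h5, h6⟩ := hi.pairing_tExpGen hj hin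
  refine s.H_conj_evalSum ?_
  simp only [Term.QComm, List.forall_mem_cons, curlTerms, List.not_mem_nil, false_implies,
      implies_true, and_true, true_and, eTermsGen, List.cons_append, List.nil_append]
  simp [h2, h3, h6]

theorem H_conj_fTermsGen {i j : ℕ} (hi : IsGeneral X i) (hj : IsGeneral X j) (hin : i ≤ n) :
    (s.H (.ofAdd (tExpGen X i)) : R) * s.evalSum (fTermsGen X v j) * s.H (.ofAdd (-tExpGen X i)) =
      (v : K) ^ (-(dExp X i * cartanEntry X i j)) • s.evalSum (fTermsGen X v j) := by
  obtain ⟨h1, h2, h3, h4, h5, h6⟩ := hi.pairing_tExpGen hj hin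
  refine s.H_conj_evalSum ?_
  rw [pairing_add_left] at h4
  simp only [Term.QComm, List.forall_mem_cons, curlTerms, List.not_mem_nil, false_implies,
      implies_true, and_true, true_and, fTermsGen, List.cons_append, List.nil_append, h5, h6]
  simp [h1]
  omega

end QSystem
end QuantumSeries

namespace QuantumSeries
open ZExp XExp
namespace QSystem

set_option linter.unusedSimpArgs false
set_option linter.flexible false

/-! ### Exceptional blocks for the double bonds. -/

section Blocks

variable {K : Type*} [Field K] {X : Series} {n : ℕ} {v : Kˣ} {R : Type*} [Ring R] [Algebra K R]
  (s : QSystem X n v R)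

theorem comm_mon_mon {c c' : K} {a b : ZExp} {ξ η : XExp} :
    comm (s.mon c a ξ) (s.mon c' b η) =
      s.mon (c * c' * ((v : K) ^ pairing (qExp X) ξ b - (v : K) ^ pairing (qExp X) η a))
        (a + b) (ξ + η) := by
  simp only [comm, mon_mul_mon, add_comm b, add_comm η]
  simp only [mon]
  module

theorem serre_evalSum_right {Q : K} {m : ℕ} {y : R} {l : List (Term K)}
    (h : ∀ a ∈ l, serre Q m y (s.eval a) = 0) : serre Q m y (s.evalSum l) = 0 := by
  induction l with
  | nil => exact serre_zero_right _ _ _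
  | cons a l ih =>
    rw [evalSum_cons, serre_add_right, h a (by simp), ih fun a ha => h a (by simp [ha]), add_zero]

theorem qCommute_eval_evalSum {k : ℤ} {a : Term K} {l : List (Term K)}
    (h : ∀ b ∈ l, Term.QComm X n k a b) : QCommute ((v : K) ^ k) (s.eval a) (s.evalSum l) := by
  have := s.qCommute_evalSum (l := [a]) (l' := l) (k := k) (by simpa using h)
  rwa [evalSum_cons, evalSum_nil, add_zero] at this

theorem qCommute_evalSum_eval {k : ℤ} {a : Term K} {l : List (Term K)}
    (h : ∀ b ∈ l, Term.QComm X n k b a) : QCommute ((v : K) ^ k) (s.evalSum l) (s.eval a) := by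
  have := s.qCommute_evalSum (l := l) (l' := [a]) (k := k) (by simpa using h)
  rwa [evalSum_cons, evalSum_nil, add_zero] at this

theorem QCommute.symm_zpow {k : ℤ} {a b : R} (h : QCommute ((v : K) ^ k) a b) :
    QCommute ((v : K) ^ (-k)) b a := by
  rw [zpow_neg]
  exact h.symm (zpow_ne_zero _ v.ne_zero)

/-- A block of terms for the Serre relations of type `B₂`. -/
theorem serrePair_enclosed {a b : Term K} {l : List (Term K)} (hab : Term.QComm X n 4 a b)
    (ha : ∀ y ∈ l, Term.QComm X n (-2) a y) (hb : ∀ y ∈ l, Term.QComm X n (-2) y b) :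
    SerrePair ((v : K) ^ (1 : ℤ)) ((v : K) ^ (2 : ℤ)) 3 2 (s.evalSum [a, b]) (s.evalSum l) := by
  have h1 := s.qCommute_eval_evalSum ha
  have h2 := s.qCommute_evalSum_eval hb
  have e : (v : K) ^ (-2 : ℤ) = (v : K)⁻¹ ^ 2 := by rw [inv_pow]; exact_mod_cast zpow_neg (v : K) 2
  have e' : ((v : K) ^ (2 : ℤ)) ^ (1 : ℤ) = (v : K) ^ (2 : ℤ) := zpow_one _
  have e'' : ((v : K) ^ (2 : ℤ)) ^ (-1 : ℤ) = (v : K) ^ (-2 : ℤ) := by rw [← zpow_mul]; rfl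
  refine ⟨?_, s.serre_evalSum_right ?_⟩
  · rw [e] at h1 h2
    rw [zpow_one, evalSum_cons, evalSum_cons, evalSum_nil, add_zero]
    exact serre_three_enclosed _ v.ne_zero (by exact_mod_cast hab.qCommute s) h1 h2
  -- The second relation is linear in the sum a + b. Each summand commutes with the elements of the
  -- list up to Q^{±1} for Q = v², which are the exponents at which the quadratic Serre expression
  -- vanishes.
  · simp only [List.forall_mem_cons, List.not_mem_nil, false_implies, implies_true, and_true]
    exact ⟨serre_eq_zero_of_qCommute _ (zpow_ne_zero _ v.ne_zero) (by simp) (k := 1) (by simp)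
      (by rw [e']; exact QCommute.symm_zpow h1),
      serre_eq_zero_of_qCommute _ (zpow_ne_zero _ v.ne_zero) (by simp) (k := -1) (by simp)
      (by rw [e'']; exact h2)⟩

/-- A block of terms for the Serre relations of type `C₂`. -/
theorem serrePair_square {u m l : Term K} {L : List (Term K)} (hum : Term.QComm X n 4 u m)
    (hml : Term.QComm X n 4 m l) (hul : Term.QComm X n 8 u l)
    (hu : ∀ y ∈ L, Term.QComm X n (-2) u y) (hm : ∀ y ∈ L, Term.QComm X n 0 m y)
    (hl : ∀ y ∈ L, Term.QComm X n (-2) y l)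
    (hmm : s.eval m * s.eval m = ((v : K)⁻¹ ^ 4 * (v + (v : K)⁻¹) ^ 2) • (s.eval u * s.eval l)) :
    SerrePair ((v : K) ^ (2 : ℤ)) ((v : K) ^ (1 : ℤ)) 2 3 (s.evalSum [u, m, l]) (s.evalSum L) := by
  have h1 := s.qCommute_eval_evalSum hu
  have h2 := s.qCommute_eval_evalSum hm
  have h3 := s.qCommute_evalSum_eval hl
  have e : (v : K) ^ (-2 : ℤ) = (v : K)⁻¹ ^ 2 := by rw [inv_pow]; exact_mod_cast zpow_neg (v : K) 2
  refine ⟨?_, s.serre_evalSum_right ?_⟩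
  · rw [e] at h1 h3
    rw [zpow_zero] at h2
    rw [evalSum_cons, evalSum_cons, evalSum_cons, evalSum_nil, add_zero, ← add_assoc]
    rw [show (v : K) ^ (2 : ℤ) = (v : K) ^ 2 from zpow_ofNat _ _]
    exact serre_two_square _ v.ne_zero h1 h2 h3 (by exact_mod_cast hum.qCommute s)
      (by exact_mod_cast hml.qCommute s) (by exact_mod_cast hul.qCommute s) hmm
  · simp only [List.forall_mem_cons, List.not_mem_nil, false_implies, implies_true, and_true,
      zpow_one]
    -- The three summands have the exponents 2, 0, -2, which are all those at which the cubic
    -- expression vanishes.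
    exact ⟨serre_eq_zero_of_qCommute _ v.ne_zero (by simp) (k := 2) (by simp)
        (QCommute.symm_zpow h1),
      serre_eq_zero_of_qCommute _ v.ne_zero (by simp) (k := 0) (by simp) (QCommute.symm_zpow h2),
      serre_eq_zero_of_qCommute _ v.ne_zero (by simp) (k := -2) (by simp) h3⟩

end Blocks

variable {K : Type*} [Field K] {n : ℕ} {v : Kˣ} {R : Type*} [Ring R] [Algebra K R]

/-! ### The first node in type `B` -/

section B

variable (s : QSystem .B n v R)

/-- The terms of `ρ(f_1)` in type `B`; here `x 1` stands for `z_1^{-1/2} x_1`. -/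
def fTermsB (v : Kˣ) : List (Term K) :=
  .F (xi 2 + xt 2) 1 :: (curlTerms (curlyCoeff v) (z 2) (z 1 - z 2) (x 1) ++
    curlTerms (curlyCoeff v) (z 1 - zt 2) (zt 2) (xi 2 + x 1 + xt 2))

/-- The terms of `ρ(e_1)` in type `B`. -/
def eTermsB (v : Kˣ) : List (Term K) :=
  .E 1 :: curlTerms (v * curlyCoeff v) (t 1 - zt 2) (zt 2 - t 1 - z 1) (xi 1)

/-- The exponent of `ρ(t_1)` in type `B`. -/
def tExpB : ZExp := z 1 - z 2 - zt 2 + t 1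

theorem evalSum_fTermsB : s.evalSum (fTermsB v) =
    s.monF (xi 2 + xt 2) 1 + (s.curl (curlyCoeff v) (z 2) (z 1 - z 2) (x 1) +
      s.curl (curlyCoeff v) (z 1 - zt 2) (zt 2) (xi 2 + x 1 + xt 2)) := by
  simp only [fTermsB, evalSum, curlTerms, curl, eval, List.map_cons, List.map_append,
    List.map_nil, List.sum_cons, List.sum_append, List.sum_nil, add_zero]

theorem evalSum_eTermsB : s.evalSum (eTermsB v) =
    s.E 1 + s.curl (v * curlyCoeff v) (t 1 - zt 2) (zt 2 - t 1 - z 1) (xi 1) := by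
  simp only [eTermsB, evalSum, curlTerms, curl, eval, List.map_cons, List.map_append,
    List.map_nil, List.sum_cons, List.sum_append, List.sum_nil, add_zero]

/-- The two bracket monomials of f_1 with equal sign commute up to v⁴ instead of the v² that
separate blocks would need. They therefore stay together and enclose the corresponding monomials of
f_2, for both signs. -/
theorem serrePair_fTermsB :
    SerrePair ((v : K) ^ (1 : ℤ)) ((v : K) ^ (2 : ℤ)) 3 2
      (s.evalSum (fTermsB v)) (s.evalSum (fTermsGen .B v 2)) := by
  set c := curlyCoeff (v ^ qExp .B) with hc
  set c₁ := curlyCoeff v with hc₁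
  refine s.serrePair_evalSum (k := -2) (by simp) (by simp) (by simp) (by simp)
    (l := [([.mon c₁ (z 2) (x 1), .mon c₁ (z 1 - zt 2) (xi 2 + x 1 + xt 2)],
      [.mon c (z 3 - z 2) (x 2), .mon c (zt 2 - zt 3) (xi 3 + x 2 + xt 3)]),
     ([.F (xi 2 + xt 2) 1], [.F (xi 3 + x 2 + xt 3 + xti 2) 2]),
     ([.mon (-c₁) (zt 2) (xi 2 + x 1 + xt 2), .mon (-c₁) (z 1 - z 2) (x 1)],
      [.mon (-c) (zt 3 - zt 2) (xi 3 + x 2 + xt 3), .mon (-c) (z 2 - z 3) (x 2)])]) ?_ ?_ ?_ ?_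
  · simp only [Term.Precedes, Term.QComm, List.pairwise_cons, List.forall_mem_cons, qExp,
      List.not_mem_nil, false_implies, implies_true, and_true, true_and, List.Pairwise.nil]
    simp
  · simp only [List.forall_mem_cons, List.not_mem_nil, false_implies, implies_true, and_true]
    have := s.serrePair_F (i := 1) (j := 2) (by simp) (xi 2 + xt 2) (xi 3 + x 2 + xt 3 + xti 2)
    refine ⟨s.serrePair_enclosed ?_ ?_ ?_, this, s.serrePair_enclosed ?_ ?_ ?_⟩
    all_goals
      simp only [Term.QComm, List.forall_mem_cons, qExp,
        List.not_mem_nil, false_implies, implies_true, and_true, true_and]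
      simp
  · simp [fTermsB, curlTerms, evalSum, eval, ← hc₁]; abel
  · simp [fTermsGen, curlTerms, evalSum, eval, ← hc]; abel

theorem serrePair_eTermsB (hn : 2 ≤ n) :
    SerrePair ((v : K) ^ (1 : ℤ)) ((v : K) ^ (2 : ℤ)) 3 2
      (s.evalSum (eTermsB v)) (s.evalSum (eTermsGen .B v 2)) := by
  set c := curlyCoeff (v ^ qExp .B) with hc
  set c₁ := curlyCoeff v with hc₁
  refine s.serrePair_evalSum (k := -2) (by simp) (by simp) (by simp) (by simp)
    (l := [([], [.mon c (eExp .B 2) (xi 2)]),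
     ([.mon (v * c₁) (t 1 - zt 2) (xi 1)], []),
     ([], [.mon c (zt 2 - zt 3 + t 2) (xti 2)]),
     ([.E 1], [.E 2]),
     ([], [.mon (-c) (zt 3 - zt 2 - t 2) (xti 2)]),
     ([.mon (-(v * c₁)) (zt 2 - t 1 - z 1) (xi 1)], []),
     ([], [.mon (-c) (-eExp .B 2) (xi 2)])]) ?_ ?_ ?_ ?_
  · simp only [Term.Precedes, Term.QComm, List.pairwise_cons, List.forall_mem_cons, qExp, eExp,
      List.not_mem_nil, false_implies, implies_true, and_true, true_and, List.Pairwise.nil]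
    simp [lowerExp, cartanEntry, dExp, hn, show 1 ≤ n by omega]
  · simp only [List.forall_mem_cons, List.not_mem_nil, false_implies, implies_true, and_true]
    have := s.serrePair_E (i := 1) (j := 2) (by simp)
    exact ⟨s.serrePair_evalSum_nil_left _ _ (by simp) _,
      s.serrePair_evalSum_nil_right _ _ (by simp) _,
      s.serrePair_evalSum_nil_left _ _ (by simp) _, this,
      s.serrePair_evalSum_nil_left _ _ (by simp) _,
      s.serrePair_evalSum_nil_right _ _ (by simp) _,
      s.serrePair_evalSum_nil_left _ _ (by simp) _⟩
  · simp [eTermsB, curlTerms, evalSum, eval, ← hc₁]; abel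
  · simp [eTermsGen, curlTerms, evalSum, eval, ← hc]; abel

theorem commute_fTermsB {j : ℕ} (hj : 3 ≤ j) :
    Commute (s.evalSum (fTermsB v)) (s.evalSum (fTermsGen .B v j)) := by
  obtain ⟨l, rfl⟩ := Nat.exists_eq_add_of_le' hj
  refine s.commute_evalSum (s.commute_F (by omega) (by simp [cartanEntry]) _ _) ?_ ?_
  all_goals
    simp only [Term.QComm, List.forall_mem_cons, curlTerms, List.not_mem_nil, false_implies,
      implies_true, and_true, true_and, List.cons_append, List.nil_append]
    simp +arith

theorem commute_eTermsB {j : ℕ} (hj : 3 ≤ j) (hjn : j ≤ n) :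
    Commute (s.evalSum (eTermsB v)) (s.evalSum (eTermsGen .B v j)) := by
  obtain ⟨l, rfl⟩ := Nat.exists_eq_add_of_le' hj
  refine s.commute_evalSum (s.commute_E (by omega) (by simp [cartanEntry])) ?_ ?_
  all_goals
    simp only [Term.QComm, List.forall_mem_cons, curlTerms, List.not_mem_nil, false_implies,
      implies_true, and_true, true_and, List.cons_append, List.nil_append, eExp]
    simp +arith [lowerExp, cartanEntry]

theorem comm_eTermsB_fTermsB (hn : 1 ≤ n) (hv : (v : K) ^ 2 ≠ 1) :
    comm (s.evalSum (eTermsB v)) (s.evalSum (fTermsB v)) =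
      s.curl (curlyCoeff v) tExpB (-tExpB) 0 := by
  have hc := curlyCoeff_mul hv
  rw [evalSum_fTermsB, evalSum_eTermsB]
  simp only [comm_add, add_comm_left]
  rw [s.comm_E_curl (by simp) (by simp), s.comm_E_curl (by simp) (by simp),
    s.comm_E_monF le_rfl _ (fun h => by
        simp only [P_add, s.P_xi_eq_zero 2 (by omega), zero_mul]),
    s.comm_curl_monF (by simp [hn, dExp, cartanEntry, qExp])
      (by simp [hn, dExp, cartanEntry, qExp]),
    s.comm_curl_curl (by simp [qExp]) (by simp [qExp]),
    s.comm_curl_curl (by simp [qExp]) (by simp [qExp])]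
  simp only [zero_add, add_zero]
  rw [add_left_comm, s.curl_add_curl_eq_zero, add_zero]
  · refine s.curl_congr ?_ ?_ ?_ ?_
    -- The exponents of this bracket differ by q = v² and yield 1 - v⁻². The extra coefficient v in
    -- e_1 turns this into v - v⁻¹.
    · simp [qExp, zpow_neg]
      have h : (v : K) * (v : K)⁻¹ = 1 := mul_inv_cancel₀ v.ne_zero
      linear_combination (curlyCoeff v) * hc
        - curlyCoeff v * curlyCoeff v * (v : K)⁻¹ * h
    · simp [tExpB]; abel
    · simp [tExpB]; abel
    · rw [add_comm, s.x_xi _ le_rfl hn, P_zero]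
  · simp [dExp, qExp]
    rw [show ((v : K) - (v : K)⁻¹)⁻¹ = curlyCoeff v by simp [curlyCoeff]]
    have h : (v : K) * (v : K)⁻¹ = 1 := mul_inv_cancel₀ v.ne_zero
    linear_combination (-curlyCoeff v) * hc + curlyCoeff v * curlyCoeff v * (v : K)⁻¹ * h
  · abel
  · abel
  · rw [show xi 1 + (xi 2 + x 1 + xt 2) = (xi 2 + xt 2) + (x 1 + xi 1) by abel, s.P_add _ (x 1 + _),
      s.x_xi _ le_rfl hn, mul_one]

theorem comm_eTermsB_fTermsGen {j : ℕ} (hj : 2 ≤ j) (hn : 1 ≤ n) :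
    comm (s.evalSum (eTermsB v)) (s.evalSum (fTermsGen .B v j)) = 0 := by
  rw [evalSum_fTermsGen, evalSum_eTermsB]
  simp only [comm_add, add_comm_left]
  rw [s.comm_E_curl (by simp) (by simp), s.comm_E_curl (by simp) (by simp),
    s.comm_E_monF_of_ne (by omega), s.comm_curl_monF, s.comm_curl_curl_eq_zero,
    s.comm_curl_curl_eq_zero]
  · simp
  all_goals
    obtain ⟨l, rfl⟩ := Nat.exists_eq_add_of_le' hj
    simp +arith [cartanEntry, dExp, qExp, hn]
    try (split_ifs <;> omega)

theorem comm_eTermsGen_fTermsB {i : ℕ} (hi : 2 ≤ i) (hin : i ≤ n) :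
    comm (s.evalSum (eTermsGen .B v i)) (s.evalSum (fTermsB v)) = 0 := by
  rw [evalSum_fTermsB, evalSum_eTermsGen]
  simp only [comm_add, add_comm_left]
  rw [s.comm_E_curl (by simp) (by simp), s.comm_E_curl (by simp) (by simp),
    s.comm_E_monF_of_ne (by omega)]
  rcases Nat.eq_or_lt_of_le hi with rfl | hi
  · rw [s.comm_curl_monF, s.comm_curl_monF, s.comm_curl_curl (ξ := xi 2) (η := x 1),
      s.comm_curl_curl_eq_zero (ξ := xti 2) (η := x 1), s.comm_curl_curl_eq_zero (ξ := xi 2),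
      s.comm_curl_curl (ξ := xti 2)]
    · simp only [zero_add, add_zero]
      rw [s.curl_add_curl_eq_zero]
      · simp [eExp, lowerExp]; ring
      · simp [eExp, lowerExp]; abel
      · simp [eExp, lowerExp]; abel
      · have := s.xt_xti 2 (by simp [numTilde]; omega) hin
        rw [show xti 2 + (xi 2 + x 1 + xt 2) = (xi 2 + x 1) + (xt 2 + xti 2) by abel,
          s.P_add _ (xt 2 + _), this, mul_one]
    all_goals simp [eExp, lowerExp, cartanEntry, dExp, qExp, hin]
  · rw [s.comm_curl_monF, s.comm_curl_monF, s.comm_curl_curl_eq_zero, s.comm_curl_curl_eq_zero,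
      s.comm_curl_curl_eq_zero, s.comm_curl_curl_eq_zero]
    · simp
    all_goals
      obtain ⟨l, rfl⟩ : ∃ l, i = l + 3 := ⟨i - 3, by omega⟩
      simp +arith [cartanEntry, dExp, qExp, eExp, lowerExp]
      try (split_ifs <;> simp)

theorem H_conj_tExpB (hn : 1 ≤ n) :
    (s.H (.ofAdd tExpB) : R) * s.evalSum (eTermsB v) * s.H (.ofAdd (-tExpB)) =
      (v : K) ^ (dExp .B 1 * cartanEntry .B 1 1) • s.evalSum (eTermsB v) ∧
    (s.H (.ofAdd tExpB) : R) * s.evalSum (fTermsB v) * s.H (.ofAdd (-tExpB)) =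
      (v : K) ^ (-(dExp .B 1 * cartanEntry .B 1 1)) • s.evalSum (fTermsB v) := by
  constructor
  all_goals
    refine s.H_conj_evalSum ?_
    simp only [Term.QComm, qExp, List.forall_mem_cons, curlTerms, List.not_mem_nil, false_implies,
        implies_true, and_true, true_and, eTermsB, fTermsB, tExpB, List.cons_append,
        List.nil_append]
    simp [hn, cartanEntry, dExp]

theorem H_conj_tExpB_gen {j : ℕ} (hj : 2 ≤ j) (hn : 1 ≤ n) :
    (s.H (.ofAdd tExpB) : R) * s.evalSum (eTermsGen .B v j) * s.H (.ofAdd (-tExpB)) =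
      (v : K) ^ (dExp .B 1 * cartanEntry .B 1 j) • s.evalSum (eTermsGen .B v j) ∧
    (s.H (.ofAdd tExpB) : R) * s.evalSum (fTermsGen .B v j) * s.H (.ofAdd (-tExpB)) =
      (v : K) ^ (-(dExp .B 1 * cartanEntry .B 1 j)) • s.evalSum (fTermsGen .B v j) := by
  constructor
  all_goals
    refine s.H_conj_evalSum ?_
    obtain ⟨l, rfl⟩ := Nat.exists_eq_add_of_le' hj
    simp only [Term.QComm, qExp, List.forall_mem_cons, curlTerms, List.not_mem_nil, false_implies,
        implies_true, and_true, true_and, eTermsGen, fTermsGen, tExpB, List.cons_append,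
        List.nil_append]
    simp +arith [hn, cartanEntry, dExp]
    try split_ifs <;> omega

theorem H_conj_tExpGen_B {i : ℕ} (hi : 2 ≤ i) (hin : i ≤ n) :
    (s.H (.ofAdd (tExpGen .B i)) : R) * s.evalSum (eTermsB v) * s.H (.ofAdd (-tExpGen .B i)) =
      (v : K) ^ (dExp .B i * cartanEntry .B i 1) • s.evalSum (eTermsB v) ∧
    (s.H (.ofAdd (tExpGen .B i)) : R) * s.evalSum (fTermsB v) * s.H (.ofAdd (-tExpGen .B i)) =
      (v : K) ^ (-(dExp .B i * cartanEntry .B i 1)) • s.evalSum (fTermsB v) := by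
  constructor
  all_goals
    refine s.H_conj_evalSum ?_
    obtain ⟨l, rfl⟩ := Nat.exists_eq_add_of_le' hi
    simp only [Term.QComm, qExp, List.forall_mem_cons, curlTerms, List.not_mem_nil, false_implies,
        implies_true, and_true, true_and, eTermsB, fTermsB, tExpGen, eExp, List.cons_append,
        List.nil_append, lowerExp]
    rcases l with - | l
    · simp [hin, cartanEntry, dExp]
    · simp +arith [hin, cartanEntry, dExp]
      try split_ifs <;> simp

end B
end QSystem
end QuantumSeries

namespace QuantumSeries
open ZExp XExp
namespace QSystem

set_option linter.unusedSimpArgs false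
set_option linter.flexible false

variable {K : Type*} [Field K] {n : ℕ} {v : Kˣ} {R : Type*} [Ring R] [Algebra K R]

/-! ### The first node in type `C` -/

section C

variable (s : QSystem .C n v R)

/-- The terms of `ρ(f_1)` in type `C`. -/
def fTermsC (v : Kˣ) : List (Term K) :=
  .F (2 • xi 2 + 2 • xt 2) 1 ::
    (curlTerms (curlyCoeff (v ^ 2)) (2 • z 1 - 2 • zt 2) (2 • zt 2 - 2 • z 1)
      (2 • xi 2 + x 1 + 2 • xt 2) ++
    (curlTerms (curlyCoeff v) (z 2 - zt 2) (zt 2 - z 2) (xi 2 + x 1 + xt 2) ++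
    curlTerms (curlyCoeff (v ^ 2)) (2 • z 2 - 2 • z 1) (2 • z 1 - 2 • z 2) (x 1)))

/-- The terms of `ρ(e_1)` in type `C`. -/
def eTermsC (v : Kˣ) : List (Term K) :=
  .E 1 :: curlTerms (curlyCoeff (v ^ 2)) (2 • z 1 - 2 • zt 2 + t 1) (2 • zt 2 - 2 • z 1 - t 1) (xi 1)

/-- The exponent of `ρ(t_1)` in type `C`. -/
def tExpC : ZExp := 4 • z 1 - 2 • z 2 - 2 • zt 2 + t 1

theorem evalSum_fTermsC : s.evalSum (fTermsC v) =
    s.monF (2 • xi 2 + 2 • xt 2) 1 +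
      (s.curl (curlyCoeff (v ^ 2)) (2 • z 1 - 2 • zt 2) (2 • zt 2 - 2 • z 1)
        (2 • xi 2 + x 1 + 2 • xt 2) +
      (s.curl (curlyCoeff v) (z 2 - zt 2) (zt 2 - z 2) (xi 2 + x 1 + xt 2) +
      s.curl (curlyCoeff (v ^ 2)) (2 • z 2 - 2 • z 1) (2 • z 1 - 2 • z 2) (x 1))) := by
  simp only [fTermsC, evalSum, curlTerms, curl, eval, List.map_cons, List.map_append,
    List.map_nil, List.sum_cons, List.sum_append, List.sum_nil, add_zero]

theorem evalSum_eTermsC : s.evalSum (eTermsC v) =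
    s.E 1 + s.curl (curlyCoeff (v ^ 2)) (2 • z 1 - 2 • zt 2 + t 1) (2 • zt 2 - 2 • z 1 - t 1)
      (xi 1) := by
  simp only [eTermsC, evalSum, curlTerms, curl, eval, List.map_cons, List.map_append,
    List.map_nil, List.sum_cons, List.sum_append, List.sum_nil, add_zero]

theorem smul_mon (r c : K) (a : ZExp) (ξ : XExp) : r • s.mon c a ξ = s.mon (r * c) a ξ := by
  simp only [mon, smul_smul]

/-- This compares the denominator q - q⁻¹ of the middle bracket of f_1 with the denominator q² - q⁻²
of the outer ones. -/
theorem curlyCoeff_sq (hv : (v : K) ^ 2 ≠ 1) (hv' : (v : K) ^ 4 ≠ 1) :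
    curlyCoeff v = curlyCoeff (v ^ 2) * ((v : K) + (v : K)⁻¹) := by
  have h1 := curlyCoeff_mul hv
  have h2 : curlyCoeff (v ^ 2) * (((v ^ 2 : Kˣ) : K) - ((v ^ 2 : Kˣ) : K)⁻¹) = 1 := curlyCoeff_mul
    (by rwa [Units.val_pow_eq_pow_val, ← pow_mul])
  rw [Units.val_pow_eq_pow_val] at h2
  linear_combination (curlyCoeff (v ^ 2) * ((v : K) + (v : K)⁻¹)) * h1 - curlyCoeff v * h2

/-- The three bracket monomials of f_1 with equal sign behave like p², pr + rp, r², the terms of the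
square of a sum, and form one block with the monomials of f_2 of that sign. -/
theorem serrePair_fTermsC (hv : (v : K) ^ 2 ≠ 1) (hv' : (v : K) ^ 4 ≠ 1) :
    SerrePair ((v : K) ^ (2 : ℤ)) ((v : K) ^ (1 : ℤ)) 2 3
      (s.evalSum (fTermsC v)) (s.evalSum (fTermsGen .C v 2)) := by
  set c := curlyCoeff (v ^ qExp .C) with hc
  set c₁ := curlyCoeff v with hc₁
  set c₂ := curlyCoeff (v ^ 2) with hc₂
  have hcc : c₁ = c₂ * ((v : K) + (v : K)⁻¹) := curlyCoeff_sq hv hv'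
  refine s.serrePair_evalSum (k := -2) (by simp) (by simp) (by simp) (by simp)
    (l := [([.mon c₂ (2 • z 2 - 2 • z 1) (x 1), .mon c₁ (z 2 - zt 2) (xi 2 + x 1 + xt 2),
        .mon c₂ (2 • z 1 - 2 • zt 2) (2 • xi 2 + x 1 + 2 • xt 2)],
      [.mon c (z 3 - z 2) (x 2), .mon c (zt 2 - zt 3) (xi 3 + x 2 + xt 3)]),
     ([.F (2 • xi 2 + 2 • xt 2) 1], [.F (xi 3 + x 2 + xt 3 + xti 2) 2]),
     ([.mon (-c₂) (2 • zt 2 - 2 • z 1) (2 • xi 2 + x 1 + 2 • xt 2),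
        .mon (-c₁) (zt 2 - z 2) (xi 2 + x 1 + xt 2), .mon (-c₂) (2 • z 1 - 2 • z 2) (x 1)],
      [.mon (-c) (zt 3 - zt 2) (xi 3 + x 2 + xt 3), .mon (-c) (z 2 - z 3) (x 2)])]) ?_ ?_ ?_ ?_
  · simp only [Term.Precedes, Term.QComm, List.pairwise_cons, List.forall_mem_cons, qExp,
      List.not_mem_nil, false_implies, implies_true, and_true, true_and, List.Pairwise.nil]
    simp
  · simp only [List.forall_mem_cons, List.not_mem_nil, false_implies, implies_true, and_true]
    have := s.serrePair_F (i := 1) (j := 2) (by simp) (2 • xi 2 + 2 • xt 2)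
      (xi 3 + x 2 + xt 3 + xti 2)
    have h0 : (v : K) ≠ 0 := v.ne_zero
    refine ⟨s.serrePair_square ?_ ?_ ?_ ?_ ?_ ?_ ?_, this, s.serrePair_square ?_ ?_ ?_ ?_ ?_ ?_ ?_⟩
    -- The relation between the square of the middle monomial and the product of the outer ones;
    -- this is where the coefficients of the brackets matter.
    case refine_7 | refine_14 =>
      simp only [eval, mon_mul_mon, smul_mon]
      refine s.mon_congr ?_ (by abel) (by abel)
      simp [qExp, hcc]
      field_simp
    all_goals
      simp only [Term.QComm, List.forall_mem_cons, qExp,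
        List.not_mem_nil, false_implies, implies_true, and_true, true_and]
      simp
  · simp [fTermsC, curlTerms, evalSum, eval, ← hc₁, ← hc₂]; abel
  · simp [fTermsGen, curlTerms, evalSum, eval, ← hc]; abel

theorem serrePair_eTermsC (hn : 2 ≤ n) :
    SerrePair ((v : K) ^ (2 : ℤ)) ((v : K) ^ (1 : ℤ)) 2 3
      (s.evalSum (eTermsC v)) (s.evalSum (eTermsGen .C v 2)) := by
  set c := curlyCoeff (v ^ qExp .C) with hc
  set c₂ := curlyCoeff (v ^ 2) with hc₂
  refine s.serrePair_evalSum (k := -2) (by simp) (by simp) (by simp) (by simp)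
    (l := [([], [.mon c (eExp .C 2) (xi 2)]),
     ([.mon c₂ (2 • z 1 - 2 • zt 2 + t 1) (xi 1)], []),
     ([], [.mon c (zt 2 - zt 3 + t 2) (xti 2)]),
     ([.E 1], [.E 2]),
     ([], [.mon (-c) (zt 3 - zt 2 - t 2) (xti 2)]),
     ([.mon (-c₂) (2 • zt 2 - 2 • z 1 - t 1) (xi 1)], []),
     ([], [.mon (-c) (-eExp .C 2) (xi 2)])]) ?_ ?_ ?_ ?_
  · simp only [Term.Precedes, Term.QComm, List.pairwise_cons, List.forall_mem_cons, qExp, eExp,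
      List.not_mem_nil, false_implies, implies_true, and_true, true_and, List.Pairwise.nil]
    simp [lowerExp, cartanEntry, dExp, hn, show 1 ≤ n by omega]
  · simp only [List.forall_mem_cons, List.not_mem_nil, false_implies, implies_true, and_true]
    have := s.serrePair_E (i := 1) (j := 2) (by simp)
    exact ⟨s.serrePair_evalSum_nil_left _ _ (by simp) _,
      s.serrePair_evalSum_nil_right _ _ (by simp) _,
      s.serrePair_evalSum_nil_left _ _ (by simp) _, this,
      s.serrePair_evalSum_nil_left _ _ (by simp) _,
      s.serrePair_evalSum_nil_right _ _ (by simp) _,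
      s.serrePair_evalSum_nil_left _ _ (by simp) _⟩
  · simp [eTermsC, curlTerms, evalSum, eval, ← hc₂]; abel
  · simp [eTermsGen, curlTerms, evalSum, eval, ← hc]; abel

theorem comm_eTermsC_fTermsC (hn : 1 ≤ n) (hv' : (v : K) ^ 4 ≠ 1) :
    comm (s.evalSum (eTermsC v)) (s.evalSum (fTermsC v)) =
      s.curl (curlyCoeff (v ^ 2)) tExpC (-tExpC) 0 := by
  have hc : curlyCoeff (v ^ 2) * (((v ^ 2 : Kˣ) : K) - ((v ^ 2 : Kˣ) : K)⁻¹) = 1 := curlyCoeff_mul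
    (by rwa [Units.val_pow_eq_pow_val, ← pow_mul])
  rw [Units.val_pow_eq_pow_val] at hc
  rw [evalSum_fTermsC, evalSum_eTermsC]
  simp only [comm_add, add_comm_left]
  rw [s.comm_E_curl (by simp) (by simp), s.comm_E_curl (by simp) (by simp),
    s.comm_E_curl (by simp) (by simp),
    s.comm_E_monF le_rfl _ (fun h => by
        simp only [P_add, two_nsmul, s.P_xi_eq_zero 2 (by omega), zero_mul]),
    s.comm_curl_monF (by simp [hn, dExp, cartanEntry, qExp])
      (by simp [hn, dExp, cartanEntry, qExp]),
    s.comm_curl_curl (by simp [qExp]) (by simp [qExp]),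
    s.comm_curl_curl_eq_zero (η := xi 2 + x 1 + xt 2) (by simp [qExp]) (by simp [qExp])
      (by simp [qExp]),
    s.comm_curl_curl (by simp [qExp]) (by simp [qExp])]
  simp only [zero_add, add_zero]
  rw [← add_assoc, s.curl_add_curl_eq_zero, zero_add]
  · refine s.curl_congr ?_ ?_ ?_ ?_
    · simp [qExp, zpow_neg]
      linear_combination (curlyCoeff (v ^ 2)) * hc
    · simp only [tExpC]; abel
    · simp only [tExpC]; abel
    · rw [add_comm, s.x_xi _ le_rfl hn, P_zero]
  · simp [dExp, qExp]
    rw [show ((v : K) ^ 2 - ((v : K) ^ 2)⁻¹)⁻¹ = curlyCoeff (v ^ 2) by simp [curlyCoeff]]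
    linear_combination (-curlyCoeff (v ^ 2)) * hc
  · abel
  · abel
  · rw [show xi 1 + (2 • xi 2 + x 1 + 2 • xt 2) = (2 • xi 2 + 2 • xt 2) + (x 1 + xi 1) by abel,
      s.P_add _ (x 1 + _), s.x_xi _ le_rfl hn, mul_one]

theorem commute_fTermsC {j : ℕ} (hj : 3 ≤ j) :
    Commute (s.evalSum (fTermsC v)) (s.evalSum (fTermsGen .C v j)) := by
  obtain ⟨l, rfl⟩ := Nat.exists_eq_add_of_le' hj
  refine s.commute_evalSum (s.commute_F (by omega) (by simp [cartanEntry]) _ _) ?_ ?_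
  all_goals
    simp only [Term.QComm, List.forall_mem_cons, curlTerms, List.not_mem_nil, false_implies,
      implies_true, and_true, true_and, List.cons_append, List.nil_append]
    simp +arith

theorem commute_eTermsC {j : ℕ} (hj : 3 ≤ j) (hjn : j ≤ n) :
    Commute (s.evalSum (eTermsC v)) (s.evalSum (eTermsGen .C v j)) := by
  obtain ⟨l, rfl⟩ := Nat.exists_eq_add_of_le' hj
  refine s.commute_evalSum (s.commute_E (by omega) (by simp [cartanEntry])) ?_ ?_
  all_goals
    simp only [Term.QComm, List.forall_mem_cons, curlTerms, List.not_mem_nil, false_implies,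
      implies_true, and_true, true_and, List.cons_append, List.nil_append, eExp]
    simp +arith [lowerExp, cartanEntry]

theorem comm_eTermsC_fTermsGen {j : ℕ} (hj : 2 ≤ j) (hn : 1 ≤ n) :
    comm (s.evalSum (eTermsC v)) (s.evalSum (fTermsGen .C v j)) = 0 := by
  rw [evalSum_fTermsGen, evalSum_eTermsC]
  simp only [comm_add, add_comm_left]
  rw [s.comm_E_curl (by simp) (by simp), s.comm_E_curl (by simp) (by simp),
    s.comm_E_monF_of_ne (by omega), s.comm_curl_monF, s.comm_curl_curl_eq_zero,
    s.comm_curl_curl_eq_zero]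
  · simp
  all_goals
    obtain ⟨l, rfl⟩ := Nat.exists_eq_add_of_le' hj
    simp +arith [cartanEntry, dExp, qExp, hn]

/-- For i = 2 four commutators of brackets are nonzero. They cancel in two pairs: x̃_2⁻¹ with the
first bracket of f_1 against x_2⁻¹ with the middle one, and x̃_2⁻¹ with the middle one against x_2⁻¹
with the last one. -/
theorem comm_eTermsGen_fTermsC {i : ℕ} (hi : 2 ≤ i) (hin : i ≤ n) (hv : (v : K) ^ 2 ≠ 1)
    (hv' : (v : K) ^ 4 ≠ 1) :
    comm (s.evalSum (eTermsGen .C v i)) (s.evalSum (fTermsC v)) = 0 := by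
  have hc := curlyCoeff_mul hv
  have hc' : curlyCoeff (v ^ 2) * (((v ^ 2 : Kˣ) : K) - ((v ^ 2 : Kˣ) : K)⁻¹) = 1 := curlyCoeff_mul
    (by rwa [Units.val_pow_eq_pow_val, ← pow_mul])
  rw [Units.val_pow_eq_pow_val] at hc'
  rw [evalSum_fTermsC, evalSum_eTermsGen]
  simp only [comm_add, add_comm_left]
  rw [s.comm_E_curl (by simp) (by simp), s.comm_E_curl (by simp) (by simp),
    s.comm_E_curl (by simp) (by simp), s.comm_E_monF_of_ne (by omega)]
  rcases Nat.eq_or_lt_of_le hi with rfl | hi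
  · have hx := s.xt_xti 2 (by simp [numTilde]; omega) hin
    rw [s.comm_curl_monF, s.comm_curl_monF,
      s.comm_curl_curl_eq_zero (ξ := xi 2) (η := 2 • xi 2 + x 1 + 2 • xt 2),
      s.comm_curl_curl (ξ := xti 2) (η := 2 • xi 2 + x 1 + 2 • xt 2),
      s.comm_curl_curl (ξ := xi 2) (η := xi 2 + x 1 + xt 2),
      s.comm_curl_curl (ξ := xti 2) (η := xi 2 + x 1 + xt 2),
      s.comm_curl_curl (ξ := xi 2) (η := x 1), s.comm_curl_curl_eq_zero (ξ := xti 2) (η := x 1)]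
    · simp only [zero_add, add_zero]
      rw [add_assoc (s.curl _ _ _ _), s.curl_add_curl_eq_zero, add_zero, s.curl_add_curl_eq_zero]
      · simp [eExp, lowerExp, qExp]
        linear_combination curlyCoeff v * hc' - curlyCoeff v * hc
      · simp only [eExp, lowerExp, if_pos]; abel
      · simp only [eExp, lowerExp, if_pos]; abel
      · rw [show xti 2 + (2 • xi 2 + x 1 + 2 • xt 2) =
            (xi 2 + (xi 2 + x 1 + xt 2)) + (xt 2 + xti 2) by abel, s.P_add _ (xt 2 + _), hx, mul_one]
      · simp [eExp, lowerExp, qExp]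
        linear_combination curlyCoeff v * hc - curlyCoeff v * hc'
      · simp only [eExp, lowerExp, if_pos]; abel
      · simp only [eExp, lowerExp, if_pos]; abel
      · rw [show xti 2 + (xi 2 + x 1 + xt 2) = (xi 2 + x 1) + (xt 2 + xti 2) by abel,
          s.P_add _ (xt 2 + _), hx, mul_one]
    all_goals simp [eExp, lowerExp, cartanEntry, dExp, qExp, hin]
  · rw [s.comm_curl_monF, s.comm_curl_monF, s.comm_curl_curl_eq_zero, s.comm_curl_curl_eq_zero,
      s.comm_curl_curl_eq_zero, s.comm_curl_curl_eq_zero, s.comm_curl_curl_eq_zero,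
      s.comm_curl_curl_eq_zero]
    · simp
    all_goals
      obtain ⟨l, rfl⟩ : ∃ l, i = l + 3 := ⟨i - 3, by omega⟩
      simp +arith [cartanEntry, dExp, qExp, eExp, lowerExp]
      try (split_ifs <;> simp)

theorem H_conj_tExpC (hn : 1 ≤ n) :
    (s.H (.ofAdd tExpC) : R) * s.evalSum (eTermsC v) * s.H (.ofAdd (-tExpC)) =
      (v : K) ^ (dExp .C 1 * cartanEntry .C 1 1) • s.evalSum (eTermsC v) ∧
    (s.H (.ofAdd tExpC) : R) * s.evalSum (fTermsC v) * s.H (.ofAdd (-tExpC)) =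
      (v : K) ^ (-(dExp .C 1 * cartanEntry .C 1 1)) • s.evalSum (fTermsC v) := by
  constructor
  all_goals
    refine s.H_conj_evalSum ?_
    simp only [Term.QComm, qExp, List.forall_mem_cons, curlTerms, List.not_mem_nil, false_implies,
        implies_true, and_true, true_and, eTermsC, fTermsC, tExpC, List.cons_append,
        List.nil_append]
    simp [hn, cartanEntry, dExp]

theorem H_conj_tExpC_gen {j : ℕ} (hj : 2 ≤ j) (hn : 1 ≤ n) :
    (s.H (.ofAdd tExpC) : R) * s.evalSum (eTermsGen .C v j) * s.H (.ofAdd (-tExpC)) =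
      (v : K) ^ (dExp .C 1 * cartanEntry .C 1 j) • s.evalSum (eTermsGen .C v j) ∧
    (s.H (.ofAdd tExpC) : R) * s.evalSum (fTermsGen .C v j) * s.H (.ofAdd (-tExpC)) =
      (v : K) ^ (-(dExp .C 1 * cartanEntry .C 1 j)) • s.evalSum (fTermsGen .C v j) := by
  constructor
  all_goals
    refine s.H_conj_evalSum ?_
    obtain ⟨l, rfl⟩ := Nat.exists_eq_add_of_le' hj
    simp only [Term.QComm, qExp, List.forall_mem_cons, curlTerms, List.not_mem_nil, false_implies,
        implies_true, and_true, true_and, eTermsGen, fTermsGen, tExpC, List.cons_append,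
        List.nil_append]
    simp +arith [hn, cartanEntry, dExp]
    try split_ifs <;> omega

theorem H_conj_tExpGen_C {i : ℕ} (hi : 2 ≤ i) (hin : i ≤ n) :
    (s.H (.ofAdd (tExpGen .C i)) : R) * s.evalSum (eTermsC v) * s.H (.ofAdd (-tExpGen .C i)) =
      (v : K) ^ (dExp .C i * cartanEntry .C i 1) • s.evalSum (eTermsC v) ∧
    (s.H (.ofAdd (tExpGen .C i)) : R) * s.evalSum (fTermsC v) * s.H (.ofAdd (-tExpGen .C i)) =
      (v : K) ^ (-(dExp .C i * cartanEntry .C i 1)) • s.evalSum (fTermsC v) := by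
  constructor
  all_goals
    refine s.H_conj_evalSum ?_
    obtain ⟨l, rfl⟩ := Nat.exists_eq_add_of_le' hi
    simp only [Term.QComm, qExp, List.forall_mem_cons, curlTerms, List.not_mem_nil, false_implies,
        implies_true, and_true, true_and, eTermsC, fTermsC, tExpGen, eExp, List.cons_append,
        List.nil_append, lowerExp]
    rcases l with - | l
    · simp [hin, cartanEntry, dExp]
    · simp +arith [hin, cartanEntry, dExp]
      try split_ifs <;> simp

end C
end QSystem
end QuantumSeries

namespace QuantumSeries
open ZExp XExp
namespace QSystem

set_option linter.unusedSimpArgs false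
set_option linter.flexible false

variable {K : Type*} [Field K] {n : ℕ} {v : Kˣ} {R : Type*} [Ring R] [Algebra K R]

/-! ### The first two nodes in type `D` -/

section D

variable (s : QSystem .D n v R)

/-- The terms of `ρ(f_i)` in type `D` for `{i, j} = {1, 2}`. -/
def fTermsD (v : Kˣ) (i j : ℕ) : List (Term K) :=
  .F (xi 3 + x i + xi j + xt 3) j :: (curlTerms (curlyCoeff v) (z 3 - z i) (z i - z 3) (x i) ++
    curlTerms (curlyCoeff v) (z j - zt 3) (zt 3 - z j) (xt 3 + xi 3 + x i))

/-- The terms of `ρ(e_i)` in type `D` for `i = 1, 2`. -/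
def eTermsD (v : Kˣ) (i : ℕ) : List (Term K) :=
  .E i :: curlTerms (curlyCoeff v) (z i - zt 3 + t i) (zt 3 - z i - t i) (xi i)

/-- The exponent of `ρ(t_i)` in type `D` for `i = 1, 2`. -/
def tExpD (i : ℕ) : ZExp := 2 • z i - z 3 - zt 3 + t i

theorem evalSum_fTermsD (i j : ℕ) : s.evalSum (fTermsD v i j) =
    s.monF (xi 3 + x i + xi j + xt 3) j +
      (s.curl (curlyCoeff v) (z 3 - z i) (z i - z 3) (x i) +
      s.curl (curlyCoeff v) (z j - zt 3) (zt 3 - z j) (xt 3 + xi 3 + x i)) := by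
  simp only [fTermsD, evalSum, curlTerms, curl, eval, List.map_cons, List.map_append,
    List.map_nil, List.sum_cons, List.sum_append, List.sum_nil, add_zero]

theorem evalSum_eTermsD (i : ℕ) : s.evalSum (eTermsD v i) =
    s.E i + s.curl (curlyCoeff v) (z i - zt 3 + t i) (zt 3 - z i - t i) (xi i) := by
  simp only [eTermsD, evalSum, curlTerms, curl, eval, List.map_cons, List.map_append,
    List.map_nil, List.sum_cons, List.sum_append, List.sum_nil, add_zero]

/-- The two mixed commutators, of the first bracket of either generator with the second bracket of
the other, do not vanish separately but cancel each other. -/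
theorem commute_fTermsD : Commute (s.evalSum (fTermsD v 1 2)) (s.evalSum (fTermsD v 2 1)) := by
  set c := curlyCoeff v with hc
  have hF := s.commute_F (i := 2) (j := 1) (by simp) (by simp [cartanEntry])
    (xi 3 + x 1 + xi 2 + xt 3) (xi 3 + x 2 + xi 1 + xt 3)
  simp only [eval] at hF
  have h1 : comm (s.curl c (z 3 - z 1) (z 1 - z 3) (x 1))
      (s.curl c (z 1 - zt 3) (zt 3 - z 1) (xt 3 + xi 3 + x 2)) +
      comm (s.curl c (z 2 - zt 3) (zt 3 - z 2) (xt 3 + xi 3 + x 1))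
      (s.curl c (z 3 - z 2) (z 2 - z 3) (x 2)) = 0 := by
    simp only [curl, comm_add, add_comm_left, comm_mon_mon]
    simp [qExp]
    simp only [mon, zero_smul, zero_add, add_zero]
    rw [show xt 3 + xi 3 + x 1 + x 2 = x 1 + (xt 3 + xi 3 + x 2) by abel]
    module
  rw [Commute, SemiconjBy, ← sub_eq_zero]
  change comm _ _ = 0
  rw [evalSum_fTermsD, evalSum_fTermsD]
  simp only [comm_add, add_comm_left]
  have hz {a b : R} (h : Commute a b) : comm a b = 0 := sub_eq_zero.2 h
  have hF' {a b : ZExp} {ξ η : XExp} {i : ℕ}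
      (h : pairing (qExp .D) η a + weight .D n i a = 0)
      (h' : pairing (qExp .D) η b + weight .D n i b = 0) :
      comm (s.monF η i) (s.curl c a b ξ) = 0 := by
    rw [← neg_eq_zero, ← s.comm_curl_monF (c := c) (ξ := ξ) h h', comm, comm, neg_sub]
  rw [hz hF, s.comm_curl_monF, s.comm_curl_monF, hF', hF',
    s.comm_curl_curl_eq_zero (ξ := x 1) (η := x 2),
    s.comm_curl_curl_eq_zero (ξ := xt 3 + xi 3 + x 1) (η := xt 3 + xi 3 + x 2)]
  · simp only [zero_add, add_zero]
    rw [add_comm, h1]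
  all_goals simp

theorem commute_eTermsD :
    Commute (s.evalSum (eTermsD v 1)) (s.evalSum (eTermsD v 2)) := by
  refine s.commute_evalSum (s.commute_E (by omega) (by simp [cartanEntry])) ?_ ?_
  all_goals
    simp only [Term.QComm, List.forall_mem_cons, curlTerms, List.not_mem_nil, false_implies,
      implies_true, and_true, true_and, List.cons_append, List.nil_append]
    simp [cartanEntry]


theorem serrePair_fTermsD {i j : ℕ} (h : i = 1 ∧ j = 2 ∨ i = 2 ∧ j = 1) :
    SerrePair ((v : K) ^ (1 : ℤ)) ((v : K) ^ (1 : ℤ)) 2 2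
      (s.evalSum (fTermsD v i j)) (s.evalSum (fTermsGen .D v 3)) := by
  set c := curlyCoeff (v ^ qExp .D) with hc
  set c₁ := curlyCoeff v with hc₁
  refine s.serrePair_evalSum (k := -1) (by simp) (by simp) (by simp) (by simp)
    (l := [([.mon c₁ (z 3 - z i) (x i)], []),
     ([], [.mon c (z 4 - z 3) (x 3)]),
     ([], [.mon c (zt 3 - zt 4) (xi 4 + x 3 + xt 4)]),
     ([.mon c₁ (z j - zt 3) (xt 3 + xi 3 + x i)], []),
     ([.F (xi 3 + x i + xi j + xt 3) j], [.F (xi 4 + x 3 + xt 4 + xti 3) 3]),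
     ([.mon (-c₁) (zt 3 - z j) (xt 3 + xi 3 + x i)], []),
     ([], [.mon (-c) (zt 4 - zt 3) (xi 4 + x 3 + xt 4)]),
     ([], [.mon (-c) (z 3 - z 4) (x 3)]),
     ([.mon (-c₁) (z i - z 3) (x i)], [])]) ?_ ?_ ?_ ?_
  · simp only [Term.Precedes, Term.QComm, List.pairwise_cons, List.forall_mem_cons, qExp,
      List.not_mem_nil, false_implies, implies_true, and_true, true_and, List.Pairwise.nil]
    rcases h with ⟨rfl, rfl⟩ | ⟨rfl, rfl⟩ <;> simp
  · simp only [List.forall_mem_cons, List.not_mem_nil, false_implies, implies_true, and_true]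
    -- The term of f_i from Ū is a multiple of F_j, so the Serre relation of F_j and F_3 is the
    -- relevant one; both nodes are joined to 3 in the same way.
    have := s.serrePair_F (i := j) (j := 3) (by omega) (xi 3 + x i + xi j + xt 3)
      (xi 4 + x 3 + xt 4 + xti 3)
    rw [show cartanEntry .D j 3 = -1 by
        rcases h with ⟨rfl, rfl⟩ | ⟨rfl, rfl⟩ <;> simp [cartanEntry],
      show cartanEntry .D 3 j = -1 by
        rcases h with ⟨rfl, rfl⟩ | ⟨rfl, rfl⟩ <;> simp [cartanEntry]] at this
    exact ⟨s.serrePair_evalSum_nil_right _ _ (by simp) _,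
      s.serrePair_evalSum_nil_left _ _ (by simp) _,
      s.serrePair_evalSum_nil_left _ _ (by simp) _,
      s.serrePair_evalSum_nil_right _ _ (by simp) _, this,
      s.serrePair_evalSum_nil_right _ _ (by simp) _,
      s.serrePair_evalSum_nil_left _ _ (by simp) _,
      s.serrePair_evalSum_nil_left _ _ (by simp) _,
      s.serrePair_evalSum_nil_right _ _ (by simp) _⟩
  · simp [fTermsD, curlTerms, evalSum, eval, ← hc₁]; abel
  · simp [fTermsGen, curlTerms, evalSum, eval, ← hc]; abel

theorem serrePair_eTermsD {i j : ℕ} (h : i = 1 ∧ j = 2 ∨ i = 2 ∧ j = 1) (hn : 3 ≤ n) :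
    SerrePair ((v : K) ^ (1 : ℤ)) ((v : K) ^ (1 : ℤ)) 2 2
      (s.evalSum (eTermsD v i)) (s.evalSum (eTermsGen .D v 3)) := by
  set c := curlyCoeff (v ^ qExp .D) with hc
  set c₁ := curlyCoeff v with hc₁
  refine s.serrePair_evalSum (k := -1) (by simp) (by simp) (by simp) (by simp)
    (l := [([], [.mon c (eExp .D 3) (xi 3)]),
     ([.mon c₁ (z i - zt 3 + t i) (xi i)], []),
     ([], [.mon c (zt 3 - zt 4 + t 3) (xti 3)]),
     ([.E i], [.E 3]),
     ([], [.mon (-c) (zt 4 - zt 3 - t 3) (xti 3)]),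
     ([.mon (-c₁) (zt 3 - z i - t i) (xi i)], []),
     ([], [.mon (-c) (-eExp .D 3) (xi 3)])]) ?_ ?_ ?_ ?_
  · simp only [Term.Precedes, Term.QComm, List.pairwise_cons, List.forall_mem_cons, qExp, eExp,
      List.not_mem_nil, false_implies, implies_true, and_true, true_and, List.Pairwise.nil]
    rcases h with ⟨rfl, rfl⟩ | ⟨rfl, rfl⟩ <;>
    simp [lowerExp, cartanEntry, dExp, hn, show 1 ≤ n by omega, show 2 ≤ n by omega]
  · simp only [List.forall_mem_cons, List.not_mem_nil, false_implies, implies_true, and_true]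
    have := s.serrePair_E (i := i) (j := 3) (by omega)
    rw [show cartanEntry .D i 3 = -1 by
        rcases h with ⟨rfl, rfl⟩ | ⟨rfl, rfl⟩ <;> simp [cartanEntry],
      show cartanEntry .D 3 i = -1 by
        rcases h with ⟨rfl, rfl⟩ | ⟨rfl, rfl⟩ <;> simp [cartanEntry]] at this
    exact ⟨s.serrePair_evalSum_nil_left _ _ (by simp) _,
      s.serrePair_evalSum_nil_right _ _ (by simp) _,
      s.serrePair_evalSum_nil_left _ _ (by simp) _, this,
      s.serrePair_evalSum_nil_left _ _ (by simp) _,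
      s.serrePair_evalSum_nil_right _ _ (by simp) _,
      s.serrePair_evalSum_nil_left _ _ (by simp) _⟩
  · simp [eTermsD, curlTerms, evalSum, eval, ← hc₁]; abel
  · simp [eTermsGen, curlTerms, evalSum, eval, ← hc]; abel

theorem commute_fTermsD_gen {i j : ℕ} (h : i = 1 ∧ j = 2 ∨ i = 2 ∧ j = 1) {k : ℕ} (hk : 4 ≤ k) :
    Commute (s.evalSum (fTermsD v i j)) (s.evalSum (fTermsGen .D v k)) := by
  obtain ⟨l, rfl⟩ := Nat.exists_eq_add_of_le' hk
  rcases h with ⟨rfl, rfl⟩ | ⟨rfl, rfl⟩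
  all_goals
    refine s.commute_evalSum (s.commute_F (by omega) (by simp [cartanEntry]) _ _) ?_ ?_
    all_goals
      simp only [Term.QComm, List.forall_mem_cons, curlTerms, List.not_mem_nil, false_implies,
        implies_true, and_true, true_and, List.cons_append, List.nil_append]
      simp +arith

theorem commute_eTermsD_gen {i j : ℕ} (h : i = 1 ∧ j = 2 ∨ i = 2 ∧ j = 1) {k : ℕ} (hk : 4 ≤ k) :
    Commute (s.evalSum (eTermsD v i)) (s.evalSum (eTermsGen .D v k)) := by
  obtain ⟨l, rfl⟩ := Nat.exists_eq_add_of_le' hk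
  rcases h with ⟨rfl, rfl⟩ | ⟨rfl, rfl⟩
  all_goals
    refine s.commute_evalSum (s.commute_E (by omega) (by simp [cartanEntry])) ?_ ?_
    all_goals
      simp only [Term.QComm, List.forall_mem_cons, curlTerms, List.not_mem_nil, false_implies,
        implies_true, and_true, true_and, List.cons_append, List.nil_append, eExp]
      simp +arith [lowerExp, cartanEntry]

theorem comm_eTermsD_fTermsD_self {i j : ℕ} (h : i = 1 ∧ j = 2 ∨ i = 2 ∧ j = 1) (hn : 3 ≤ n) (hv : (v : K) ^ 2 ≠ 1) :
    comm (s.evalSum (eTermsD v i)) (s.evalSum (fTermsD v i j)) =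
      s.curl (curlyCoeff v) (tExpD i) (-tExpD i) 0 := by
  have hc := curlyCoeff_mul hv
  rw [evalSum_fTermsD, evalSum_eTermsD]
  simp only [comm_add, add_comm_left]
  rw [s.comm_E_curl (by simp) (by simp), s.comm_E_curl (by simp) (by simp),
    s.comm_E_monF_of_ne (by omega), s.comm_curl_monF, s.comm_curl_curl,
    s.comm_curl_curl_eq_zero]
  · simp only [zero_add, add_zero]
    refine s.curl_congr ?_ ?_ ?_ ?_
    · rcases h with ⟨rfl, rfl⟩ | ⟨rfl, rfl⟩ <;> simp [qExp] <;>
      linear_combination (curlyCoeff v) * hc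
    · simp only [tExpD]; abel
    · simp only [tExpD]; abel
    · rw [add_comm, s.x_xi _ (by omega) (by omega), P_zero]
  all_goals
    rcases h with ⟨rfl, rfl⟩ | ⟨rfl, rfl⟩ <;>
    simp [dExp, cartanEntry, qExp, show 1 ≤ n by omega, show 2 ≤ n by omega]

/-- Since the roles of F_1 and F_2 are exchanged, E_i meets F_i in f_j. The bracket so produced is
cancelled by the bracket of e_i against the second bracket of f_j. -/
theorem comm_eTermsD_fTermsD {i j : ℕ} (h : i = 1 ∧ j = 2 ∨ i = 2 ∧ j = 1) (hn : 3 ≤ n) (hv : (v : K) ^ 2 ≠ 1) :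
    comm (s.evalSum (eTermsD v i)) (s.evalSum (fTermsD v j i)) = 0 := by
  have hc := curlyCoeff_mul hv
  rw [evalSum_fTermsD, evalSum_eTermsD]
  simp only [comm_add, add_comm_left]
  rw [s.comm_E_curl (by simp) (by simp), s.comm_E_curl (by simp) (by simp),
    s.comm_E_monF (by omega) _ (by omega), s.comm_curl_monF, s.comm_curl_curl_eq_zero (η := x j),
    s.comm_curl_curl]
  · simp only [zero_add, add_zero]
    rw [s.curl_add_curl_eq_zero]
    · rcases h with ⟨rfl, rfl⟩ | ⟨rfl, rfl⟩ <;> simp [dExp, qExp] <;>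
      rw [show ((v : K) - (v : K)⁻¹)⁻¹ = curlyCoeff v by simp [curlyCoeff]] <;>
      linear_combination (-curlyCoeff v) * hc
    · abel
    · abel
    · congr 2; abel
  all_goals
    rcases h with ⟨rfl, rfl⟩ | ⟨rfl, rfl⟩ <;>
    simp [dExp, cartanEntry, qExp, show 1 ≤ n by omega, show 2 ≤ n by omega]

theorem comm_eTermsD_fTermsGen {i j : ℕ} (h : i = 1 ∧ j = 2 ∨ i = 2 ∧ j = 1) {k : ℕ} (hk : 3 ≤ k) (hn : 3 ≤ n) :
    comm (s.evalSum (eTermsD v i)) (s.evalSum (fTermsGen .D v k)) = 0 := by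
  rw [evalSum_fTermsGen, evalSum_eTermsD]
  simp only [comm_add, add_comm_left]
  rw [s.comm_E_curl (by simp) (by simp), s.comm_E_curl (by simp) (by simp),
    s.comm_E_monF_of_ne (by omega), s.comm_curl_monF, s.comm_curl_curl_eq_zero,
    s.comm_curl_curl_eq_zero]
  · simp
  all_goals
    obtain ⟨l, rfl⟩ := Nat.exists_eq_add_of_le' hk
    rcases h with ⟨rfl, rfl⟩ | ⟨rfl, rfl⟩
    all_goals
      simp +arith [cartanEntry, dExp, qExp, show 1 ≤ n by omega, show 2 ≤ n by omega]

theorem comm_eTermsGen_fTermsD {i j : ℕ} (h : i = 1 ∧ j = 2 ∨ i = 2 ∧ j = 1) {k : ℕ} (hk : 3 ≤ k) (hkn : k ≤ n) :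
    comm (s.evalSum (eTermsGen .D v k)) (s.evalSum (fTermsD v i j)) = 0 := by
  rw [evalSum_fTermsD, evalSum_eTermsGen]
  simp only [comm_add, add_comm_left]
  rw [s.comm_E_curl (by simp) (by simp), s.comm_E_curl (by simp) (by simp),
    s.comm_E_monF_of_ne (by omega)]
  rcases Nat.eq_or_lt_of_le hk with rfl | hk
  · rw [s.comm_curl_monF, s.comm_curl_monF, s.comm_curl_curl (ξ := xi 3) (η := x i),
      s.comm_curl_curl_eq_zero (ξ := xti 3) (η := x i), s.comm_curl_curl_eq_zero (ξ := xi 3),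
      s.comm_curl_curl (ξ := xti 3)]
    · simp only [zero_add, add_zero]
      rw [s.curl_add_curl_eq_zero]
      · rcases h with ⟨rfl, rfl⟩ | ⟨rfl, rfl⟩ <;> simp [eExp, lowerExp, qExp] <;> ring
      · rcases h with ⟨rfl, rfl⟩ | ⟨rfl, rfl⟩ <;> simp [eExp, lowerExp] <;> abel
      · rcases h with ⟨rfl, rfl⟩ | ⟨rfl, rfl⟩ <;> simp [eExp, lowerExp] <;> abel
      · have := s.xt_xti 3 (by simp [numTilde]; omega) hkn
        rw [show xti 3 + (xt 3 + xi 3 + x i) = (xi 3 + x i) + (xt 3 + xti 3) by abel,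
          s.P_add _ (xt 3 + _), this, mul_one]
    all_goals
      rcases h with ⟨rfl, rfl⟩ | ⟨rfl, rfl⟩ <;>
      simp [eExp, lowerExp, cartanEntry, dExp, qExp, hkn]
  · rw [s.comm_curl_monF, s.comm_curl_monF, s.comm_curl_curl_eq_zero, s.comm_curl_curl_eq_zero,
      s.comm_curl_curl_eq_zero, s.comm_curl_curl_eq_zero]
    · simp
    all_goals
      obtain ⟨l, rfl⟩ : ∃ l, k = l + 4 := ⟨k - 4, by omega⟩
      rcases h with ⟨rfl, rfl⟩ | ⟨rfl, rfl⟩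
      all_goals
        simp +arith [cartanEntry, dExp, qExp, eExp, lowerExp]
        try (split_ifs <;> simp)

theorem H_conj_tExpD {i j : ℕ} (h : i = 1 ∧ j = 2 ∨ i = 2 ∧ j = 1) (hn : 3 ≤ n) {k : ℕ} (hk : k = 1 ∨ k = 2) :
    (s.H (.ofAdd (tExpD k)) : R) * s.evalSum (eTermsD v i) * s.H (.ofAdd (-tExpD k)) =
      (v : K) ^ (dExp .D k * cartanEntry .D k i) • s.evalSum (eTermsD v i) ∧
    (s.H (.ofAdd (tExpD k)) : R) * s.evalSum (fTermsD v i j) * s.H (.ofAdd (-tExpD k)) =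
      (v : K) ^ (-(dExp .D k * cartanEntry .D k i)) • s.evalSum (fTermsD v i j) := by
  constructor
  all_goals
    refine s.H_conj_evalSum ?_
    simp only [Term.QComm, qExp, List.forall_mem_cons, curlTerms, List.not_mem_nil, false_implies,
        implies_true, and_true, true_and, eTermsD, fTermsD, tExpD, List.cons_append,
        List.nil_append]
    rcases h with ⟨rfl, rfl⟩ | ⟨rfl, rfl⟩ <;> rcases hk with rfl | rfl <;>
    simp [cartanEntry, dExp, show 1 ≤ n by omega, show 2 ≤ n by omega]

theorem H_conj_tExpD_gen (hn : 3 ≤ n) {k : ℕ} (hk : 3 ≤ k) {i : ℕ} (hi : i = 1 ∨ i = 2) :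
    (s.H (.ofAdd (tExpD i)) : R) * s.evalSum (eTermsGen .D v k) * s.H (.ofAdd (-tExpD i)) =
      (v : K) ^ (dExp .D i * cartanEntry .D i k) • s.evalSum (eTermsGen .D v k) ∧
    (s.H (.ofAdd (tExpD i)) : R) * s.evalSum (fTermsGen .D v k) * s.H (.ofAdd (-tExpD i)) =
      (v : K) ^ (-(dExp .D i * cartanEntry .D i k)) • s.evalSum (fTermsGen .D v k) := by
  constructor
  all_goals
    refine s.H_conj_evalSum ?_
    obtain ⟨l, rfl⟩ := Nat.exists_eq_add_of_le' hk
    simp only [Term.QComm, qExp, List.forall_mem_cons, curlTerms, List.not_mem_nil, false_implies,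
        implies_true, and_true, true_and, eTermsGen, fTermsGen, tExpD, List.cons_append,
        List.nil_append]
    rcases hi with rfl | rfl
    all_goals
      simp +arith [cartanEntry, dExp, show 1 ≤ n by omega, show 2 ≤ n by omega]
      try split_ifs <;> simp

theorem H_conj_tExpGen_D {i j : ℕ} (h : i = 1 ∧ j = 2 ∨ i = 2 ∧ j = 1) {k : ℕ} (hk : 3 ≤ k) (hkn : k ≤ n) :
    (s.H (.ofAdd (tExpGen .D k)) : R) * s.evalSum (eTermsD v i) * s.H (.ofAdd (-tExpGen .D k)) =
      (v : K) ^ (dExp .D k * cartanEntry .D k i) • s.evalSum (eTermsD v i) ∧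
    (s.H (.ofAdd (tExpGen .D k)) : R) * s.evalSum (fTermsD v i j) * s.H (.ofAdd (-tExpGen .D k)) =
      (v : K) ^ (-(dExp .D k * cartanEntry .D k i)) • s.evalSum (fTermsD v i j) := by
  constructor
  all_goals
    refine s.H_conj_evalSum ?_
    obtain ⟨l, rfl⟩ := Nat.exists_eq_add_of_le' hk
    simp only [Term.QComm, qExp, List.forall_mem_cons, curlTerms, List.not_mem_nil, false_implies,
        implies_true, and_true, true_and, eTermsD, fTermsD, tExpGen, eExp, List.cons_append,
        List.nil_append, lowerExp]
    rcases h with ⟨rfl, rfl⟩ | ⟨rfl, rfl⟩ <;> rcases l with - | l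
    all_goals
      simp +arith [hkn, cartanEntry, dExp]
      try split_ifs <;> simp

end D
end QSystem
end QuantumSeries

namespace QuantumSeries
open ZExp XExp
namespace QSystem

/-! ### The homomorphism from the quantized enveloping algebra -/

variable {K : Type*} [Field K]

/-- The terms of `ρ(f_i)`. -/
def fTerms (X : Series) (v : Kˣ) (i : ℕ) : List (Term K) :=
  match X with
  | .A => fTermsA v i
  | .B => if i = 1 then fTermsB v else fTermsGen .B v i
  | .C => if i = 1 then fTermsC v else fTermsGen .C v i
  | .D => if i = 1 then fTermsD v 1 2 else if i = 2 then fTermsD v 2 1 else fTermsGen .D v i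

/-- The terms of `ρ(e_i)`. -/
def eTerms (X : Series) (v : Kˣ) (i : ℕ) : List (Term K) :=
  match X with
  | .A => eTermsA v i
  | .B => if i = 1 then eTermsB v else eTermsGen .B v i
  | .C => if i = 1 then eTermsC v else eTermsGen .C v i
  | .D => if i = 1 then eTermsD v 1 else if i = 2 then eTermsD v 2 else eTermsGen .D v i

/-- The exponent of `ρ(t_i)`. -/
def tExp (X : Series) (i : ℕ) : ZExp :=
  match X with
  | .A => tExpA i
  | .B => if i = 1 then tExpB else tExpGen .B i
  | .C => if i = 1 then tExpC else tExpGen .C i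
  | .D => if i = 1 then tExpD 1 else if i = 2 then tExpD 2 else tExpGen .D i

/-- The nodes other than the general ones. -/
theorem not_isGeneral {X : Series} {i : ℕ} (hi : 1 ≤ i) (h : ¬ IsGeneral X i) :
    X = .A ∨ (X = .B ∧ i = 1) ∨ (X = .C ∧ i = 1) ∨ (X = .D ∧ (i = 1 ∨ i = 2)) := by
  cases X <;> simp [IsGeneral] at h ⊢ <;> omega

section IsGeneral

variable {X : Series} {i : ℕ} (h : IsGeneral X i) (v : Kˣ)
include h

theorem IsGeneral.fTerms_eq : fTerms X v i = fTermsGen X v i := by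
  cases X <;> simp only [IsGeneral] at h <;> simp only [fTerms] <;> (repeat rw [if_neg (by omega)])

theorem IsGeneral.eTerms_eq : eTerms X v i = eTermsGen X v i := by
  cases X <;> simp only [IsGeneral] at h <;> simp only [eTerms] <;> (repeat rw [if_neg (by omega)])

theorem IsGeneral.tExp_eq : tExp X i = tExpGen X i := by
  cases X <;> simp only [IsGeneral] at h <;> simp only [tExp] <;> (repeat rw [if_neg (by omega)])

end IsGeneral

variable {X : Series} {n : ℕ} {v : Kˣ} {R : Type*} [Ring R] [Algebra K R] (s : QSystem X n v R)

/-- Both Serre relations for the images of two generators of the same kind. -/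
def NodeSerre (X : Series) (v : Kˣ) (i j : ℕ) (x y : R) : Prop :=
  SerrePair ((v : K) ^ (dExp X i : ℤ)) ((v : K) ^ (dExp X j : ℤ)) (1 - cartanEntry X i j).toNat
    (1 - cartanEntry X j i).toNat x y

theorem nodeSerre_of_commute {i j : ℕ} {x y : R} (h : Commute x y) (h1 : cartanEntry X i j = 0)
    (h2 : cartanEntry X j i = 0) : NodeSerre X v i j x y := by
  rw [NodeSerre, h1, h2]
  exact serrePair_one_iff.2 h

theorem NodeSerre.of_serrePair {i j m m' : ℕ} {d d' : ℤ} {x y : R}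
    (h : SerrePair ((v : K) ^ d) ((v : K) ^ d') m m' x y) (hd : dExp X i = d)
    (hd' : dExp X j = d') (hm : (1 - cartanEntry X i j).toNat = m)
    (hm' : (1 - cartanEntry X j i).toNat = m') : NodeSerre X v i j x y := by
  rwa [NodeSerre, hd, hd', hm, hm']

theorem nodeSerre_fTerms_of_lt {i j : ℕ} (hi : 1 ≤ i) (hij : i < j)
    (hC : X = .C → (v : K) ^ 2 ≠ 1 ∧ (v : K) ^ 4 ≠ 1) :
    NodeSerre X v i j (s.evalSum (fTerms X v i)) (s.evalSum (fTerms X v j)) := by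
  by_cases hg : IsGeneral X i
  · rw [hg.fTerms_eq, (hg.mono hij.le).fTerms_eq]
    rcases Nat.eq_or_lt_of_le (Nat.succ_le_of_lt hij) with rfl | h
    · exact .of_serrePair (s.serrePair_fTermsGen_succ hg) (by rw [hg.dExp_eq])
        (by rw [(hg.mono hij.le).dExp_eq]) (by rw [hg.cartanEntry_succ]; rfl)
        (by rw [hg.cartanEntry_succ']; rfl)
    · exact nodeSerre_of_commute (s.commute_fTermsGen hg h) (hg.cartanEntry_far h)
        (hg.cartanEntry_far' h)
  rcases not_isGeneral hi hg with rfl | ⟨rfl, rfl⟩ | ⟨rfl, rfl⟩ | ⟨rfl, hi'⟩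
  · obtain ⟨k, rfl⟩ := Nat.exists_eq_add_of_le' hi
    rcases Nat.eq_or_lt_of_le (Nat.succ_le_of_lt hij) with rfl | h
    · exact .of_serrePair (s.serrePair_fTermsA_succ k) rfl rfl (by simp [cartanEntry])
        (by simp [cartanEntry])
    · exact nodeSerre_of_commute (s.commute_fTermsA hi h) (by simp [cartanEntry]; omega)
        (by simp [cartanEntry]; omega)
  · have hj : IsGeneral .B j := hij
    rw [hj.fTerms_eq]
    rcases Nat.eq_or_lt_of_le (Nat.succ_le_of_lt hij) with rfl | h
    · exact .of_serrePair s.serrePair_fTermsB rfl rfl rfl rfl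
    · exact nodeSerre_of_commute (s.commute_fTermsB h) (by simp [cartanEntry]; omega)
        (by simp [cartanEntry]; omega)
  · have hj : IsGeneral .C j := hij
    rw [hj.fTerms_eq]
    rcases Nat.eq_or_lt_of_le (Nat.succ_le_of_lt hij) with rfl | h
    · exact .of_serrePair (s.serrePair_fTermsC (hC rfl).1 (hC rfl).2) rfl rfl rfl rfl
    · exact nodeSerre_of_commute (s.commute_fTermsC h) (by simp [cartanEntry]; omega)
        (by simp [cartanEntry]; omega)
  · rcases Nat.lt_or_ge j 3 with h | h
    · obtain ⟨rfl, rfl⟩ : i = 1 ∧ j = 2 := by omega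
      exact nodeSerre_of_commute s.commute_fTermsD (by simp [cartanEntry]) (by simp [cartanEntry])
    have hj : IsGeneral .D j := h
    rw [hj.fTerms_eq]
    obtain ⟨k, hk, hf⟩ : ∃ k, (i = 1 ∧ k = 2 ∨ i = 2 ∧ k = 1) ∧ fTerms .D v i = fTermsD v i k := by
      rcases hi' with rfl | rfl
      · exact ⟨2, by simp, rfl⟩
      · exact ⟨1, by simp, rfl⟩
    rw [hf]
    rcases Nat.eq_or_lt_of_le h with rfl | h
    · exact .of_serrePair (s.serrePair_fTermsD hk) rfl rfl
        (by rcases hi' with rfl | rfl <;> simp [cartanEntry])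
        (by rcases hi' with rfl | rfl <;> simp [cartanEntry])
    · exact nodeSerre_of_commute (s.commute_fTermsD_gen hk h) (by simp [cartanEntry]; omega)
        (by simp [cartanEntry]; omega)

theorem nodeSerre_eTerms_of_lt {i j : ℕ} (hi : 1 ≤ i) (hij : i < j) (hjn : j ≤ n) :
    NodeSerre X v i j (s.evalSum (eTerms X v i)) (s.evalSum (eTerms X v j)) := by
  by_cases hg : IsGeneral X i
  · rw [hg.eTerms_eq, (hg.mono hij.le).eTerms_eq]
    rcases Nat.eq_or_lt_of_le (Nat.succ_le_of_lt hij) with rfl | h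
    · exact .of_serrePair (s.serrePair_eTermsGen_succ hg hjn) (by rw [hg.dExp_eq])
        (by rw [(hg.mono hij.le).dExp_eq]) (by rw [hg.cartanEntry_succ]; rfl)
        (by rw [hg.cartanEntry_succ']; rfl)
    · exact nodeSerre_of_commute (s.commute_eTermsGen hg h hjn) (hg.cartanEntry_far h)
        (hg.cartanEntry_far' h)
  rcases not_isGeneral hi hg with rfl | ⟨rfl, rfl⟩ | ⟨rfl, rfl⟩ | ⟨rfl, hi'⟩
  · obtain ⟨k, rfl⟩ := Nat.exists_eq_add_of_le' hi
    rcases Nat.eq_or_lt_of_le (Nat.succ_le_of_lt hij) with rfl | h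
    · exact .of_serrePair (s.serrePair_eTermsA_succ k hjn) rfl rfl (by simp [cartanEntry])
        (by simp [cartanEntry])
    · exact nodeSerre_of_commute (s.commute_eTermsA hi h hjn) (by simp [cartanEntry]; omega)
        (by simp [cartanEntry]; omega)
  · have hj : IsGeneral .B j := hij
    rw [hj.eTerms_eq]
    rcases Nat.eq_or_lt_of_le (Nat.succ_le_of_lt hij) with rfl | h
    · exact .of_serrePair (s.serrePair_eTermsB hjn) rfl rfl rfl rfl
    · exact nodeSerre_of_commute (s.commute_eTermsB h hjn) (by simp [cartanEntry]; omega)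
        (by simp [cartanEntry]; omega)
  · have hj : IsGeneral .C j := hij
    rw [hj.eTerms_eq]
    rcases Nat.eq_or_lt_of_le (Nat.succ_le_of_lt hij) with rfl | h
    · exact .of_serrePair (s.serrePair_eTermsC hjn) rfl rfl rfl rfl
    · exact nodeSerre_of_commute (s.commute_eTermsC h hjn) (by simp [cartanEntry]; omega)
        (by simp [cartanEntry]; omega)
  · rcases Nat.lt_or_ge j 3 with h | h
    · obtain ⟨rfl, rfl⟩ : i = 1 ∧ j = 2 := by omega
      exact nodeSerre_of_commute s.commute_eTermsD (by simp [cartanEntry]) (by simp [cartanEntry])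
    have hj : IsGeneral .D j := h
    rw [hj.eTerms_eq]
    obtain ⟨k, hk⟩ : ∃ k, i = 1 ∧ k = 2 ∨ i = 2 ∧ k = 1 := by
      rcases hi' with rfl | rfl
      · exact ⟨2, by simp⟩
      · exact ⟨1, by simp⟩
    have hf : eTerms .D v i = eTermsD v i := by rcases hi' with rfl | rfl <;> rfl
    rw [hf]
    rcases Nat.eq_or_lt_of_le h with rfl | h
    · exact .of_serrePair (s.serrePair_eTermsD hk hjn) rfl rfl
        (by rcases hi' with rfl | rfl <;> simp [cartanEntry])
        (by rcases hi' with rfl | rfl <;> simp [cartanEntry])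
    · exact nodeSerre_of_commute (s.commute_eTermsD_gen hk h) (by simp [cartanEntry]; omega)
        (by simp [cartanEntry]; omega)

theorem NodeSerre.symm {i j : ℕ} {x y : R} (h : NodeSerre X v i j x y) : NodeSerre X v j i y x :=
  ⟨h.2, h.1⟩

/-- The hypothesis on the parameter. -/
def Admissible (X : Series) (n : ℕ) (v : Kˣ) : Prop :=
  ∀ i, 1 ≤ i → i ≤ n → ((v : K) ^ dExp X i) ^ 2 ≠ 1

/-- The condition at the long root alone suffices, so that rank 1 is covered. -/
theorem Admissible.of_C (h : Admissible .C n v) (hn : 1 ≤ n) :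
    (v : K) ^ 2 ≠ 1 ∧ (v : K) ^ 4 ≠ 1 := by
  have h4 : (v : K) ^ 4 ≠ 1 := by
    have := h 1 le_rfl hn
    rwa [show dExp .C 1 = 2 from rfl, ← pow_mul] at this
  refine ⟨fun h2 => h4 ?_, h4⟩
  rw [show 4 = 2 * 2 from rfl, pow_mul, h2, one_pow]

theorem nodeSerre_fTerms {i j : ℕ} (hv : Admissible X n v) (hi : 1 ≤ i) (hin : i ≤ n) (hj : 1 ≤ j)
    (hij : i ≠ j) : NodeSerre X v i j (s.evalSum (fTerms X v i)) (s.evalSum (fTerms X v j)) := by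
  have hC : X = .C → (v : K) ^ 2 ≠ 1 ∧ (v : K) ^ 4 ≠ 1 := by
    rintro rfl
    exact hv.of_C (hi.trans hin)
  rcases lt_or_gt_of_ne hij with h | h
  · exact s.nodeSerre_fTerms_of_lt hi h hC
  · exact (s.nodeSerre_fTerms_of_lt hj h hC).symm

theorem nodeSerre_eTerms {i j : ℕ} (hi : 1 ≤ i) (hin : i ≤ n) (hj : 1 ≤ j) (hjn : j ≤ n)
    (hij : i ≠ j) : NodeSerre X v i j (s.evalSum (eTerms X v i)) (s.evalSum (eTerms X v j)) := by
  rcases lt_or_gt_of_ne hij with h | h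
  · exact s.nodeSerre_eTerms_of_lt hi h hjn
  · exact (s.nodeSerre_eTerms_of_lt hj h hin).symm

theorem comm_eTerms_fTerms {i j : ℕ} (hn : minRank X ≤ n) (hv : Admissible X n v) (hi : 1 ≤ i)
    (hin : i ≤ n) (hj : 1 ≤ j) (hjn : j ≤ n) :
    comm (s.evalSum (eTerms X v i)) (s.evalSum (fTerms X v j)) =
      if i = j then s.curl (curlyCoeff (v ^ dExp X i)) (tExp X i) (-tExp X i) 0 else 0 := by
  have hvi := hv i hi hin
  rw [← Units.val_pow_eq_pow_val] at hvi
  by_cases hgi : IsGeneral X i <;> by_cases hgj : IsGeneral X j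
  · rw [hgi.eTerms_eq, hgj.fTerms_eq, hgi.tExp_eq, hgi.dExp_eq]
    rw [hgi.dExp_eq] at hvi
    refine s.comm_eTermsGen_fTermsGen hgi hgj hin ?_ hvi
    cases X <;> simp [IsGeneral, numTilde, minRank] at * <;> omega
  · have hij : i ≠ j := fun h => hgj (h ▸ hgi)
    rw [if_neg hij, hgi.eTerms_eq]
    rcases not_isGeneral hj hgj with rfl | ⟨rfl, rfl⟩ | ⟨rfl, rfl⟩ | ⟨rfl, rfl | rfl⟩
    · exact hgi.elim
    · exact s.comm_eTermsGen_fTermsB hgi hin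
    · have := hv.of_C hn
      exact s.comm_eTermsGen_fTermsC hgi hin this.1 this.2
    · exact s.comm_eTermsGen_fTermsD (by simp) hgi hin
    · exact s.comm_eTermsGen_fTermsD (by simp) hgi hin
  · have hij : i ≠ j := fun h => hgi (h ▸ hgj)
    rw [if_neg hij, hgj.fTerms_eq]
    rcases not_isGeneral hi hgi with rfl | ⟨rfl, rfl⟩ | ⟨rfl, rfl⟩ | ⟨rfl, rfl | rfl⟩
    · exact hgj.elim
    · exact s.comm_eTermsB_fTermsGen hgj hn
    · exact s.comm_eTermsC_fTermsGen hgj hn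
    · exact s.comm_eTermsD_fTermsGen (j := 2) (by simp) hgj hn
    · exact s.comm_eTermsD_fTermsGen (j := 1) (by simp) hgj hn
  · rcases not_isGeneral hi hgi with rfl | ⟨rfl, rfl⟩ | ⟨rfl, rfl⟩ | ⟨rfl, hi'⟩
    · rw [show dExp .A i = 1 from rfl, pow_one]
      rw [show dExp .A i = 1 from rfl, pow_one] at hvi
      exact s.comm_eTermsA_fTermsA i j hi hj hin hjn hvi
    · obtain rfl : j = 1 := by simp [IsGeneral] at hgj; omega
      rw [show dExp .B 1 = 1 from rfl, pow_one] at *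
      exact (s.comm_eTermsB_fTermsB hn hvi).trans (if_pos rfl).symm
    · obtain rfl : j = 1 := by simp [IsGeneral] at hgj; omega
      exact (s.comm_eTermsC_fTermsC hn (hv.of_C hn).2).trans (if_pos rfl).symm
    · rw [show dExp .D i = 1 from rfl, pow_one] at *
      have hj' : j = 1 ∨ j = 2 := by simp [IsGeneral] at hgj; omega
      rcases hi' with rfl | rfl <;> rcases hj' with rfl | rfl
      · exact (s.comm_eTermsD_fTermsD_self (j := 2) (by simp) hn hvi).trans (if_pos rfl).symm
      · exact s.comm_eTermsD_fTermsD (by simp) hn hvi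
      · exact s.comm_eTermsD_fTermsD (by simp) hn hvi
      · exact (s.comm_eTermsD_fTermsD_self (j := 1) (by simp) hn hvi).trans (if_pos rfl).symm

theorem H_conj_tExp {i j : ℕ} (hn : minRank X ≤ n) (hi : 1 ≤ i) (hin : i ≤ n) (hj : 1 ≤ j)
    (hjn : j ≤ n) :
    (s.H (.ofAdd (tExp X i)) : R) * s.evalSum (eTerms X v j) * s.H (.ofAdd (-tExp X i)) =
      (v : K) ^ (dExp X i * cartanEntry X i j) • s.evalSum (eTerms X v j) ∧
    (s.H (.ofAdd (tExp X i)) : R) * s.evalSum (fTerms X v j) * s.H (.ofAdd (-tExp X i)) =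
      (v : K) ^ (-(dExp X i * cartanEntry X i j)) • s.evalSum (fTerms X v j) := by
  by_cases hgi : IsGeneral X i <;> by_cases hgj : IsGeneral X j
  · rw [hgj.eTerms_eq, hgj.fTerms_eq, hgi.tExp_eq]
    exact ⟨s.H_conj_eTermsGen hgi hgj hin, s.H_conj_fTermsGen hgi hgj hin⟩
  · rw [hgi.tExp_eq]
    rcases not_isGeneral hj hgj with rfl | ⟨rfl, rfl⟩ | ⟨rfl, rfl⟩ | ⟨rfl, rfl | rfl⟩
    · exact hgi.elim
    · exact s.H_conj_tExpGen_B hgi hin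
    · exact s.H_conj_tExpGen_C hgi hin
    · exact s.H_conj_tExpGen_D (by simp) hgi hin
    · exact s.H_conj_tExpGen_D (by simp) hgi hin
  · rw [hgj.eTerms_eq, hgj.fTerms_eq]
    rcases not_isGeneral hi hgi with rfl | ⟨rfl, rfl⟩ | ⟨rfl, rfl⟩ | ⟨rfl, rfl | rfl⟩
    · exact hgj.elim
    · exact s.H_conj_tExpB_gen hgj hn
    · exact s.H_conj_tExpC_gen hgj hn
    · exact s.H_conj_tExpD_gen hn hgj (by simp)
    · exact s.H_conj_tExpD_gen hn hgj (by simp)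
  · rcases not_isGeneral hi hgi with rfl | ⟨rfl, rfl⟩ | ⟨rfl, rfl⟩ | ⟨rfl, hi'⟩
    · exact ⟨s.H_conj_eTermsA i j hi hj hin hjn, s.H_conj_fTermsA i j hi hj hin hjn⟩
    · obtain rfl : j = 1 := by simp [IsGeneral] at hgj; omega
      exact s.H_conj_tExpB hn
    · obtain rfl : j = 1 := by simp [IsGeneral] at hgj; omega
      exact s.H_conj_tExpC hn
    · have hj' : j = 1 ∨ j = 2 := by simp [IsGeneral] at hgj; omega
      rcases hi' with rfl | rfl <;> rcases hj' with rfl | rfl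
      · exact s.H_conj_tExpD (by simp) hn (by simp)
      · exact s.H_conj_tExpD (by simp) hn (by simp)
      · exact s.H_conj_tExpD (by simp) hn (by simp)
      · exact s.H_conj_tExpD (by simp) hn (by simp)

/-- The homomorphism from the quantized enveloping algebra. -/
def lift (hn : minRank X ≤ n) (hv : Admissible X n v) : U X n (v : K) →ₐ[K] R :=
  RingQuot.liftAlgHom K (s := Rel (cartan X n) (fun i => dExp X (i + 1)) (v : K) Set.univ)
    ⟨FreeAlgebra.lift K fun y => match y with
      | .e i => s.evalSum (eTerms X v (i + 1))
      | .f i => s.evalSum (fTerms X v ((i : Fin n) + 1))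
      | .t i => s.H (.ofAdd (tExp X (i + 1)))
      | .tInv i => s.H (.ofAdd (-tExp X (i + 1))), by
    have hne {i j : Fin n} (h : i ≠ j) : (i : ℕ) + 1 ≠ (j : ℕ) + 1 := by
      simpa [Fin.ext_iff] using h
    have hneg (a : ZExp) : (s.H (.ofAdd (-a)) : R) * s.H (.ofAdd a) = 1 := by
      rw [← H_add, neg_add_cancel, ofAdd_zero, map_one, Units.val_one]
    intro y y' hy
    cases hy with
    | t_comm i j => simp only [map_mul, FreeAlgebra.lift_ι_apply, ← H_add, add_comm]
    | t_tInv i => simp only [map_mul, FreeAlgebra.lift_ι_apply, H_mul_H_neg, map_one]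
    | tInv_t i => simp only [map_mul, FreeAlgebra.lift_ι_apply, hneg, map_one]
    | t_e i j =>
      simp only [map_mul, FreeAlgebra.lift_ι_apply, map_smul]
      exact (s.H_conj_tExp hn (by omega) (by omega) (by omega) (by omega)).1
    | t_f i j =>
      simp only [map_mul, FreeAlgebra.lift_ι_apply, map_smul]
      exact (s.H_conj_tExp hn (by omega) (by omega) (by omega) (by omega)).2
    | e_f i =>
      simp only [map_mul, FreeAlgebra.lift_ι_apply, map_smul, map_sub]
      refine (s.comm_eTerms_fTerms hn hv (by omega) (by omega) (by omega) (by omega)).trans ?_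
      rw [if_pos rfl, curl, mon, mon, P_zero, mul_one, mul_one, neg_smul, ← sub_eq_add_neg,
        ← smul_sub]
      simp [curlyCoeff]
    | e_f_ne i j h =>
      simp only [map_mul, FreeAlgebra.lift_ι_apply, map_sub, map_zero]
      refine (s.comm_eTerms_fTerms hn hv (by omega) (by omega) (by omega) (by omega)).trans ?_
      exact if_neg (hne h)
    | serre_e i j h =>
      simp only [map_sum, map_smul, map_mul, map_pow, FreeAlgebra.lift_ι_apply, map_zero]
      have := (s.nodeSerre_eTerms (i := i + 1) (j := j + 1) (by omega) (by omega) (by omega)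
        (by omega) (hne h)).1
      rwa [zpow_natCast] at this
    | serre_f i j h =>
      simp only [map_sum, map_smul, map_mul, map_pow, FreeAlgebra.lift_ι_apply, map_zero]
      have := (s.nodeSerre_fTerms (i := (i : Fin n) + 1) (j := (j : Fin n) + 1) hv (by omega)
        (by omega) (by omega) (hne fun h' => h (Subtype.ext h'))).1
      rwa [zpow_natCast] at this⟩

variable (hn : minRank X ≤ n) (hv : Admissible X n v)

theorem lift_e (i : Fin n) : s.lift hn hv (QAlg.gen X n (v : K) _ (.e i)) =
    s.evalSum (eTerms X v (i + 1)) := by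
  simp only [lift, QAlg.gen, QAlg.mk]
  exact (RingQuot.liftAlgHom_mkAlgHom_apply ..).trans (FreeAlgebra.lift_ι_apply ..)

theorem lift_f (i : Fin n) : s.lift hn hv (QAlg.gen X n (v : K) _ (.f ⟨i, Set.mem_univ i⟩)) =
    s.evalSum (fTerms X v (i + 1)) := by
  simp only [lift, QAlg.gen, QAlg.mk]
  exact (RingQuot.liftAlgHom_mkAlgHom_apply ..).trans (FreeAlgebra.lift_ι_apply ..)

theorem lift_t (i : Fin n) : s.lift hn hv (QAlg.gen X n (v : K) _ (.t i)) =
    s.H (.ofAdd (tExp X (i + 1))) := by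
  simp only [lift, QAlg.gen, QAlg.mk]
  exact (RingQuot.liftAlgHom_mkAlgHom_apply ..).trans (FreeAlgebra.lift_ι_apply ..)

end QSystem
end QuantumSeries

namespace QuantumSeries
open ZExp XExp

/-! ### Monomials in commuting elements -/

section Monomials

open scoped IsMulCommutative

theorem ZExp.induction {p : ZExp → Prop} (zero : p 0) (add : ∀ a b, p a → p b → p (a + b))
    (neg : ∀ a, p a → p (-a)) (single : ∀ l, p (Finsupp.single l 1)) (a : ZExp) : p a := by
  induction a using Finsupp.induction_linear with
  | zero => exact zero
  | add f g hf hg => exact add f g hf hg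
  | single l k =>
    induction k using Int.induction_on with
    | zero => simpa using zero
    | succ k ih => rw [Finsupp.single_add]; exact add _ _ ih (single l)
    | pred k ih =>
      rw [sub_eq_add_neg, Finsupp.single_add, Finsupp.single_neg l (1 : ℤ)]
      exact add _ _ ih (neg _ (single l))

theorem XExp.induction {p : XExp → Prop} (zero : p 0) (add : ∀ a b, p a → p b → p (a + b))
    (single : ∀ l, p (Finsupp.single l 1)) (a : XExp) : p a := by
  induction a using Finsupp.induction_linear with
  | zero => exact zero
  | add f g hf hg => exact add f g hf hg
  | single l k =>
    induction k with
    | zero => simpa using zero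
    | succ k ih => rw [Finsupp.single_add]; exact add _ _ ih (single l)

/-- The monomials in commuting units. -/
def zMonomial {G : Type*} [Group G] (f : ZLabel → G) (h : ∀ a b, f a * f b = f b * f a) :
    Multiplicative ZExp →* G :=
  -- The subgroup generated by commuting elements is commutative, so the universal property of the
  -- free abelian group on the labels applies to it.
  haveI := Subgroup.isMulCommutative_closure (k := Set.range f) (by
    rintro _ ⟨a, rfl⟩ _ ⟨b, rfl⟩; exact h a b)
  (Subgroup.closure (Set.range f)).subtype.comp (AddMonoidHom.toMultiplicativeLeft
    (Finsupp.liftAddHom fun l => zmultiplesHom (Additive (Subgroup.closure (Set.range f)))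
      (.ofMul ⟨f l, Subgroup.subset_closure ⟨l, rfl⟩⟩)))

theorem zMonomial_single {G : Type*} [Group G] (f : ZLabel → G)
    (h : ∀ a b, f a * f b = f b * f a) (l : ZLabel) :
    zMonomial f h (.ofAdd (Finsupp.single l 1)) = f l := by
  simp [zMonomial]

/-- The monomials in commuting elements. -/
def xMonomial {M : Type*} [Monoid M] (f : XLabel → M) (h : ∀ a b, f a * f b = f b * f a) :
    Multiplicative XExp →* M :=
  haveI := Submonoid.isMulCommutative_closure M (s := Set.range f) (by
    rintro _ ⟨a, rfl⟩ _ ⟨b, rfl⟩; exact h a b)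
  (Submonoid.closure (Set.range f)).subtype.comp (AddMonoidHom.toMultiplicativeLeft
    (Finsupp.liftAddHom fun l => multiplesHom (Additive (Submonoid.closure (Set.range f)))
      (.ofMul ⟨f l, Submonoid.subset_closure ⟨l, rfl⟩⟩)))

theorem xMonomial_single {M : Type*} [Monoid M] (f : XLabel → M)
    (h : ∀ a b, f a * f b = f b * f a) (l : XLabel) :
    xMonomial f h (.ofAdd (Finsupp.single l 1)) = f l := by
  simp [xMonomial]

end Monomials

/-! ### Commutation up to scalars with monomials. -/

section Generic

variable {K : Type*} [Field K] {R : Type*} [Ring R] [Algebra K R]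

theorem QCommute.mul_left {c c' : K} {a a' b : R} (h : QCommute c a b) (h' : QCommute c' a' b) :
    QCommute (c * c') (a * a') b := by
  have h0 : a * b = c • (b * a) := h
  have h1 : a' * b = c' • (b * a') := h'
  rw [QCommute, mul_assoc, h1, mul_smul_comm, ← mul_assoc, h0, smul_mul_assoc, smul_smul, mul_comm c,
    mul_assoc]

theorem QCommute.mul_right {c c' : K} {a b b' : R} (h : QCommute c a b) (h' : QCommute c' a b') :
    QCommute (c * c') a (b * b') := by
  have h0 : a * b = c • (b * a) := h
  have h1 : a * b' = c' • (b' * a) := h'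
  rw [QCommute, ← mul_assoc, h0, smul_mul_assoc, mul_assoc, h1, mul_smul_comm, smul_smul, mul_assoc]

theorem QCommute.one_left (b : R) : QCommute (1 : K) 1 b := by simp [QCommute]

theorem QCommute.one_right (a : R) : QCommute (1 : K) a 1 := by simp [QCommute]

theorem qCommute_one_iff {a b : R} : QCommute (1 : K) a b ↔ Commute a b := by
  rw [QCommute, one_smul]; rfl

theorem QCommute.inv_right {c : K} (hc : c ≠ 0) {a : R} {b : Rˣ} (h : QCommute c a (b : R)) :
    QCommute c⁻¹ a ((b⁻¹ : Rˣ) : R) := by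
  have h0 : a * b = c • (b * a) := h
  rw [QCommute]
  refine b.isUnit.mul_left_cancel ?_
  rw [mul_smul_comm, ← mul_assoc (b : R) ((b⁻¹ : Rˣ) : R), Units.mul_inv, one_mul, ← mul_assoc,
    ← inv_smul_smul₀ hc ((b : R) * a), ← h0, smul_mul_assoc, mul_assoc, Units.mul_inv, mul_one]

theorem QCommute.inv_left {c : K} (hc : c ≠ 0) {a : Rˣ} {b : R} (h : QCommute c (a : R) b) :
    QCommute c⁻¹ ((a⁻¹ : Rˣ) : R) b := by
  have h1 := (h.symm hc).inv_right (inv_ne_zero hc)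
  simpa using h1.symm (by simpa using hc)

/-- Commutation with monomials in units. -/
theorem qCommute_zMonomial {f : ZLabel → Rˣ} {h : ∀ a b, f a * f b = f b * f a} {v : Kˣ} {y : R}
    {φ : ZExp →+ ℤ} (hf : ∀ l, QCommute ((v : K) ^ φ (Finsupp.single l 1)) y (f l : R)) (a : ZExp) :
    QCommute ((v : K) ^ φ a) y (zMonomial f h (.ofAdd a) : R) := by
  induction a using ZExp.induction with
  | zero => simpa using QCommute.one_right y
  | add a b ha hb =>
    rw [map_add, zpow_add₀ v.ne_zero, ofAdd_add, map_mul, Units.val_mul]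
    exact ha.mul_right hb
  | neg a ha =>
    rw [map_neg, zpow_neg, ofAdd_neg, map_inv]
    exact ha.inv_right (zpow_ne_zero _ v.ne_zero)
  | single l => rw [zMonomial_single]; exact hf l

/-- Commutation with monomials. -/
theorem qCommute_xMonomial {f : XLabel → R} {h : ∀ a b, f a * f b = f b * f a} {v : Kˣ} {y : R}
    {φ : XExp →+ ℤ} (hf : ∀ l, QCommute ((v : K) ^ φ (Finsupp.single l 1)) (f l) y) (ξ : XExp) :
    QCommute ((v : K) ^ φ ξ) (xMonomial f h (.ofAdd ξ)) y := by
  induction ξ using XExp.induction with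
  | zero => simpa using QCommute.one_left y
  | add a b ha hb =>
    rw [map_add, zpow_add₀ v.ne_zero, ofAdd_add, map_mul]
    exact ha.mul_left hb
  | single l => rw [xMonomial_single]; exact hf l

theorem commute_xMonomial {f : XLabel → R} {h : ∀ a b, f a * f b = f b * f a} {y : R}
    (hf : ∀ l, Commute (f l) y) (ξ : XExp) : Commute (xMonomial f h (.ofAdd ξ)) y := by
  induction ξ using XExp.induction with
  | zero => simp
  | add a b ha hb =>
    rw [ofAdd_add, map_mul]
    exact ha.mul_left hb
  | single l => rw [xMonomial_single]; exact hf l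

end Generic

end QuantumSeries

namespace QuantumSeries
open ZExp XExp

/-! ### The target algebra -/

section Target

variable {K : Type u} [Field K] (X : Series) (n : ℕ) (v : Kˣ)

/-- The inclusion of a Weyl algebra in the target algebra. -/
def weylIncl (k : WIdx X n) : Weyl ((v ^ qExp X : Kˣ) : K) →ₐ[K] Target X n v :=
  (Algebra.TensorProduct.includeLeft (S := K) (A := WTensor X n v) (B := UBar X n (v : K))).comp
    (PiTensorProduct.singleAlgHom (R := K)
      (A := fun _ : WIdx X n => Weyl ((v ^ qExp X : Kˣ) : K)) k)

/-- The inclusion of `Ū_q(X_{n-1})` in the target algebra. -/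
def uIncl : UBar X n (v : K) →ₐ[K] Target X n v := Algebra.TensorProduct.includeRight

theorem commute_weylIncl {k k' : WIdx X n} (h : k ≠ k') (a b : Weyl ((v ^ qExp X : Kˣ) : K)) :
    Commute (weylIncl X n v k a) (weylIncl X n v k' b) := by
  have h1 : Commute (PiTensorProduct.singleAlgHom (R := K)
      (A := fun _ : WIdx X n => Weyl ((v ^ qExp X : Kˣ) : K)) k a)
      (PiTensorProduct.singleAlgHom (R := K)
      (A := fun _ : WIdx X n => Weyl ((v ^ qExp X : Kˣ) : K)) k' b) :=
    Commute.tprod (Pi.mulSingle_commute (f := fun _ : WIdx X n => Weyl ((v ^ qExp X : Kˣ) : K)) h a b)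
  exact h1.map (Algebra.TensorProduct.includeLeft (S := K) (A := WTensor X n v)
    (B := UBar X n (v : K)))

theorem commute_weylIncl_uIncl (k : WIdx X n) (a : Weyl ((v ^ qExp X : Kˣ) : K))
    (b : UBar X n (v : K)) : Commute (weylIncl X n v k a) (uIncl X n v b) := by
  refine Eq.trans (Algebra.TensorProduct.tmul_mul_tmul _ _ _ _)
    (Eq.trans ?_ (Algebra.TensorProduct.tmul_mul_tmul _ _ _ _).symm)
  rw [mul_one, one_mul, mul_one, one_mul]

variable {X n}

theorem idx_eq_some {i : ℕ} {k : WIdx X n} (h : idx X n i = some k) :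
    ∃ j : Fin n, k = .inl j ∧ i = j + 1 := by
  rw [idx] at h
  split_ifs at h with hi
  exact ⟨_, (Option.some_injective _ h).symm, (Nat.sub_add_cancel hi.1).symm⟩

theorem idxTilde_eq_some {i : ℕ} {k : WIdx X n} (h : idxTilde X n i = some k) :
    ∃ j : Fin (numTilde X n), k = .inr j ∧ i = n - numTilde X n + j + 1 := by
  rw [idxTilde] at h
  split_ifs at h with hi
  exact ⟨_, (Option.some_injective _ h).symm, by dsimp only; omega⟩

theorem idx_inj {i j : ℕ} {k : WIdx X n} (h : idx X n i = some k) (h' : idx X n j = some k) :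
    i = j := by
  obtain ⟨a, rfl, rfl⟩ := idx_eq_some h
  obtain ⟨b, hb, rfl⟩ := idx_eq_some h'
  rw [Sum.inl_injective hb]

theorem idxTilde_inj {i j : ℕ} {k : WIdx X n} (h : idxTilde X n i = some k)
    (h' : idxTilde X n j = some k) : i = j := by
  obtain ⟨a, rfl, rfl⟩ := idxTilde_eq_some h
  obtain ⟨b, hb, rfl⟩ := idxTilde_eq_some h'
  rw [Sum.inr_injective hb]

variable (X n)

/-- The position of the Weyl algebra of an element `x_i^{±1}`, `x̃_i^{±1}`. -/
def XLabel.pos : XLabel → Option (WIdx X n)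
  | .x i => idx X n i
  | .xi i => idx X n i
  | .xt i => idxTilde X n i
  | .xti i => idxTilde X n i

/-- The sign of the exponent in `x_i^{±1}`, `x̃_i^{±1}`. -/
def XLabel.sign : XLabel → ℤ
  | .x _ => 1
  | .xi _ => -1
  | .xt _ => 1
  | .xti _ => -1

/-- The position of the Weyl algebra of an element `z_i`, `z̃_i`. -/
def ZLabel.pos : ZLabel → Option (WIdx X n)
  | .z i => idx X n i
  | .zt i => idxTilde X n i
  | .t _ => none

variable {X n}

/-- Together with the next lemma: the form on labels, which compares indices, agrees with
commutation in the tensor product, which compares positions of factors. An untilded and a tilded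
label never share a position. -/
theorem weylForm_of_pos_eq {l : XLabel} {a : ZLabel} {k : WIdx X n} (hl : l.pos X n = some k)
    (ha : a.pos X n = some k) : weylForm l a = l.sign := by
  cases l <;> cases a <;> simp only [XLabel.pos, ZLabel.pos, reduceCtorEq] at hl ha <;>
    simp only [weylForm, XLabel.sign]
  case x.z | xi.z => exact if_pos (idx_inj hl ha)
  case xt.zt | xti.zt => exact if_pos (idxTilde_inj hl ha)
  all_goals
    obtain ⟨j, h, -⟩ := idx_eq_some (by assumption)
    obtain ⟨j', h', -⟩ := idxTilde_eq_some (by assumption)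
    simp [h] at h'

theorem weylForm_of_pos_ne {l : XLabel} {a : ZLabel} {k : WIdx X n} (hl : l.pos X n = some k)
    (ha : a.pos X n ≠ some k) : weylForm l a = 0 := by
  cases l <;> cases a <;> simp only [weylForm] <;>
    exact if_neg fun h => ha (by subst h; exact hl)

variable (X n)

/-- The element `x ^ k` of the Weyl algebra. -/
def weylPow (k : ℤ) : Weyl ((v ^ qExp X : Kˣ) : K) :=
  ((Weyl.x ((v ^ qExp X : Kˣ) : K) ^ k : (Weyl ((v ^ qExp X : Kˣ) : K))ˣ) :
    Weyl ((v ^ qExp X : Kˣ) : K))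

/-- The elements `x_i^{±1}`, `x̃_i^{±1}` of the target algebra. For the series `B` the first one is
`z_1^{-1/2} x_1`. -/
def xElem (l : XLabel) : Target X n v :=
  (l.pos X n).elim 0 fun k => weylIncl X n v k (weylPow X v l.sign)

/-- The elements `z_i`, `z̃_i`, `T_i` of the target algebra. -/
def zElem (l : ZLabel) : (Target X n v)ˣ :=
  match l with
  | .t i => if h : 1 ≤ i ∧ i ≤ n then
      Units.map (uIncl X n v).toRingHom.toMonoidHom (QAlg.tUnit X n (v : K) _ ⟨i - 1, by omega⟩)
    else 1
  | l => (l.pos X n).elim 1 fun k =>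
      Units.map (weylIncl X n v k).toRingHom.toMonoidHom (Weyl.z _)

/-- The elements `E_i` of the target algebra. -/
def eElem (i : ℕ) : Target X n v :=
  if h : 1 ≤ i ∧ i ≤ n then uIncl X n v (QAlg.gen X n (v : K) _ (.e ⟨i - 1, by omega⟩)) else 0

/-- The elements `F_i` of the target algebra. -/
def fElem (i : ℕ) : Target X n v :=
  if h : 1 ≤ i ∧ i < n then
    uIncl X n v (QAlg.gen X n (v : K) _ (.f ⟨⟨i - 1, by omega⟩, by change i - 1 + 1 < n; omega⟩))
  else 0

theorem zElem_eq {l : ZLabel} (h : ∀ i, l ≠ .t i) : zElem X n v l = (l.pos X n).elim 1 fun k =>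
    Units.map (weylIncl X n v k).toRingHom.toMonoidHom (Weyl.z _) := by
  cases l with
  | t i => exact absurd rfl (h i)
  | _ => rfl

/-- Every unit `z_i`, `z̃_i`, `T_i` is `1`, or comes from a Weyl algebra, or comes from `Ū`. -/
theorem zElem_cases (l : ZLabel) : zElem X n v l = 1 ∨
    (∃ k, l.pos X n = some k ∧
      (zElem X n v l : Target X n v) = weylIncl X n v k (Weyl.z _).val) ∨
    (∃ i : Fin n, l = .t (i + 1) ∧ (zElem X n v l : Target X n v) =
      uIncl X n v (QAlg.tUnit X n (v : K) _ i).val) := by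
  by_cases h : ∃ i, l = .t i
  · obtain ⟨i, rfl⟩ := h
    by_cases hi : 1 ≤ i ∧ i ≤ n
    · refine .inr (.inr ⟨⟨i - 1, by omega⟩, ?_, ?_⟩)
      · simp only [ZLabel.t.injEq]; omega
      · rw [zElem, dif_pos hi]; rfl
    · exact .inl (by rw [zElem, dif_neg hi])
  · rw [zElem_eq _ _ _ fun i hi => h ⟨i, hi⟩]
    rcases hp : l.pos X n with - | k
    · exact .inl rfl
    · exact .inr (.inl ⟨k, rfl, rfl⟩)

theorem xElem_cases (l : XLabel) : (l.pos X n = none ∧ xElem X n v l = 0) ∨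
    ∃ k, l.pos X n = some k ∧
      xElem X n v l = weylIncl X n v k (weylPow X v l.sign) := by
  rcases hp : l.pos X n with - | k
  · exact .inl ⟨rfl, by rw [xElem, hp]; rfl⟩
  · exact .inr ⟨k, rfl, by rw [xElem, hp]; rfl⟩

theorem commute_xElem (l l' : XLabel) : Commute (xElem X n v l) (xElem X n v l') := by
  rcases xElem_cases X n v l with ⟨-, h⟩ | ⟨k, -, h⟩
  · rw [h]; exact Commute.zero_left _
  rcases xElem_cases X n v l' with ⟨-, h'⟩ | ⟨k', -, h'⟩
  · rw [h']; exact Commute.zero_right _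
  rw [h, h']
  rcases eq_or_ne k k' with rfl | hk
  · exact Commute.map (Commute.units_val (Commute.zpow_zpow_self _ _ _)) _
  · exact commute_weylIncl X n v hk _ _

theorem commute_tUnit (S : Set (Fin n)) (i j : Fin n) :
    (QAlg.tUnit X n (v : K) S i : QAlg X n (v : K) S) * QAlg.tUnit X n (v : K) S j =
      QAlg.tUnit X n (v : K) S j * QAlg.tUnit X n (v : K) S i := by
  have := QAlg.mk_rel X n (v : K) S (Rel.t_comm i j)
  simp only [map_mul] at this
  exact this

theorem commute_zElem (l l' : ZLabel) : zElem X n v l * zElem X n v l' =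
    zElem X n v l' * zElem X n v l := by
  rcases zElem_cases X n v l with h | ⟨k, hk, h⟩ | ⟨i, rfl, h⟩
  · rw [h, one_mul, mul_one]
  all_goals
    rcases zElem_cases X n v l' with h' | ⟨k', hk', h'⟩ | ⟨i', rfl, h'⟩
    · rw [h', one_mul, mul_one]
    all_goals
      refine Units.ext ?_
      rw [Units.val_mul, Units.val_mul, h, h']
  · rcases eq_or_ne k k' with rfl | hk
    · rfl
    · exact (commute_weylIncl X n v hk _ _).eq
  · exact (commute_weylIncl_uIncl X n v _ _ _).eq
  · exact (commute_weylIncl_uIncl X n v _ _ _).symm.eq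
  · rw [← map_mul, commute_tUnit, map_mul]

theorem Weyl.qCommute_x_z (q : Kˣ) (ε : ℤ) (hε : ε = 1 ∨ ε = -1) :
    QCommute ((q : K) ^ ε) ((Weyl.x (q : K) ^ ε : (Weyl (q : K))ˣ) : Weyl (q : K))
      (Weyl.z (q : K) : Weyl (q : K)) := by
  have h : QCommute (q : K) (Weyl.x (q : K) : Weyl (q : K)) (Weyl.z (q : K) : Weyl (q : K)) :=
    Weyl.x_mul_z _
  rcases hε with rfl | rfl
  · simpa using h
  · simpa using h.inv_left q.ne_zero

theorem QCommute.map {R R' : Type*} [Ring R] [Algebra K R] [Ring R'] [Algebra K R'] {c : K}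
    {a b : R} (h : QCommute c a b) (φ : R →ₐ[K] R') : QCommute c (φ a) (φ b) := by
  have h0 : a * b = c • (b * a) := h
  rw [QCommute, ← map_mul, h0, map_smul, map_mul]

theorem XLabel.sign_eq (l : XLabel) : l.sign = 1 ∨ l.sign = -1 := by cases l <;> simp [XLabel.sign]

theorem qCommute_xElem_zElem (l : XLabel) (a : ZLabel) :
    QCommute ((v : K) ^ (qExp X * weylForm l a)) (xElem X n v l) (zElem X n v a : Target X n v) := by
  rcases xElem_cases X n v l with ⟨-, h⟩ | ⟨k, hk, h⟩
  · rw [h]; exact .zero_left _ _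
  rw [h]
  by_cases ha : a.pos X n = some k
  · rw [weylForm_of_pos_eq hk ha]
    have hz : (zElem X n v a : Target X n v) = weylIncl X n v k (Weyl.z _).val := by
      rw [zElem_eq _ _ _ (by rintro i rfl; simp [ZLabel.pos] at ha), ha]; rfl
    rw [hz, zpow_mul, zpow_natCast, ← Units.val_pow_eq_pow_val]
    exact (Weyl.qCommute_x_z _ _ l.sign_eq).map _
  · rw [weylForm_of_pos_ne hk ha, mul_zero, zpow_zero, qCommute_one_iff]
    rcases zElem_cases X n v a with h' | ⟨k', hk', h'⟩ | ⟨i', rfl, h'⟩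
    · rw [h']; exact Commute.one_right _
    · rw [h']
      exact commute_weylIncl X n v (by rintro rfl; exact ha hk') _ _
    · rw [h']
      exact commute_weylIncl_uIncl X n v _ _ _

theorem commute_xElem_uIncl (l : XLabel) (b : UBar X n (v : K)) :
    Commute (xElem X n v l) (uIncl X n v b) := by
  rcases xElem_cases X n v l with ⟨-, h⟩ | ⟨k, -, h⟩
  · rw [h]; exact Commute.zero_left _
  · rw [h]; exact commute_weylIncl_uIncl X n v _ _ _

theorem eElem_mem (i : ℕ) : ∃ b, eElem X n v i = uIncl X n v b := by
  rw [eElem]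
  split_ifs
  · exact ⟨_, rfl⟩
  · exact ⟨0, (map_zero _).symm⟩

theorem fElem_mem (i : ℕ) : ∃ b, fElem X n v i = uIncl X n v b := by
  rw [fElem]
  split_ifs
  · exact ⟨_, rfl⟩
  · exact ⟨0, (map_zero _).symm⟩

end Target

end QuantumSeries

namespace QuantumSeries
open ZExp XExp

/-! ### The target algebra as a system. -/

section TargetSystem

variable {K : Type u} [Field K] (X : Series) (n : ℕ) (v : Kˣ)

theorem eElem_succ (i : Fin n) : eElem X n v (i + 1) = uIncl X n v (QAlg.gen X n (v : K) _ (.e i)) :=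
  dif_pos (by omega)

theorem eElem_eq_zero {i : ℕ} (h : ¬ (1 ≤ i ∧ i ≤ n)) : eElem X n v i = 0 := dif_neg h

theorem fElem_succ (i : {i : Fin n | (i : ℕ) + 1 < n}) :
    fElem X n v ((i : Fin n) + 1) = uIncl X n v (QAlg.gen X n (v : K) _ (.f i)) :=
  dif_pos ⟨by omega, i.2⟩

theorem fElem_eq_zero {i : ℕ} (h : ¬ (1 ≤ i ∧ i < n)) : fElem X n v i = 0 := dif_neg h

theorem zElem_t_succ (i : Fin n) : (zElem X n v (.t (i + 1)) : Target X n v) =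
    uIncl X n v (QAlg.gen X n (v : K) _ (.t i)) := by
  rw [zElem, dif_pos (by omega)]; rfl

theorem zElem_t_succ_inv (i : Fin n) : (((zElem X n v (.t (i + 1)))⁻¹ : (Target X n v)ˣ) :
    Target X n v) = uIncl X n v (QAlg.gen X n (v : K) _ (.tInv i)) := by
  rw [zElem, dif_pos (by omega)]; rfl

theorem exists_fin_of_range {i : ℕ} (h : 1 ≤ i ∧ i ≤ n) : ∃ j : Fin n, i = j + 1 :=
  ⟨⟨i - 1, by omega⟩, by dsimp only; omega⟩

theorem exists_fin_of_range' {i : ℕ} (h : 1 ≤ i ∧ i < n) :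
    ∃ j : {i : Fin n | (i : ℕ) + 1 < n}, i = (j : Fin n) + 1 :=
  ⟨⟨⟨i - 1, by omega⟩, by change i - 1 + 1 < n; omega⟩, by dsimp only; omega⟩

/-- A relation `t y t⁻¹ = c y`. -/
theorem qCommute_of_conj {R : Type*} [Ring R] [Algebra K R] {c : K} (hc : c ≠ 0) {y : R} {t : Rˣ}
    (h : (t : R) * y * ((t⁻¹ : Rˣ) : R) = c • y) : QCommute c⁻¹ y (t : R) := by
  have h1 : (t : R) * y = c • (y * t) := by
    rw [← smul_mul_assoc, ← h, mul_assoc, Units.inv_mul, mul_one]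
  rw [QCommute, h1, inv_smul_smul₀ hc]

theorem qCommute_eElem_zElem (j : ℕ) (l : ZLabel) :
    QCommute ((v : K) ^ (-weight X n j (Finsupp.single l 1))) (eElem X n v j)
      (zElem X n v l : Target X n v) := by
  obtain ⟨b, hb⟩ := eElem_mem X n v j
  cases l with
  | t i =>
    change QCommute ((v : K) ^ (-weight X n j (t i))) _ _
    rw [weight_t]
    split_ifs with hi
    · by_cases hj : 1 ≤ j ∧ j ≤ n
      · obtain ⟨i, rfl⟩ := exists_fin_of_range n hi
        obtain ⟨j, rfl⟩ := exists_fin_of_range n hj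
        rw [zpow_neg]
        refine qCommute_of_conj (zpow_ne_zero _ v.ne_zero) ?_
        rw [zElem_t_succ, zElem_t_succ_inv, eElem_succ, ← map_mul, ← map_mul, ← map_smul]
        have := QAlg.mk_rel X n (v : K) {i | (i : ℕ) + 1 < n} (Rel.t_e i j)
        simp only [map_mul, map_smul] at this
        exact congrArg _ this
      · rw [eElem_eq_zero _ _ _ hj]; exact .zero_left _ _
    · rw [zElem, dif_neg hi, neg_zero, zpow_zero]
      exact .one_right _
  | z i | zt i =>
    simp only [weight, weightHom, Finsupp.liftAddHom_apply_single, zmultiplesHom_apply, smul_zero,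
      neg_zero, zpow_zero, qCommute_one_iff]
    rw [hb]
    rcases zElem_cases X n v _ with h' | ⟨k', hk', h'⟩ | ⟨i', h'', h'⟩
    · rw [h']; exact Commute.one_right _
    · rw [h']; exact (commute_weylIncl_uIncl X n v _ _ _).symm
    · cases h''

theorem qCommute_fElem_zElem (j : ℕ) (l : ZLabel) :
    QCommute ((v : K) ^ (weight X n j (Finsupp.single l 1))) (fElem X n v j)
      (zElem X n v l : Target X n v) := by
  obtain ⟨b, hb⟩ := fElem_mem X n v j
  cases l with
  | t i =>
    change QCommute ((v : K) ^ (weight X n j (t i))) _ _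
    rw [weight_t]
    split_ifs with hi
    · by_cases hj : 1 ≤ j ∧ j < n
      · obtain ⟨i, rfl⟩ := exists_fin_of_range n hi
        obtain ⟨j, rfl⟩ := exists_fin_of_range' n hj
        rw [← neg_neg ((dExp X _ : ℤ) * _), zpow_neg]
        refine qCommute_of_conj (zpow_ne_zero _ v.ne_zero) ?_
        rw [zElem_t_succ, zElem_t_succ_inv, fElem_succ, ← map_mul, ← map_mul, ← map_smul]
        have := QAlg.mk_rel X n (v : K) {i | (i : ℕ) + 1 < n} (Rel.t_f i j)
        simp only [map_mul, map_smul] at this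
        exact congrArg _ this
      · rw [fElem_eq_zero _ _ _ hj]; exact .zero_left _ _
    · rw [zElem, dif_neg hi, zpow_zero]
      exact .one_right _
  | z i | zt i =>
    simp only [weight, weightHom, Finsupp.liftAddHom_apply_single, zmultiplesHom_apply, smul_zero,
      zpow_zero, qCommute_one_iff]
    rw [hb]
    rcases zElem_cases X n v _ with h' | ⟨k', hk', h'⟩ | ⟨i', h'', h'⟩
    · rw [h']; exact Commute.one_right _
    · rw [h']; exact (commute_weylIncl_uIncl X n v _ _ _).symm
    · cases h''

theorem commute_eElem_fElem {i j : ℕ} (h : i ≠ j) : Commute (eElem X n v i) (fElem X n v j) := by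
  by_cases hi : 1 ≤ i ∧ i ≤ n
  · by_cases hj : 1 ≤ j ∧ j < n
    · obtain ⟨i, rfl⟩ := exists_fin_of_range n hi
      obtain ⟨j, rfl⟩ := exists_fin_of_range' n hj
      rw [eElem_succ, fElem_succ]
      have := QAlg.mk_rel X n (v : K) {i | (i : ℕ) + 1 < n}
        (Rel.e_f_ne i j (by rintro rfl; exact h rfl))
      simp only [map_mul, map_sub, map_zero, sub_eq_zero] at this
      exact Commute.map (show Commute _ _ from this) _
    · rw [fElem_eq_zero _ _ _ hj]; exact Commute.zero_right _
  · rw [eElem_eq_zero _ _ _ hi]; exact Commute.zero_left _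

theorem eElem_mul_fElem_sub {i : ℕ} (h : 1 ≤ i) (h' : i < n) :
    eElem X n v i * fElem X n v i - fElem X n v i * eElem X n v i =
      ((v : K) ^ dExp X i - ((v : K) ^ dExp X i)⁻¹)⁻¹ •
        ((zElem X n v (.t i) : Target X n v) - ((zElem X n v (.t i))⁻¹ : (Target X n v)ˣ)) := by
  obtain ⟨i, rfl⟩ := exists_fin_of_range' n ⟨h, h'⟩
  rw [eElem_succ, fElem_succ, zElem_t_succ, zElem_t_succ_inv, ← map_mul, ← map_mul, ← map_sub,
    ← map_sub, ← map_smul]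
  have := QAlg.mk_rel X n (v : K) {i | (i : ℕ) + 1 < n} (Rel.e_f i)
  simp only [map_mul, map_sub, map_smul] at this
  exact congrArg _ this

/-- Needed for labels out of range as well: there the first argument of the Serre expression is 0,
and the expression vanishes because its degree in that argument is positive. -/
theorem one_sub_cartanEntry {i j : ℕ} (h : i ≠ j) : (1 - cartanEntry X i j).toNat = 1 ∨
    (1 - cartanEntry X i j).toNat = 2 ∨ (1 - cartanEntry X i j).toNat = 3 := by
  simp only [cartanEntry, if_neg h]
  cases X <;> dsimp only <;> split_ifs <;> simp

theorem serre_map {R R' : Type*} [Ring R] [Algebra K R] [Ring R'] [Algebra K R'] (φ : R →ₐ[K] R')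
    (Q : K) (m : ℕ) (x y : R) : serre Q m (φ x) (φ y) = φ (serre Q m x y) := by
  simp only [serre, map_sum, map_smul, map_mul, map_pow]

theorem serre_eElem {i j : ℕ} (h : i ≠ j) :
    serre ((v : K) ^ dExp X i) (1 - cartanEntry X i j).toNat (eElem X n v i) (eElem X n v j) = 0 := by
  by_cases hj : 1 ≤ j ∧ j ≤ n
  · by_cases hi : 1 ≤ i ∧ i ≤ n
    · obtain ⟨i, rfl⟩ := exists_fin_of_range n hi
      obtain ⟨j, rfl⟩ := exists_fin_of_range n hj
      rw [eElem_succ, eElem_succ, serre_map]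
      have := QAlg.mk_rel X n (v : K) {i | (i : ℕ) + 1 < n}
        (Rel.serre_e i j (by rintro rfl; exact h rfl))
      simp only [map_sum, map_smul, map_mul, map_pow, map_zero] at this
      exact (congrArg _ this).trans (map_zero _)
    · rw [eElem_eq_zero _ _ _ hi]
      exact serre_zero_left _ (one_sub_cartanEntry X h) (pow_ne_zero _ v.ne_zero) _
  · rw [eElem_eq_zero _ _ _ hj]; exact serre_zero_right _ _ _

theorem serre_fElem {i j : ℕ} (h : i ≠ j) :
    serre ((v : K) ^ dExp X i) (1 - cartanEntry X i j).toNat (fElem X n v i) (fElem X n v j) = 0 := by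
  by_cases hj : 1 ≤ j ∧ j < n
  · by_cases hi : 1 ≤ i ∧ i < n
    · obtain ⟨i, rfl⟩ := exists_fin_of_range' n hi
      obtain ⟨j, rfl⟩ := exists_fin_of_range' n hj
      rw [fElem_succ, fElem_succ, serre_map]
      have := QAlg.mk_rel X n (v : K) {i | (i : ℕ) + 1 < n}
        (Rel.serre_f i j (by rintro rfl; exact h rfl))
      simp only [map_sum, map_smul, map_mul, map_pow, map_zero] at this
      exact (congrArg _ this).trans (map_zero _)
    · rw [fElem_eq_zero _ _ _ hi]
      exact serre_zero_left _ (one_sub_cartanEntry X h) (pow_ne_zero _ v.ne_zero) _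
  · rw [fElem_eq_zero _ _ _ hj]; exact serre_zero_right _ _ _

theorem xElem_mul_xElem {l l' : XLabel} {k : WIdx X n} (h : l.pos X n = some k)
    (h' : l'.pos X n = some k) (hs : l.sign + l'.sign = 0) :
    xElem X n v l * xElem X n v l' = 1 := by
  rw [xElem, xElem, h, h', Option.elim_some, Option.elim_some, ← map_mul, weylPow, weylPow,
    ← Units.val_mul, ← zpow_add, hs, zpow_zero, Units.val_one, map_one]

/-- The elements of the target algebra. -/
def targetSystem : QSystem X n v (Target X n v) where
  H := zMonomial (zElem X n v) (commute_zElem X n v)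
  P := xMonomial (xElem X n v) fun l l' => (commute_xElem X n v l l').eq
  E := eElem X n v
  F := fElem X n v
  -- The exponent is additive in ξ and in a, so two inductions reduce the rule to the generators.
  P_H ξ a := qCommute_xMonomial (φ := (pairingHom (qExp X)).flip a) (fun l =>
    qCommute_zMonomial (φ := pairingHom (qExp X) (Finsupp.single l 1)) (fun l' => by
      have := pairing_single (qExp X) l l'
      rw [pairing] at this
      rw [this]
      exact qCommute_xElem_zElem X n v l l') a) ξ
  E_H j a := qCommute_zMonomial (φ := -weightHom X n j) (fun l => qCommute_eElem_zElem X n v j l) a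
  F_H j a := qCommute_zMonomial (φ := weightHom X n j) (fun l => qCommute_fElem_zElem X n v j l) a
  P_E ξ j := commute_xMonomial (fun l => by
    obtain ⟨b, hb⟩ := eElem_mem X n v j
    rw [hb]; exact commute_xElem_uIncl X n v l b) ξ
  P_F ξ j := commute_xMonomial (fun l => by
    obtain ⟨b, hb⟩ := fElem_mem X n v j
    rw [hb]; exact commute_xElem_uIncl X n v l b) ξ
  E_F_of_ne _ _ h := commute_eElem_fElem X n v h
  E_F i h h' := by
    rw [eElem_mul_fElem_sub X n v h h', ofAdd_neg, map_inv, t, zMonomial_single]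
  F_eq_zero _ h := fElem_eq_zero X n v (by omega)
  serre_E _ _ h := serre_eElem X n v h
  serre_F _ _ h := serre_fElem X n v h
  P_xi_eq_zero i h := by
    rw [xi, xMonomial_single, xElem, XLabel.pos, idx, dif_neg (by omega)]; rfl
  x_xi i h h' := by
    rw [ofAdd_add, map_mul, x, xi, xMonomial_single, xMonomial_single]
    exact xElem_mul_xElem X n v (k := .inl ⟨i - 1, by omega⟩) (dif_pos ⟨h, h'⟩)
      (dif_pos ⟨h, h'⟩) rfl
  xt_xti i h h' := by
    rw [ofAdd_add, map_mul, xt, xti, xMonomial_single, xMonomial_single]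
    exact xElem_mul_xElem X n v (k := .inr ⟨i - (n - numTilde X n) - 1, by omega⟩)
      (dif_pos ⟨h, h'⟩) (dif_pos ⟨h, h'⟩) rfl

end TargetSystem

end QuantumSeries

namespace QuantumSeries
open ZExp XExp

namespace QSystem

/-! ### Transport of systems along homomorphisms. -/

section Map

variable {K : Type*} [Field K] {X : Series} {n : ℕ} {v : Kˣ} {R R' : Type*} [Ring R] [Algebra K R]
  [Ring R'] [Algebra K R'] (s : QSystem X n v R) (φ : R →ₐ[K] R')

/-- The image of a system of elements under a homomorphism. -/
def map : QSystem X n v R' where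
  H := (Units.map (φ : R →* R')).comp s.H
  P := (φ : R →* R').comp s.P
  E i := φ (s.E i)
  F i := φ (s.F i)
  P_H ξ a := (s.P_H ξ a).map φ
  E_H j a := (s.E_H j a).map φ
  F_H j a := (s.F_H j a).map φ
  P_E ξ j := (s.P_E ξ j).map φ
  P_F ξ j := (s.P_F ξ j).map φ
  E_F_of_ne i j h := (s.E_F_of_ne i j h).map φ
  E_F i h h' := by
    have := congrArg φ (s.E_F i h h')
    rwa [map_sub, map_mul, map_mul, map_smul, map_sub] at this
  F_eq_zero i h := by rw [s.F_eq_zero i h, map_zero]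
  serre_E i j h := by rw [serre_map, s.serre_E i j h, map_zero]
  serre_F i j h := by rw [serre_map, s.serre_F i j h, map_zero]
  P_xi_eq_zero i h := (congrArg φ (s.P_xi_eq_zero i h)).trans (map_zero φ)
  x_xi i h h' := (congrArg φ (s.x_xi i h h')).trans (map_one φ)
  xt_xti i h h' := (congrArg φ (s.xt_xti i h h')).trans (map_one φ)

theorem map_H (a : Multiplicative ZExp) : ((s.map φ).H a : R') = φ (s.H a) := rfl

theorem map_P (ξ : Multiplicative XExp) : (s.map φ).P ξ = φ (s.P ξ) := rfl

theorem map_F (i : ℕ) : (s.map φ).F i = φ (s.F i) := rfl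

theorem evalSum_map (l : List (Term K)) : (s.map φ).evalSum l = φ (s.evalSum l) := by
  induction l with
  | nil => exact (map_zero φ).symm
  | cons t l ih =>
    rw [evalSum_cons, evalSum_cons, map_add, ih]
    congr 1
    cases t with
    | mon c a ξ => simp only [eval, mon, map_H, map_P, map_smul, map_mul]
    | E i => rfl
    | F ξ i => simp only [eval, monF, map_P, map_F, map_mul]

end Map

/-! ### Comparison of the terms with the formulas. -/

section Symbols

variable {K : Type u} [Field K] {X : Series} {n : ℕ} {v : Kˣ} {R : Type u} [Ring R] [Algebra K R]

/-- The elements of a system are those of the formulas. For the series `B`, the place of `x_1` is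
taken by `z_1^{-1/2} x_1`. -/
structure Realizes (s : QSystem X n v R) (y : Symbols R) : Prop where
  z (i : ℕ) : y.z i = s.H (.ofAdd (z i))
  zt (i : ℕ) : y.zt i = s.H (.ofAdd (zt i))
  T (i : ℕ) : y.T i = s.H (.ofAdd (t i))
  E (i : ℕ) : y.E i = s.E i
  F (i : ℕ) : y.F i = s.F i
  x (i : ℕ) (h : X = .B → i ≠ 1) : y.x i = s.P (.ofAdd (x i))
  xi (i : ℕ) (h : X = .B → i ≠ 1) : y.xi i = s.P (.ofAdd (xi i))
  xt (i : ℕ) : y.xt i = s.P (.ofAdd (xt i))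
  xti (i : ℕ) : y.xti i = s.P (.ofAdd (xti i))
  zt_one (h : X = .B) : s.H (.ofAdd (ZExp.zt 1)) = 1
  zh_pow (h : X = .B) : y.zh * y.zh = s.H (.ofAdd (ZExp.z 1))
  x_one (h : X = .B) : y.x 1 = y.zh * s.P (.ofAdd (XExp.x 1))
  xi_one (h : X = .B) : y.xi 1 = s.P (.ofAdd (XExp.xi 1)) * ((y.zh⁻¹ : Rˣ) : R)
  xi_one_zh (h : X = .B) : QCommute ((v : K)⁻¹) (s.P (.ofAdd (XExp.xi 1))) (y.zh : R)
  zh_comm (h : X = .B) (a : ZExp) : y.zh * s.H (.ofAdd a) = s.H (.ofAdd a) * y.zh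
  zh_comm_xi (h : X = .B) : Commute (y.zh : R) (s.P (.ofAdd (XExp.xi 2)))

variable {s : QSystem X n v R} {y : Symbols R}

theorem curl_eq (c : K) (a b : ZExp) (ξ : XExp) :
    s.curl c a b ξ = c • (((s.H (.ofAdd a) : R) - s.H (.ofAdd b)) * s.P (.ofAdd ξ)) := by
  rw [curl, mon, mon, neg_smul, ← sub_eq_add_neg, ← smul_sub, sub_mul]

theorem curl_eq_curly (Q : Kˣ) {a b : ZExp} (h : b = -a) {g : Rˣ} (hg : s.H (.ofAdd a) = g)
    {ξ : XExp} {p : R} (hp : s.P (.ofAdd ξ) = p) :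
    s.curl (curlyCoeff Q) a b ξ = curly Q g * p := by
  rw [curl_eq, h, ofAdd_neg, map_inv, hg, hp, curly, smul_mul_assoc, curlyCoeff]

theorem monF_eq {ξ : XExp} {p f : R} (i : ℕ) (hp : s.P (.ofAdd ξ) = p) (hf : s.F i = f) :
    s.monF ξ i = p * f := by rw [monF, hp, hf]

namespace Realizes

variable (h : Realizes s y)
include h

/-- With s = z_1^{1/2} and A the monomial of a, the reason is (A⁻¹s - A s⁻¹)s = A⁻¹z_1 - A. One
factor s is absorbed by passing from y_1 = s⁻¹x_1 to x_1, which is why the bracket on the left is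
not symmetric. -/
theorem curl_half (hX : X = .B) {ξ : XExp} {w : R} (hw : w = y.zh * s.P (.ofAdd ξ)) (a : ZExp) :
    s.curl (curlyCoeff v) (ZExp.z 1 - a) a ξ = curly v ((s.H (.ofAdd a))⁻¹ * y.zh) * w := by
  have hz := h.zh_pow hX
  have hc : Commute y.zh (s.H (.ofAdd a)) := h.zh_comm hX a
  have e1 : s.H (.ofAdd (ZExp.z 1 - a)) = (s.H (.ofAdd a))⁻¹ * y.zh * y.zh := by
    rw [mul_assoc, hz, sub_eq_neg_add, ofAdd_add, ofAdd_neg, map_mul, map_inv]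
  have e2 : ((s.H (.ofAdd a))⁻¹ * y.zh)⁻¹ * y.zh = s.H (.ofAdd a) := by
    rw [mul_inv_rev, inv_inv, mul_assoc, ← hc.eq, inv_mul_cancel_left]
  rw [curl_eq, curly, hw, ← mul_assoc, smul_mul_assoc, smul_mul_assoc,
    sub_mul _ _ (y.zh : R), ← Units.val_mul, ← Units.val_mul, e1, e2, curlyCoeff]

theorem curl_half_inv (hX : X = .B) {ξ : XExp} {w : R} (hw : w = y.zh * s.P (.ofAdd ξ)) (a : ZExp) :
    s.curl (curlyCoeff v) a (ZExp.z 1 - a) ξ = curly v (s.H (.ofAdd a) * y.zh⁻¹) * w := by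
  have hc : Commute y.zh (s.H (.ofAdd a)) := h.zh_comm hX a
  have e : curly v (s.H (.ofAdd a) * y.zh⁻¹) = -curly v ((s.H (.ofAdd a))⁻¹ * y.zh) := by
    rw [curly, curly, ← smul_neg, neg_sub, mul_inv_rev, mul_inv_rev, inv_inv, inv_inv,
      hc.inv_left.eq, hc.inv_right.eq]
  rw [e, neg_mul, ← h.curl_half hX hw, curl_eq, curl_eq, ← smul_neg, ← neg_mul, neg_sub]

/-- In x_1⁻¹ = y_1⁻¹ z_1^{-1/2} the root has to be moved to the left of y_1⁻¹. This produces the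
factor v in the coefficient of e_1. -/
theorem curl_half_xi (hX : X = .B) (a : ZExp) :
    s.curl (v * curlyCoeff v) a (-a - ZExp.z 1) (XExp.xi 1) =
      curly v (y.zh * s.H (.ofAdd a)) * y.xi 1 := by
  have hz := h.zh_pow hX
  have hc : Commute y.zh (s.H (.ofAdd a)) := h.zh_comm hX a
  have e : y.xi 1 = (v : K) • (((y.zh⁻¹ : Rˣ) : R) * s.P (.ofAdd (XExp.xi 1))) := by
    have h1 : s.P (.ofAdd (XExp.xi 1)) * (y.zh : R) =
      (v : K)⁻¹ • ((y.zh : R) * s.P (.ofAdd (XExp.xi 1))) := h.xi_one_zh hX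
    rw [h.xi_one hX]
    refine (Units.mul_inv_eq_iff_eq_mul y.zh).2 ?_
    rw [smul_mul_assoc, mul_assoc, h1, mul_smul_comm, smul_smul, mul_inv_cancel₀ v.ne_zero,
      one_smul, Units.inv_mul_cancel_left]
  have e1 : y.zh * s.H (.ofAdd a) * y.zh⁻¹ = s.H (.ofAdd a) := by rw [hc.eq, mul_inv_cancel_right]
  have e2 : (y.zh * s.H (.ofAdd a))⁻¹ * y.zh⁻¹ = s.H (.ofAdd (-a - ZExp.z 1)) := by
    rw [mul_inv_rev, mul_assoc, ← mul_inv_rev, hz, sub_eq_add_neg, ofAdd_add, map_mul, ofAdd_neg,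
      ofAdd_neg, map_inv, map_inv]
  rw [curl_eq, curly, e, mul_smul_comm, smul_mul_assoc, ← mul_assoc,
    sub_mul _ _ ((y.zh⁻¹ : Rˣ) : R), ← Units.val_mul, ← Units.val_mul, e1, e2, curlyCoeff, smul_smul]

theorem evalSum_fTerms (i : ℕ) (hi : 1 ≤ i) :
    s.evalSum (fTerms X v i) = fFormula X v y i := by
  by_cases hg : IsGeneral X i
  · have h2 := hg.two_le
    have hx : y.x i = s.P (.ofAdd (XExp.x i)) := h.x i fun _ => by omega
    have hxi : y.xi (i + 1) = s.P (.ofAdd (XExp.xi (i + 1))) := h.xi _ fun _ => by omega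
    have key : s.evalSum (fTermsGen X v i) =
        curly (v ^ qExp X) (y.z (i + 1) * (y.z i)⁻¹) * y.x i
          + curly (v ^ qExp X) (y.zt i * (y.zt (i + 1))⁻¹) * (y.xi (i + 1) * y.x i * y.xt (i + 1))
          + y.xi (i + 1) * y.x i * y.xt (i + 1) * y.xti i * y.F i := by
      rw [evalSum_fTermsGen, add_comm]
      simp only [hx, hxi, h.xt, h.xti, h.z, h.zt, h.F]
      congr 1
      · congr 1
        · exact curl_eq_curly _ (by abel) (by simp [sub_eq_add_neg]) rfl
        · exact curl_eq_curly _ (by abel) (by simp [sub_eq_add_neg]) (by simp)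
      · exact monF_eq _ (by simp) rfl
    rw [hg.fTerms_eq, key]
    cases X with
    | A => exact hg.elim
    | B | C => exact (if_neg (by omega)).symm
    | D =>
      have h3 : 3 ≤ i := hg
      exact ((if_neg (by omega)).trans (if_neg (by omega))).symm
  rcases not_isGeneral hi hg with rfl | ⟨rfl, rfl⟩ | ⟨rfl, rfl⟩ | ⟨rfl, rfl | rfl⟩
  · have hx := fun i => h.x i (by simp)
    have hxi := fun i => h.xi i (by simp)
    refine (s.evalSum_fTermsA i).trans ?_
    rw [add_comm]
    simp only [fFormula, hx, hxi, h.z, h.F, qExp, pow_one]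
    congr 1
    · exact curl_eq_curly _ (by abel) (by simp [sub_eq_add_neg]) rfl
    · exact monF_eq _ (by simp) rfl
  · have hxi : y.xi 2 = s.P (.ofAdd (XExp.xi 2)) := h.xi _ (by simp)
    refine (s.evalSum_fTermsB).trans ?_
    rw [add_comm]
    simp only [fFormula, hxi, h.xt, h.z, h.zt, h.F, if_true]
    congr 1
    · congr 1
      · exact h.curl_half_inv rfl (h.x_one rfl) _
      · refine h.curl_half rfl ?_ _
        rw [h.x_one rfl, ofAdd_add, ofAdd_add, map_mul, map_mul, ← mul_assoc, ← mul_assoc,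
          ← mul_assoc, ← (h.zh_comm_xi rfl).eq]
    · exact monF_eq _ (by simp) rfl
  · have hx := fun i => h.x i (by simp)
    have hxi := fun i => h.xi i (by simp)
    refine s.evalSum_fTermsC.trans ?_
    simp only [fFormula, hx, hxi, h.xt, h.z, h.zt, h.F, if_true, qExp, pow_one]
    rw [add_comm, ← add_assoc]
    congr 1
    · congr 1
      · congr 1
        · exact curl_eq_curly _ (by abel) (by simp [sub_eq_add_neg]) (by simp)
        · exact curl_eq_curly _ (by abel) (by simp [sub_eq_add_neg]) (by simp)
      · exact curl_eq_curly _ (by abel) (by simp [sub_eq_add_neg]) rfl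
    · exact monF_eq _ (by simp) rfl
  all_goals
    have hx := fun i => h.x i (by simp)
    have hxi := fun i => h.xi i (by simp)
    refine (s.evalSum_fTermsD _ _).trans ?_
    rw [add_comm]
    simp only [fFormula, hx, hxi, h.xt, h.z, h.zt, h.F, if_true, qExp, pow_one, OfNat.ofNat_ne_one,
      if_false]
    congr 1
    · congr 1
      · exact curl_eq_curly _ (by abel) (by simp [sub_eq_add_neg]) rfl
      · exact curl_eq_curly _ (by abel) (by simp [sub_eq_add_neg]) (by simp)
    · exact monF_eq _ (by simp) rfl

theorem lower_eq {i : ℕ} (hg : IsGeneral X i) :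
    lower X y i = s.H (.ofAdd (lowerExp X i)) := by
  cases X with
  | A => exact hg.elim
  | B =>
    simp only [lower, lowerExp, h.z, h.zt]
    split_ifs with hi
    · subst hi; simp [h.zt_one rfl]
    · simp [sub_eq_add_neg]
  | C | D =>
    simp only [lower, lowerExp, h.z, h.zt]
    split_ifs with hi <;> simp [sub_eq_add_neg]

theorem evalSum_eTerms (i : ℕ) (hi : 1 ≤ i) :
    s.evalSum (eTerms X v i) = eFormula X v y i := by
  by_cases hg : IsGeneral X i
  · have h2 := hg.two_le
    have hxi : y.xi i = s.P (.ofAdd (XExp.xi i)) := h.xi _ fun _ => by omega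
    have key : s.evalSum (eTermsGen X v i) =
        curly (v ^ qExp X) (y.z i * lower X y i * y.zt i ^ 2 * (y.zt (i + 1))⁻¹ * y.T i) * y.xi i
          + curly (v ^ qExp X) (y.zt i * (y.zt (i + 1))⁻¹ * y.T i) * y.xti i + y.E i := by
      rw [evalSum_eTermsGen, add_comm]
      simp only [hxi, h.xti, h.z, h.zt, h.T, h.E, h.lower_eq hg]
      congr 1
      congr 1
      · exact curl_eq_curly _ rfl (by simp [eExp, sub_eq_add_neg]) rfl
      · exact curl_eq_curly _ (by abel) (by simp [sub_eq_add_neg]) rfl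
    rw [hg.eTerms_eq, key]
    cases X with
    | A => exact hg.elim
    | B | C => exact (if_neg (by omega)).symm
    | D =>
      have h3 : 3 ≤ i := hg
      exact (if_neg (by omega)).symm
  rcases not_isGeneral hi hg with rfl | ⟨rfl, rfl⟩ | ⟨rfl, rfl⟩ | ⟨rfl, rfl | rfl⟩
  · refine (s.evalSum_eTermsA i).trans ?_
    rw [add_comm]
    simp only [eFormula, h.xi i (by simp), h.z, h.T, h.E, qExp, pow_one]
    congr 1
    exact curl_eq_curly _ (by abel) (by simp [sub_eq_add_neg]) rfl
  · refine s.evalSum_eTermsB.trans ?_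
    rw [add_comm]
    simp only [eFormula, h.zt, h.T, h.E, if_true]
    congr 1
    convert h.curl_half_xi rfl (t 1 - ZExp.zt 2) using 2
    · abel
    · rw [sub_eq_neg_add, ofAdd_add, map_mul, ofAdd_neg, map_inv, mul_assoc]
  · refine s.evalSum_eTermsC.trans ?_
    rw [add_comm]
    simp only [eFormula, h.xi _ (by simp), h.z, h.zt, h.T, h.E, qExp, pow_one, if_true]
    congr 1
    exact curl_eq_curly _ (by abel) (by simp [sub_eq_add_neg]) rfl
  all_goals
    refine (s.evalSum_eTermsD _).trans ?_
    rw [add_comm]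
    simp only [eFormula, h.xi _ (by simp), h.z, h.zt, h.T, h.E, qExp, pow_one, true_or, or_true,
      if_true]
    congr 1
    exact curl_eq_curly _ (by abel) (by simp [sub_eq_add_neg]) rfl

theorem H_tExp (i : ℕ) (hi : 1 ≤ i) : s.H (.ofAdd (tExp X i)) = tFormula X y i := by
  by_cases hg : IsGeneral X i
  · have h2 := hg.two_le
    have key : s.H (.ofAdd (tExpGen X i)) =
        (y.z (i + 1))⁻¹ * y.z i ^ 2 * lower X y i * y.zt i ^ 2 * (y.zt (i + 1))⁻¹ * y.T i := by
      simp only [h.z, h.zt, h.T, h.lower_eq hg, ← map_mul, ← map_inv, ← map_pow, ← ofAdd_neg,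
        ← ofAdd_add, ← ofAdd_nsmul]
      congr 2
      rw [tExpGen, eExp]
      abel
    rw [hg.tExp_eq, key]
    cases X with
    | A => exact hg.elim
    | B | C => exact (if_neg (by omega)).symm
    | D =>
      have h3 : 3 ≤ i := hg
      exact (if_neg (by omega)).symm
  rcases not_isGeneral hi hg with rfl | ⟨rfl, rfl⟩ | ⟨rfl, rfl⟩ | ⟨rfl, rfl | rfl⟩
  all_goals
    simp only [tExp, tFormula, h.z, h.zt, h.T, ← map_mul, ← map_inv, ← map_pow, ← ofAdd_neg,
        ← ofAdd_add, ← ofAdd_nsmul, if_true, true_or, or_true, OfNat.ofNat_ne_one, if_false]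
    congr 2
    simp only [tExpA, tExpB, tExpC, tExpD]
    abel

end Realizes

end Symbols

end QSystem

end QuantumSeries

namespace QuantumSeries
open ZExp XExp

/-! ### Adjoining the square root of z_1. -/

section ToRoot

variable {K : Type u} [Field K] (X : Series) (n : ℕ) (v : Kˣ)

/-- The homomorphism of Weyl algebras that adjoins a root of `z_1` for the series `B`. -/
def weylRoot (k : WIdx X n) :
    Weyl ((v ^ qExp X : Kˣ) : K) →ₐ[K] Weyl ((rootParam X n v k : Kˣ) : K) :=
  Weyl.adjoinRoot ((rootParam X n v k : Kˣ) : K) ((v ^ qExp X : Kˣ) : K)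
    (rootDeg X n k) (by rw [← rootParam_pow X n v k, Units.val_pow_eq_pow_val])

/-- The inclusion of a factor of the tensor product of the Weyl algebras. -/
def weylSingle (k : WIdx X n) : Weyl ((v ^ qExp X : Kˣ) : K) →ₐ[K] WTensor X n v :=
  PiTensorProduct.singleAlgHom (R := K)
    (A := fun _ : WIdx X n => Weyl ((v ^ qExp X : Kˣ) : K)) k

theorem piTensorMap_tprod {ι : Type} {A B : ι → Type u} [∀ i, Ring (A i)] [∀ i, Algebra K (A i)]
    [∀ i, Ring (B i)] [∀ i, Algebra K (B i)] (φ : ∀ i, A i →ₐ[K] B i) (a : ∀ i, A i) :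
    piTensorMap φ (PiTensorProduct.tprod K a) = PiTensorProduct.tprod K fun i => φ i (a i) :=
  PiTensorProduct.lift.tprod _

theorem piTensorMap_single {ι : Type} [DecidableEq ι] {A B : ι → Type u} [∀ i, Ring (A i)]
    [∀ i, Algebra K (A i)] [∀ i, Ring (B i)] [∀ i, Algebra K (B i)] (φ : ∀ i, A i →ₐ[K] B i)
    (k : ι) (a : A k) : piTensorMap φ (PiTensorProduct.singleAlgHom (R := K) k a) =
      PiTensorProduct.singleAlgHom (R := K) k (φ k a) :=
  (piTensorMap_tprod φ _).trans (congrArg (PiTensorProduct.tprod K) (funext fun i =>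
    Pi.apply_mulSingle (fun i => φ i) (fun i => map_one (φ i)) k a i))

theorem weylToRoot_single (k : WIdx X n) (a : Weyl ((v ^ qExp X : Kˣ) : K)) :
    weylToRoot X n v (weylSingle X n v k a) = singleW X n v k (weylRoot X n v k a) :=
  piTensorMap_single (B := fun k => Weyl ((rootParam X n v k : Kˣ) : K))
    (fun k => weylRoot X n v k) k a

theorem toRoot_weylIncl (k : WIdx X n) (a : Weyl ((v ^ qExp X : Kˣ) : K)) :
    toRoot X n v (weylIncl X n v k a) = inclW X n v k (weylRoot X n v k a) :=
  (Algebra.TensorProduct.map_tmul _ _ _ _).trans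
    (congrArg₂ (· ⊗ₜ[K] ·) (weylToRoot_single X n v k a) (map_one (AlgHom.id K _)))

theorem toRoot_uIncl (b : UBar X n (v : K)) : toRoot X n v (uIncl X n v b) = inclU X n v b := by
  refine (Algebra.TensorProduct.map_tmul _ _ _ _).trans ?_
  rw [map_one]
  rfl

theorem Weyl.lift_x {q : K} {R : Type*} [Ring R] [Algebra K R] (a b : Rˣ)
    (h : (a : R) * (b : R) = q • ((b : R) * (a : R))) : Weyl.lift q a b h (Weyl.x q) = a := by
  exact (RingQuot.liftAlgHom_mkAlgHom_apply ..).trans (FreeAlgebra.lift_ι_apply ..)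

theorem Weyl.lift_x_inv {q : K} {R : Type*} [Ring R] [Algebra K R] (a b : Rˣ)
    (h : (a : R) * (b : R) = q • ((b : R) * (a : R))) :
    Weyl.lift q a b h ((Weyl.x q)⁻¹ : (Weyl q)ˣ) = (a⁻¹ : Rˣ) := by
  exact (RingQuot.liftAlgHom_mkAlgHom_apply ..).trans (FreeAlgebra.lift_ι_apply ..)

theorem Weyl.lift_z {q : K} {R : Type*} [Ring R] [Algebra K R] (a b : Rˣ)
    (h : (a : R) * (b : R) = q • ((b : R) * (a : R))) : Weyl.lift q a b h (Weyl.z q) = b := by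
  exact (RingQuot.liftAlgHom_mkAlgHom_apply ..).trans (FreeAlgebra.lift_ι_apply ..)

/-- The generator `z_1^{1/2}` appears only in this factor. -/
theorem rootDeg_ne_one {k : WIdx X n} (h : rootDeg X n k ≠ 1) :
    X = .B ∧ idx X n 1 = some k ∧ rootDeg X n k = 2 := by
  rcases k with k | k
  · cases X <;> simp only [rootDeg, ne_eq, not_true] at h
    by_cases hk : (k : ℕ) = 0
    · refine ⟨rfl, ?_, if_pos hk⟩
      rw [idx, dif_pos (by omega)]
      congr 2
      exact Fin.ext hk.symm
    · exact absurd (if_neg hk) h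
  · exact absurd rfl h

theorem weylRoot_z (k : WIdx X n) : weylRoot X n v k (Weyl.z _).val =
    ((Weyl.z _ ^ rootDeg X n k : (Weyl ((rootParam X n v k : Kˣ) : K))ˣ) : Weyl _) := by
  rw [weylRoot, Weyl.adjoinRoot, Weyl.lift_z, Units.val_pow_eq_pow_val]

theorem weylRoot_weylPow (k : WIdx X n) (ε : ℤ) (hε : ε = 1 ∨ ε = -1) :
    weylRoot X n v k (weylPow X v ε) =
      (((Weyl.z _ ^ (1 - rootDeg X n k : ℤ) * Weyl.x _) ^ ε :
        (Weyl ((rootParam X n v k : Kˣ) : K))ˣ) : Weyl _) := by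
  rw [weylPow, weylRoot, Weyl.adjoinRoot]
  rcases hε with rfl | rfl
  · rw [zpow_one, zpow_one, Weyl.lift_x]
  · rw [zpow_neg_one, zpow_neg_one, Weyl.lift_x_inv]

theorem toRoot_weylPow (k : WIdx X n) (ε : ℤ) (hε : ε = 1 ∨ ε = -1) :
    toRoot X n v (weylIncl X n v k (weylPow X v ε)) =
      (((zAt X n v k ^ (1 - rootDeg X n k : ℤ) * xAt X n v k) ^ ε : (TargetRoot X n v)ˣ) :
        TargetRoot X n v) := by
  rw [toRoot_weylIncl, weylRoot_weylPow _ _ _ _ _ hε]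
  simp only [zAt, xAt, ← map_zpow, ← map_mul]
  rfl

theorem toRoot_weylPow_of_rootDeg {k : WIdx X n} (hk : rootDeg X n k = 1) (ε : ℤ)
    (hε : ε = 1 ∨ ε = -1) :
    toRoot X n v (weylIncl X n v k (weylPow X v ε)) =
      ((xAt X n v k ^ ε : (TargetRoot X n v)ˣ) : TargetRoot X n v) := by
  rw [toRoot_weylPow _ _ _ _ _ hε, hk, Nat.cast_one, sub_self, zpow_zero, one_mul]

theorem rootDeg_idx {i : ℕ} {k : WIdx X n} (h : idx X n i = some k) (hi : X = .B → i ≠ 1) :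
    rootDeg X n k = 1 := by
  by_contra hk
  obtain ⟨hX, h1, -⟩ := rootDeg_ne_one X n hk
  exact hi hX (idx_inj h h1)

theorem rootDeg_idx_one (hX : X = .B) {k : WIdx X n} (h : idx X n 1 = some k) :
    rootDeg X n k = 2 := by
  subst hX
  obtain ⟨j, rfl, hj⟩ := idx_eq_some h
  exact if_pos (by omega)

theorem rootDeg_idxTilde {i : ℕ} {k : WIdx X n} (h : idxTilde X n i = some k) :
    rootDeg X n k = 1 := by
  obtain ⟨j, rfl, -⟩ := idxTilde_eq_some h
  rfl

theorem commute_inclW {k k' : WIdx X n} (h : k ≠ k') (a b) :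
    Commute (inclW X n v k a) (inclW X n v k' b) := by
  have h1 : Commute (singleW X n v k a) (singleW X n v k' b) :=
    Commute.tprod (Pi.mulSingle_commute
      (f := fun k : WIdx X n => Weyl ((rootParam X n v k : Kˣ) : K)) h a b)
  exact h1.map (Algebra.TensorProduct.includeLeft (S := K) (A := WTensorRoot X n v)
    (B := UBar X n (v : K)))

theorem commute_inclW_inclU (k : WIdx X n) (a) (b : UBar X n (v : K)) :
    Commute (inclW X n v k a) (inclU X n v b) := by
  refine Eq.trans (Algebra.TensorProduct.tmul_mul_tmul _ _ _ _)
    (Eq.trans ?_ (Algebra.TensorProduct.tmul_mul_tmul _ _ _ _).symm)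
  rw [mul_one, one_mul, mul_one, one_mul]

theorem toRoot_xElem (l : XLabel) (hl : ∀ k, l.pos X n = some k → rootDeg X n k = 1) :
    toRoot X n v (xElem X n v l) = (l.pos X n).elim 0 fun k =>
      ((xAt X n v k ^ l.sign : (TargetRoot X n v)ˣ) : TargetRoot X n v) := by
  rw [xElem]
  rcases hp : l.pos X n with - | k
  · exact map_zero _
  · exact toRoot_weylPow_of_rootDeg X n v (hl k hp) _ l.sign_eq

theorem toRoot_zElem (l : ZLabel) (hl : ∀ i, l ≠ .t i) :
    Units.map (toRoot X n v : _ →* _) (zElem X n v l) =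
      (l.pos X n).elim 1 fun k => zAt X n v k ^ rootDeg X n k := by
  rw [zElem_eq _ _ _ hl]
  rcases hp : l.pos X n with - | k
  · exact map_one _
  · refine Units.ext ?_
    refine (toRoot_weylIncl X n v k _).trans ?_
    rw [weylRoot_z]
    simp only [Option.elim_some, zAt, ← map_pow]
    rfl

theorem targetSystem_H_single (l : ZLabel) :
    (targetSystem X n v).H (.ofAdd (Finsupp.single l 1)) = zElem X n v l := by
  simp only [targetSystem, zMonomial_single]

theorem targetSystem_P_single (l : XLabel) :
    (targetSystem X n v).P (.ofAdd (Finsupp.single l 1)) = xElem X n v l := by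
  simp only [targetSystem, xMonomial_single]

theorem rootSystem_H_single (l : ZLabel) :
    ((targetSystem X n v).map (toRoot X n v)).H (.ofAdd (Finsupp.single l 1)) =
      Units.map (toRoot X n v : Target X n v →* TargetRoot X n v) (zElem X n v l) :=
  congrArg (Units.map (toRoot X n v : Target X n v →* TargetRoot X n v))
    (targetSystem_H_single X n v l)

theorem rootSystem_P_single (l : XLabel) :
    ((targetSystem X n v).map (toRoot X n v)).P (.ofAdd (Finsupp.single l 1)) =
      toRoot X n v (xElem X n v l) :=
  congrArg (toRoot X n v) (targetSystem_P_single X n v l)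

/-- The images of the elements of the target algebra are those of the formulas. -/
theorem realizes : ((targetSystem X n v).map (toRoot X n v)).Realizes (symbols X n v) where
  z i := ((rootSystem_H_single X n v (.z i)).trans (toRoot_zElem X n v (.z i) (by simp))).symm
  zt i := ((rootSystem_H_single X n v (.zt i)).trans (toRoot_zElem X n v (.zt i) (by simp))).symm
  T i := by
    refine Eq.trans ?_ (rootSystem_H_single X n v (.t i)).symm
    refine Units.ext ?_
    change _ = toRoot X n v (zElem X n v (.t i))
    simp only [symbols, zElem]
    split_ifs with h
    · exact (toRoot_uIncl X n v _).symm
    · exact (map_one (toRoot X n v)).symm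
  E i := by
    change _ = toRoot X n v (eElem X n v i)
    simp only [symbols, eElem]
    split_ifs with h
    · exact (toRoot_uIncl X n v _).symm
    · exact (map_zero (toRoot X n v)).symm
  F i := by
    change _ = toRoot X n v (fElem X n v i)
    simp only [symbols, fElem]
    split_ifs with h
    · exact (toRoot_uIncl X n v _).symm
    · exact (map_zero (toRoot X n v)).symm
  x i h := by
    refine Eq.trans ?_ ((rootSystem_P_single X n v (.x i)).trans
      (toRoot_xElem X n v (.x i) fun k hk => rootDeg_idx X n hk h)).symm
    simp only [symbols, XLabel.pos, XLabel.sign, zpow_one]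
  xi i h := by
    refine Eq.trans ?_ ((rootSystem_P_single X n v (.xi i)).trans
      (toRoot_xElem X n v (.xi i) fun k hk => rootDeg_idx X n hk h)).symm
    simp only [symbols, XLabel.pos, XLabel.sign, zpow_neg_one]
  xt i := by
    refine Eq.trans ?_ ((rootSystem_P_single X n v (.xt i)).trans
      (toRoot_xElem X n v (.xt i) fun k hk => rootDeg_idxTilde X n hk)).symm
    simp only [symbols, XLabel.pos, XLabel.sign, zpow_one]
  xti i := by
    refine Eq.trans ?_ ((rootSystem_P_single X n v (.xti i)).trans
      (toRoot_xElem X n v (.xti i) fun k hk => rootDeg_idxTilde X n hk)).symm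
    simp only [symbols, XLabel.pos, XLabel.sign, zpow_neg_one]
  zt_one h := by
    subst h
    refine (rootSystem_H_single _ n v (.zt 1)).trans
      ((toRoot_zElem .B n v (.zt 1) (by simp)).trans ?_)
    rw [ZLabel.pos, idxTilde, dif_neg]
    · rfl
    · simp only [numTilde]; omega
  zh_pow h := by
    refine Eq.trans ?_ ((rootSystem_H_single _ n v (.z 1)).trans
      (toRoot_zElem X n v (.z 1) (by simp))).symm
    simp only [symbols, ZLabel.pos]
    rcases hp : idx X n 1 with - | k
    · exact mul_one _
    · simp only [Option.elim_some]
      rw [rootDeg_idx_one X n h hp, pow_two]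
  x_one h := by
    rw [XExp.x, rootSystem_P_single]
    simp only [symbols, xElem, XLabel.pos]
    rcases hp : idx X n 1 with - | k
    · simp
    · simp only [Option.elim_some, XLabel.sign]
      rw [toRoot_weylPow X n v k 1 (.inl rfl), rootDeg_idx_one X n h hp, ← Units.val_mul]
      norm_num
  xi_one h := by
    rw [XExp.xi, rootSystem_P_single]
    simp only [symbols, xElem, XLabel.pos]
    rcases hp : idx X n 1 with - | k
    · simp
    · simp only [Option.elim_some, XLabel.sign]
      rw [toRoot_weylPow X n v k (-1) (.inr rfl), rootDeg_idx_one X n h hp, ← Units.val_mul]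
      norm_num
  xi_one_zh h := by
    rw [XExp.xi, rootSystem_P_single]
    simp only [symbols, xElem, XLabel.pos]
    rcases hp : idx X n 1 with - | k
    · simpa using QCommute.zero_left _ _
    · simp only [Option.elim_some, XLabel.sign]
      rw [toRoot_weylPow X n v k (-1) (.inr rfl), rootDeg_idx_one X n h hp]
      -- The element z_1^{-1/2}x_1 commutes with z_1^{1/2} up to the same factor v = q^{1/2} as x_1
      -- does.
      have h1 : QCommute (v : K) ((Weyl.z (rootParam X n v k : K))⁻¹ * Weyl.x _ :
          (Weyl (rootParam X n v k : K))ˣ).val (Weyl.z (rootParam X n v k : K)).val := by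
        have h2 : rootParam X n v k = v := if_pos (rootDeg_idx_one X n h hp)
        have h3 := Weyl.x_mul_z (rootParam X n v k : K)
        rw [QCommute, Units.val_mul, mul_assoc, h3, h2, mul_smul_comm, Units.inv_mul_cancel_left,
          Units.mul_inv_cancel_left]
      simpa [zAt, xAt] using (h1.inv_left v.ne_zero).map (inclW X n v k)
  zh_comm h a := by
    induction a using ZExp.induction with
    | zero => simp
    | add a b ha hb =>
      rw [ofAdd_add, map_mul]
      exact Commute.mul_right (a := (symbols X n v).zh) ha hb
    | neg a ha =>
      rw [ofAdd_neg, map_inv]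
      exact Commute.inv_right (a := (symbols X n v).zh) ha
    | single l =>
      rw [rootSystem_H_single]
      refine Units.ext ?_
      change ((symbols X n v).zh : TargetRoot X n v) * toRoot X n v (zElem X n v l) =
        toRoot X n v (zElem X n v l) * (symbols X n v).zh
      simp only [symbols]
      rcases hp : idx X n 1 with - | k
      · simp
      simp only [Option.elim_some]
      rcases zElem_cases X n v l with h | ⟨k', hk, h⟩ | ⟨i, -, h⟩
      · rw [h, Units.val_one, map_one, one_mul, mul_one]
      · rw [h, toRoot_weylIncl, weylRoot_z]
        rcases eq_or_ne k k' with rfl | hk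
        · exact Commute.map (Commute.units_val ((Commute.refl _).pow_right _)) (inclW X n v k)
        · exact commute_inclW X n v hk _ _
      · rw [h, toRoot_uIncl]
        exact commute_inclW_inclU X n v _ _ _
  zh_comm_xi h := by
    rw [XExp.xi, rootSystem_P_single]
    simp only [symbols]
    rcases hp : idx X n 1 with - | k
    · exact Commute.one_left _
    rcases xElem_cases X n v (.xi 2) with ⟨-, h⟩ | ⟨k', hk, h⟩
    · rw [h, map_zero]; exact Commute.zero_right _
    · rw [h, toRoot_weylIncl]
      exact commute_inclW X n v (by rintro rfl; exact absurd (idx_inj hp hk) (by simp)) _ _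

end ToRoot

end QuantumSeries

namespace QuantumSeries

/-! ### The number of positive roots -/

section RootCount

/-- The vectors `ε_k`, with `ε_{-k} = -ε_k` and `ε_0 = 0`. -/
def eps (k : ℤ) (m : ℕ) : ℤ := if k = m + 1 then 1 else if k = -(m + 1) then -1 else 0

/-- The tail sums of `eps k`. -/
def epsTail (k : ℤ) (m : ℕ) : ℤ := if (m : ℤ) < k then 1 else if (m : ℤ) < -k then -1 else 0

theorem epsTail_sub_succ (k : ℤ) (m : ℕ) : epsTail k m - epsTail k (m + 1) = eps k m := by
  unfold epsTail eps; split_ifs <;> omega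

theorem epsTail_eq_zero {k : ℤ} {m : ℕ} (h : |k| ≤ m) : epsTail k m = 0 := by
  rw [abs_le] at h
  unfold epsTail; split_ifs <;> omega

/-- The signed permutation of indices induced by the reflection in `ε_a + ε_b`. -/
def signedSwap (a b k : ℤ) : ℤ :=
  if k = a then -b else if k = -a then b else if k = b then -a else if k = -b then a else k

theorem eps_neg (k : ℤ) (r : ℕ) : eps (-k) r = -eps k r := by
  unfold eps; split_ifs <;> omega

/-- The coefficient of `ε_a` in `ε_k`. -/
def epsPairing (a k : ℤ) : ℤ := if k = a then 1 else if k = -a then -1 else 0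

theorem eps_eq_epsPairing (k : ℤ) (m : ℕ) : eps k m = epsPairing (m + 1) k := rfl

theorem epsPairing_neg {a : ℤ} (ha : a ≠ 0) (k : ℤ) : epsPairing (-a) k = -epsPairing a k := by
  unfold epsPairing; split_ifs <;> omega

/-- For a ≠ ±b the vector ε_a + ε_b has square length 2, so its coroot is the sum of the two
coordinates, and the reflection sends ε_a to -ε_b and ε_b to -ε_a. -/
theorem eps_signedSwap {a b : ℤ} (ha : a ≠ 0) (hb : b ≠ 0) (h : a ≠ b) (h' : a ≠ -b) (k : ℤ)
    (r : ℕ) : eps k r - (epsPairing a k + epsPairing b k) * (eps a r + eps b r) =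
      eps (signedSwap a b k) r := by
  have e1 : k ≠ a → k ≠ -a → epsPairing a k = 0 := fun h h' => by simp [epsPairing, h, h']
  have e2 : k ≠ b → k ≠ -b → epsPairing b k = 0 := fun h h' => by simp [epsPairing, h, h']
  have e3 : epsPairing a a = 1 := if_pos rfl
  have e4 : epsPairing b b = 1 := if_pos rfl
  have e5 : epsPairing a (-a) = -1 := (if_neg (by omega)).trans (if_pos rfl)
  have e6 : epsPairing b (-b) = -1 := (if_neg (by omega)).trans (if_pos rfl)
  unfold signedSwap
  split_ifs with h1 h2 h3 h4
  · subst h1; rw [e3, e2 h h', eps_neg]; ring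
  · subst h2; rw [e5, e2 (by omega) (by omega), eps_neg]; ring
  · subst h3; rw [e4, e1 (by omega) (by omega), eps_neg]; ring
  · subst h4; rw [e6, e1 (by omega) (by omega), eps_neg]; ring
  · rw [e1 h1 h2, e2 h3 h4]; ring

theorem eps_signedSwap_succ {m : ℕ} (hm : 1 ≤ m) (k : ℤ) (r : ℕ) :
    eps k r - (eps k m - eps k (m - 1)) * (eps (m + 1) r + eps (-m) r) =
      eps (signedSwap (m + 1) (-m) k) r := by
  have h : eps k (m - 1) = epsPairing m k := by
    rw [eps_eq_epsPairing, Nat.cast_sub hm, Nat.cast_one, sub_add_cancel]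
  rw [← eps_signedSwap (by omega) (by omega) (by omega) (by omega), epsPairing_neg (by omega), h,
    eps_eq_epsPairing k m, ← sub_eq_add_neg]

theorem eps_signedSwap_two_one (k : ℤ) (r : ℕ) :
    eps k r - (eps k 0 + eps k 1) * (eps 2 r + eps 1 r) = eps (signedSwap 2 1 k) r := by
  rw [← eps_signedSwap (by omega) (by omega) (by omega) (by omega), add_comm (eps k 0)]
  rfl

/-- The common reflection in ε_1 and 2ε_1. In type B the factor 2 belongs to the coroot, in type C
to the root. -/
theorem eps_signedSwap_one (k : ℤ) (r : ℕ) :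
    eps k r - 2 * eps k 0 * eps 1 r = eps (signedSwap 1 1 k) r := by
  have e3 : eps 1 0 = 1 := rfl
  have e5 : eps (-1) 0 = -1 := rfl
  unfold signedSwap
  split_ifs with h1 h2
  · subst h1; rw [e3, eps_neg]; ring
  · subst h2; rw [e5, eps_neg]; ring
  · rw [show eps k 0 = 0 by simp [eps, h1, h2]]; ring

/-- Downward induction from the range where both sequences agree. It is used to recover coefficients
from coordinates, which are differences of coefficients. -/
theorem eq_of_sub_succ_eq {b c : ℕ → ℤ} {m₀ M : ℕ}
    (h : ∀ m, m₀ ≤ m → b m - b (m + 1) = c m - c (m + 1)) (h' : ∀ m, M ≤ m → b m = c m) (m : ℕ)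
    (hm : m₀ ≤ m) : b m = c m := by
  obtain ⟨t, ht⟩ : ∃ t, M ≤ m + t := ⟨M, by omega⟩
  induction t generalizing m with
  | zero => exact h' m (by omega)
  | succ t ih =>
    have := ih (m + 1) (by omega) (by omega)
    have := h m hm
    omega

variable (X : Series) {n : ℕ}

/-- The label of the first node when the nodes are numbered by the coordinate vectors. -/
def rootShift : ℕ :=
  match X with
  | .A => 1
  | _ => 0

/-- The coefficients of a vector, continued by `0`. -/
def rootCoeff (β : Fin n → ℤ) (m : ℕ) : ℤ :=
  if h : rootShift X ≤ m ∧ m < n + rootShift X then β ⟨m - rootShift X, by omega⟩ else 0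

/-- The coordinates of a vector in the basis `ε_1, ε_2, …`, from its coefficients. -/
def epsCoord (b : ℕ → ℤ) (m : ℕ) : ℤ :=
  match X, m with
  | .C, 0 => 2 * b 0 - b 1
  | .D, 0 => b 0 - b 1
  | .D, 1 => b 0 + b 1 - b 2
  | _, m => b m - b (m + 1)

/-- The coroots as linear forms in the coordinates. -/
def epsCoroot (w : ℕ → ℤ) (m : ℕ) : ℤ :=
  match X, m with
  | .B, 0 => 2 * w 0
  | .C, 0 => w 0
  | .D, 0 => w 0 + w 1
  | _, m => w m - w (m - 1)

/-- The index pairs of the simple roots. -/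
def simplePair (m : ℕ) : ℤ × ℤ :=
  match X, m with
  | .B, 0 => (1, 0)
  | .C, 0 => (1, 1)
  | .D, 0 => (2, 1)
  | _, m => (m + 1, -m)

/-- The signed permutations of the simple reflections. -/
def simplePerm (m : ℕ) : ℤ → ℤ :=
  match X, m with
  | .D, 0 => signedSwap 2 1
  | _, 0 => signedSwap 1 1
  | _, m => signedSwap (m + 1) (-m)

theorem eps_simplePerm {m : ℕ} (hm : rootShift X ≤ m) (k : ℤ) (r : ℕ) :
    eps k r - epsCoroot X (eps k) m * (eps (simplePair X m).1 r + eps (simplePair X m).2 r) =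
      eps (simplePerm X m k) r := by
  have h0 : eps 0 r = 0 := by simp only [eps]; split_ifs <;> omega
  rcases m with - | m
  · cases X
    · simp [rootShift] at hm
    · simp only [epsCoroot, simplePair, simplePerm, h0, add_zero]
      exact eps_signedSwap_one k r
    · simp only [epsCoroot, simplePair, simplePerm]
      rw [← eps_signedSwap_one k r]; ring
    · simp only [epsCoroot, simplePair, simplePerm]
      exact eps_signedSwap_two_one k r
  · have := eps_signedSwap_succ (m := m + 1) (by omega) k r
    cases X <;> exact this

theorem rootCoeff_single (i : Fin n) (m : ℕ) :
    rootCoeff X (Pi.single i 1) m = if m = i + rootShift X then 1 else 0 := by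
  unfold rootCoeff
  split_ifs with h h' h'
  · subst h'; simp
  · exact Pi.single_eq_of_ne (by rw [Ne, Fin.ext_iff]; dsimp only; omega) _
  · omega
  · rfl

theorem epsCoord_single (i : Fin n) (r : ℕ) :
    epsCoord X (rootCoeff X (Pi.single i 1)) r =
      eps (simplePair X (i + rootShift X)).1 r + eps (simplePair X (i + rootShift X)).2 r := by
  obtain ⟨i, hi⟩ := i
  have h0 : eps 0 r = 0 := by simp only [eps]; split_ifs <;> omega
  cases X
  · simp only [epsCoord, simplePair, rootCoeff_single, rootShift, eps]
    split_ifs <;> omega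
  all_goals
    rcases i with - | i
    all_goals
      rcases r with - | - | r
      all_goals
        simp only [epsCoord, simplePair, rootCoeff_single, rootShift, eps]
        split_ifs <;> first | contradiction | omega

theorem rootCoeff_eq_zero (β : Fin n → ℤ) {m : ℕ} (h : ¬ (rootShift X ≤ m ∧ m < n + rootShift X)) :
    rootCoeff X β m = 0 := dif_neg h

theorem sum_ite_eq_rootCoeff (β : Fin n → ℤ) (m : ℕ) :
    ∑ j : Fin n, (if (j : ℕ) + rootShift X = m then β j else 0) = rootCoeff X β m := by
  unfold rootCoeff
  split_ifs with h
  · rw [Finset.sum_eq_single ⟨m - rootShift X, by omega⟩]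
    · rw [if_pos (by dsimp only; omega)]
    · intro j _ hj
      rw [if_neg]
      rw [Ne, Fin.ext_iff] at hj
      dsimp only at hj
      omega
    · simp
  · exact Finset.sum_eq_zero fun j _ => if_neg (by omega)

/-- A row of the Cartan matrix is the coroot as a linear form in the coordinates. Each row is a
combination of indicator functions of the node and its neighbours; the nodes near the beginning of
the diagram are treated separately. -/
theorem sum_cartan (β : Fin n → ℤ) (i : Fin n) :
    ∑ j, cartan X n i j * β j = epsCoroot X (epsCoord X (rootCoeff X β)) (i + rootShift X) := by
  obtain ⟨i, hi⟩ := i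
  cases X
  · have h0 := rootCoeff_eq_zero .A β (m := 0) (by simp [rootShift])
    have : ∀ j : Fin n, cartan .A n ⟨i, hi⟩ j * β j =
        2 * (if (j : ℕ) + rootShift .A = i + 1 then β j else 0) -
        (if (j : ℕ) + rootShift .A = i then β j else 0) -
        (if (j : ℕ) + rootShift .A = i + 2 then β j else 0) := fun j => by
      simp only [cartan, Matrix.of_apply, cartanEntry, rootShift]
      split_ifs <;> omega
    simp only [this, Finset.sum_sub_distrib, ← Finset.mul_sum, sum_ite_eq_rootCoeff]
    simp only [epsCoroot, rootShift, epsCoord]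
    rw [Nat.add_sub_cancel]
    ring
  · rcases i with - | i
    · have : ∀ j : Fin n, cartan .B n ⟨0, hi⟩ j * β j =
          2 * (if (j : ℕ) + rootShift .B = 0 then β j else 0) -
          2 * (if (j : ℕ) + rootShift .B = 1 then β j else 0) := fun j => by
        simp only [cartan, Matrix.of_apply, cartanEntry, rootShift]
        split_ifs <;> first | contradiction | omega | grind
      simp only [this, Finset.sum_sub_distrib, ← Finset.mul_sum, sum_ite_eq_rootCoeff]
      simp only [epsCoroot, rootShift, epsCoord]
      ring
    · have : ∀ j : Fin n, cartan .B n ⟨i + 1, hi⟩ j * β j =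
          2 * (if (j : ℕ) + rootShift .B = i + 1 then β j else 0) -
          (if (j : ℕ) + rootShift .B = i then β j else 0) -
          (if (j : ℕ) + rootShift .B = i + 2 then β j else 0) := fun j => by
        simp only [cartan, Matrix.of_apply, cartanEntry, rootShift]
        split_ifs <;> first | contradiction | omega
      simp only [this, Finset.sum_sub_distrib, ← Finset.mul_sum, sum_ite_eq_rootCoeff]
      simp only [epsCoroot, rootShift, epsCoord, Nat.add_zero, Nat.add_sub_cancel]
      ring
  · rcases i with - | - | i
    · have : ∀ j : Fin n, cartan .C n ⟨0, hi⟩ j * β j =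
          2 * (if (j : ℕ) + rootShift .C = 0 then β j else 0) -
          (if (j : ℕ) + rootShift .C = 1 then β j else 0) := fun j => by
        simp only [cartan, Matrix.of_apply, cartanEntry, rootShift]
        split_ifs <;> first | contradiction | omega
      simp only [this, Finset.sum_sub_distrib, ← Finset.mul_sum, sum_ite_eq_rootCoeff]
      simp only [epsCoroot, rootShift, epsCoord]
    · have : ∀ j : Fin n, cartan .C n ⟨0 + 1, hi⟩ j * β j =
          2 * (if (j : ℕ) + rootShift .C = 1 then β j else 0) -
          2 * (if (j : ℕ) + rootShift .C = 0 then β j else 0) -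
          (if (j : ℕ) + rootShift .C = 2 then β j else 0) := fun j => by
        simp only [cartan, Matrix.of_apply, cartanEntry, rootShift]
        split_ifs <;> first | contradiction | omega | grind
      simp only [this, Finset.sum_sub_distrib, ← Finset.mul_sum, sum_ite_eq_rootCoeff]
      simp only [epsCoroot, rootShift, epsCoord]
      ring
    · have : ∀ j : Fin n, cartan .C n ⟨i + 1 + 1, hi⟩ j * β j =
          2 * (if (j : ℕ) + rootShift .C = i + 2 then β j else 0) -
          (if (j : ℕ) + rootShift .C = i + 1 then β j else 0) -
          (if (j : ℕ) + rootShift .C = i + 3 then β j else 0) := fun j => by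
        simp only [cartan, Matrix.of_apply, cartanEntry, rootShift]
        split_ifs <;> first | contradiction | omega
      simp only [this, Finset.sum_sub_distrib, ← Finset.mul_sum, sum_ite_eq_rootCoeff]
      simp only [epsCoroot, rootShift, epsCoord, Nat.add_zero,
        show i + 1 + 1 - 1 = i + 1 from rfl]
      ring
  · rcases i with - | - | - | i
    · have : ∀ j : Fin n, cartan .D n ⟨0, hi⟩ j * β j =
          2 * (if (j : ℕ) + rootShift .D = 0 then β j else 0) -
          (if (j : ℕ) + rootShift .D = 2 then β j else 0) := fun j => by
        simp only [cartan, Matrix.of_apply, cartanEntry, rootShift]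
        split_ifs <;> first | contradiction | omega | grind
      simp only [this, Finset.sum_sub_distrib, ← Finset.mul_sum, sum_ite_eq_rootCoeff]
      simp only [epsCoroot, rootShift, epsCoord]
      ring
    · have : ∀ j : Fin n, cartan .D n ⟨0 + 1, hi⟩ j * β j =
          2 * (if (j : ℕ) + rootShift .D = 1 then β j else 0) -
          (if (j : ℕ) + rootShift .D = 2 then β j else 0) := fun j => by
        simp only [cartan, Matrix.of_apply, cartanEntry, rootShift]
        split_ifs <;> first | contradiction | omega | grind
      simp only [this, Finset.sum_sub_distrib, ← Finset.mul_sum, sum_ite_eq_rootCoeff]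
      simp only [epsCoroot, rootShift, epsCoord]
      ring
    · have : ∀ j : Fin n, cartan .D n ⟨0 + 1 + 1, hi⟩ j * β j =
          2 * (if (j : ℕ) + rootShift .D = 2 then β j else 0) -
          (if (j : ℕ) + rootShift .D = 0 then β j else 0) -
          (if (j : ℕ) + rootShift .D = 1 then β j else 0) -
          (if (j : ℕ) + rootShift .D = 3 then β j else 0) := fun j => by
        simp only [cartan, Matrix.of_apply, cartanEntry, rootShift]
        split_ifs <;> first | contradiction | omega | grind
      simp only [this, Finset.sum_sub_distrib, ← Finset.mul_sum, sum_ite_eq_rootCoeff]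
      simp only [epsCoroot, rootShift, epsCoord]
      ring
    · have : ∀ j : Fin n, cartan .D n ⟨i + 1 + 1 + 1, hi⟩ j * β j =
          2 * (if (j : ℕ) + rootShift .D = i + 3 then β j else 0) -
          (if (j : ℕ) + rootShift .D = i + 2 then β j else 0) -
          (if (j : ℕ) + rootShift .D = i + 4 then β j else 0) := fun j => by
        simp only [cartan, Matrix.of_apply, cartanEntry, rootShift]
        split_ifs <;> first | contradiction | omega
      simp only [this, Finset.sum_sub_distrib, ← Finset.mul_sum, sum_ite_eq_rootCoeff]
      simp only [epsCoroot, rootShift, epsCoord, Nat.add_zero,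
        show i + 1 + 1 + 1 - 1 = i + 1 + 1 from rfl]
      ring

theorem rootCoeff_sub (β γ : Fin n → ℤ) (m : ℕ) :
    rootCoeff X (β - γ) m = rootCoeff X β m - rootCoeff X γ m := by
  unfold rootCoeff; split_ifs <;> simp

theorem rootCoeff_single_apply (i : Fin n) (c : ℤ) (m : ℕ) :
    rootCoeff X (Pi.single i c) m = c * rootCoeff X (Pi.single i 1) m := by
  unfold rootCoeff
  split_ifs with h
  · rw [Pi.single_apply, Pi.single_apply]; split_ifs <;> simp
  · simp

/-- Reflections in the coordinates. -/
theorem epsCoord_reflect (β : Fin n → ℤ) (i : Fin n) (r : ℕ) :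
    epsCoord X (rootCoeff X (β - Pi.single i (∑ j, cartan X n i j * β j))) r =
      epsCoord X (rootCoeff X β) r -
        epsCoroot X (epsCoord X (rootCoeff X β)) (i + rootShift X) *
          (eps (simplePair X (i + rootShift X)).1 r + eps (simplePair X (i + rootShift X)).2 r) := by
  rw [← sum_cartan, ← epsCoord_single]
  generalize ∑ j, cartan X n i j * β j = c
  have h (m : ℕ) : rootCoeff X (β - Pi.single i c) m =
      rootCoeff X β m - c * rootCoeff X (Pi.single i 1) m := by
    rw [rootCoeff_sub, rootCoeff_single_apply]
  cases X
  · simp only [epsCoord, h]; ring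
  all_goals
    rcases r with - | - | r
    all_goals simp only [epsCoord, h]; ring

/-- A root with the coordinates `ε_k + ε_l`. -/
def HasIndices (β : Fin n → ℤ) (k l : ℤ) : Prop :=
  epsCoord X (rootCoeff X β) = fun r => eps k r + eps l r

variable {X}

/-- The coroot is linear in the coordinates, so the reflection can be applied to ε_k and ε_l one at
a time. -/
theorem HasIndices.reflect {β : Fin n → ℤ} {k l : ℤ} (h : HasIndices X β k l) (i : Fin n) :
    HasIndices X (β - Pi.single i (∑ j, cartan X n i j * β j))
      (simplePerm X (i + rootShift X) k) (simplePerm X (i + rootShift X) l) := by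
  have hadd (m : ℕ) : epsCoroot X (fun r => eps k r + eps l r) m =
      epsCoroot X (eps k) m + epsCoroot X (eps l) m := by
    cases X
    · simp only [epsCoroot]; ring
    all_goals
      rcases m with - | m
      all_goals
        simp only [epsCoroot]
        try ring
  funext r
  rw [epsCoord_reflect, h, ← eps_simplePerm X (by omega), ← eps_simplePerm X (by omega), hadd]
  ring

end RootCount

end QuantumSeries

namespace QuantumSeries

/-! ### Enumeration of the positive roots by pairs of indices. -/

section RootCount

variable {X : Series} {n : ℕ}

/-- The pairs of indices of roots. -/
def IndexCond (X : Series) (N k l : ℤ) : Prop :=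
  -N ≤ k ∧ k ≤ N ∧ -N ≤ l ∧ l ≤ N ∧
  match X with
  | .A => 0 < k ∧ l < 0 ∧ k ≠ -l
  | .B => k ≠ l ∧ k ≠ -l
  | .C => k ≠ 0 ∧ l ≠ 0 ∧ k ≠ -l
  | .D => k ≠ 0 ∧ l ≠ 0 ∧ k ≠ l ∧ k ≠ -l

theorem signedSwap_injective {a b : ℤ} (ha : a ≠ 0) (hb : b ≠ 0)
    (h : a = b ∨ a ≠ b ∧ a ≠ -b) : Function.Injective (signedSwap a b) := by
  intro k l hkl
  unfold signedSwap at hkl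
  split_ifs at hkl <;> omega

theorem signedSwap_neg {a b : ℤ} (ha : a ≠ 0) (hb : b ≠ 0) (k : ℤ) :
    signedSwap a b (-k) = -signedSwap a b k := by
  unfold signedSwap
  split_ifs <;> omega

theorem signedSwap_bounds {a b N k : ℤ} (ha : -N ≤ a ∧ a ≤ N) (hb : -N ≤ b ∧ b ≤ N)
    (hk : -N ≤ k ∧ k ≤ N) : -N ≤ signedSwap a b k ∧ signedSwap a b k ≤ N := by
  unfold signedSwap
  split_ifs <;> omega

theorem signedSwap_pos {a b k : ℤ} (ha : 0 < a) (hb : b < 0) : 0 < signedSwap a b k ↔ 0 < k := by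
  unfold signedSwap
  split_ifs <;> omega

theorem simplePerm_eq (m : ℕ) : ∃ a b : ℤ, simplePerm X m = signedSwap a b ∧ a ≠ 0 ∧ b ≠ 0 ∧
    (a = b ∨ a ≠ b ∧ a ≠ -b) ∧ (1 ≤ m → 0 < a ∧ b < 0) ∧ -(m + 1 : ℤ) ≤ b ∧ b ≤ m + 1 ∧ 0 < a ∧
    (X ≠ .D ∨ 1 ≤ m → a ≤ m + 1) ∧ a ≤ m + 2 := by
  rcases m with - | m
  · cases X
    case D => exact ⟨2, 1, rfl, by simp⟩
    all_goals exact ⟨1, 1, rfl, by simp⟩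
  · refine ⟨(m + 1 : ℕ) + 1, -(m + 1 : ℕ), by cases X <;> rfl, ?_⟩
    push_cast
    omega

/-- A signed permutation is injective and odd, hence it preserves the conditions k ≠ l, k ≠ -l, k ≠
0. In type A the permutations also preserve signs. -/
theorem IndexCond.perm {k l : ℤ} {m : ℕ} {N : ℕ} (h : IndexCond X N k l) (hm : rootShift X ≤ m)
    (hm' : m < N) (hN : X = .D → 2 ≤ N) :
    IndexCond X N (simplePerm X m k) (simplePerm X m l) := by
  obtain ⟨a, b, h1, ha, hb, hab, hA, hb1, hb2, ha0, ha1, ha2⟩ := simplePerm_eq (X := X) m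
  have haN : a ≤ N := by
    by_cases hX : X = .D
    · have := hN hX
      by_cases h1m : 1 ≤ m
      · have := ha1 (.inr h1m); omega
      · omega
    · have := ha1 (.inl hX); omega
  rw [h1]
  have hinj := signedSwap_injective ha hb hab
  have hneg := signedSwap_neg ha hb
  have h0 : signedSwap a b 0 = 0 := by have := hneg 0; rw [neg_zero] at this; omega
  have hne0 {x : ℤ} (hx : x ≠ 0) : signedSwap a b x ≠ 0 := by
    rw [← h0]; exact hinj.ne hx
  have hne1 {x y : ℤ} (hx : x ≠ -y) : signedSwap a b x ≠ -signedSwap a b y := by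
    rw [← hneg]; exact hinj.ne hx
  obtain ⟨hk1, hk2, hl1, hl2, h⟩ := h
  have hk := signedSwap_bounds (a := a) (b := b) (by omega) (by omega) ⟨hk1, hk2⟩
  have hl := signedSwap_bounds (a := a) (b := b) (by omega) (by omega) ⟨hl1, hl2⟩
  refine ⟨hk.1, hk.2, hl.1, hl.2, ?_⟩
  cases X with
  | A =>
    have hA' := hA hm
    have h2 := signedSwap_pos (k := k) hA'.1 hA'.2
    have h3 := signedSwap_pos (k := l) hA'.1 hA'.2
    have h4 := hne0 (x := l) (by omega)
    exact ⟨h2.2 h.1, by omega, hne1 h.2.2⟩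
  | B => exact ⟨hinj.ne h.1, hne1 h.2⟩
  | C => exact ⟨hne0 h.1, hne0 h.2.1, hne1 h.2.2⟩
  | D => exact ⟨hne0 h.1, hne0 h.2.1, hinj.ne h.2.2.1, hne1 h.2.2.2⟩

theorem indexCond_simplePair {m N : ℕ} (hm : rootShift X ≤ m) (hm' : m < N)
    (hN : X = .D → 2 ≤ N) : IndexCond X N (simplePair X m).1 (simplePair X m).2 := by
  rcases m with - | m
  · cases X
    case A => simp [rootShift] at hm
    all_goals simp [IndexCond, simplePair] at hN ⊢; omega
  · cases X <;> simp only [IndexCond, simplePair] <;> push_cast <;> omega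

/-- Rank 1 is excluded for D: its only simple root would be ε_2 + ε_1, with an index beyond the
rank. -/
theorem IsRoot.exists_hasIndices {β : Fin n → ℤ} (h : IsRoot (cartan X n) β)
    (hN : X = .D → 2 ≤ n) :
    ∃ k l, HasIndices X β k l ∧ IndexCond X (n + rootShift X : ℕ) k l := by
  have hN' : X = .D → 2 ≤ n + rootShift X := fun h => (hN h).trans (Nat.le_add_right _ _)
  induction h with
  | simple i => exact ⟨_, _, funext (epsCoord_single X i),
      indexCond_simplePair (by omega) (by omega) hN'⟩
  | reflect i β _ ih =>
    obtain ⟨k, l, h, hc⟩ := ih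
    exact ⟨_, _, h.reflect i, hc.perm (by omega) (by omega) hN'⟩

/-- The index from which on the coordinates are the differences of the coefficients. -/
def tailStart (X : Series) : ℕ :=
  match X with
  | .A => 0
  | .B => 0
  | .C => 1
  | .D => 2

theorem epsCoord_of_le (b : ℕ → ℤ) {m : ℕ} (h : tailStart X ≤ m) :
    epsCoord X b m = b m - b (m + 1) := by
  rcases m with - | - | m <;> cases X <;> first | rfl | (simp [tailStart] at h)

/-- From `tailStart` on, a coordinate is the difference of two consecutive coefficients, so a
coefficient is the tail sum of the coordinates. -/
theorem HasIndices.rootCoeff_eq {β : Fin n → ℤ} {k l : ℤ} (h : HasIndices X β k l)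
    (hk : |k| ≤ (n + rootShift X : ℕ)) (hl : |l| ≤ (n + rootShift X : ℕ)) (m : ℕ)
    (hm : tailStart X ≤ m) : rootCoeff X β m = epsTail k m + epsTail l m := by
  refine eq_of_sub_succ_eq (c := fun m => epsTail k m + epsTail l m) (M := n + rootShift X)
    (fun m hm => ?_) (fun m hm => ?_) m hm
  · rw [← epsCoord_of_le _ hm, congrFun h m, ← epsTail_sub_succ, ← epsTail_sub_succ]
    ring
  · rw [rootCoeff_eq_zero _ _ (by omega), epsTail_eq_zero (hk.trans (by exact_mod_cast hm)),
      epsTail_eq_zero (hl.trans (by exact_mod_cast hm)), add_zero]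

theorem rootCoeff_injective : Function.Injective (rootCoeff X (n := n)) := by
  intro β β' h
  funext i
  have := congrFun h (i + rootShift X)
  simpa [rootCoeff] using this

theorem epsCoord_rootCoeff_injective :
    Function.Injective fun β : Fin n → ℤ => epsCoord X (rootCoeff X β) := by
  intro β β' h
  refine rootCoeff_injective (X := X) (funext fun m => ?_)
  have key := eq_of_sub_succ_eq (b := rootCoeff X β) (c := rootCoeff X β') (m₀ := tailStart X)
    (M := n + rootShift X)
    (fun m hm => by rw [← epsCoord_of_le _ hm, ← epsCoord_of_le _ hm]; exact congrFun h m)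
    (fun m hm => by rw [rootCoeff_eq_zero _ _ (by omega), rootCoeff_eq_zero _ _ (by omega)])
  by_cases hm : tailStart X ≤ m
  · exact key m hm
  have h0 := congrFun h 0
  have h1 := congrFun h 1
  have k1 := key 1
  have k2 := key 2
  rcases m with - | - | m <;> cases X <;>
    simp only [tailStart, epsCoord, Nat.zero_add] at hm h0 h1 k1 k2 ⊢ <;> omega

theorem HasIndices.symm {β : Fin n → ℤ} {k l : ℤ} (h : HasIndices X β k l) :
    HasIndices X β l k := h.trans (funext fun _ => add_comm _ _)

/-- The second indices of the positive roots with the first index `i + 1 + rootShift X`. -/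
def posLayer (X : Series) (i : ℕ) : Finset ℤ :=
  match X with
  | .A => Finset.Ioo (-(i + 2 : ℤ)) 0
  | .B => Finset.Icc (-i : ℤ) i
  | .C => insert (i + 1 : ℤ) ((Finset.Icc (-i : ℤ) i).erase 0)
  | .D => (Finset.Icc (-i : ℤ) i).erase 0

/-- The indices of the positive roots. -/
def posIndices (X : Series) (n : ℕ) : Finset (Σ _ : ℕ, ℤ) := (Finset.range n).sigma (posLayer X)

/-- The first index. -/
def firstIndex (X : Series) (p : Σ _ : ℕ, ℤ) : ℤ := (p.1 + 1 + rootShift X : ℕ)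

theorem posLayer_bounds {i : ℕ} {l : ℤ} (h : l ∈ posLayer X i) :
    -((i : ℤ) + rootShift X) ≤ l ∧ l ≤ i + 1 := by
  cases X <;> simp [posLayer, rootShift] at h ⊢ <;> omega

/-- A positive root has a positive first index. -/
theorem HasIndices.exists_mem_posIndices {β : Fin n → ℤ} {k l : ℤ} (h : HasIndices X β k l)
    (hc : IndexCond X (n + rootShift X : ℕ) k l) (hβ : ∀ i, 0 ≤ β i) :
    ∃ p ∈ posIndices X n, HasIndices X β (firstIndex X p) p.2 := by
  -- The pair of indices may be interchanged, so the index of larger absolute value is put first. In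
  -- type A the first index is already the positive one.
  wlog hkl : |l| ≤ |k| ∨ X = .A with H
  · push Not at hkl
    refine H h.symm ?_ hβ (.inl hkl.1.le)
    obtain ⟨h1, h2, h3, h4, h5⟩ := hc
    refine ⟨h3, h4, h1, h2, ?_⟩
    cases X <;> simp at hkl h5 ⊢ <;> omega
  obtain ⟨h1, h2, h3, h4, h5⟩ := hc
  have hb (m : ℕ) : 0 ≤ rootCoeff X β m := by
    unfold rootCoeff; split_ifs
    exacts [hβ _, le_rfl]
  have htail := h.rootCoeff_eq (abs_le.2 ⟨h1, h2⟩) (abs_le.2 ⟨h3, h4⟩)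
  have ht (m : ℕ) (hm : tailStart X ≤ m) : 0 ≤ epsTail k m + epsTail l m := by
    rw [← htail m hm]; exact hb m
  have hk : 0 < k ∧ l ∈ posLayer X (k - 1 - rootShift X).toNat := by
    cases X with
    | A =>
      -- At this place the tail sum of ε_l is -1, which must be compensated by ε_k. This forces k ≥
      -- -l.
      have := ht (-l - 1).toNat (by simp [tailStart])
      simp only [rootShift, posLayer, Finset.mem_Ioo]
      unfold epsTail at this
      refine ⟨h5.1, ?_⟩
      split_ifs at this <;> omega
    | B =>
      have hkl : |l| ≤ |k| := by simpa using hkl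
      -- For negative k the tail sum of ε_k is -1 at this place. That of ε_l could compensate it
      -- only for l = -k, which is excluded.
      have := ht (-k - 1).toNat (by simp [tailStart])
      simp only [rootShift, posLayer, Finset.mem_Icc]
      unfold epsTail at this
      simp only [abs, max_def] at hkl
      split_ifs at this hkl <;> omega
    | C =>
      have hkl : |l| ≤ |k| := by simpa using hkl
      have h0 := congrFun h 0
      have hb0 := hb 0
      have ht1 := htail 1 (by simp [tailStart])
      simp only [epsCoord, ht1] at h0
      have hk : 0 < k := by
        by_contra hk
        -- For k = -1 the place used above would be 0, where the tail formula is not available; the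
        -- coordinate 2b_0 - b_1 is used instead.
        by_cases hk1 : k = -1
        · have hl1 : l = -1 := by
            simp only [abs, max_def] at hkl
            split_ifs at hkl <;> omega
          subst hk1 hl1
          simp [epsTail, eps] at h0
          omega
        · have := ht (-k - 1).toNat (by simp [tailStart]; omega)
          unfold epsTail at this
          simp only [abs, max_def] at hkl
          split_ifs at this hkl <;> omega
      refine ⟨hk, ?_⟩
      simp only [rootShift, posLayer, Finset.mem_insert, Finset.mem_erase, Finset.mem_Icc]
      simp only [abs, max_def] at hkl
      split_ifs at hkl <;> omega
    | D =>
      have hkl : |l| ≤ |k| := by simpa using hkl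
      have h1' := congrFun h 1
      have hb0 := hb 0
      have hb1 := hb 1
      have ht2 := htail 2 (by simp [tailStart])
      simp only [epsCoord, ht2] at h1'
      have hk : 0 < k := by
        by_contra hk
        -- The tail formula starts at 2 here. The remaining indices k = -2, l = ±1 are excluded by
        -- the coordinate b_0 + b_1 - b_2.
        by_cases hk1 : -2 ≤ k
        · have : k = -2 ∧ (l = -1 ∨ l = 1) := by
            simp only [abs, max_def] at hkl
            split_ifs at hkl <;> omega
          obtain ⟨rfl, rfl | rfl⟩ := this <;>
          · simp [epsTail, eps] at h1'
            omega
        · have := ht (-k - 1).toNat (by simp [tailStart]; omega)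
          unfold epsTail at this
          simp only [abs, max_def] at hkl
          split_ifs at this hkl <;> omega
      refine ⟨hk, ?_⟩
      simp only [rootShift, posLayer, Finset.mem_erase, Finset.mem_Icc]
      simp only [abs, max_def] at hkl
      split_ifs at hkl <;> omega
  have hk' : (rootShift X : ℤ) < k := by
    cases X <;> simp [rootShift, posLayer] at hk h5 ⊢ <;> omega
  refine ⟨⟨(k - 1 - rootShift X).toNat, l⟩, ?_, ?_⟩
  · rw [posIndices, Finset.mem_sigma, Finset.mem_range]
    exact ⟨by dsimp only; omega, hk.2⟩
  · have : firstIndex X ⟨(k - 1 - rootShift X).toNat, l⟩ = k := by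
      simp only [firstIndex]; omega
    rwa [this]

/-- The coefficients of a root with a positive first index are not negative. -/
theorem HasIndices.nonneg {β : Fin n → ℤ} {p : Σ _ : ℕ, ℤ} (hp : p ∈ posIndices X n)
    (h : HasIndices X β (firstIndex X p) p.2) (i : Fin n) : 0 ≤ β i := by
  obtain ⟨k, l⟩ := p
  rw [posIndices, Finset.mem_sigma, Finset.mem_range] at hp
  obtain ⟨hk, hl⟩ := hp
  dsimp only at hk hl h
  have hl' := posLayer_bounds hl
  have htail := h.rootCoeff_eq (by rw [abs_le, firstIndex]; dsimp only; omega)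
    (by rw [abs_le]; omega)
  have hβ : β i = rootCoeff X β (i + rootShift X) := by simp [rootCoeff]
  have ht (m : ℕ) : 0 ≤ epsTail (firstIndex X ⟨k, l⟩) m + epsTail l m := by
    rw [firstIndex]
    unfold epsTail
    dsimp only
    split_ifs <;> omega
  by_cases hi : tailStart X ≤ i + rootShift X
  · rw [hβ, htail _ hi]; exact ht _
  rw [hβ]
  cases X with
  | A | B => simp [tailStart] at hi
  | C =>
    have h0 := congrFun h 0
    have h1 := htail 1 le_rfl
    have : (i : ℕ) = 0 := by simpa [tailStart, rootShift] using hi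
    simp only [epsCoord, h1] at h0
    simp only [rootShift, this, Nat.add_zero]
    simp only [firstIndex, rootShift] at h0 hl'
    unfold eps epsTail at h0
    split_ifs at h0 <;> omega
  | D =>
    have h0 := congrFun h 0
    have h1 := congrFun h 1
    have h2 := htail 2 le_rfl
    have : (i : ℕ) = 0 ∨ (i : ℕ) = 1 := by simp [tailStart, rootShift] at hi; omega
    simp only [epsCoord, h2] at h0 h1
    simp only [posLayer, Finset.mem_erase, Finset.mem_Icc] at hl
    simp only [firstIndex, rootShift] at h0 h1 hl'
    -- The first two coordinates are b_0 - b_1 and b_0 + b_1 - b_2; their sum and difference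
    -- determine b_0 and b_1.
    have h3 : 2 * rootCoeff .D β 0 = eps (k + 1 : ℕ) 0 + eps l 0 + (eps (k + 1 : ℕ) 1 + eps l 1) +
      (epsTail (k + 1 : ℕ) 2 + epsTail l 2) := by rw [← h0, ← h1]; ring
    have h4 : 2 * rootCoeff .D β 1 = (eps (k + 1 : ℕ) 1 + eps l 1) - (eps (k + 1 : ℕ) 0 + eps l 0) +
      (epsTail (k + 1 : ℕ) 2 + epsTail l 2) := by rw [← h0, ← h1]; ring
    have e0 : eps (k + 1 : ℕ) 0 = 0 := by unfold eps; split_ifs <;> omega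
    have e1 : eps (k + 1 : ℕ) 1 + epsTail (k + 1 : ℕ) 2 = 1 := by
      unfold eps epsTail; split_ifs <;> omega
    have e2 : -1 ≤ eps l 0 + eps l 1 + epsTail l 2 := by unfold eps epsTail; split_ifs <;> omega
    have e3 : -1 ≤ -eps l 0 + eps l 1 + epsTail l 2 := by unfold eps epsTail; split_ifs <;> omega
    rcases this with this | this <;> simp only [rootShift, this, Nat.add_zero]
    · omega
    · omega

theorem eps_injective {k l : ℤ} (h : ∀ r, eps k r = eps l r) : k = l := by
  have h1 := h (k.natAbs - 1)
  have h2 := h (l.natAbs - 1)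
  unfold eps at h1 h2
  split_ifs at h1 h2 <;> omega

theorem posIndices_injective {p p' : Σ _ : ℕ, ℤ} (hp : p ∈ posIndices X n)
    (hp' : p' ∈ posIndices X n)
    (h : ∀ r, eps (firstIndex X p) r + eps p.2 r = eps (firstIndex X p') r + eps p'.2 r) :
    p = p' := by
  wlog hk : p.1 ≤ p'.1 with H
  · exact (H hp' hp (fun r => (h r).symm) (by omega)).symm
  obtain ⟨k, l⟩ := p
  obtain ⟨k', l'⟩ := p'
  rw [posIndices, Finset.mem_sigma, Finset.mem_range] at hp hp'
  dsimp only at hp hp' h hk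
  have hl := posLayer_bounds hp.2
  have hl' := posLayer_bounds hp'.2
  have hkk : k = k' := by
    by_contra hne
    have h1 := h (k' + rootShift X)
    simp only [firstIndex] at h1
    unfold eps at h1
    split_ifs at h1 <;> omega
  subst hkk
  have : l = l' := eps_injective fun r => by
    have := h r
    simp only [firstIndex] at this
    omega
  rw [this]

/-- `ε_k + ε_l` is a root. -/
def IsIndexed (X : Series) (n : ℕ) (k l : ℤ) : Prop :=
  ∃ β : Fin n → ℤ, IsRoot (cartan X n) β ∧ HasIndices X β k l

theorem isIndexed_simplePair {m : ℕ} (hm : rootShift X ≤ m) (hm' : m < n + rootShift X) :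
    IsIndexed X n (simplePair X m).1 (simplePair X m).2 := by
  refine ⟨Pi.single ⟨m - rootShift X, by omega⟩ 1, .simple _, funext fun r => ?_⟩
  rw [epsCoord_single]
  dsimp only
  rw [Nat.sub_add_cancel hm]

theorem IsIndexed.perm {m : ℕ} {k l k' l' : ℤ} (h : IsIndexed X n k l) (hm : rootShift X ≤ m)
    (hm' : m < n + rootShift X) (hk : simplePerm X m k = k') (hl : simplePerm X m l = l') :
    IsIndexed X n k' l' := by
  obtain ⟨β, hβ, h⟩ := h
  refine ⟨_, .reflect ⟨m - rootShift X, by omega⟩ β hβ, ?_⟩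
  have := h.reflect ⟨m - rootShift X, by omega⟩
  dsimp only at this
  rwa [Nat.sub_add_cancel hm, hk, hl] at this

theorem simplePair_succ (m : ℕ) : simplePair X (m + 1) = (((m + 1 : ℕ) : ℤ) + 1, -((m + 1 : ℕ) : ℤ)) := by
  cases X <;> rfl

theorem simplePerm_succ (m : ℕ) :
    simplePerm X (m + 1) = signedSwap (((m + 1 : ℕ) : ℤ) + 1) (-((m + 1 : ℕ) : ℤ)) := by
  cases X <;> rfl

theorem rootShift_le_one : rootShift X ≤ 1 := by cases X <;> simp [rootShift]

/-- Induction on the distance of the indices: the reflection in ε_{j+2} - ε_{j+1} moves the second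
index from -(j + 2) to -(j + 1) and fixes the first. -/
theorem isIndexed_sub (d j : ℕ) (h : j + 1 + d < n + rootShift X) :
    IsIndexed X n (j + d + 2 : ℕ) (-((j + 1 : ℕ) : ℤ)) := by
  have := rootShift_le_one (X := X)
  induction d generalizing j with
  | zero =>
    have := isIndexed_simplePair (X := X) (n := n) (m := j + 1) (by omega) (by omega)
    rw [simplePair_succ] at this
    convert this using 1
    push_cast
    ring
  | succ d ih =>
    refine (ih (j + 1) (by omega)).perm (m := j + 1) (by omega) (by omega) ?_ ?_ <;>
    · rw [simplePerm_succ]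
      unfold signedSwap
      push_cast
      split_ifs <;> omega

/-- The second index 1 is reached from -1 by the sign change of ε_1 in types B and C. In type D it
is reached from -2 by the reflection in ε_2 + ε_1, apart from the simple root ε_2 + ε_1 itself.
Larger second indices follow by simple reflections. -/
theorem isIndexed_add (hX : X ≠ .A) (d j : ℕ) (h : j + 1 + d < n) :
    IsIndexed X n (j + d + 2 : ℕ) (j + 1 : ℕ) := by
  have h0 : rootShift X = 0 := by cases X <;> simp [rootShift] at hX ⊢
  induction j generalizing d with
  | zero =>
    by_cases hD : X = .D
    · subst hD
      rcases d with - | d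
      · exact isIndexed_simplePair (X := .D) (n := n) (m := 0) (by omega) (by omega)
      · refine (isIndexed_sub d 1 (by omega)).perm (m := 0) (by omega) (by omega) ?_ ?_
        all_goals
          simp only [simplePerm]
          unfold signedSwap
          push_cast
        all_goals split_ifs <;> first | contradiction | omega
    · refine (isIndexed_sub d 0 (by omega)).perm (m := 0) (by omega) (by omega) ?_ ?_
      all_goals
        cases X <;> first | contradiction | skip
        all_goals
          simp only [simplePerm]
          unfold signedSwap
          push_cast
        all_goals split_ifs <;> omega
  | succ j ih =>
    refine (ih (d + 1) (by omega)).perm (m := j + 1) (by omega) (by omega) ?_ ?_ <;>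
    · rw [simplePerm_succ]
      unfold signedSwap
      push_cast
      split_ifs <;> omega

theorem isIndexed_B (k : ℕ) (h : k < n) : IsIndexed .B n (k + 1 : ℕ) 0 := by
  induction k with
  | zero => exact isIndexed_simplePair (X := .B) (n := n) (m := 0) (by simp [rootShift]) (by omega)
  | succ k ih =>
    refine (ih (by omega)).perm (m := k + 1) (by simp [rootShift]) (by omega) ?_ ?_ <;>
    · rw [simplePerm_succ]
      unfold signedSwap
      push_cast
      split_ifs <;> omega

theorem isIndexed_C (k : ℕ) (h : k < n) : IsIndexed .C n (k + 1 : ℕ) (k + 1 : ℕ) := by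
  induction k with
  | zero => exact isIndexed_simplePair (X := .C) (n := n) (m := 0) (by simp [rootShift]) (by omega)
  | succ k ih =>
    refine (ih (by omega)).perm (m := k + 1) (by simp [rootShift]) (by omega) ?_ ?_ <;>
    · rw [simplePerm_succ]
      unfold signedSwap
      push_cast
      split_ifs <;> omega

theorem isIndexed_of_mem {p : Σ _ : ℕ, ℤ} (hp : p ∈ posIndices X n) :
    IsIndexed X n (firstIndex X p) p.2 := by
  obtain ⟨k, l⟩ := p
  rw [posIndices, Finset.mem_sigma, Finset.mem_range] at hp
  obtain ⟨hk, hl⟩ := hp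
  have hb := posLayer_bounds hl
  dsimp only at hk hl hb ⊢
  simp only [firstIndex]
  rcases lt_trichotomy l 0 with h | h | h
  · have := isIndexed_sub (X := X) (n := n) (k + 1 + rootShift X - 1 - l.natAbs) (l.natAbs - 1)
      (by omega)
    convert this using 1 <;> omega
  · subst h
    cases X with
    | B => exact isIndexed_B k hk
    | A => simp [posLayer] at hl
    | C => simp [posLayer] at hl; omega
    | D => simp [posLayer] at hl
  · have hX : X ≠ .A := by rintro rfl; simp [posLayer] at hl; omega
    have h0 : rootShift X = 0 := by cases X <;> simp [rootShift] at hX ⊢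
    rw [h0]
    by_cases hlk : l = k + 1
    · subst hlk
      cases X with
      | C => exact isIndexed_C k hk
      | A => exact absurd rfl hX
      | B | D => simp [posLayer] at hl
    · have := isIndexed_add (X := X) (n := n) hX (k - l.natAbs) (l.natAbs - 1) (by omega)
      convert this using 1 <;> omega

/-- Positive roots and index pairs both embed into coordinate vectors, and the images coincide. -/
theorem numPosRoots_eq (hN : X = .D → 2 ≤ n) :
    numPosRoots X n = ∑ i ∈ Finset.range n, (posLayer X i).card := by
  rw [← Finset.card_sigma, ← posIndices, numPosRoots, ← Set.ncard_coe_finset,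
    ← Set.ncard_image_of_injective _ (epsCoord_rootCoeff_injective (X := X) (n := n)),
    ← Set.InjOn.ncard_image (s := (posIndices X n : Set (Σ _ : ℕ, ℤ)))
      (f := fun p => fun r => eps (firstIndex X p) r + eps p.2 r)
      fun p hp p' hp' h => posIndices_injective hp hp' (congrFun h)]
  congr 1
  ext w
  constructor
  · rintro ⟨β, ⟨hβ, h0⟩, rfl⟩
    obtain ⟨k, l, h, hc⟩ := hβ.exists_hasIndices hN
    obtain ⟨p, hp, hp'⟩ := h.exists_mem_posIndices hc h0
    exact ⟨p, hp, Eq.symm hp'⟩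
  · rintro ⟨p, hp, rfl⟩
    obtain ⟨β, hβ, h⟩ := isIndexed_of_mem hp
    exact ⟨β, ⟨hβ, h.nonneg hp⟩, h⟩

/-- The number of Weyl algebras. -/
theorem card_wIdx (X : Series) {n : ℕ} (hn : minRank X ≤ n) :
    Fintype.card (WIdx X n) = numPosRoots X n - numPosRoots X (n - 1) := by
  obtain ⟨m, rfl⟩ : ∃ m, n = m + 1 := ⟨n - 1, by cases X <;> simp [minRank] at hn <;> omega⟩
  have hm : X = .D → 2 ≤ m := by rintro rfl; simp [minRank] at hn; omega
  rw [Nat.add_sub_cancel, numPosRoots_eq fun h => (hm h).trans (by omega), numPosRoots_eq hm,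
    Finset.sum_range_succ, Nat.add_sub_cancel_left, Fintype.card_sum, Fintype.card_fin,
    Fintype.card_fin]
  -- With m = n - 1 the last layer has m + 1, 2m + 1, 2m + 1 and 2m elements in the four types.
  cases X with
  | A => simp [posLayer, numTilde]; omega
  | B => simp [posLayer, numTilde]; omega
  | C =>
    simp only [posLayer, numTilde]
    rw [Finset.card_insert_of_notMem (by simp), Finset.card_erase_of_mem (by simp)]
    simp
    omega
  | D =>
    have := hm rfl
    simp only [posLayer, numTilde]
    rw [Finset.card_erase_of_mem (by simp)]
    simp
    omega

end RootCount

end QuantumSeries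

namespace QuantumSeries

/-! ### The representation space -/

section WSpace

variable {K : Type u} [Field K] (X : Series) (n N : ℕ)

/-- The standard basis of `(K^N)^{⊗ l}`. -/
def wBasis : Module.Basis (WIdx X n → Fin N) K (WSpace K X n N) :=
  Basis.piTensorProduct fun _ => Pi.basisFun K (Fin N)

theorem rank_wSpace_tensor (V : Type w) [AddCommGroup V] [Module K V] :
    Module.rank K (WSpace K X n N ⊗[K] V) =
      (N : Cardinal) ^ Fintype.card (WIdx X n) * Cardinal.lift.{u, w} (Module.rank K V) := by
  rw [rank_tensorProduct, rank_eq_card_basis (wBasis X n N), Fintype.card_fun, Fintype.card_fin]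
  rw [Cardinal.lift_natCast, Nat.cast_pow]

theorem exists_wSpace_functional [NeZero N] :
    ∃ (w : WSpace K X n N) (f : WSpace K X n N →ₗ[K] K), f w = 1 :=
  ⟨wBasis X n N 0, (wBasis X n N).coord 0, by simp⟩

/-- As N is not 0, some functional on the Weyl part takes the value 1 on a vector; applied to the
first tensor factor it recovers elements of V. -/
theorem wSpace_tmul_injective [NeZero N] {V : Type w} [AddCommGroup V] [Module K V] {x y : V}
    (h : ∀ w : WSpace K X n N, w ⊗ₜ[K] x = w ⊗ₜ[K] y) : x = y := by
  obtain ⟨w, f, hw⟩ := exists_wSpace_functional (K := K) X n N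
  have := congrArg (TensorProduct.lid K V ∘ f.rTensor V) (h w)
  simpa [hw] using this

theorem nontrivial_end_wSpace_tensor [NeZero N] (V : Type w) [AddCommGroup V] [Module K V]
    [Nontrivial V] : Nontrivial (Module.End K (WSpace K X n N ⊗[K] V)) := by
  obtain ⟨x, hx⟩ := exists_ne (0 : V)
  have : Nontrivial (WSpace K X n N ⊗[K] V) := by
    by_contra h
    rw [not_nontrivial_iff_subsingleton] at h
    exact hx (wSpace_tmul_injective X n N fun w : WSpace K X n N =>
      Subsingleton.elim _ _)
  infer_instance

end WSpace

end QuantumSeries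

namespace QuantumSeries
open ZExp XExp

/-! ### Separation of terms -/

theorem list_sum_map_sub {α M : Type*} [AddCommGroup M] (f g : α → M) (L : List α) :
    (L.map fun a => f a - g a).sum = (L.map f).sum - (L.map g).sum := by
  induction L with
  | nil => simp
  | cons a L ih =>
    rw [List.map_cons, List.sum_cons, ih, List.map_cons, List.sum_cons, List.map_cons,
      List.sum_cons]
    abel

/-- Elements with different characters under commutation with units are independent. -/
theorem eq_zero_of_sum_eq_zero {K R ι α : Type*} [Field K] [Ring R] [Algebra K R] (y : ι → Rˣ)
    (χ : α → ι → K) (L : List α) (hsep : L.Pairwise fun a b => ∃ l, χ a l ≠ χ b l) (d : α → R)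
    (hd : ∀ a ∈ L, ∀ l, QCommute (χ a l) (y l : R) (d a)) (hsum : (L.map d).sum = 0) :
    ∀ a ∈ L, d a = 0 := by
  induction L generalizing d with
  | nil => simp
  | cons a L ih =>
    rw [List.pairwise_cons] at hsep
    have hrel (l : ι) (L' : List α) (h : ∀ b ∈ L', QCommute (χ b l) (y l : R) (d b)) :
        (y l : R) * (L'.map d).sum = (L'.map fun b => χ b l • d b).sum * y l := by
      induction L' with
      | nil => simp
      | cons b L' ih =>
        have hb : (y l : R) * d b = χ b l • (d b * y l) := h b (by simp)
        rw [List.map_cons, List.sum_cons, mul_add, ih fun c hc => h c (by simp [hc]), hb,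
          List.map_cons, List.sum_cons, add_mul, smul_mul_assoc]
    have hsub (l : ι) (L' : List α) : (L'.map fun b => (χ b l - χ a l) • d b).sum =
        (L'.map fun b => χ b l • d b).sum - χ a l • (L'.map d).sum := by
      induction L' with
      | nil => simp
      | cons b L' ih =>
        rw [List.map_cons, List.sum_cons, ih, List.map_cons, List.sum_cons, List.map_cons,
          List.sum_cons, smul_add, sub_smul]
        abel
    -- Commuting the sum with y l multiplies d b by χ b l. Subtracting χ a l times the original sum
    -- removes d a and scales d b by χ b l - χ a l. For a given b, l is chosen such that this factor
    -- is not zero.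
    have htail : ∀ b ∈ L, d b = 0 := by
      intro b hb
      obtain ⟨l, hl⟩ := hsep.1 b hb
      have h0 : (((a :: L).map fun b => χ b l • d b)).sum = 0 := by
        have := hrel l (a :: L) fun b hb => hd b hb l
        rw [hsum, mul_zero] at this
        exact (Units.mul_left_eq_zero (y l)).1 this.symm
      have h1 := hsub l (a :: L)
      rw [h0, hsum, smul_zero, sub_zero, List.map_cons, List.sum_cons, sub_self, zero_smul,
        zero_add] at h1
      have := ih hsep.2 (fun b => (χ b l - χ a l) • d b) (fun c hc m => by
        have hc' : (y m : R) * d c = χ c m • (d c * y m) := hd c (by simp [hc]) m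
        rw [QCommute, mul_smul_comm, hc', smul_mul_assoc, smul_comm]) h1 b hb
      exact (smul_eq_zero.1 this).resolve_left (sub_ne_zero.2 (Ne.symm hl))
    intro b hb
    rcases List.mem_cons.1 hb with rfl | hb
    · have : (L.map d).sum = 0 := List.sum_eq_zero fun x hx => by
        obtain ⟨c, hc, rfl⟩ := List.mem_map.1 hx
        exact htail c hc
      rwa [List.map_cons, List.sum_cons, this, add_zero] at hsum
    · exact htail b hb

namespace QSystem

variable {K : Type*} [Field K] {X : Series} {n : ℕ} {v : Kˣ} {R : Type*} [Ring R] [Algebra K R]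

/-- The exponent in the commutation relation of a monomial with a term. -/
def Term.deg (X : Series) (n : ℕ) (a : ZExp) (ξ : XExp) : Term K → ℤ
  | .mon _ b η => pairing (qExp X) ξ b - pairing (qExp X) η a
  | .E i => weight X n i a
  | .F η i => -(pairing (qExp X) η a + weight X n i a)

theorem Term.qComm_deg (a : ZExp) (ξ : XExp) (t : Term K) :
    Term.QComm X n (t.deg X n a ξ) (.mon 1 a ξ) t := by
  cases t <;> rfl

/-- Monomials that agree up to scalars in two systems. -/
def MonScaled (s s' : QSystem X n v R) (c : Kˣ) (a : ZExp) (ξ : XExp) : Prop :=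
  s.mon 1 a ξ = (c : K) • s'.mon 1 a ξ

/-- The separation of the groups of terms in an equation of sums of terms. -/
theorem evalSum_eq_of_separated {s s' : QSystem X n v R} {ι : Type*} (a : ι → ZExp) (ξ : ι → XExp)
    (hu : ∀ l, IsUnit (s.mon 1 (a l) (ξ l))) (c : ι → Kˣ)
    (hc : ∀ l, MonScaled s s' (c l) (a l) (ξ l)) (L : List (List (Term K) × (ι → ℤ)))
    (hL : ∀ p ∈ L, ∀ l, ∀ t ∈ p.1, Term.deg X n (a l) (ξ l) t = p.2 l)
    {m : ℤ} (hm : (v : K) ^ m ≠ 1) (hsep : (L.map Prod.snd).Pairwise fun w w' => ∃ l, w l - w' l ∣ m)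
    (hsum : s.evalSum (L.map Prod.fst).flatten = s'.evalSum (L.map Prod.fst).flatten) :
    ∀ p ∈ L, s.evalSum p.1 = s'.evalSum p.1 := by
  -- Only one inequality v^m ≠ 1 is at hand. It separates two powers of v as soon as the difference
  -- of their exponents divides m.
  replace hsep : L.Pairwise fun p p' => ∃ l, (v : K) ^ p.2 l ≠ (v : K) ^ p'.2 l := by
    refine (List.pairwise_map.1 hsep).imp fun ⟨l, k, hk⟩ => ⟨l, fun h => hm ?_⟩
    rw [hk, zpow_mul, zpow_sub₀ v.ne_zero, h, div_self (zpow_ne_zero _ v.ne_zero), one_zpow]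
  have hflat (s : QSystem X n v R) (L : List (List (Term K) × (ι → ℤ))) :
      s.evalSum (L.map Prod.fst).flatten = (L.map fun p => s.evalSum p.1).sum := by
    induction L with
    | nil => rfl
    | cons p L ih =>
      rw [List.map_cons, List.flatten_cons, evalSum, List.map_append, List.sum_append,
        List.map_cons, List.sum_cons]
      exact congrArg _ ih
  have hq (s : QSystem X n v R) (p) (hp : p ∈ L) (l : ι) :
      QCommute ((v : K) ^ p.2 l) (s.mon 1 (a l) (ξ l)) (s.evalSum p.1) := by
    have := s.qCommute_evalSum (k := p.2 l) (l := [.mon 1 (a l) (ξ l)]) (l' := p.1) fun t ht t' ht' => by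
      rw [List.mem_singleton.1 ht, ← hL p hp l t' ht']
      exact t'.qComm_deg _ _
    rwa [evalSum_cons, evalSum_nil, add_zero] at this
  -- The separating units of the two systems differ by scalars only. Hence the sums of a group in
  -- both systems, and their difference, commute with the same unit up to the same factor.
  have := eq_zero_of_sum_eq_zero (fun l => (hu l).unit) (fun p l => (v : K) ^ p.2 l) L hsep
    (fun p => s.evalSum p.1 - s'.evalSum p.1) (fun p hp l => by
      have h1 : _ = _ := hq s p hp l
      have h2 : _ = _ := hq s' p hp l
      rw [QCommute, IsUnit.unit_spec, mul_sub, sub_mul, h1, hc l, smul_mul_assoc, h2, mul_smul_comm,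
        mul_smul_comm, smul_sub, smul_comm (c l : K) ((v : K) ^ p.2 l) (s'.evalSum p.1 * _)]) (by
      rw [hflat, hflat] at hsum
      rw [list_sum_map_sub, hsum, sub_self])
  exact fun p hp => sub_eq_zero.1 (this p hp)

theorem MonScaled.add {s s' : QSystem X n v R} {c c' : Kˣ} {a b : ZExp} {ξ η : XExp}
    (h : MonScaled s s' c a ξ) (h' : MonScaled s s' c' b η) :
    MonScaled s s' (c * c') (a + b) (ξ + η) := by
  have key (s : QSystem X n v R) : s.mon 1 (a + b) (ξ + η) =
      ((v : K) ^ pairing (qExp X) ξ b)⁻¹ • (s.mon 1 a ξ * s.mon 1 b η) := by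
    rw [mon_mul_mon, mon, mon, smul_smul, one_mul, one_mul,
      inv_mul_cancel₀ (zpow_ne_zero _ v.ne_zero)]
  rw [MonScaled, key, key, h, h', smul_mul_smul_comm, Units.val_mul, smul_comm]

theorem mon_H (s : QSystem X n v R) (a : ZExp) : s.mon 1 a 0 = s.H (.ofAdd a) := by
  rw [mon, P_zero, one_smul, mul_one]

theorem mon_P (s : QSystem X n v R) (ξ : XExp) : s.mon 1 0 ξ = s.P (.ofAdd ξ) := by
  rw [mon, ofAdd_zero, map_one, Units.val_one, one_smul, one_mul]

theorem MonScaled.neg {s s' : QSystem X n v R} {c : Kˣ} {a : ZExp} (h : MonScaled s s' c a 0) :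
    MonScaled s s' c⁻¹ (-a) 0 := by
  rw [MonScaled, mon_H, mon_H] at h ⊢
  rw [ofAdd_neg, map_inv, map_inv]
  refine Units.inv_eq_of_mul_eq_one_right ?_
  rw [h, smul_mul_smul_comm, Units.mul_inv, ← Units.val_mul, mul_inv_cancel, Units.val_one, one_smul]

theorem MonScaled.nsmul {s s' : QSystem X n v R} {c : Kˣ} {a : ZExp} {ξ : XExp}
    (h : MonScaled s s' c a ξ) (k : ℕ) : MonScaled s s' (c ^ k) (k • a) (k • ξ) := by
  induction k with
  | zero =>
    rw [zero_smul, zero_smul, MonScaled, mon_H, mon_H, ofAdd_zero, map_one, map_one, pow_zero,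
      Units.val_one, Units.val_one, one_smul]
  | succ k ih => rw [pow_succ, succ_nsmul, succ_nsmul]; exact ih.add h

theorem MonScaled.mul_mon {s s' : QSystem X n v R} {c c' : Kˣ} {a : ZExp} {ξ : XExp}
    (h : MonScaled s s' c a 0) (h' : MonScaled s s' c' 0 ξ) : MonScaled s s' (c * c') a ξ := by
  simpa using h.add h'

theorem MonScaled.eq_one [Nontrivial R] {s s' : QSystem X n v R} {c : Kˣ} {a : ZExp} {ξ : XExp}
    (h : MonScaled s s' c a ξ) (hu : IsUnit (s'.P (.ofAdd ξ))) {k : K} (hk : k ≠ 0)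
    (he : s.eval (.mon k a ξ) = s'.eval (.mon k a ξ)) : c = 1 := by
  have hmon (s : QSystem X n v R) : s.eval (.mon k a ξ) = k • s.mon 1 a ξ := by
    rw [eval, mon, mon, one_smul]
  have hu' : IsUnit (s'.mon 1 a ξ) := by
    rw [mon, one_smul]; exact (s'.H _).isUnit.mul hu
  rw [hmon, hmon, h, smul_comm, ← sub_eq_zero] at he
  have : ((c : K) - 1) • k • s'.mon 1 a ξ = 0 := by rw [sub_smul, one_smul, he]
  rcases smul_eq_zero.1 this with h0 | h0
  · exact Units.ext (sub_eq_zero.1 h0)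
  · exact absurd ((smul_eq_zero.1 h0).resolve_left hk) hu'.ne_zero

theorem isUnit_P_x (s : QSystem X n v R) {i : ℕ} (h : 1 ≤ i) (h' : i ≤ n) :
    IsUnit (s.P (.ofAdd (x i))) ∧ IsUnit (s.P (.ofAdd (xi i))) := by
  have h1 := s.x_xi i h h'
  have h2 := h1
  rw [add_comm, P_add] at h2
  rw [P_add] at h1
  exact ⟨⟨⟨_, _, h1, h2⟩, rfl⟩, ⟨⟨_, _, h2, h1⟩, rfl⟩⟩

theorem isUnit_P_xt (s : QSystem X n v R) {i : ℕ} (h : n - numTilde X n < i) (h' : i ≤ n) :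
    IsUnit (s.P (.ofAdd (xt i))) ∧ IsUnit (s.P (.ofAdd (xti i))) := by
  have h1 := s.xt_xti i h h'
  have h2 := h1
  rw [add_comm, P_add] at h2
  rw [P_add] at h1
  exact ⟨⟨⟨_, _, h1, h2⟩, rfl⟩, ⟨⟨_, _, h2, h1⟩, rfl⟩⟩

/-- Two systems whose elements `z_i`, `z̃_i`, `x_i`, `x̃_i` agree up to scalars. -/
structure Scaled (s s' : QSystem X n v R) (σ σt ρ ρt : ℕ → Kˣ) : Prop where
  z_scaled (i : ℕ) : MonScaled s s' (σ i) (z i) 0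
  zt_scaled (i : ℕ) : MonScaled s s' (σt i) (zt i) 0
  x_scaled (i : ℕ) : MonScaled s s' (ρ i) 0 (x i)
  xi_scaled (i : ℕ) : MonScaled s s' (ρ i)⁻¹ 0 (xi i)
  xt_scaled (i : ℕ) : MonScaled s s' (ρt i) 0 (xt i)
  xti_scaled (i : ℕ) : MonScaled s s' (ρt i)⁻¹ 0 (xti i)

namespace Scaled

variable {s s' : QSystem X n v R} {σ σt ρ ρt : ℕ → Kˣ}
  (h : Scaled s s' σ σt ρ ρt)
include h

theorem z_sub_z (i j : ℕ) : MonScaled s s' (σ i * (σ j)⁻¹) (z i - z j) 0 := by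
  rw [sub_eq_add_neg]; simpa using (h.z_scaled i).add (h.z_scaled j).neg

theorem zt_sub_zt (i j : ℕ) : MonScaled s s' (σt i * (σt j)⁻¹) (zt i - zt j) 0 := by
  rw [sub_eq_add_neg]; simpa using (h.zt_scaled i).add (h.zt_scaled j).neg

theorem z_sub_zt (i j : ℕ) : MonScaled s s' (σ i * (σt j)⁻¹) (z i - zt j) 0 := by
  rw [sub_eq_add_neg]; simpa using (h.z_scaled i).add (h.zt_scaled j).neg

end Scaled

end QSystem

end QuantumSeries

namespace QuantumSeries
open ZExp XExp

/-! ### Ratios of the parameters. -/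

namespace QSystem

variable {K : Type*} [Field K] {X : Series} {n : ℕ} {v : Kˣ} {R : Type*} [Ring R] [Algebra K R]

theorem curlyCoeff_ne_zero {Q : Kˣ} (h : (Q : K) ^ 2 ≠ 1) : curlyCoeff Q ≠ 0 := fun h' => by
  have := curlyCoeff_mul h
  rw [h', zero_mul] at this
  exact zero_ne_one this

theorem isUnit_mon_P (s : QSystem X n v R) {ξ : XExp} (h : IsUnit (s.P (.ofAdd ξ))) :
    IsUnit (s.mon 1 0 ξ) := by rwa [mon_P]

theorem isUnit_mon_H (s : QSystem X n v R) (a : ZExp) : IsUnit (s.mon 1 a 0) := by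
  rw [mon_H]; exact Units.isUnit _

/-- The equations given by a pair of terms. -/
theorem eq_one_of_curlTerms [Nontrivial R] {s s' : QSystem X n v R} {a : ZExp} {ξ : XExp}
    {c r : Kˣ} {k : K} (hk : k ≠ 0) (ha : MonScaled s s' c a 0) (hξ : MonScaled s s' r 0 ξ)
    (hu : IsUnit (s'.P (.ofAdd ξ))) {b : ZExp} (hb : b = -a)
    (h1 : s.eval (.mon k a ξ) = s'.eval (.mon k a ξ))
    (h2 : s.eval (.mon (-k) b ξ) = s'.eval (.mon (-k) b ξ)) : c ^ 2 = 1 ∧ r ^ 2 = 1 := by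
  subst hb
  -- The two monomials of the bracket scale by c r and c⁻¹ r, and both factors must be 1.
  have e1 := (ha.mul_mon hξ).eq_one hu hk h1
  have e2 := (ha.neg.mul_mon hξ).eq_one hu (neg_ne_zero.2 hk) h2
  have e3 : r = c := by rw [← inv_mul_eq_one.1 e2]
  rw [e3, ← pow_two] at e1
  exact ⟨e1, e3 ▸ e1⟩

namespace Scaled

variable {s s' : QSystem X n v R} {σ σt ρ ρt : ℕ → Kˣ} (h : Scaled s s' σ σt ρ ρt)
include h

/-- The degrees with respect to x_i and x̃_i distinguish all five terms: x_i sees only the first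
bracket and x̃_i only the second, with opposite signs on the two monomials. -/
theorem eval_fTermsGen (hv : Admissible X n v) {i : ℕ} (hi : IsGeneral X i) (hin : i ≤ n)
    (he : s.evalSum (fTerms X v i) = s'.evalSum (fTerms X v i)) :
    ∀ t ∈ fTermsGen X v i, s.eval t = s'.eval t := by
  have h2 := hi.two_le
  have hm : (v : K) ^ (2 * dExp X i : ℤ) ≠ 1 := by
    have := hv i (by omega) hin
    rwa [← pow_mul, ← zpow_natCast, Nat.cast_mul, mul_comm] at this
  have hd : dExp X i = qExp X := by
    cases X
    · exact hi.elim
    all_goals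
      have := hi.two_le
      simp [dExp, qExp]
      try omega
  have hxt : n - numTilde X n < i := by
    cases X <;> simp [IsGeneral, numTilde] at hi ⊢ <;> omega
  have hsep : ([![0, 0], ![-(qExp X : ℤ), 0], ![(qExp X : ℤ), 0], ![0, (qExp X : ℤ)],
      ![0, -(qExp X : ℤ)]] : List (Fin 2 → ℤ)).Pairwise fun w w' => ∃ l, w l - w' l ∣ (2 * qExp X : ℤ) := by
    clear * -
    cases X <;> decide
  rw [hi.fTerms_eq] at he
  have key := evalSum_eq_of_separated (s := s) (s' := s') (ι := Fin 2) (a := fun _ => 0)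
    (ξ := ![x i, xt i])
    (by rw [Fin.forall_fin_two]
        exact ⟨by rw [mon_P]; exact (s.isUnit_P_x (by omega) hin).1,
          by rw [mon_P]; exact (s.isUnit_P_xt hxt hin).1⟩)
    (c := ![ρ i, ρt i]) (by rw [Fin.forall_fin_two]; exact ⟨h.x_scaled i, h.xt_scaled i⟩)
    (L := [([.F (xi (i + 1) + x i + xt (i + 1) + xti i) i], ![0, 0]),
      ([.mon (curlyCoeff (v ^ qExp X)) (z (i + 1) - z i) (x i)], ![-(qExp X : ℤ), 0]),
      ([.mon (-curlyCoeff (v ^ qExp X)) (z i - z (i + 1)) (x i)], ![(qExp X : ℤ), 0]),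
      ([.mon (curlyCoeff (v ^ qExp X)) (zt i - zt (i + 1)) (xi (i + 1) + x i + xt (i + 1))], ![0, (qExp X : ℤ)]),
      ([.mon (-curlyCoeff (v ^ qExp X)) (zt (i + 1) - zt i) (xi (i + 1) + x i + xt (i + 1))],
        ![0, -(qExp X : ℤ)])])
    (by simp [Fin.forall_fin_two, Term.deg]) hm (by rw [hd]; exact hsep) he
  simpa [fTermsGen, curlTerms, evalSum_cons, evalSum_nil] using key

end Scaled

namespace Scaled

theorem eval_fTermsA {s s' : QSystem .A n v R} {σ σt ρ ρt : ℕ → Kˣ} (h : Scaled s s' σ σt ρ ρt)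
    (hv : Admissible .A n v) {i : ℕ} (hi : 1 ≤ i) (hin : i ≤ n)
    (he : s.evalSum (fTermsA v i) = s'.evalSum (fTermsA v i)) :
    ∀ t ∈ fTermsA v i, s.eval t = s'.eval t := by
  have hm : (v : K) ^ (2 : ℤ) ≠ 1 := by simpa [dExp] using hv i hi hin
  have hne : i ≠ i - 1 := by omega
  have key := evalSum_eq_of_separated (s := s) (s' := s') (ι := Fin 1) (a := fun _ => 0)
    (ξ := ![x i])
    (by rw [Fin.forall_fin_one, mon_P]; exact (s.isUnit_P_x hi hin).1)
    (c := ![ρ i]) (by rw [Fin.forall_fin_one]; exact h.x_scaled i)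
    (L := [([.F (xi (i - 1) + x i) (i - 1)], ![0]),
      ([.mon (curlyCoeff v) (z (i - 1) - z i) (x i)], ![-1]),
      ([.mon (-curlyCoeff v) (z i - z (i - 1)) (x i)], ![1])])
    (by simp [Fin.forall_fin_one, Term.deg, qExp, hne]) hm (by simp only [List.map_cons, List.map_nil]; decide) he
  simpa [fTermsA, curlTerms, evalSum_cons, evalSum_nil] using key

/-- The degree with respect to x_1 is 0 for three of the five terms; the degrees with respect to
z̃_2 and z_1 separate these. -/
theorem eval_fTermsB {s s' : QSystem .B n v R} {σ σt ρ ρt : ℕ → Kˣ} (h : Scaled s s' σ σt ρ ρt)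
    (hv : Admissible .B n v) (hn : 1 ≤ n)
    (he : s.evalSum (fTermsB v) = s'.evalSum (fTermsB v)) :
    ∀ t ∈ fTermsB v, s.eval t = s'.eval t := by
  have hm : (v : K) ^ (2 : ℤ) ≠ 1 := by simpa [dExp] using hv 1 le_rfl hn
  have key := evalSum_eq_of_separated (s := s) (s' := s') (ι := Fin 3) (a := ![0, zt 2, z 1])
    (ξ := ![x 1, 0, 0])
    (by simp only [Fin.forall_fin_succ, IsEmpty.forall_iff, and_true]
        exact ⟨s.isUnit_mon_P (s.isUnit_P_x le_rfl hn).1,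
          s.isUnit_mon_H _, s.isUnit_mon_H _⟩)
    (c := ![ρ 1, σt 2, σ 1])
    (by simp only [Fin.forall_fin_succ, IsEmpty.forall_iff, and_true]
        exact ⟨h.x_scaled 1, h.zt_scaled 2, h.z_scaled 1⟩)
    (L := [([.F (xi 2 + xt 2) 1], ![0, -2, 0]),
      ([.mon (curlyCoeff v) (z 2) (x 1)], ![0, 0, -2]),
      ([.mon (-curlyCoeff v) (z 1 - z 2) (x 1)], ![2, 0, -2]),
      ([.mon (curlyCoeff v) (z 1 - zt 2) (xi 2 + x 1 + xt 2)], ![2, -2, -2]),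
      ([.mon (-curlyCoeff v) (zt 2) (xi 2 + x 1 + xt 2)], ![0, -2, -2])])
    (by simp [Fin.forall_fin_succ, Term.deg, qExp]) hm (by simp only [List.map_cons, List.map_nil]; decide) he
  simpa [fTermsB, curlTerms, evalSum_cons, evalSum_nil] using key

/-- For the series `C`, all terms but two are determined. -/
theorem eval_fTermsC {s s' : QSystem .C n v R} {σ σt ρ ρt : ℕ → Kˣ} (h : Scaled s s' σ σt ρ ρt)
    (hv : Admissible .C n v) (hn : 1 ≤ n)
    (he : s.evalSum (fTermsC v) = s'.evalSum (fTermsC v)) :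
    ∀ t ∈ (.F (2 • xi 2 + 2 • xt 2) 1 ::
      (curlTerms (curlyCoeff (v ^ 2)) (2 • z 1 - 2 • zt 2) (2 • zt 2 - 2 • z 1)
        (2 • xi 2 + x 1 + 2 • xt 2) ++
      curlTerms (curlyCoeff (v ^ 2)) (2 • z 2 - 2 • z 1) (2 • z 1 - 2 • z 2) (x 1)) :
        List (Term K)), s.eval t = s'.eval t := by
  have hm : (v : K) ^ (4 : ℤ) ≠ 1 := by
    have := hv 1 le_rfl hn
    rw [← pow_mul] at this
    exact_mod_cast this
  have key := evalSum_eq_of_separated (s := s) (s' := s') (ι := Fin 3) (a := ![0, zt 2, z 1])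
    (ξ := ![x 1, 0, 0])
    (by simp only [Fin.forall_fin_succ, IsEmpty.forall_iff, and_true]
        exact ⟨s.isUnit_mon_P (s.isUnit_P_x le_rfl hn).1,
          s.isUnit_mon_H _, s.isUnit_mon_H _⟩)
    (c := ![ρ 1, σt 2, σ 1])
    (by simp only [Fin.forall_fin_succ, IsEmpty.forall_iff, and_true]
        exact ⟨h.x_scaled 1, h.zt_scaled 2, h.z_scaled 1⟩)
    (L := [([.F (2 • xi 2 + 2 • xt 2) 1], ![0, -2, 0]),
      ([.mon (curlyCoeff (v ^ 2)) (2 • z 1 - 2 • zt 2) (2 • xi 2 + x 1 + 2 • xt 2)], ![2, -2, -1]),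
      ([.mon (-curlyCoeff (v ^ 2)) (2 • zt 2 - 2 • z 1) (2 • xi 2 + x 1 + 2 • xt 2)],
        ![-2, -2, -1]),
      (curlTerms (curlyCoeff v) (z 2 - zt 2) (zt 2 - z 2) (xi 2 + x 1 + xt 2), ![0, -1, -1]),
      ([.mon (curlyCoeff (v ^ 2)) (2 • z 2 - 2 • z 1) (x 1)], ![-2, 0, -1]),
      ([.mon (-curlyCoeff (v ^ 2)) (2 • z 1 - 2 • z 2) (x 1)], ![2, 0, -1])])
    (by simp [Fin.forall_fin_succ, Term.deg, qExp, curlTerms]) hm (by simp only [List.map_cons, List.map_nil]; decide) he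
  simp only [List.forall_mem_cons, evalSum_cons, evalSum_nil, add_zero] at key
  simp only [curlTerms, List.forall_mem_cons, List.cons_append, List.nil_append]
  exact ⟨key.1, key.2.1, key.2.2.1, key.2.2.2.2.1, key.2.2.2.2.2.1, by simp⟩

theorem eval_fTermsD {s s' : QSystem .D n v R} {σ σt ρ ρt : ℕ → Kˣ} (h : Scaled s s' σ σt ρ ρt)
    (hv : Admissible .D n v) (hn : 3 ≤ n) {i j : ℕ} (hij : i = 1 ∧ j = 2 ∨ i = 2 ∧ j = 1)
    (he : s.evalSum (fTermsD v i j) = s'.evalSum (fTermsD v i j)) :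
    ∀ t ∈ fTermsD v i j, s.eval t = s'.eval t := by
  have hm : (v : K) ^ (2 : ℤ) ≠ 1 := by simpa [dExp] using hv 1 le_rfl (by omega)
  have key := evalSum_eq_of_separated (s := s) (s' := s') (ι := Fin 2) (a := fun _ => 0)
    (ξ := ![x i, x j])
    (by rw [Fin.forall_fin_two]
        exact ⟨by rw [mon_P]; exact (s.isUnit_P_x (by omega) (by omega)).1,
          by rw [mon_P]; exact (s.isUnit_P_x (by omega) (by omega)).1⟩)
    (c := ![ρ i, ρ j]) (by rw [Fin.forall_fin_two]; exact ⟨h.x_scaled i, h.x_scaled j⟩)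
    (L := [([.F (xi 3 + x i + xi j + xt 3) j], ![0, 0]),
      ([.mon (curlyCoeff v) (z 3 - z i) (x i)], ![-1, 0]),
      ([.mon (-curlyCoeff v) (z i - z 3) (x i)], ![1, 0]),
      ([.mon (curlyCoeff v) (z j - zt 3) (xt 3 + xi 3 + x i)], ![0, 1]),
      ([.mon (-curlyCoeff v) (zt 3 - z j) (xt 3 + xi 3 + x i)], ![0, -1])])
    (by rcases hij with ⟨rfl, rfl⟩ | ⟨rfl, rfl⟩ <;> simp [Fin.forall_fin_two, Term.deg, qExp]) hm
    (by simp only [List.map_cons, List.map_nil]; decide) he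
  simpa [fTermsD, curlTerms, evalSum_cons, evalSum_nil] using key

end Scaled

/-- The ratios of the parameters are roots of unity. -/
structure IsTorsion (X : Series) (n : ℕ) (σ σt ρ ρt : ℕ → Kˣ) : Prop where
  -- A bracket gives ratios of square 1, and squared generators in type C double the order. The
  -- exponent 8 is a bound that covers all types.
  z (i : ℕ) (h : 1 ≤ i) (h' : i ≤ n) : σ i ∈ rootsOfUnity 8 K
  x (i : ℕ) (h : 1 ≤ i) (h' : i ≤ n) : ρ i ∈ rootsOfUnity 8 K
  zt (i : ℕ) (h : n - numTilde X n < i) (h' : i ≤ n) : σt i ∈ rootsOfUnity 8 K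
  xt (i : ℕ) (h : n - numTilde X n < i) (h' : i ≤ n) : ρt i ∈ rootsOfUnity 8 K

theorem mem_rootsOfUnity_of_sq {x : Kˣ} (h : x ^ 2 = 1) : x ∈ rootsOfUnity 8 K := by
  rw [mem_rootsOfUnity, show 8 = 2 * 4 from rfl, pow_mul, h, one_pow]

theorem mem_of_inv_mul_mem {G : Type*} [CommGroup G] {H : Subgroup G} {x y : G} (h : x * y⁻¹ ∈ H)
    (hx : x ∈ H) : y ∈ H := by
  have := H.mul_mem (H.inv_mem h) hx
  simpa using this

namespace Scaled

variable [Nontrivial R] {s s' : QSystem X n v R} {σ σt ρ ρt : ℕ → Kˣ}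
  (h : Scaled s s' σ σt ρ ρt) (hv : Admissible X n v)
include h hv

/-- The second bracket is informative only for i < n: for i = n its monomial contains x_{n+1}⁻¹ = 0.
-/
theorem ratios_general {i : ℕ} (hi : IsGeneral X i) (hin : i ≤ n)
    (he : s.evalSum (fTerms X v i) = s'.evalSum (fTerms X v i)) :
    ((σ (i + 1) * (σ i)⁻¹) ^ 2 = 1 ∧ ρ i ^ 2 = 1) ∧ (i < n →
      (σt i * (σt (i + 1))⁻¹) ^ 2 = 1 ∧ ((ρ (i + 1))⁻¹ * ρ i * ρt (i + 1)) ^ 2 = 1) := by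
  have h2 := hi.two_le
  have key := h.eval_fTermsGen hv hi hin he
  have hxt : n - numTilde X n < i := by
    cases X <;> simp [IsGeneral, numTilde] at hi ⊢ <;> omega
  have hd : dExp X i = qExp X := by
    cases X
    · exact hi.elim
    all_goals
      simp [dExp, qExp]
      try omega
  have hcc : curlyCoeff (v ^ qExp X) ≠ 0 := by
    refine curlyCoeff_ne_zero ?_
    rw [Units.val_pow_eq_pow_val, ← hd]
    exact hv i (by omega) hin
  simp only [fTermsGen, curlTerms, List.forall_mem_cons, List.cons_append, List.nil_append] at key
  obtain ⟨-, k1, k2, k3, k4, -⟩ := key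
  have hx := s'.isUnit_P_x (i := i) (by omega) hin
  refine ⟨eq_one_of_curlTerms hcc (h.z_sub_z _ _) (h.x_scaled i) hx.1 (by abel) k1 k2,
    fun hin' => ?_⟩
  refine eq_one_of_curlTerms hcc (h.zt_sub_zt _ _) ?_ ?_ (by abel) k3 k4
  · simpa using ((h.xi_scaled (i + 1)).add (h.x_scaled i)).add (h.xt_scaled (i + 1))
  · rw [P_add, P_add]
    exact ((s'.isUnit_P_x (by omega) (by omega)).2.mul hx.1).mul
      (s'.isUnit_P_xt (by omega) (by omega)).1

/-- Descending induction along the chain, starting from z_{n+1} = 1. -/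
theorem sq_eq_one_of_isGeneral (h1 : σ (n + 1) = 1)
    (he : ∀ i, 1 ≤ i → i ≤ n → s.evalSum (fTerms X v i) = s'.evalSum (fTerms X v i))
    {i : ℕ} (hi : IsGeneral X i) (hin : i ≤ n + 1) : σ i ^ 2 = 1 := by
  obtain ⟨t, ht⟩ : ∃ t, i + t = n + 1 := ⟨n + 1 - i, by omega⟩
  induction t generalizing i with
  | zero =>
    obtain rfl : i = n + 1 := by omega
    rw [h1, one_pow]
  | succ t ih =>
    have := hi.two_le
    have h2 := (h.ratios_general hv hi (by omega) (he i (by omega) (by omega))).1.1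
    rwa [mul_pow, ih (hi.mono (by omega)) (by omega) (by omega), one_mul, inv_pow, inv_eq_one] at h2

/-- The parameters of the second kind at the general nodes. -/
theorem tilde_mem_of_isGeneral {i₀ : ℕ} (hi₀ : IsGeneral X i₀) (h1 : σt i₀ ∈ rootsOfUnity 8 K)
    (h2 : ρt i₀ ∈ rootsOfUnity 8 K)
    (he : ∀ i, 1 ≤ i → i ≤ n → s.evalSum (fTerms X v i) = s'.evalSum (fTerms X v i))
    {i : ℕ} (hi : i₀ ≤ i) (hin : i ≤ n) : σt i ∈ rootsOfUnity 8 K ∧ ρt i ∈ rootsOfUnity 8 K := by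
  have := hi₀.two_le
  induction i, hi using Nat.le_induction with
  | base => exact ⟨h1, h2⟩
  | succ i hi ih =>
    have k1 := h.ratios_general hv (hi₀.mono hi) (by omega) (he i (by omega) (by omega))
    have k2 := h.ratios_general hv (hi₀.mono (by omega : i₀ ≤ i + 1)) hin (he _ (by omega) hin)
    have k3 := k1.2 (by omega)
    refine ⟨mem_of_inv_mul_mem (mem_rootsOfUnity_of_sq k3.1) (ih (by omega)).1, ?_⟩
    refine (Subgroup.mul_mem_cancel_left _ ?_).1 (mem_rootsOfUnity_of_sq k3.2)
    exact mul_mem (inv_mem (mem_rootsOfUnity_of_sq k2.1.2)) (mem_rootsOfUnity_of_sq k1.1.2)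

end Scaled

namespace Scaled

variable [Nontrivial R] {σ σt ρ ρt : ℕ → Kˣ}

/-- Here the bracket of f_i compares z_{i-1} with z_i, so the induction ascends from z_0 = 1. -/
theorem isTorsion_A {s s' : QSystem .A n v R} (h : Scaled s s' σ σt ρ ρt)
    (hv : Admissible .A n v) (h0 : σ 0 = 1)
    (he : ∀ i, 1 ≤ i → i ≤ n → s.evalSum (fTerms .A v i) = s'.evalSum (fTerms .A v i)) :
    IsTorsion .A n σ σt ρ ρt := by
  have key (i : ℕ) (hi : 1 ≤ i) (hin : i ≤ n) :
      (σ (i - 1) * (σ i)⁻¹) ^ 2 = 1 ∧ ρ i ^ 2 = 1 := by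
    have hcc : curlyCoeff v ≠ 0 := curlyCoeff_ne_zero (by simpa [dExp] using hv i hi hin)
    have key := eval_fTermsA h hv hi hin (he i hi hin)
    simp only [fTermsA, curlTerms, List.forall_mem_cons] at key
    exact eq_one_of_curlTerms hcc (h.z_sub_z _ _) (h.x_scaled i) (s'.isUnit_P_x hi hin).1
      (by abel) key.2.1 key.2.2.1
  have hσ (i : ℕ) (hin : i ≤ n) : σ i ∈ rootsOfUnity 8 K := by
    induction i with
    | zero => rw [h0]; exact one_mem _
    | succ i ih =>
      exact mem_of_inv_mul_mem (mem_rootsOfUnity_of_sq (key (i + 1) (by omega) hin).1)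
        (ih (by omega))
  exact ⟨fun i _ => hσ i, fun i hi hin => mem_rootsOfUnity_of_sq (key i hi hin).2,
    fun i hi hin => by simp [numTilde] at hi; omega, fun i hi hin => by simp [numTilde] at hi; omega⟩

/-- At the first node the brackets are not symmetric, as half of z_1 is absorbed in y_1. The first
bracket gives σ_2 ρ_1 = 1 and σ_1 σ_2⁻¹ ρ_1 = 1, which with σ_2² = 1 yields σ_1 = 1. The second
bracket then starts the induction for the tilded parameters. -/
theorem isTorsion_B {s s' : QSystem .B n v R} (h : Scaled s s' σ σt ρ ρt) (hn : 1 ≤ n)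
    (hv : Admissible .B n v) (h1 : σ (n + 1) = 1)
    (he : ∀ i, 1 ≤ i → i ≤ n → s.evalSum (fTerms .B v i) = s'.evalSum (fTerms .B v i)) :
    IsTorsion .B n σ σt ρ ρt := by
  have key := eval_fTermsB h hv hn (he 1 le_rfl hn)
  have hcc : curlyCoeff v ≠ 0 := curlyCoeff_ne_zero (by simpa [dExp] using hv 1 le_rfl hn)
  simp only [fTermsB, curlTerms, List.forall_mem_cons, List.cons_append, List.nil_append] at key
  obtain ⟨-, k1, k2, k3, k4, -⟩ := key
  have hx := s'.isUnit_P_x (i := 1) (by omega) hn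
  have e1 := ((h.z_scaled 2).mul_mon (h.x_scaled 1)).eq_one hx.1 hcc k1
  have e2 := ((h.z_sub_z 1 2).mul_mon (h.x_scaled 1)).eq_one hx.1 (neg_ne_zero.2 hcc) k2
  have hσ2 := h.sq_eq_one_of_isGeneral hv h1 he (i := 2) (le_refl 2) (by omega)
  have e1' : ρ 1 = (σ 2)⁻¹ := eq_inv_of_mul_eq_one_right e1
  have hσ1' : σ 1 = 1 := by
    rw [e1', mul_assoc, ← mul_inv, ← pow_two, hσ2, inv_one, mul_one] at e2
    exact e2
  have hρ1 : ρ 1 ^ 2 = 1 := by rw [e1', inv_pow, hσ2, inv_one]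
  have hρ (i : ℕ) (hi : 1 ≤ i) (hin : i ≤ n) : ρ i ∈ rootsOfUnity 8 K := by
    rcases hi.eq_or_lt with rfl | hi'
    · exact mem_rootsOfUnity_of_sq hρ1
    · exact mem_rootsOfUnity_of_sq (h.ratios_general hv (i := i) hi' hin (he i hi hin)).1.2
  have ht (hn2 : 2 ≤ n) : σt 2 ∈ rootsOfUnity 8 K ∧ ρt 2 ∈ rootsOfUnity 8 K := by
    have hξ : MonScaled s s' ((ρ 2)⁻¹ * ρ 1 * ρt 2) 0 (XExp.xi 2 + XExp.x 1 + XExp.xt 2) := by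
      simpa using ((h.xi_scaled 2).add (h.x_scaled 1)).add (h.xt_scaled 2)
    have hu : IsUnit (s'.P (.ofAdd (XExp.xi 2 + XExp.x 1 + XExp.xt 2))) := by
      rw [P_add, P_add]
      exact ((s'.isUnit_P_x (by omega) hn2).2.mul hx.1).mul
        (s'.isUnit_P_xt (by simp only [numTilde]; omega) hn2).1
    have e3 := ((h.z_sub_zt 1 2).mul_mon hξ).eq_one hu hcc k3
    have e4 := ((h.zt_scaled 2).mul_mon hξ).eq_one hu (neg_ne_zero.2 hcc) k4
    rw [hσ1', one_mul] at e3
    have e5 : σt 2 ^ 2 = 1 := by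
      rw [inv_mul_eq_one] at e3
      rwa [← e3, ← pow_two] at e4
    refine ⟨mem_rootsOfUnity_of_sq e5, mem_rootsOfUnity_of_sq ?_⟩
    have e6 : ((ρ 2)⁻¹ * ρ 1 * ρt 2) ^ 2 = 1 := by
      rw [eq_inv_of_mul_eq_one_right e4, inv_pow, e5, inv_one]
    rwa [mul_pow, mul_pow, hρ1, mul_one, inv_pow, (h.ratios_general hv (i := 2) (le_refl 2) hn2
      (he 2 (by omega) hn2)).1.2, inv_one, one_mul] at e6
  refine ⟨fun i hi hin => ?_, hρ, fun i hi hin => ?_, fun i hi hin => ?_⟩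
  · rcases hi.eq_or_lt with rfl | hi'
    · rw [hσ1']; exact one_mem _
    · exact mem_rootsOfUnity_of_sq (h.sq_eq_one_of_isGeneral hv h1 he (i := i) hi' (by omega))
  all_goals
    have hi2 : 2 ≤ i := by simp only [numTilde] at hi; omega
    have := h.tilde_mem_of_isGeneral hv (i₀ := 2) (le_refl 2) (ht (by omega)).1 (ht (by omega)).2
      he hi2 hin
  exacts [this.1, this.2]

/-- The outer brackets of f_1 contain squares of the z's, so they give only σ_1⁴ = 1. The first
bracket then passes to z̃_2 and x̃_2, where the induction along the chain begins. -/
theorem isTorsion_C {s s' : QSystem .C n v R} (h : Scaled s s' σ σt ρ ρt) (hn : 1 ≤ n)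
    (hv : Admissible .C n v) (h1 : σ (n + 1) = 1)
    (he : ∀ i, 1 ≤ i → i ≤ n → s.evalSum (fTerms .C v i) = s'.evalSum (fTerms .C v i)) :
    IsTorsion .C n σ σt ρ ρt := by
  have key := eval_fTermsC h hv hn (he 1 le_rfl hn)
  have hcc : curlyCoeff (v ^ 2) ≠ 0 := curlyCoeff_ne_zero (by
    rw [Units.val_pow_eq_pow_val]; exact hv 1 le_rfl hn)
  simp only [curlTerms, List.forall_mem_cons, List.cons_append, List.nil_append] at key
  obtain ⟨-, k1, k2, k3, k4, -⟩ := key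
  have hx := s'.isUnit_P_x (i := 1) (by omega) hn
  have hσ2 := h.sq_eq_one_of_isGeneral hv h1 he (i := 2) (le_refl 2) (by omega)
  have e1 := eq_one_of_curlTerms hcc (c := (σ 2 * (σ 1)⁻¹) ^ 2)
    (by simpa [smul_sub] using (h.z_sub_z 2 1).nsmul 2) (h.x_scaled 1) hx.1 (by abel) k3 k4
  have hσ1 : σ 1 ∈ rootsOfUnity 8 K := by
    have e2 := e1.1
    rw [mul_pow, hσ2, one_mul, inv_pow, inv_pow, inv_eq_one, ← pow_mul] at e2
    rw [mem_rootsOfUnity, show 8 = 2 * 2 * 2 from rfl, pow_mul, e2, one_pow]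
  have hρ (i : ℕ) (hi : 1 ≤ i) (hin : i ≤ n) : ρ i ^ 2 = 1 := by
    rcases hi.eq_or_lt with rfl | hi'
    · exact e1.2
    · exact (h.ratios_general hv (i := i) hi' hin (he i hi hin)).1.2
  have ht (hn2 : 2 ≤ n) : σt 2 ∈ rootsOfUnity 8 K ∧ ρt 2 ∈ rootsOfUnity 8 K := by
    have hξ : MonScaled s s' ((ρ 2)⁻¹ ^ 2 * ρ 1 * ρt 2 ^ 2) 0
        (2 • XExp.xi 2 + XExp.x 1 + 2 • XExp.xt 2) := by
      simpa using (((h.xi_scaled 2).nsmul 2).add (h.x_scaled 1)).add ((h.xt_scaled 2).nsmul 2)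
    have hu : IsUnit (s'.P (.ofAdd (2 • XExp.xi 2 + XExp.x 1 + 2 • XExp.xt 2))) := by
      rw [P_add, P_add, ofAdd_nsmul, ofAdd_nsmul, map_pow, map_pow]
      exact (((s'.isUnit_P_x (by omega) hn2).2.pow 2).mul hx.1).mul
        ((s'.isUnit_P_xt (by simp only [numTilde]; omega) hn2).1.pow 2)
    have e3 := eq_one_of_curlTerms hcc (c := (σ 1 * (σt 2)⁻¹) ^ 2)
      (by simpa [smul_sub] using (h.z_sub_zt 1 2).nsmul 2) hξ hu (by abel) k1 k2
    constructor
    · refine mem_of_inv_mul_mem (x := σ 1) ?_ hσ1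
      rw [mem_rootsOfUnity, show 8 = 2 * 2 * 2 from rfl, pow_mul, pow_mul, e3.1, one_pow]
    · have e4 := e3.2
      rw [inv_pow, hρ 2 (by omega) hn2, inv_one, one_mul, mul_pow, e1.2, one_mul, ← pow_mul] at e4
      rw [mem_rootsOfUnity, show 8 = 2 * 2 * 2 from rfl, pow_mul, e4, one_pow]
  refine ⟨fun i hi hin => ?_, fun i hi hin => mem_rootsOfUnity_of_sq (hρ i hi hin),
    fun i hi hin => ?_, fun i hi hin => ?_⟩
  · rcases hi.eq_or_lt with rfl | hi'
    · exact hσ1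
    · exact mem_rootsOfUnity_of_sq (h.sq_eq_one_of_isGeneral hv h1 he (i := i) hi' (by omega))
  all_goals
    have hi2 : 2 ≤ i := by simp only [numTilde] at hi; omega
    have := h.tilde_mem_of_isGeneral hv (i₀ := 2) (le_refl 2) (ht (by omega)).1 (ht (by omega)).2
      he hi2 hin
  exacts [this.1, this.2]

/-- Starting from σ_3² = 1, the first brackets of f_1 and f_2 determine the ratios at the nodes 1
and 2, and a second bracket passes on to z̃_3 and x̃_3. -/
theorem isTorsion_D {s s' : QSystem .D n v R} (h : Scaled s s' σ σt ρ ρt) (hn : 3 ≤ n)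
    (hv : Admissible .D n v) (h1 : σ (n + 1) = 1)
    (he : ∀ i, 1 ≤ i → i ≤ n → s.evalSum (fTerms .D v i) = s'.evalSum (fTerms .D v i)) :
    IsTorsion .D n σ σt ρ ρt := by
  have hcc : curlyCoeff v ≠ 0 := curlyCoeff_ne_zero (by simpa [dExp] using hv 1 le_rfl (by omega))
  have hσ3 := h.sq_eq_one_of_isGeneral hv h1 he (i := 3) (le_refl 3) (by omega)
  have key {i j : ℕ} (hij : i = 1 ∧ j = 2 ∨ i = 2 ∧ j = 1)
      (he : s.evalSum (fTermsD v i j) = s'.evalSum (fTermsD v i j)) :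
      (σ i ^ 2 = 1 ∧ ρ i ^ 2 = 1) ∧ (σ j * (σt 3)⁻¹) ^ 2 = 1 ∧
        (ρt 3 * (ρ 3)⁻¹ * ρ i) ^ 2 = 1 := by
    have key := eval_fTermsD h hv hn hij he
    simp only [fTermsD, curlTerms, List.forall_mem_cons, List.cons_append, List.nil_append] at key
    obtain ⟨-, k1, k2, k3, k4, -⟩ := key
    have hx := s'.isUnit_P_x (i := i) (by omega) (by omega)
    have e1 := eq_one_of_curlTerms hcc (h.z_sub_z 3 i) (h.x_scaled i) hx.1 (by abel) k1 k2
    rw [mul_pow, hσ3, one_mul, inv_pow, inv_eq_one] at e1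
    refine ⟨e1, eq_one_of_curlTerms hcc (h.z_sub_zt j 3) ?_ ?_ (by abel) k3 k4⟩
    · simpa using ((h.xt_scaled 3).add (h.xi_scaled 3)).add (h.x_scaled i)
    · rw [P_add, P_add]
      exact ((s'.isUnit_P_xt (by simp only [numTilde]; omega) hn).1.mul
        (s'.isUnit_P_x (by omega) hn).2).mul hx.1
  have key1 := key (.inl ⟨rfl, rfl⟩) (he 1 le_rfl (by omega))
  have key2 := key (.inr ⟨rfl, rfl⟩) (he 2 (by omega) (by omega))
  have hρ3 := (h.ratios_general hv (i := 3) (le_refl 3) hn (he 3 (by omega) hn)).1.2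
  have ht1 : σt 3 ^ 2 = 1 := by
    have := key1.2.1
    rwa [mul_pow, key2.1.1, one_mul, inv_pow, inv_eq_one] at this
  have ht2 : ρt 3 ^ 2 = 1 := by
    have := key1.2.2
    rwa [mul_pow, mul_pow, key1.1.2, mul_one, inv_pow, hρ3, inv_one, mul_one] at this
  refine ⟨fun i hi hin => ?_, fun i hi hin => ?_, fun i hi hin => ?_, fun i hi hin => ?_⟩
  · obtain rfl | rfl | hi' : i = 1 ∨ i = 2 ∨ 3 ≤ i := by omega
    · exact mem_rootsOfUnity_of_sq key1.1.1
    · exact mem_rootsOfUnity_of_sq key2.1.1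
    · exact mem_rootsOfUnity_of_sq (h.sq_eq_one_of_isGeneral hv h1 he (i := i) hi' (by omega))
  · obtain rfl | rfl | hi' : i = 1 ∨ i = 2 ∨ 3 ≤ i := by omega
    · exact mem_rootsOfUnity_of_sq key1.1.2
    · exact mem_rootsOfUnity_of_sq key2.1.2
    · exact mem_rootsOfUnity_of_sq (h.ratios_general hv (i := i) hi' hin (he i hi hin)).1.2
  all_goals
    have hi2 : 3 ≤ i := by simp only [numTilde] at hi; omega
    have := h.tilde_mem_of_isGeneral hv (i₀ := 3) (le_refl 3) (mem_rootsOfUnity_of_sq ht1)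
      (mem_rootsOfUnity_of_sq ht2) he hi2 hin
  exacts [this.1, this.2]

theorem isTorsion {s s' : QSystem X n v R} (h : Scaled s s' σ σt ρ ρt) (hn : minRank X ≤ n)
    (hv : Admissible X n v) (h0 : σ 0 = 1) (h1 : σ (n + 1) = 1)
    (he : ∀ i, 1 ≤ i → i ≤ n → s.evalSum (fTerms X v i) = s'.evalSum (fTerms X v i)) :
    IsTorsion X n σ σt ρ ρt := by
  cases X
  · exact h.isTorsion_A hv h0 he
  · exact h.isTorsion_B hn hv h1 he
  · exact h.isTorsion_C hn hv h1 he
  · exact h.isTorsion_D hn hv h1 he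

end Scaled

end QSystem

end QuantumSeries

namespace QuantumSeries
open ZExp XExp

/-! ### Determination of a system by the images of the generators -/

namespace QSystem

/-- Modulo the z's and z̃'s the image of t_i is T_i. -/
theorem map_tExp {G : Type*} [AddCommGroup G] (f : ZExp →+ G) (hz : ∀ i, f (z i) = 0)
    (hzt : ∀ i, f (zt i) = 0) (X : Series) (i : ℕ) (hi : 1 ≤ i) : f (tExp X i) = f (t i) := by
  have gen : f (tExpGen X i) = f (t i) := by
    have : f (lowerExp X i) = 0 := by
      cases X <;> simp only [lowerExp] <;> try split_ifs
      all_goals simp [hz, hzt]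
    simp [tExpGen, eExp, hz, hzt, this]
  cases X
  · simp [tExp, tExpA, hz]
  all_goals
    simp only [tExp]
    split_ifs
    all_goals first
      | exact gen
      | (subst i; simp [tExpB, tExpC, tExpD, hz, hzt])

/-- The terms that are monomials. -/
def Term.IsMon {K : Type*} : Term K → Prop
  | .mon _ _ _ => True
  | _ => False

variable {K : Type*} [Field K] {X : Series} {n : ℕ} {v : Kˣ} {R : Type*} [Ring R] [Algebra K R]

theorem isMon_curlTerms (c : K) (a b : ZExp) (ξ : XExp) : ∀ t ∈ curlTerms c a b ξ, t.IsMon := by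
  simp [curlTerms, Term.IsMon]

theorem eTerms_eq_cons (X : Series) (v : Kˣ) (i : ℕ) :
    ∃ l, eTerms X v i = .E i :: l ∧ ∀ t ∈ l, t.IsMon := by
  cases X <;> simp only [eTerms] <;> try split_ifs
  all_goals
    try subst i
    refine ⟨_, rfl, ?_⟩
    simp [curlTerms, Term.IsMon]

/-- The element F_j with j < n occurs with an invertible coefficient in some f_i: i = j + 1 in type
A, i the other one of 1 and 2 for these nodes in type D, and i = j otherwise. -/
theorem fTerms_eq_cons (s : QSystem X n v R) (hn : minRank X ≤ n) {j : ℕ} (hj : 1 ≤ j)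
    (hjn : j < n) : ∃ i, 1 ≤ i ∧ i ≤ n ∧ ∃ ξ l, fTerms X v i = .F ξ j :: l ∧
      IsUnit (s.P (.ofAdd ξ)) ∧ ∀ t ∈ l, t.IsMon := by
  have gen (hg : IsGeneral X j) : ∃ i, 1 ≤ i ∧ i ≤ n ∧ ∃ ξ l, fTerms X v i = .F ξ j :: l ∧
      IsUnit (s.P (.ofAdd ξ)) ∧ ∀ t ∈ l, t.IsMon := by
    refine ⟨j, hj, hjn.le, _, _, hg.fTerms_eq v, ?_, by simp [curlTerms, Term.IsMon]⟩
    have hxt : n - numTilde X n < j := by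
      cases X <;> simp [IsGeneral, numTilde] at hg ⊢ <;> omega
    simp only [P_add]
    exact (((s.isUnit_P_x (by omega) (by omega)).2.mul (s.isUnit_P_x hj hjn.le).1).mul
      (s.isUnit_P_xt (by omega) (by omega)).1).mul (s.isUnit_P_xt hxt hjn.le).2
  by_cases hg : IsGeneral X j
  · exact gen hg
  rcases not_isGeneral hj hg with rfl | ⟨rfl, rfl⟩ | ⟨rfl, rfl⟩ | ⟨rfl, rfl | rfl⟩
  · refine ⟨j + 1, by omega, hjn, _, _, rfl, ?_, isMon_curlTerms _ _ _ _⟩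
    rw [P_add]
    exact (s.isUnit_P_x hj hjn.le).2.mul (s.isUnit_P_x (by omega) hjn).1
  · refine ⟨1, le_rfl, hjn.le, _, _, rfl, ?_, by simp [curlTerms, Term.IsMon]⟩
    rw [P_add]
    exact (s.isUnit_P_x (by omega) hjn).2.mul
      (s.isUnit_P_xt (by simp only [numTilde]; omega) hjn).1
  · refine ⟨1, le_rfl, hjn.le, _, _, rfl, ?_, by simp [curlTerms, Term.IsMon]⟩
    rw [P_add, ofAdd_nsmul, ofAdd_nsmul, map_pow, map_pow]
    exact ((s.isUnit_P_x (by omega) hjn).2.pow 2).mul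
      ((s.isUnit_P_xt (by simp only [numTilde]; omega) hjn).1.pow 2)
  all_goals
    replace hn : 3 ≤ n := hn
  · refine ⟨2, by omega, by omega, _, _, rfl, ?_, by simp [curlTerms, Term.IsMon]⟩
    simp only [P_add]
    exact (((s.isUnit_P_x (by omega) (by omega)).2.mul (s.isUnit_P_x (by omega) (by omega)).1).mul
      (s.isUnit_P_x (by omega) (by omega)).2).mul
      (s.isUnit_P_xt (by simp only [numTilde]; omega) (by omega)).1
  · refine ⟨1, by omega, by omega, _, _, rfl, ?_, by simp [curlTerms, Term.IsMon]⟩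
    simp only [P_add]
    exact (((s.isUnit_P_x (by omega) (by omega)).2.mul (s.isUnit_P_x (by omega) (by omega)).1).mul
      (s.isUnit_P_x (by omega) (by omega)).2).mul
      (s.isUnit_P_xt (by simp only [numTilde]; omega) (by omega)).1

theorem evalSum_eq_of_isMon {s s' : QSystem X n v R} (hH : s.H = s'.H) (hP : s.P = s'.P)
    {l : List (Term K)} (hl : ∀ t ∈ l, t.IsMon) : s.evalSum l = s'.evalSum l := by
  induction l with
  | nil => rfl
  | cons t l ih =>
    rw [evalSum_cons, evalSum_cons, ih fun t ht => hl t (by simp [ht])]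
    congr 1
    have := hl t (by simp)
    cases t with
    | mon c a ξ => simp only [eval, mon, hH, hP]
    | E i => exact this.elim
    | F ξ i => exact this.elim

/-- The exponents on which two systems agree form a subgroup. It contains the z's and z̃'s, so it
contains the image exponent of t_i exactly if it contains that of T_i. -/
theorem H_eq_of_tExp {s s' : QSystem X n v R} (hz : ∀ i, s.H (.ofAdd (z i)) = s'.H (.ofAdd (z i)))
    (hzt : ∀ i, s.H (.ofAdd (zt i)) = s'.H (.ofAdd (zt i)))
    (ht : ∀ i, ¬ (1 ≤ i ∧ i ≤ n) → s.H (.ofAdd (t i)) = s'.H (.ofAdd (t i)))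
    (ht' : ∀ i, 1 ≤ i → i ≤ n → s.H (.ofAdd (tExp X i)) = s'.H (.ofAdd (tExp X i))) :
    s.H = s'.H := by
  let A : AddSubgroup ZExp := Subgroup.toAddSubgroup' (s.H.eqLocus s'.H)
  have hA (a : ZExp) : a ∈ A ↔ s.H (.ofAdd a) = s'.H (.ofAdd a) := Iff.rfl
  have key (i : ℕ) : t i ∈ A := by
    by_cases hi : 1 ≤ i ∧ i ≤ n
    · have := map_tExp (QuotientAddGroup.mk' A)
        (fun i => (QuotientAddGroup.eq_zero_iff _).2 (hz i))
        (fun i => (QuotientAddGroup.eq_zero_iff _).2 (hzt i)) X i hi.1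
      rw [← QuotientAddGroup.eq_zero_iff]
      refine this.symm.trans ((QuotientAddGroup.eq_zero_iff _).2 (ht' i hi.1 hi.2))
    · exact ht i hi
  refine MonoidHom.ext fun a => ?_
  change Multiplicative.toAdd a ∈ A
  generalize Multiplicative.toAdd a = b
  induction b using ZExp.induction with
  | zero => exact A.zero_mem
  | add a b ha hb => exact A.add_mem ha hb
  | neg a ha => exact A.neg_mem ha
  | single l =>
    cases l with
    | z i => exact hz i
    | zt i => exact hzt i
    | t i => exact key i

theorem E_eq_of_eTerms {s s' : QSystem X n v R} (hH : s.H = s'.H) (hP : s.P = s'.P) {i : ℕ}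
    (he : s.evalSum (eTerms X v i) = s'.evalSum (eTerms X v i)) : s.E i = s'.E i := by
  obtain ⟨l, hl, hm⟩ := eTerms_eq_cons X v i
  rw [hl, evalSum_cons, evalSum_cons, evalSum_eq_of_isMon hH hP hm] at he
  exact add_right_cancel he

theorem F_eq_of_fTerms {s s' : QSystem X n v R} (hn : minRank X ≤ n) (hH : s.H = s'.H)
    (hP : s.P = s'.P)
    (hf : ∀ i, 1 ≤ i → i ≤ n → s.evalSum (fTerms X v i) = s'.evalSum (fTerms X v i))
    {j : ℕ} (hj : 1 ≤ j) (hjn : j < n) : s.F j = s'.F j := by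
  obtain ⟨i, hi, hin, ξ, l, hl, hu, hm⟩ := s.fTerms_eq_cons hn hj hjn
  have h := hf i hi hin
  rw [hl, evalSum_cons, evalSum_cons, evalSum_eq_of_isMon hH hP hm] at h
  replace h : s.P (.ofAdd ξ) * s.F j = s'.P (.ofAdd ξ) * s'.F j := add_right_cancel h
  rw [← hP] at h
  exact hu.mul_left_cancel h

end QSystem

end QuantumSeries

namespace QuantumSeries
open ZExp XExp

/-! ### Dependence of the representations on the parameters -/

theorem units_inv_eq_smul {K R : Type*} [Field K] [Ring R] [Algebra K R] {a b : Rˣ} {c : Kˣ}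
    (h : (a : R) = (c : K) • (b : R)) :
    ((a⁻¹ : Rˣ) : R) = ((c⁻¹ : Kˣ) : K) • ((b⁻¹ : Rˣ) : R) := by
  refine Units.inv_eq_of_mul_eq_one_right ?_
  rw [h, smul_mul_smul_comm, Units.mul_inv, ← Units.val_mul, mul_inv_cancel, Units.val_one, one_smul]

namespace Weyl

variable {K : Type u} [Field K]

theorem shiftOp_eq_smul (N : ℕ) {a b : Fin N → Kˣ} {c : Kˣ} (h : ∀ j, a j = c * b j) :
    (shiftOp N a : Module.End K (Fin N → K)) = (c : K) • (shiftOp N b : Module.End K (Fin N → K)) := by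
  refine LinearMap.ext fun y => funext fun j => ?_
  change (a j : K) * _ = (c : K) * ((b j : K) * _)
  rw [h, Units.val_mul, mul_assoc]

theorem diagOp_eq_smul (N : ℕ) {a b : Fin N → Kˣ} {c : Kˣ} (h : ∀ j, a j = c * b j) :
    (diagOp N a : Module.End K (Fin N → K)) = (c : K) • (diagOp N b : Module.End K (Fin N → K)) := by
  refine LinearMap.ext fun y => funext fun j => ?_
  change (a j : K) * _ = (c : K) * ((b j : K) * _)
  rw [h, Units.val_mul, mul_assoc]

variable (p q : Kˣ) (d : ℕ) (hpq : p ^ d = q) (N : ℕ) (hN : q ^ N = 1) (g h g' h' : Kˣ)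

theorem sigma_z : sigma p q d hpq N hN g h (Weyl.z (q : K)) =
    (((h * h'⁻¹) ^ d : Kˣ) : K) • sigma p q d hpq N hN g' h' (Weyl.z (q : K)) := by
  rw [sigma, lift_z, sigma, lift_z]
  refine diagOp_eq_smul N fun j => ?_
  rw [← mul_pow, ← mul_assoc, inv_mul_cancel_right]

theorem sigma_x : sigma p q d hpq N hN g h (Weyl.x (q : K)) =
    (((h * h'⁻¹) ^ (1 - d : ℤ) * (g * g'⁻¹) : Kˣ) : K) •
      sigma p q d hpq N hN g' h' (Weyl.x (q : K)) := by
  rw [sigma, lift_x, sigma, lift_x]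
  refine shiftOp_eq_smul N fun j => ?_
  rw [mul_mul_mul_comm, ← mul_zpow, ← mul_assoc (h * h'⁻¹), inv_mul_cancel_right,
    inv_mul_cancel_right]

theorem sigma_x_inv : sigma p q d hpq N hN g h (((Weyl.x (q : K))⁻¹ : (Weyl (q : K))ˣ)) =
    ((((h * h'⁻¹) ^ (1 - d : ℤ) * (g * g'⁻¹))⁻¹ : Kˣ) : K) •
      sigma p q d hpq N hN g' h' (((Weyl.x (q : K))⁻¹ : (Weyl (q : K))ˣ)) := by
  have := sigma_x p q d hpq N hN g h g' h'
  rw [sigma, lift_x, sigma, lift_x] at this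
  rw [sigma, lift_x_inv, sigma, lift_x_inv]
  exact units_inv_eq_smul this

end Weyl

/-! ### The system attached to a tuple of parameters. -/

section Rep

variable {K : Type u} [Field K] (X : Series) (n : ℕ) (v : Kˣ) (N : ℕ)
  (hN : (v ^ qExp X) ^ N = 1) {V : Type w} [AddCommGroup V] [Module K V]

/-- The representation of the target algebra given by the parameters. -/
def targetRep (p : (WIdx X n → Kˣ) × (WIdx X n → Kˣ) × (UBar X n (v : K) →ₐ[K] Module.End K V)) :
    Target X n v →ₐ[K] Module.End K (WSpace K X n N ⊗[K] V) :=
  (Module.endTensorEndAlgHom (R := K) (S := K) (A := K)).comp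
    ((Algebra.TensorProduct.map (AlgHom.id K _) p.2.2).comp
      (Algebra.TensorProduct.map (sigma X n v N hN p.1 p.2.1) (AlgHom.id K _)))

theorem piRep_apply (ρ : U X n (v : K) →ₐ[K] Target X n v)
    (p : (WIdx X n → Kˣ) × (WIdx X n → Kˣ) × (UBar X n (v : K) →ₐ[K] Module.End K V))
    (y : U X n (v : K)) :
    piRep X n v N ρ hN p.1 p.2.1 p.2.2 y = targetRep X n v N hN p (ρ y) := rfl

/-- The action of an endomorphism of one factor. -/
def factorEnd (k : WIdx X n) :
    Module.End K (Fin N → K) →ₗ[K] Module.End K (WSpace K X n N ⊗[K] V) :=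
  (LinearMap.rTensorHom V).comp
    ((PiTensorProduct.mapMultilinear K (fun _ : WIdx X n => Fin N → K) fun _ => Fin N → K).toLinearMap
      1 k)

theorem targetRep_weylIncl
    (p : (WIdx X n → Kˣ) × (WIdx X n → Kˣ) × (UBar X n (v : K) →ₐ[K] Module.End K V))
    (k : WIdx X n) (a : Weyl ((v ^ qExp X : Kˣ) : K)) :
    targetRep X n v N hN p (weylIncl X n v k a) = factorEnd X n N k
      (Weyl.sigma (rootParam X n v k) (v ^ qExp X) (rootDeg X n k) (rootParam_pow X n v k) N hN
        (p.1 k) (p.2.1 k) a) := by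
  have h1 : sigma X n v N hN p.1 p.2.1 (weylSingle X n v k a) =
      (PiTensorProduct.mapMultilinear K (fun _ : WIdx X n => Fin N → K) fun _ => Fin N → K).toLinearMap
      1 k (Weyl.sigma (rootParam X n v k) (v ^ qExp X) (rootDeg X n k) (rootParam_pow X n v k) N hN
        (p.1 k) (p.2.1 k) a) := by
    refine (PiTensorProduct.lift.tprod _).trans ?_
    refine congrArg (PiTensorProduct.mapMultilinear K (fun _ : WIdx X n => Fin N → K)
      fun _ => Fin N → K) (funext fun j => ?_)
    exact Pi.apply_mulSingle (fun j => Weyl.sigma (rootParam X n v j) (v ^ qExp X) (rootDeg X n j)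
      (rootParam_pow X n v j) N hN (p.1 j) (p.2.1 j)) (fun j => map_one _) k a j
  have h2 : targetRep X n v N hN p (weylIncl X n v k a) =
      Module.endTensorEndAlgHom (R := K) (S := K) (A := K)
        (sigma X n v N hN p.1 p.2.1 (weylSingle X n v k a) ⊗ₜ[K] p.2.2 1) := rfl
  rw [h2, h1, map_one]
  rfl

theorem targetRep_uIncl
    (p : (WIdx X n → Kˣ) × (WIdx X n → Kˣ) × (UBar X n (v : K) →ₐ[K] Module.End K V))
    (b : UBar X n (v : K)) (y : WSpace K X n N) (y' : V) :
    targetRep X n v N hN p (uIncl X n v b) (y ⊗ₜ[K] y') = y ⊗ₜ[K] p.2.2 b y' := by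
  have h : targetRep X n v N hN p (uIncl X n v b) =
      Module.endTensorEndAlgHom (R := K) (S := K) (A := K)
        (sigma X n v N hN p.1 p.2.1 1 ⊗ₜ[K] p.2.2 b) := rfl
  rw [h, map_one]
  rfl

/-- The ring of endomorphisms of the representation space. -/
@[reducible] def endRing : Ring (Module.End K (WSpace K X n N ⊗[K] V)) :=
  let _ : AddCommGroup (WSpace K X n N ⊗[K] V) := TensorProduct.addCommGroup
  Module.End.instRing

attribute [local instance] endRing

/-- The system given by a representation of the target algebra. -/
def repSystem (p : (WIdx X n → Kˣ) × (WIdx X n → Kˣ) × (UBar X n (v : K) →ₐ[K] Module.End K V)) :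
    QSystem X n v (Module.End K (WSpace K X n N ⊗[K] V)) :=
  (targetSystem X n v).map (targetRep X n v N hN p)

variable (p p' : (WIdx X n → Kˣ) × (WIdx X n → Kˣ) × (UBar X n (v : K) →ₐ[K] Module.End K V))

/-- The ratio of the images of `z` in a factor. -/
def zRatio (k : WIdx X n) : Kˣ := (p.2.1 k * (p'.2.1 k)⁻¹) ^ rootDeg X n k

/-- The ratio of the images of `x` in a factor. -/
def xRatio (k : WIdx X n) : Kˣ :=
  (p.2.1 k * (p'.2.1 k)⁻¹) ^ (1 - rootDeg X n k : ℤ) * (p.1 k * (p'.1 k)⁻¹)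

theorem repSystem_H (l : ZLabel) (hl : ∀ i, l ≠ .t i) :
    QSystem.MonScaled (repSystem X n v N hN p) (repSystem X n v N hN p')
      ((l.pos X n).elim 1 (zRatio X n v p p')) (Finsupp.single l 1) 0 := by
  rw [QSystem.MonScaled, QSystem.mon_H, QSystem.mon_H, repSystem, repSystem, QSystem.map_H,
    QSystem.map_H, targetSystem_H_single, zElem_eq _ _ _ hl]
  rcases l.pos X n with - | k
  · simp
  · change targetRep X n v N hN p (weylIncl X n v k (Weyl.z _).val) =
      (zRatio X n v p p' k : K) • targetRep X n v N hN p' (weylIncl X n v k (Weyl.z _).val)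
    rw [targetRep_weylIncl, targetRep_weylIncl, ← map_smul]
    exact congrArg _ (Weyl.sigma_z _ _ _ _ _ _ _ _ _ _)

theorem repSystem_P (l : XLabel) :
    QSystem.MonScaled (repSystem X n v N hN p) (repSystem X n v N hN p')
      (((l.pos X n).elim 1 (xRatio X n v p p')) ^ l.sign) 0 (Finsupp.single l 1) := by
  rw [QSystem.MonScaled, QSystem.mon_P, QSystem.mon_P, repSystem, repSystem, QSystem.map_P,
    QSystem.map_P, targetSystem_P_single, xElem]
  rcases l.pos X n with - | k
  · simp
  · rw [Option.elim_some, Option.elim_some, targetRep_weylIncl, targetRep_weylIncl, ← map_smul,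
      weylPow]
    refine congrArg _ ?_
    rcases l.sign_eq with h | h <;> rw [h]
    · rw [zpow_one, zpow_one]
      exact Weyl.sigma_x _ _ _ _ _ _ _ _ _ _
    · rw [zpow_neg_one, zpow_neg_one]
      exact Weyl.sigma_x_inv _ _ _ _ _ _ _ _ _ _

theorem scaled_repSystem : QSystem.Scaled (repSystem X n v N hN p) (repSystem X n v N hN p')
    (fun i => (idx X n i).elim 1 (zRatio X n v p p'))
    (fun i => (idxTilde X n i).elim 1 (zRatio X n v p p'))
    (fun i => (idx X n i).elim 1 (xRatio X n v p p'))
    (fun i => (idxTilde X n i).elim 1 (xRatio X n v p p')) where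
  z_scaled i := repSystem_H X n v N hN p p' (.z i) (by simp)
  zt_scaled i := repSystem_H X n v N hN p p' (.zt i) (by simp)
  x_scaled i := by simpa [XLabel.sign, XLabel.pos, XExp.x, XExp.xi, XExp.xt, XExp.xti] using repSystem_P X n v N hN p p' (.x i)
  xi_scaled i := by simpa [XLabel.sign, XLabel.pos, XExp.x, XExp.xi, XExp.xt, XExp.xti] using repSystem_P X n v N hN p p' (.xi i)
  xt_scaled i := by simpa [XLabel.sign, XLabel.pos, XExp.x, XExp.xi, XExp.xt, XExp.xti] using repSystem_P X n v N hN p p' (.xt i)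
  xti_scaled i := by simpa [XLabel.sign, XLabel.pos, XExp.x, XExp.xi, XExp.xt, XExp.xti] using repSystem_P X n v N hN p p' (.xti i)

end Rep

end QuantumSeries

namespace QuantumSeries
open ZExp XExp

/-! ### Finiteness of the fibres. -/

section Fibres

attribute [local instance] endRing

theorem QAlg.hom_ext {K : Type u} [Field K] {X : Series} {n : ℕ} {v : K} {S : Set (Fin n)}
    {A : Type*} [Semiring A] [Algebra K A] {φ ψ : QAlg X n v S →ₐ[K] A}
    (h : ∀ y, φ (QAlg.gen X n v S y) = ψ (QAlg.gen X n v S y)) : φ = ψ :=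
  RingQuot.ringQuot_ext' K _ _ (FreeAlgebra.hom_ext (funext h))

variable {K : Type u} [Field K] (X : Series) (n : ℕ) (v : Kˣ) (N : ℕ)
  (hN : (v ^ qExp X) ^ N = 1) {V : Type w} [AddCommGroup V] [Module K V]
  (p p' : (WIdx X n → Kˣ) × (WIdx X n → Kˣ) × (UBar X n (v : K) →ₐ[K] Module.End K V))

theorem numTilde_le : numTilde X n ≤ n := by cases X <;> simp [numTilde]

theorem idx_succ (j : Fin n) : idx X n (j + 1) = some (.inl j) := dif_pos (by omega)

theorem idxTilde_succ (j : Fin (numTilde X n)) :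
    idxTilde X n (n - numTilde X n + j + 1) = some (.inr j) := by
  have := numTilde_le X n
  rw [idxTilde, dif_pos (by omega)]
  congr 2
  exact Fin.ext (by dsimp only; omega)

theorem rootDeg_eq (k : WIdx X n) : rootDeg X n k = 1 ∨ rootDeg X n k = 2 :=
  or_iff_not_imp_left.2 fun h => (rootDeg_ne_one X n h).2.2

/-- If the ratios of the images of the generators are roots of unity, so are those of the
parameters. -/
theorem params_of_ratios {k : WIdx X n} (hz : zRatio X n v p p' k ∈ rootsOfUnity 8 K)
    (hx : xRatio X n v p p' k ∈ rootsOfUnity 8 K) :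
    p.1 k * (p'.1 k)⁻¹ ∈ rootsOfUnity 16 K ∧ p.2.1 k * (p'.2.1 k)⁻¹ ∈ rootsOfUnity 16 K := by
  rw [mem_rootsOfUnity] at hz hx ⊢
  rw [mem_rootsOfUnity]
  rw [zRatio, ← pow_mul] at hz
  rw [xRatio, mul_pow] at hx
  generalize p.1 k * (p'.1 k)⁻¹ = a at *
  generalize p.2.1 k * (p'.2.1 k)⁻¹ = b at *
  rcases rootDeg_eq X n k with h | h <;> rw [h] at hz hx
  · rw [Nat.cast_one, sub_self, zpow_zero, one_pow, one_mul] at hx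
    exact ⟨by rw [show 16 = 8 * 2 from rfl, pow_mul, hx, one_pow],
      by rw [show 16 = 1 * 8 * 2 from rfl, pow_mul, hz, one_pow]⟩
  -- In this factor z_1 scales by b² and y_1 = z_1^{-1/2}x_1 by b⁻¹a, where a and b are the ratios
  -- of the g's and h's. This doubles the order of the roots of unity from 8 to 16.
  · refine ⟨?_, hz⟩
    have h1 : b⁻¹ ^ 8 * a ^ 8 = 1 := by simpa using hx
    have h2 : a ^ 8 = b ^ 8 := by rwa [inv_pow, inv_mul_eq_one, eq_comm] at h1
    rw [show 16 = 8 * 2 from rfl, pow_mul, h2, ← pow_mul]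
    exact hz

theorem evalSum_repSystem (l : List (QSystem.Term K)) : (repSystem X n v N hN p).evalSum l =
    targetRep X n v N hN p ((targetSystem X n v).evalSum l) :=
  QSystem.evalSum_map _ _ _

theorem params_mem [NeZero N] [Nontrivial V] (hn : minRank X ≤ n)
    (hv : QSystem.Admissible X n v)
    (hf : ∀ i, 1 ≤ i → i ≤ n → (repSystem X n v N hN p).evalSum (QSystem.fTerms X v i) =
      (repSystem X n v N hN p').evalSum (QSystem.fTerms X v i)) (k : WIdx X n) :
    p.1 k * (p'.1 k)⁻¹ ∈ rootsOfUnity 16 K ∧ p.2.1 k * (p'.2.1 k)⁻¹ ∈ rootsOfUnity 16 K := by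
  have := nontrivial_end_wSpace_tensor (K := K) X n N V
  -- The ratios at the labels 0 and n + 1 are 1 because these labels are out of range.
  have h := (scaled_repSystem X n v N hN p p').isTorsion hn hv
    (by rw [idx, dif_neg (by omega)]; rfl) (by rw [idx, dif_neg (by omega)]; rfl) hf
  have hle := numTilde_le X n
  rcases k with j | j
  · have h1 := h.z (j + 1) (by omega) (by omega)
    have h2 := h.x (j + 1) (by omega) (by omega)
    rw [idx_succ] at h1 h2
    exact params_of_ratios X n v p p' h1 h2
  · have h1 := h.zt (n - numTilde X n + j + 1) (by omega) (by omega)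
    have h2 := h.xt (n - numTilde X n + j + 1) (by omega) (by omega)
    rw [idxTilde_succ] at h1 h2
    exact params_of_ratios X n v p p' h1 h2

theorem targetRep_uIncl_injective [NeZero N] {b : UBar X n (v : K)}
    (h : targetRep X n v N hN p (uIncl X n v b) = targetRep X n v N hN p' (uIncl X n v b)) :
    p.2.2 b = p'.2.2 b := by
  refine LinearMap.ext fun y => wSpace_tmul_injective (K := K) X n N fun w => ?_
  rw [← targetRep_uIncl X n v N hN p b w y, h, targetRep_uIncl]

variable {p p'}

/-- Equal g and h make the Weyl algebras act in the same way. The images of the t_i then give the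
T_i, and cancelling the monomials in the images of the e_i and f_i gives the E_i and F_i. -/
theorem rep_eq_of_evalSum_eq [NeZero N] (hn : minRank X ≤ n) (h1 : p.1 = p'.1)
    (h2 : p.2.1 = p'.2.1)
    (ht : ∀ i, 1 ≤ i → i ≤ n → (repSystem X n v N hN p).H (.ofAdd (QSystem.tExp X i)) =
      (repSystem X n v N hN p').H (.ofAdd (QSystem.tExp X i)))
    (he : ∀ i, 1 ≤ i → i ≤ n → (repSystem X n v N hN p).evalSum (QSystem.eTerms X v i) =
      (repSystem X n v N hN p').evalSum (QSystem.eTerms X v i))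
    (hf : ∀ i, 1 ≤ i → i ≤ n → (repSystem X n v N hN p).evalSum (QSystem.fTerms X v i) =
      (repSystem X n v N hN p').evalSum (QSystem.fTerms X v i)) : p.2.2 = p'.2.2 := by
  have hz (k : WIdx X n) (a) : targetRep X n v N hN p (weylIncl X n v k a) =
      targetRep X n v N hN p' (weylIncl X n v k a) := by
    rw [targetRep_weylIncl, targetRep_weylIncl, h1, h2]
  have hP : (repSystem X n v N hN p).P = (repSystem X n v N hN p').P := by
    refine MonoidHom.ext fun ξ => ?_
    rw [← ofAdd_toAdd ξ]
    generalize ξ.toAdd = η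
    induction η using XExp.induction with
    | zero => rw [ofAdd_zero, map_one, map_one]
    | add a b ha hb => rw [ofAdd_add, map_mul, map_mul, ha, hb]
    | single l =>
      rw [repSystem, repSystem, QSystem.map_P, QSystem.map_P, targetSystem_P_single]
      rcases xElem_cases X n v l with ⟨-, h⟩ | ⟨k, -, h⟩ <;> rw [h]
      · rw [map_zero, map_zero]
      · exact hz k _
  have hH' (l : ZLabel) (hl : ∀ i : Fin n, l ≠ .t (i + 1)) :
      (repSystem X n v N hN p).H (.ofAdd (Finsupp.single l 1)) =
        (repSystem X n v N hN p').H (.ofAdd (Finsupp.single l 1)) := by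
    refine Units.ext ?_
    rw [repSystem, repSystem, QSystem.map_H, QSystem.map_H, targetSystem_H_single]
    rcases zElem_cases X n v l with h | ⟨k, -, h⟩ | ⟨i, rfl, -⟩
    · rw [h, Units.val_one, map_one, map_one]
    · rw [h]; exact hz k _
    · exact absurd rfl (hl i)
  have hH : (repSystem X n v N hN p).H = (repSystem X n v N hN p').H :=
    QSystem.H_eq_of_tExp (fun i => hH' (.z i) (by simp)) (fun i => hH' (.zt i) (by simp))
      (fun i hi => hH' (.t i) fun j hj => hi (by cases hj; omega)) ht
  have hE (i : Fin n) : p.2.2 (QAlg.gen X n (v : K) _ (.e i)) =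
      p'.2.2 (QAlg.gen X n (v : K) _ (.e i)) := by
    refine targetRep_uIncl_injective X n v N hN p p' ?_
    rw [← eElem_succ]
    exact QSystem.E_eq_of_eTerms hH hP (he _ (by omega) (by omega))
  have hF (i : {i : Fin n | (i : ℕ) + 1 < n}) : p.2.2 (QAlg.gen X n (v : K) _ (.f i)) =
      p'.2.2 (QAlg.gen X n (v : K) _ (.f i)) := by
    refine targetRep_uIncl_injective X n v N hN p p' ?_
    rw [← fElem_succ]
    exact QSystem.F_eq_of_fTerms hn hH hP hf (by omega) i.2
  have hT (i : Fin n) : p.2.2 (QAlg.gen X n (v : K) _ (.t i)) =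
      p'.2.2 (QAlg.gen X n (v : K) _ (.t i)) := by
    refine targetRep_uIncl_injective X n v N hN p p' ?_
    rw [← zElem_t_succ, ← targetSystem_H_single]
    exact congrArg Units.val (DFunLike.congr_fun hH _)
  refine QAlg.hom_ext fun y => ?_
  cases y with
  | e i => exact hE i
  | f i => exact hF i
  | t i => exact hT i
  | tInv i =>
    have : Units.map (p.2.2 : UBar X n (v : K) →* Module.End K V) (QAlg.tUnit X n (v : K) _ i) =
        Units.map (p'.2.2 : UBar X n (v : K) →* Module.End K V) (QAlg.tUnit X n (v : K) _ i) :=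
      Units.ext (hT i)
    exact congrArg (fun u : (Module.End K V)ˣ => ((u⁻¹ : (Module.End K V)ˣ) : Module.End K V)) this

theorem finite_fibre [NeZero N] [Nontrivial V] (hn : minRank X ≤ n)
    (hv : QSystem.Admissible X n v)
    (π₀ : U X n (v : K) →ₐ[K] Module.End K (WSpace K X n N ⊗[K] V)) :
    {p : (WIdx X n → Kˣ) × (WIdx X n → Kˣ) × (UBar X n (v : K) →ₐ[K] Module.End K V) |
      piRep X n v N ((targetSystem X n v).lift hn hv) hN p.1 p.2.1 p.2.2 = π₀}.Finite := by
  have key {p p' : (WIdx X n → Kˣ) × (WIdx X n → Kˣ) × (UBar X n (v : K) →ₐ[K] Module.End K V)}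
      (hp : piRep X n v N ((targetSystem X n v).lift hn hv) hN p.1 p.2.1 p.2.2 = π₀)
      (hp' : piRep X n v N ((targetSystem X n v).lift hn hv) hN p'.1 p'.2.1 p'.2.2 = π₀)
      (i : ℕ) (hi : 1 ≤ i) (hin : i ≤ n) :
      (repSystem X n v N hN p).H (.ofAdd (QSystem.tExp X i)) =
        (repSystem X n v N hN p').H (.ofAdd (QSystem.tExp X i)) ∧
      (repSystem X n v N hN p).evalSum (QSystem.eTerms X v i) =
        (repSystem X n v N hN p').evalSum (QSystem.eTerms X v i) ∧
      (repSystem X n v N hN p).evalSum (QSystem.fTerms X v i) =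
        (repSystem X n v N hN p').evalSum (QSystem.fTerms X v i) := by
    obtain ⟨j, rfl⟩ := exists_fin_of_range n ⟨hi, hin⟩
    have h (y) : targetRep X n v N hN p ((targetSystem X n v).lift hn hv y) =
        targetRep X n v N hN p' ((targetSystem X n v).lift hn hv y) := by
      rw [← piRep_apply, ← piRep_apply, hp, hp']
    refine ⟨Units.ext ?_, ?_, ?_⟩
    · have := h (QAlg.gen X n (v : K) _ (.t j))
      rwa [QSystem.lift_t] at this
    · have := h (QAlg.gen X n (v : K) _ (.e j))
      rwa [QSystem.lift_e, ← evalSum_repSystem, ← evalSum_repSystem] at this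
    · have := h (QAlg.gen X n (v : K) _ (.f ⟨j, Set.mem_univ j⟩))
      rwa [QSystem.lift_f, ← evalSum_repSystem, ← evalSum_repSystem] at this
  rcases Set.eq_empty_or_nonempty {p : (WIdx X n → Kˣ) × (WIdx X n → Kˣ) ×
      (UBar X n (v : K) →ₐ[K] Module.End K V) |
      piRep X n v N ((targetSystem X n v).lift hn hv) hN p.1 p.2.1 p.2.2 = π₀} with h0 | ⟨p', hp'⟩
  · rw [h0]; exact Set.finite_empty
  have hfin (a : WIdx X n → Kˣ) :
      {b : WIdx X n → Kˣ | ∀ k, b k * (a k)⁻¹ ∈ rootsOfUnity 16 K}.Finite := by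
    have : {b : WIdx X n → Kˣ | ∀ k, b k * (a k)⁻¹ ∈ rootsOfUnity 16 K} =
        Set.pi Set.univ fun k => (fun x => x * (a k)⁻¹) ⁻¹' (rootsOfUnity 16 K : Set Kˣ) := by
      ext b; simp
    rw [this]
    have hr : Finite (rootsOfUnity 16 K) := inferInstance
    exact Set.Finite.pi fun k => (@Set.toFinite _ (rootsOfUnity 16 K : Set Kˣ) hr).preimage (mul_left_injective _).injOn
  -- The projection of the fibre to (g, h) is injective, as (g, h) determines the representation of
  -- Ū. Its image is finite, since all ratios to one fixed point of the fibre are 16th roots of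
  -- unity.
  refine Set.Finite.of_finite_image (f := fun p => (p.1, p.2.1))
    (((hfin p'.1).prod (hfin p'.2.1)).subset ?_) ?_
  · rintro _ ⟨p, hp, rfl⟩
    have := params_mem X n v N hN p p' hn hv fun i hi hin => (key hp hp' i hi hin).2.2
    exact ⟨fun k => (this k).1, fun k => (this k).2⟩
  · intro p hp p'' hp'' h
    obtain ⟨h1, h2⟩ := Prod.mk.inj h
    refine Prod.ext h1 (Prod.ext h2 (rep_eq_of_evalSum_eq X n v N hN hn h1 h2
      (fun i hi hin => (key hp hp'' i hi hin).1) (fun i hi hin => (key hp hp'' i hi hin).2.1)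
      fun i hi hin => (key hp hp'' i hi hin).2.2))

end Fibres

end QuantumSeries

end

/-! ### The theorem. -/

open QuantumSeries

theorem mainTheorem1 {K : Type u} [Field K] (X : Series) (n : ℕ) (hn : minRank X ≤ n)
    (v : Kˣ) (hv : ∀ i : Fin n, ((v : K) ^ dExp X (i + 1)) ^ 2 ≠ 1) :
    ∃ ρ : U X n (v : K) →ₐ[K] Target X n v,
      (∀ i : Fin n, toRoot X n v (ρ (QAlg.gen X n (v : K) _ (.e i)))
        = eFormula X v (symbols X n v) (i + 1)) ∧
      (∀ i : Fin n, toRoot X n v (ρ (QAlg.gen X n (v : K) _ (.f ⟨i, Set.mem_univ i⟩)))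
        = fFormula X v (symbols X n v) (i + 1)) ∧
      (∀ i : Fin n, toRoot X n v (ρ (QAlg.gen X n (v : K) _ (.t i)))
        = tFormula X (symbols X n v) (i + 1)) ∧
      Fintype.card (WIdx X n) = numPosRoots X n - numPosRoots X (n - 1) ∧
      ∀ (N : ℕ) (_ : NeZero N) (hN : IsPrimitiveRoot (v ^ qExp X) N)
        (V : Type w) [AddCommGroup V] [Module K V],
        Module.rank K (WSpace K X n N ⊗[K] V)
            = (N : Cardinal) ^ (numPosRoots X n - numPosRoots X (n - 1))
              * Cardinal.lift.{u, w} (Module.rank K V) ∧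
        (Nontrivial V →
          ∀ π₀ : U X n (v : K) →ₐ[K] Module.End K (WSpace K X n N ⊗[K] V),
            {p : (WIdx X n → Kˣ) × (WIdx X n → Kˣ) × (UBar X n (v : K) →ₐ[K] Module.End K V) |
              piRep X n v N ρ hN.pow_eq_one p.1 p.2.1 p.2.2 = π₀}.Finite) := by
  have hv' : QSystem.Admissible X n v := fun i hi hin => by
    obtain ⟨j, rfl⟩ := exists_fin_of_range n ⟨hi, hin⟩
    exact hv j
  have hr := realizes X n v
  refine ⟨(targetSystem X n v).lift hn hv', fun i => ?_, fun i => ?_, fun i => ?_, card_wIdx X hn,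
    fun N _ hN V _ _ => ⟨?_, fun _ => finite_fibre X n v N hN.pow_eq_one hn hv'⟩⟩
  · rw [QSystem.lift_e, ← QSystem.evalSum_map]
    exact hr.evalSum_eTerms _ (by omega)
  · rw [QSystem.lift_f, ← QSystem.evalSum_map]
    exact hr.evalSum_fTerms _ (by omega)
  · rw [QSystem.lift_t, ← QSystem.map_H]
    exact congrArg Units.val (hr.H_tExp _ (by omega))
  · rw [rank_wSpace_tensor, card_wIdx X hn]
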